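/- **Setting.** Let $M$ be a (Hausdorff) real analytic manifold; all vector fields, functions and diffeomorphisms below are real analytic unless stated otherwise. For a family $V$ of local vector fields on an open set $U$, write $V_x\subset T_xM$ for the span of the values at $x$ of the fields of $V$ defined near $x$, and $V^{(Lie)}$ for the family of the local fields that are locally finite sums $\sum f_iY_i$, with $f_i$ analytic functions and $Y_i$ iterated Lie brackets $[X_1,[X_2,\dots[X_{k-1},X_k]\dots]]$, $k\ge1$, of fields of $V$ ($k$ is the depth of the bracket). $\Phi^X_t$ denotes the local flow of $X$. The maximal integral leaf in $U$ through $x$ of an involutive family is the set of the points that can be joined to $x$ by finitely many consecutive arcs, inside $U$, of integral curves of fields of the family. A *rigged distribution* of rank $m+1$ on $M$ is a triple $(\mathcal D,\mathcal D^I,\mathcal T)$ of a regular analytic distribution $\mathcal D$ of rank $m+1$, an involutive regular analytic distribution $\mathcal D^I\subset\mathcal D$ of rank $m$, and a nowhere vanishing analytic section $\mathcal T$ of $\mathcal D/\mathcal D^I$. A *lift* of $\mathcal T$ on an open set $U$ is an analytic field $\mathbb T$ on $U$ with values in $\mathcal D$ such that $\mathcal T_x=\mathbb T_x \bmod \mathcal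 D^I_x$ on $U$. *Secondary distribution.* For an involutive distribution $\mathcal D^I$ and a field $\mathbb T$ on $U$, $V^{II}$ is the family of the local fields on open subsets of $U$ that are locally finite sums $\sum f_i\,\mathrm{ad}_{\mathbb T}^{k_i}Z_i$, with $Z_i$ fields with values in $\mathcal D^I$, $k_i\ge0$ and $f_i$ analytic functions. Put $\mathcal D^{II}_x=V^{II}_x$ and $\mathcal E_x=(V^{II(Lie)})_x$ (the bracket generated distribution). A *decomposition of $U$ into $\mathcal D^{II}$-strata* is a finite partition $U=U_0\sqcup\dots\sqcup U_q$ such that on each $U_j$ the dimension of $\mathcal E$ is constant, each $U_j$ contains the maximal integral leaf in $U$ of $V^{II(Lie)}$ through each of its points, and there are integers $1\le\mu_j\le\mu$ (the *depths*, with $\mu$ independent of $j$) such that, for each $x\in U_j$, $\mathcal E_x$ is spanned by the values at $x$ of iterated brackets of depth at most $\mu_j$ of fields of $V^{II}$. *$\mathbb T$-adapted generators* on $U$ are given by fields $W_1,\dots,W_m$ on $U$ that form a basis of $\mathcal D^I$ at each point, and integers (heights) $a_1,\dots,a_m\ge0$, such that each field of $V^{II}$ is, locally, a combination with analytic coefficients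 of the generators $W_{\alpha,\ell}=\mathrm{ad}^\ell_{\mathbb T}W_\alpha$, $0\le\ell\le a_\alpha$, and such that, at each point of $U$, the vector $\mathrm{ad}_{\mathbb T}^{a_\alpha+1}W_\alpha$ is a linear combination of the vectors $W_{\beta,\ell}$ with $a_\beta\le a_\alpha$ and $\ell\le a_\beta$. The *secondary sub-distribution generated by $W_\beta$* is the one that is obtained with $\langle W_\beta\rangle$ in place of $\mathcal D^I$ and the same $\mathbb T$. *Good of the first kind.* $y_o\in U$ is good of the first kind for a secondary distribution $(V^{II},\mathcal D^{II})$ on $U$ if $y_o$ has an open neighbourhood in $U$ with a decomposition into $\mathcal D^{II}$-strata such that, at the points near $y_o$ of the stratum of $y_o$, the dimension of $\mathcal D^{II}$ is constant and the brackets of fields of $V^{II}$ have values in $\mathcal D^{II}$. *Good points.* Let $\mathbb T$ be a field on $U$ and $y_o\in U$. Given $\mathbb T$-adapted generators on a neighbourhood of $y_o$ and $T_0>0$, a *$\mathbb T$-surrogate leaflet of dimension $d$ centred at $y_o$, with $\mathbb T$-depths in $(0,T_0)$*, is given by a smooth map $F$ from a neighbourhood $P$ of $0\in\mathbb R^d$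 to $M$, that is an immersion and a homeomorphism onto its image, with $F(0)=y_o$, of the form $$F(s)=\Phi^{X_K}_{\sigma_K(s^{i_K})}\circ\dots\circ\Phi^{X_1}_{\sigma_1(s^{i_1})}(y_o),\qquad K\ge d,$$ where $i_\ell\in\{1,\dots,d\}$, the $\sigma_\ell$ are smooth real functions on an interval $(-\varepsilon,\varepsilon)$ and the $X_\ell$ are local fields of $V^{II}$ of the form $X_\ell=\sum_\alpha\lambda^\alpha_\ell\,\Phi^{\mathbb T}_{\tau_\ell *}(W_\alpha)$ with $\lambda_\ell^\alpha\in\mathbb R$ and $T_0>\tau_1>\tau_2>\dots>\tau_K>0$. The point $y_o$ is *$\mathbb T$-good* if on some neighbourhood of it there are $\mathbb T$-adapted generators such that for every $T_0>0$ there is a $\mathbb T$-surrogate leaflet, centred at $y_o$, with $\mathbb T$-depths in $(0,T_0)$ and of dimension $\dim\mathcal E_{y_o}$. The point $y_o$ is *good* for $(\mathcal D,\mathcal D^I,\mathcal T)$ if there are an open neighbourhood $U$ of $y_o$ and a lift $\mathbb T$ of $\mathcal T$ on $U$ such that: (a) $y_o$ is $\mathbb T$-good; (b) for each analytic diffeomorphism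 $\varphi$ of $U$ onto its image that maps each maximal integral leaf in $U$ of $\mathcal D^I|_U$ into itself, and with $y_o\in\varphi(U)$, the point $y_o$ is $\varphi_*\mathbb T$-good (with respect to $\mathcal D^I$ and the field $\varphi_*\mathbb T$ on $\varphi(U)$). **Theorem.** Let $(\mathcal D,\mathcal D^I,\mathcal T)$ be a rigged distribution of rank $m+1$ on $M$ and $y_o\in M$. Let $U$ be an open neighbourhood of $y_o$ on which there are a lift $\mathbb T$ of $\mathcal T$, $\mathbb T$-adapted generators $W_{\alpha,\ell}=\mathrm{ad}_{\mathbb T}^\ell W_\alpha$, $1\le\alpha\le m$, $0\le\ell\le a_\alpha$, of the secondary distribution determined by $\mathcal D^I$ and $\mathbb T$, and a decomposition into $\mathcal D^{II}$-strata. Let $U_{j_o}$ be the stratum of $y_o$ and $r=\dim\mathcal E_{y_o}$. Assume that 1. the depth of $U_{j_o}$ is $2$; 2. there are an integer $p$ with $0\le p\le r-1$, generators $W_{A_1},\dots,W_{A_p}$ and $W_{B'_1},\dots,W_{B'_{r-p}}$ among the $W_{\alpha,\ell}$, and local fields $W_{B_1},\dots,W_{B_{r-p}}$, such that - (a) for each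 $j$ there is $\beta$ such that $W_{B_j}$ belongs, near $y_o$, to a set of $\mathbb T$-adapted generators of the secondary sub-distribution generated by $W_\beta$; - (b) for this $\beta$, the point $y_o$ is good of the first kind for the secondary sub-distribution generated by $W_\beta$; - (c) at each point $x\in U_{j_o}$ of some neighbourhood of $y_o$, the space $\mathcal E_x$ is spanned by the values at $x$ of $W_{A_1},\dots,W_{A_p},[W_{B_1},W_{B'_1}],\dots,[W_{B_{r-p}},W_{B'_{r-p}}]$. Then $y_o$ is a good point of $(\mathcal D,\mathcal D^I,\mathcal T)$. -/

import Mathlib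

open Set Manifold
open scoped ContDiff Topology

namespace RiggedControl

noncomputable section

/-- Vector fields, as total functions. A local vector field on an open set `O` is such a function
of which only the values on `O` are used. -/
abbrev VF (N : ℕ) (M : Type*) [TopologicalSpace M] [ChartedSpace (EuclideanSpace ℝ (Fin N)) M] :=
  (x : M) → TangentSpace (𝓡 N) x

/-- Families of local vector fields: `V O` is the set of the fields of the family that are
defined on `O`. -/
abbrev FieldFamily (N : ℕ) (M : Type*) [TopologicalSpace M]
    [ChartedSpace (EuclideanSpace ℝ (Fin N)) M] :=
  Set M → Set (VF N M)

/-- Families of subspaces of the tangent spaces. -/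
abbrev Distr (N : ℕ) (M : Type*) [TopologicalSpace M]
    [ChartedSpace (EuclideanSpace ℝ (Fin N)) M] :=
  (x : M) → Submodule ℝ (TangentSpace (𝓡 N) x)

section

variable {N : ℕ} {M : Type*} [TopologicalSpace M] [ChartedSpace (EuclideanSpace ℝ (Fin N)) M]

/-- `X` is real analytic on `O`. -/
def IsAnalyticVF [IsManifold (𝓡 N) ω M] (X : VF N M) (O : Set M) : Prop :=
  ContMDiffOn (𝓡 N) (𝓡 N).tangent ω (fun x => (⟨x, X x⟩ : TangentBundle (𝓡 N) M)) O

/-- `f` is a real analytic function on `O`. -/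
def IsAnalyticFun (f : M → ℝ) (O : Set M) : Prop :=
  ContMDiffOn (𝓡 N) 𝓘(ℝ, ℝ) ω f O

/-- The Lie bracket `[X, Y]`. -/
def bracket (X Y : VF N M) : VF N M := VectorField.mlieBracket (𝓡 N) X Y

/-- `[T, [T, … [T, X] …]]` with `k` brackets. -/
def adIter (T : VF N M) : ℕ → VF N M → VF N M
  | 0, X => X
  | k + 1, X => bracket T (adIter T k X)

/-- The iterated bracket `[Y₁, [Y₂, … [Y_{r-1}, Y_r] …]]` of a list (its depth is `r`). -/
def iterBracket : List (VF N M) → VF N M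
  | [] => 0
  | [X] => X
  | X :: Y :: l => bracket X (iterBracket (Y :: l))

/-- The integral curve of `X` that starts at `x` exists up to time `t` (of any sign) inside `O`
and is at `y` at time `t`, i.e. `Φ^X_t(x) = y`. -/
def FlowTo (X : VF N M) (O : Set M) (t : ℝ) (x y : M) : Prop :=
  ∃ γ : ℝ → M, γ 0 = x ∧ γ t = y ∧ IsMIntegralCurveOn γ X (uIcc 0 t) ∧ ∀ s ∈ uIcc 0 t, γ s ∈ O

open Classical in
/-- The local flow `Φ^X_t` inside `O` (with the junk value `x` where it is not defined). -/
def flow (X : VF N M) (O : Set M) (t : ℝ) (x : M) : M :=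
  if h : ∃ y, FlowTo X O t x y then h.choose else x

/-- The pushed-forward field `Φ^T_{τ*}(W)`, that is the pull-back of `W` under `Φ^T_{-τ}`. It is
meaningful at the points at which `Φ^T_{-τ}` is defined. -/
def flowPush (T : VF N M) (U : Set M) (τ : ℝ) (W : VF N M) : VF N M :=
  VectorField.mpullback (𝓡 N) (𝓡 N) (flow T U (-τ)) W

/-- The space spanned at `x` by the values of the fields of the family. -/
def fiber (V : FieldFamily N M) : Distr N M := fun x =>
  Submodule.span ℝ {v | ∃ O : Set M, IsOpen O ∧ x ∈ O ∧ ∃ X ∈ V O, v = X x}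

/-- The space spanned at `x` by the values of the iterated brackets of depth at most `μ` of
fields of the family. -/
def depthFiber (V : FieldFamily N M) (μ : ℕ) : Distr N M := fun x =>
  Submodule.span ℝ {v | ∃ O : Set M, IsOpen O ∧ x ∈ O ∧ ∃ l : List (VF N M),
    l ≠ [] ∧ l.length ≤ μ ∧ (∀ Y ∈ l, Y ∈ V O) ∧ v = iterBracket l x}

/-- The one-dimensional family of subspaces `⟨W_x⟩`. -/
def lineDistr (W : VF N M) : Distr N M := fun x => Submodule.span ℝ {W x}

variable [IsManifold (𝓡 N) ω M]

/-- The real analytic local fields that are locally finite sums `∑ fᵢ Yᵢ`, with real analytic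
functions `fᵢ` and fields `Yᵢ` in `G`. -/
def analyticSpan (G : FieldFamily N M) : FieldFamily N M := fun O =>
  {X | IsOpen O ∧ IsAnalyticVF X O ∧ ∀ x ∈ O, ∃ O' : Set M, IsOpen O' ∧ x ∈ O' ∧ O' ⊆ O ∧
    ∃ (n : ℕ) (f : Fin n → M → ℝ) (Y : Fin n → VF N M),
      (∀ i, IsAnalyticFun (N := N) (f i) O') ∧ (∀ i, Y i ∈ G O') ∧
      ∀ z ∈ O', X z = ∑ i, f i z • Y i z}

/-- The family `V^(Lie)` of the real analytic fields that are finite combinations of iterated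
brackets of fields in `V`. -/
def lieClosure (V : FieldFamily N M) : FieldFamily N M :=
  analyticSpan fun O => {X | ∃ l : List (VF N M), l ≠ [] ∧ (∀ Y ∈ l, Y ∈ V O) ∧ X = iterBracket l}

/-- The real analytic local fields with values in `D`. -/
def tangentFields (D : Distr N M) : FieldFamily N M := fun O =>
  {X | IsOpen O ∧ IsAnalyticVF X O ∧ ∀ x ∈ O, X x ∈ D x}

/-- The secondary family `V^II` on `U` determined by `D^I` and `T`: the real analytic local fields
of the form `∑ f [T, [T, … [T, Z] …]]` with `Z` a real analytic field in `D^I`. The associated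
spaces `D^II` are the spaces `fiber (secondary DI T U)`. -/
def secondary (DI : Distr N M) (T : VF N M) (U : Set M) : FieldFamily N M :=
  analyticSpan fun O => {Y | O ⊆ U ∧ ∃ Z ∈ tangentFields DI O, ∃ k : ℕ, Y = adIter T k Z}

/-- `D` is a regular real analytic distribution of rank `r`. -/
def IsRegularDistr (D : Distr N M) (r : ℕ) : Prop :=
  ∀ x : M, ∃ O : Set M, IsOpen O ∧ x ∈ O ∧ ∃ X : Fin r → VF N M,
    (∀ i, IsAnalyticVF (X i) O) ∧ ∀ z ∈ O, LinearIndependent ℝ (fun i => X i z) ∧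
      D z = Submodule.span ℝ (range fun i => X i z)

/-- `D` is involutive. -/
def IsInvolutiveDistr (D : Distr N M) : Prop :=
  ∀ (O : Set M), ∀ X ∈ tangentFields D O, ∀ Y ∈ tangentFields D O, ∀ x ∈ O, bracket X Y x ∈ D x

/-- The maximal integral leaf in `U` through `x` of an involutive family `V` of fields: the set of
the points that are joined to `x` by finitely many consecutive arcs, inside `U`, of integral curves
of local fields of `V`. -/
def integralLeaf (V : FieldFamily N M) (U : Set M) (x : M) : Set M :=
  {y | Relation.ReflTransGen
    (fun a b => ∃ O : Set M, O ⊆ U ∧ ∃ X ∈ V O, ∃ t : ℝ, FlowTo X O t a b) x y}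

variable (N M) in
/-- A real analytic rigged distribution `(D, D^I, 𝒯)` of rank `m + 1`. The section `𝒯` of
`D / D^I` is seen as a section of `TM / D^I`, with values in the image of `D`. -/
structure RiggedDistribution (m : ℕ) where
  D : Distr N M
  DI : Distr N M
  D_regular : IsRegularDistr D (m + 1)
  DI_regular : IsRegularDistr DI m
  DI_le : ∀ x, DI x ≤ D x
  DI_involutive : IsInvolutiveDistr DI
  sec : (x : M) → TangentSpace (𝓡 N) x ⧸ DI x
  sec_ne_zero : ∀ x, sec x ≠ 0
  exists_lift : ∀ x, ∃ (O : Set M) (T : VF N M), IsOpen O ∧ x ∈ O ∧ IsAnalyticVF T O ∧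
    ∀ z ∈ O, T z ∈ D z ∧ (DI z).mkQ (T z) = sec z

/-- `T` is a real analytic field on `U` with values in `D` and `𝒯_x = T_x mod D^I_x` on `U`. -/
def RiggedDistribution.IsLift {m : ℕ} (R : RiggedDistribution N M m) (T : VF N M) (U : Set M) :
    Prop :=
  IsAnalyticVF T U ∧ ∀ z ∈ U, T z ∈ R.D z ∧ (R.DI z).mkQ (T z) = R.sec z

/-- The fields `W α`, with heights `a α`, determine a set of `T`-adapted generators on `U` of the
secondary family of `D^I` and `T`. The generators are the fields
`W_{ℓ(a)j} = [T, [T, … [T, W α] …]]`, `0 ≤ ℓ ≤ a α`, where `α` stands for the pair `(a, j)`. -/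
structure IsAdapted (DI : Distr N M) (T : VF N M) (U : Set M) {r : ℕ} (W : Fin r → VF N M)
    (a : Fin r → ℕ) : Prop where
  analytic : ∀ α, IsAnalyticVF (W α) U
  frame : ∀ x ∈ U, LinearIndependent ℝ (fun α => W α x) ∧
    DI x = Submodule.span ℝ (range fun α => W α x)
  generates : ∀ (O : Set M), ∀ X ∈ secondary DI T U O, ∀ x ∈ O,
    ∃ O' : Set M, IsOpen O' ∧ x ∈ O' ∧ O' ⊆ O ∧
      ∃ f : (Σ α : Fin r, Fin (a α + 1)) → M → ℝ, (∀ i, IsAnalyticFun (N := N) (f i) O') ∧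
        ∀ z ∈ O', X z = ∑ i, f i z • adIter T i.2 (W i.1) z
  top_mem : ∀ α, ∀ x ∈ U, adIter T (a α + 1) (W α) x ∈
    Submodule.span ℝ {v | ∃ β, a β ≤ a α ∧ ∃ k ≤ a β, v = adIter T k (W β) x}

/-- A decomposition of `U` into strata for the generalised distribution given by `V`. -/
structure StrataDecomposition (V : FieldFamily N M) (U : Set M) where
  q : ℕ
  stratum : Fin (q + 1) → Set M
  iUnion_eq : ⋃ j, stratum j = U
  disjoint : Pairwise fun i j => Disjoint (stratum i) (stratum j)
  finrank_eq : ∀ j, ∀ x ∈ stratum j, ∀ y ∈ stratum j,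
    Module.finrank ℝ (fiber (lieClosure V) x) = Module.finrank ℝ (fiber (lieClosure V) y)
  leaf_subset : ∀ j, ∀ x ∈ stratum j, integralLeaf (lieClosure V) U x ⊆ stratum j
  maxDepth : ℕ
  depth : Fin (q + 1) → ℕ
  one_le_depth : ∀ j, 1 ≤ depth j
  depth_le : ∀ j, depth j ≤ maxDepth
  fiber_eq : ∀ j, ∀ x ∈ stratum j, fiber (lieClosure V) x = depthFiber V (depth j) x

/-- `y` satisfies the first criterion with respect to `V`: it has a neighbourhood with a
decomposition into strata, such that on the stratum of `y`, near `y`, the generalised distribution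
given by `V` is regular and involutive. -/
def IsFirstKind (V : FieldFamily N M) (U : Set M) (y : M) : Prop :=
  ∃ U₁ : Set M, IsOpen U₁ ∧ y ∈ U₁ ∧ U₁ ⊆ U ∧
    ∃ (S : StrataDecomposition V U₁) (j : Fin (S.q + 1)), y ∈ S.stratum j ∧
      ∃ U₂ : Set M, IsOpen U₂ ∧ y ∈ U₂ ∧ ∀ x ∈ U₂ ∩ S.stratum j,
        Module.finrank ℝ (fiber V x) = Module.finrank ℝ (fiber V y) ∧
        ∀ O : Set M, x ∈ O → ∀ X ∈ V O, ∀ Y ∈ V O, bracket X Y x ∈ fiber V x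

/-- `F`, on the neighbourhood `P` of `0` in `ℝ^d`, is a map of rank `d` centred at `y` for the
generalised distribution given by `V`, with generators the fields `X ℓ` on `O ℓ`:
`F(s) = Φ^{X_K}_{σ_K(s^{i_K})} ∘ … ∘ Φ^{X_1}_{σ_1(s^{i_1})}(y)`; its image is an embedded
submanifold of dimension `d`. -/
def IsDistrMap (V : FieldFamily N M) {d : ℕ} (F : EuclideanSpace ℝ (Fin d) → M)
    (P : Set (EuclideanSpace ℝ (Fin d))) (y : M) {K : ℕ} (O : Fin K → Set M)
    (X : Fin K → VF N M) : Prop :=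
  IsOpen P ∧ 0 ∈ P ∧ ContMDiffOn (𝓡 d) (𝓡 N) ∞ F P ∧
  (∀ s ∈ P, Function.Injective (mfderiv (𝓡 d) (𝓡 N) F s)) ∧
  Topology.IsEmbedding (P.domRestrict F) ∧ F 0 = y ∧ d ≤ K ∧ (∀ ℓ, X ℓ ∈ V (O ℓ)) ∧
  ∃ ε : ℝ, 0 < ε ∧ ∃ (σ : Fin K → ℝ → ℝ) (i : Fin K → Fin d),
    (∀ ℓ, ContDiffOn ℝ ∞ (σ ℓ) (Ioo (-ε) ε)) ∧
    ∀ s ∈ P, (∀ k, s k ∈ Ioo (-ε) ε) ∧ ∃ p : Fin (K + 1) → M,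
      p 0 = y ∧ p (Fin.last K) = F s ∧
      ∀ ℓ : Fin K, FlowTo (X ℓ) (O ℓ) (σ ℓ (s (i ℓ))) (p ℓ.castSucc) (p ℓ.succ)

/-- There is a `T`-surrogate leaflet of dimension `d` centred at `y`, with `T`-depths in
`(0, T₀)`. The generators are fields `∑ λ^α Φ^T_{τ_ℓ*}(W_α)`, `λ^α ∈ ℝ`, with
`T₀ > τ_1 > … > τ_K > 0`. -/
def HasSurrogateLeaflet (DI : Distr N M) (T : VF N M) (U : Set M) {r : ℕ} (W : Fin r → VF N M)
    (y : M) (d : ℕ) (T₀ : ℝ) : Prop :=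
  ∃ (K : ℕ) (τ : Fin K → ℝ) (lam : Fin K → Fin r → ℝ) (O : Fin K → Set M)
    (F : EuclideanSpace ℝ (Fin d) → M) (P : Set (EuclideanSpace ℝ (Fin d))),
    StrictAnti τ ∧ (∀ ℓ, τ ℓ ∈ Ioo 0 T₀) ∧
    (∀ ℓ, ∀ x ∈ O ℓ, ∃ z, FlowTo T U (-τ ℓ) x z) ∧
    IsDistrMap (secondary DI T U) F P y O
      (fun ℓ x => ∑ α, lam ℓ α • flowPush T U (τ ℓ) (W α) x)

/-- `y` is `T`-good, for `T` defined on `U`: near `y` there are `T`-adapted generators for which,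
for every bound `T₀ > 0` on the depths, there is a `T`-surrogate leaflet centred at `y`, whose
dimension is the one of the bracket generated distribution at `y`. -/
def IsTGood (DI : Distr N M) (r : ℕ) (T : VF N M) (U : Set M) (y : M) : Prop :=
  ∃ U' : Set M, IsOpen U' ∧ y ∈ U' ∧ U' ⊆ U ∧
    ∃ (W : Fin r → VF N M) (a : Fin r → ℕ), IsAdapted DI T U' W a ∧
      ∀ T₀ : ℝ, 0 < T₀ → HasSurrogateLeaflet DI T U' W y
        (Module.finrank ℝ (fiber (lieClosure (secondary DI T U')) y)) T₀

/-- `φ` is a real analytic diffeomorphism of `U` onto its image that maps each maximal integral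
leaf of `DI` in `U` into itself. -/
def PreservesLeaves (DI : Distr N M) (U : Set M) (φ : M → M) : Prop :=
  ContMDiffOn (𝓡 N) (𝓡 N) ω φ U ∧ InjOn φ U ∧
  (∀ x ∈ U, Function.Bijective (mfderiv (𝓡 N) (𝓡 N) φ x)) ∧
  ∀ x ∈ U, φ '' integralLeaf (tangentFields DI) U x ⊆ integralLeaf (tangentFields DI) U x

/-- `y` is a good point of the rigged distribution. -/
def RiggedDistribution.IsGood {m : ℕ} (R : RiggedDistribution N M m) (y : M) : Prop :=
  ∃ (U : Set M) (T : VF N M), IsOpen U ∧ y ∈ U ∧ R.IsLift T U ∧ IsTGood R.DI m T U y ∧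
    ∀ (φ : M → M) (T' : VF N M), PreservesLeaves R.DI U φ → y ∈ φ '' U →
      (∀ x ∈ U, T' (φ x) = mfderiv (𝓡 N) (𝓡 N) φ x (T x)) →
      IsTGood R.DI m T' (φ '' U) y

/-- Near `y`, the field `B` is one of a set of `T`-adapted generators of the secondary
sub-distribution generated by the field `Wβ`, i.e. of the secondary distribution of the rigged
distribution `(⟨T, Wβ⟩, ⟨Wβ⟩, T mod ⟨Wβ⟩)`. -/
def IsSubAdaptedGenerator (T : VF N M) (U : Set M) (y : M) (Wβ B : VF N M) : Prop :=
  ∃ U' : Set M, IsOpen U' ∧ y ∈ U' ∧ U' ⊆ U ∧ ∃ (W' : Fin 1 → VF N M) (a' : Fin 1 → ℕ),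
    IsAdapted (lineDistr Wβ) T U' W' a' ∧ ∃ k ≤ a' 0, B = adIter T k (W' 0)

end

end

end RiggedControl

/-! At a point of a stratum of depth two, the space of the bracket generated distribution is spanned
by the values of the fields `ad_T^j W_α` and of their mutual brackets. The lift is free up to fields
of `D^I`. The proof replaces it by `T' = T + ∑ h_α W_α`, where the `h_α` are chosen so that the
vectors `ad_{T'}^j W_α` at the point already span all those values. No bracket between fields of the
secondary family is then needed.

The choice of `h` (`exists_perturbation`) is a maximality argument. Let `ξ` vanish at the point with
`T ξ ≠ 0` there. Perturbations divisible by a high power of `ξ` do not change the finitely many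
values to be absorbed. Among them, take one for which the span `D` of the values of `ad_{T'}^j W_α`
has maximal dimension. Adding `ε ξ^n W_γ` with `n` large cannot lower the dimension, so by
maximality it leaves `D` unchanged, for every `ε`. The coefficient of `ε` in `ad_{T' + ε ξ^n W_γ}^j
W_α` thus has its value in `D`. Expanding by the Leibniz rule and letting `n` vary isolates each
`ad_{T'}^a [W_γ, ad_{T'}^b W_α]` in `D` (`eval_adPow_lie_mem_of_forall_perturbation`); the Jacobi
identity gives the remaining brackets.

Surrogate leaflets then come from the transported fields `Φ^{T'}_{τ*} W_α`
(`isTGood_of_finrank_le`). Their derivatives in `τ` produce the iterated brackets, so for small `τ`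
they lie in no space of smaller dimension than the span of these brackets. Decreasing depths with
independent values are picked greedily, and composing the flows of the corresponding fields gives an
embedding. Adapted generators exist because convergent power series form a Noetherian ring, so that
some `ad_{T'}^{n+1} W_α` are analytic combinations of the lower ones (`exists_analytic_relation`).

For goodness under a diffeomorphism `φ` that preserves the leaves, let `φ x = y`. By Frobenius,
`D^I` is locally the kernel of the differential of a first integral, which `φ` preserves, so `φ`
preserves `D^I`. The points `x` and `y` lie in one leaf, hence in one stratum, and the two bracket
generated spaces have the same dimension. The rank of the iterated brackets with `T'` is lower
semicontinuous, so it is large enough at `x` too, and `φ` carries this to `y` (`isTGood_image`). -/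

namespace RiggedControl

/-! ### Division of convergent power series; their ring is Noetherian. -/

section ConvergentSeries

variable {N : ℕ}

/-- The natural number with prime exponents given by the multi-index `α`. -/
noncomputable def primeCode (α : Fin N →₀ ℕ) : ℕ := ∏ i : Fin N, (Nat.nth Nat.Prime i) ^ α i

/-- The code serves twice: as a monomial order, total because it is injective and compatible with
addition because it is multiplicative, and, through its powers, as the weight of the norms. -/
lemma primeCode_add (α β : Fin N →₀ ℕ) : primeCode (α + β) = primeCode α * primeCode β := by
  simp [primeCode, pow_add, Finset.prod_mul_distrib]

lemma primeCode_pos (α : Fin N →₀ ℕ) : 0 < primeCode α :=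
  Finset.prod_pos fun i _ => pow_pos (Nat.prime_nth_prime i).pos _

lemma factorization_primeCode (α : Fin N →₀ ℕ) (j : Fin N) :
    (primeCode α).factorization (Nat.nth Nat.Prime j) = α j := by
  unfold primeCode
  rw [Nat.factorization_prod (S := Finset.univ) (g := fun i : Fin N => Nat.nth Nat.Prime i ^ α i)
    fun i _ => pow_ne_zero _ (Nat.prime_nth_prime i).ne_zero, Finsupp.finsetSum_apply, Finset.sum_eq_single j]
  · simp
  · intro i _ hij
    have : Nat.nth Nat.Prime i ≠ Nat.nth Nat.Prime j := fun h =>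
      hij (Fin.ext (Nat.nth_injective Nat.infinite_setOfPred_prime h))
    simp [this]
  · simp

lemma primeCode_injective : Function.Injective (primeCode (N := N)) := fun α β h => by
  ext j
  rw [← factorization_primeCode α j, h, factorization_primeCode]

open scoped ENNReal

/-- The weighted `ℓ¹` norm of a power series. -/
noncomputable def seriesNorm (s : ℕ) (F : MvPowerSeries (Fin N) ℝ) : ℝ≥0∞ :=
  ∑' α, ‖MvPowerSeries.coeff α F‖ₑ * ((primeCode α : ℝ≥0∞) ^ s)⁻¹

lemma primeCode_cast_ne_zero (α : Fin N →₀ ℕ) (s : ℕ) : (primeCode α : ℝ≥0∞) ^ s ≠ 0 :=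
  pow_ne_zero _ (by exact_mod_cast (primeCode_pos α).ne')

lemma primeCode_cast_ne_top (α : Fin N →₀ ℕ) (s : ℕ) : (primeCode α : ℝ≥0∞) ^ s ≠ ⊤ :=
  ENNReal.pow_ne_top (ENNReal.natCast_ne_top _)

lemma weight_add (α β : Fin N →₀ ℕ) (s : ℕ) : ((primeCode (α + β) : ℝ≥0∞) ^ s)⁻¹ =
    ((primeCode α : ℝ≥0∞) ^ s)⁻¹ * ((primeCode β : ℝ≥0∞) ^ s)⁻¹ := by
  rw [primeCode_add, Nat.cast_mul, mul_pow, ENNReal.mul_inv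
    (Or.inl (primeCode_cast_ne_zero α s)) (Or.inl (primeCode_cast_ne_top α s))]

/-- The weight of exponent `s` is the value of the monomial at the point with coordinates
`p_i^{-s}`, with `p_i` the primes of the code. Raising `s` shrinks the polydisc. -/
lemma seriesNorm_anti {s t : ℕ} (h : s ≤ t) (F : MvPowerSeries (Fin N) ℝ) :
    seriesNorm t F ≤ seriesNorm s F := by
  refine ENNReal.tsum_le_tsum fun α => ?_
  gcongr
  exact_mod_cast primeCode_pos α

lemma seriesNorm_add_le (s : ℕ) (F G : MvPowerSeries (Fin N) ℝ) :
    seriesNorm s (F + G) ≤ seriesNorm s F + seriesNorm s G := by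
  unfold seriesNorm
  rw [← ENNReal.tsum_add]
  refine ENNReal.tsum_le_tsum fun α => ?_
  rw [← add_mul, map_add]
  gcongr
  exact enorm_add_le _ _

lemma seriesNorm_neg (s : ℕ) (F : MvPowerSeries (Fin N) ℝ) :
    seriesNorm s (-F) = seriesNorm s F := by
  simp [seriesNorm]

lemma seriesNorm_zero (s : ℕ) : seriesNorm s (0 : MvPowerSeries (Fin N) ℝ) = 0 := by
  simp [seriesNorm]

lemma seriesNorm_sum_le {ι : Type*} (s : ℕ) (t : Finset ι) (F : ι → MvPowerSeries (Fin N) ℝ) :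
    seriesNorm s (∑ i ∈ t, F i) ≤ ∑ i ∈ t, seriesNorm s (F i) := by
  classical
  induction t using Finset.induction_on with
  | empty => simp [seriesNorm_zero]
  | insert i t hi ih =>
    rw [Finset.sum_insert hi, Finset.sum_insert hi]
    exact (seriesNorm_add_le _ _ _).trans (by gcongr)

lemma seriesNorm_mul_le (s : ℕ) (F G : MvPowerSeries (Fin N) ℝ) :
    seriesNorm s (F * G) ≤ seriesNorm s F * seriesNorm s G := by
  classical
  unfold seriesNorm
  rw [← ENNReal.tsum_mul_right]
  simp_rw [← ENNReal.tsum_mul_left]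
  rw [← ENNReal.tsum_prod (f := fun α β : Fin N →₀ ℕ => ‖MvPowerSeries.coeff α F‖ₑ *
    ((primeCode α : ℝ≥0∞) ^ s)⁻¹ * (‖MvPowerSeries.coeff β G‖ₑ * ((primeCode β : ℝ≥0∞) ^ s)⁻¹)),
    ← (Finset.HasAntidiagonal.sigmaAntidiagonalEquivProd (A := Fin N →₀ ℕ)).tsum_eq, ENNReal.tsum_sigma']
  refine ENNReal.tsum_le_tsum fun γ => ?_
  rw [tsum_fintype, MvPowerSeries.coeff_mul]
  calc ‖∑ p ∈ Finset.HasAntidiagonal.antidiagonal γ, MvPowerSeries.coeff p.1 F * MvPowerSeries.coeff p.2 G‖ₑ *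
        ((primeCode γ : ℝ≥0∞) ^ s)⁻¹
      ≤ (∑ p ∈ Finset.HasAntidiagonal.antidiagonal γ,
        ‖MvPowerSeries.coeff p.1 F * MvPowerSeries.coeff p.2 G‖ₑ) *
        ((primeCode γ : ℝ≥0∞) ^ s)⁻¹ := by
        gcongr
        exact enorm_sum_le _ _
    _ = _ := by
        rw [Finset.sum_mul, ← Finset.sum_coe_sort]
        refine Finset.sum_congr rfl fun p _ => ?_
        have hp := weight_add p.1.1 p.1.2 s
        rw [Finset.HasAntidiagonal.mem_antidiagonal.1 p.2] at hp
        rw [hp, enorm_mul]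
        simp only [Finset.HasAntidiagonal.sigmaAntidiagonalEquivProd_apply]
        ring

lemma seriesNorm_monomial (s : ℕ) (α : Fin N →₀ ℕ) (c : ℝ) :
    seriesNorm s (MvPowerSeries.monomial α c) = ‖c‖ₑ * ((primeCode α : ℝ≥0∞) ^ s)⁻¹ := by
  classical
  unfold seriesNorm
  rw [tsum_eq_single α]
  · simp
  · intro β hβ
    simp [MvPowerSeries.coeff_monomial, hβ]

variable (N) in
/-- The ring of convergent power series. -/
noncomputable def convergentSeries : Subalgebra ℝ (MvPowerSeries (Fin N) ℝ) where
  carrier := {F | ∃ s, seriesNorm s F ≠ ⊤}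
  mul_mem' := by
    rintro F G ⟨s, hs⟩ ⟨t, ht⟩
    refine ⟨max s t, ne_top_of_le_ne_top (ENNReal.mul_ne_top hs ht)
      ((seriesNorm_mul_le _ _ _).trans ?_)⟩
    exact mul_le_mul' (seriesNorm_anti (le_max_left _ _) _) (seriesNorm_anti (le_max_right _ _) _)
  add_mem' := by
    rintro F G ⟨s, hs⟩ ⟨t, ht⟩
    refine ⟨max s t, ne_top_of_le_ne_top (ENNReal.add_ne_top.2 ⟨hs, ht⟩)
      ((seriesNorm_add_le _ _ _).trans ?_)⟩
    exact add_le_add (seriesNorm_anti (le_max_left _ _) _) (seriesNorm_anti (le_max_right _ _) _)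
  algebraMap_mem' := fun c => ⟨0, by
    rw [MvPowerSeries.algebraMap_apply, Algebra.algebraMap_self, RingHom.id_apply,
      ← MvPowerSeries.monomial_zero_eq_C_apply, seriesNorm_monomial]
    simp⟩

/-- The series has its initial exponent at `α`, with coefficient `1`. -/
def IsMonicAt (F : MvPowerSeries (Fin N) ℝ) (α : Fin N →₀ ℕ) : Prop :=
  MvPowerSeries.coeff α F = 1 ∧ ∀ β, primeCode β < primeCode α → MvPowerSeries.coeff β F = 0

/-- Every exponent present in `F` has code at least `p + 1`, where `p` is the code of `α`. Each
increase of `s` by one therefore gains the factor `p / (p + 1) < 1`. -/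
lemma exists_seriesNorm_tail_le {F : MvPowerSeries (Fin N) ℝ} {α : Fin N →₀ ℕ}
    (hF : ∀ β, primeCode β ≤ primeCode α → MvPowerSeries.coeff β F = 0)
    (hc : F ∈ convergentSeries N) {ε : ℝ≥0∞} (hε : ε ≠ 0) :
    ∃ s₁, ∀ s ≥ s₁, (primeCode α : ℝ≥0∞) ^ s * seriesNorm s F ≤ ε := by
  obtain ⟨s₀, hs₀⟩ := hc
  set p : ℝ≥0∞ := (primeCode α : ℝ≥0∞) with hp
  set θ : ℝ≥0∞ := p * (p + 1)⁻¹
  have hp0 : p + 1 ≠ 0 := by simp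
  have hpt : p + 1 ≠ ⊤ := by simp [p]
  have hθ : θ < 1 := by
    rw [show θ = p / (p + 1) from rfl, ENNReal.div_lt_iff (Or.inl hp0) (Or.inl hpt), one_mul]
    exact ENNReal.lt_add_right (by simp [p]) one_ne_zero
  have key : ∀ k, p ^ (s₀ + k) * seriesNorm (s₀ + k) F ≤
      θ ^ k * (p ^ s₀ * seriesNorm s₀ F) := by
    intro k
    unfold seriesNorm
    rw [← ENNReal.tsum_mul_left, ← ENNReal.tsum_mul_left, ← ENNReal.tsum_mul_left]
    refine ENNReal.tsum_le_tsum fun β => ?_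
    by_cases hβ : primeCode β ≤ primeCode α
    · simp [hF β hβ]
    · have h1 : p + 1 ≤ (primeCode β : ℝ≥0∞) := by
        simp only [p]; exact_mod_cast Nat.succ_le_of_lt (not_le.1 hβ)
      have h2 : ((primeCode β : ℝ≥0∞) ^ (s₀ + k))⁻¹ ≤
          ((primeCode β : ℝ≥0∞) ^ s₀)⁻¹ * ((p + 1)⁻¹) ^ k := by
        rw [pow_add, ENNReal.mul_inv (Or.inl (primeCode_cast_ne_zero β _))
          (Or.inl (primeCode_cast_ne_top β _)), ← ENNReal.inv_pow]
        gcongr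
      calc p ^ (s₀ + k) * (‖MvPowerSeries.coeff β F‖ₑ * ((primeCode β : ℝ≥0∞) ^ (s₀ + k))⁻¹)
          ≤ p ^ (s₀ + k) * (‖MvPowerSeries.coeff β F‖ₑ *
            (((primeCode β : ℝ≥0∞) ^ s₀)⁻¹ * ((p + 1)⁻¹) ^ k)) := by gcongr
        _ = _ := by simp only [θ, mul_pow, pow_add]; ring
  have hC : p ^ s₀ * seriesNorm s₀ F ≠ ⊤ := ENNReal.mul_ne_top (primeCode_cast_ne_top α _) hs₀
  have hlim : Filter.Tendsto (fun k => θ ^ k * (p ^ s₀ * seriesNorm s₀ F)) Filter.atTop (𝓝 0) := by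
    simpa using ENNReal.Tendsto.mul_const (ENNReal.tendsto_pow_atTop_nhds_zero_of_lt_one hθ)
      (Or.inr hC)
  obtain ⟨k₀, hk₀⟩ := Filter.eventually_atTop.1 (hlim.eventually (ge_mem_nhds (pos_iff_ne_zero.2 hε)))
  refine ⟨s₀ + k₀, fun s hs => ?_⟩
  obtain ⟨k, rfl⟩ := Nat.exists_eq_add_of_le (le_trans (Nat.le_add_right s₀ k₀) hs)
  exact (key k).trans (hk₀ k (by omega))

section Division

variable {ι : Type*} (e : ι → (Fin N →₀ ℕ)) (asg : (Fin N →₀ ℕ) → Option ι)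

open Classical in
/-- The part of the series `h` with exponents assigned to `i`, divided by the monomial with
exponent `e i`. -/
noncomputable def divPart (h : MvPowerSeries (Fin N) ℝ) (i : ι) : MvPowerSeries (Fin N) ℝ :=
  fun α => if asg (α + e i) = some i then MvPowerSeries.coeff (α + e i) h else 0

open Classical in
lemma coeff_divPart (h : MvPowerSeries (Fin N) ℝ) (i : ι) (α : Fin N →₀ ℕ) :
    MvPowerSeries.coeff α (divPart e asg h i) =
      if asg (α + e i) = some i then MvPowerSeries.coeff (α + e i) h else 0 := rfl

open Classical in
/-- The part of the series with exponents that are not assigned. -/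
noncomputable def restPart (h : MvPowerSeries (Fin N) ℝ) : MvPowerSeries (Fin N) ℝ :=
  fun α => if asg α = none then MvPowerSeries.coeff α h else 0

lemma sum_divPart_add_restPart [Fintype ι] (hasg : ∀ α i, asg α = some i → e i ≤ α)
    (h : MvPowerSeries (Fin N) ℝ) :
    ∑ i, divPart e asg h i * MvPowerSeries.monomial (e i) 1 + restPart asg h = h := by
  classical
  ext α
  rw [map_add, map_sum]
  simp_rw [MvPowerSeries.coeff_mul_monomial, coeff_divPart]
  have hrest : MvPowerSeries.coeff α (restPart asg h) =
      if asg α = none then MvPowerSeries.coeff α h else 0 := rfl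
  rw [hrest]
  cases hα : asg α with
  | none =>
    rw [Finset.sum_eq_zero]
    · simp
    · intro i _
      split_ifs with h1 h2 <;> simp_all [tsub_add_cancel_of_le]
  | some j =>
    rw [Finset.sum_eq_single j]
    · have := hasg α j hα
      simp [this, tsub_add_cancel_of_le this, hα]
    · intro i _ hij
      split_ifs with h1 h2
      · rw [tsub_add_cancel_of_le h1, hα] at h2
        exact absurd (Option.some.inj h2).symm hij
      · simp
      · rfl
    · simp

/-- Division by a monomial costs exactly the inverse of its weight. `exists_seriesNorm_tail_le`
compensates this loss when the quotient is multiplied by a series of higher initial exponent. -/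
lemma seriesNorm_divPart_le (s : ℕ) (h : MvPowerSeries (Fin N) ℝ) (i : ι) :
    seriesNorm s (divPart e asg h i) ≤ (primeCode (e i) : ℝ≥0∞) ^ s * seriesNorm s h := by
  classical
  unfold seriesNorm
  rw [← ENNReal.tsum_mul_left]
  calc _ ≤ ∑' α, (primeCode (e i) : ℝ≥0∞) ^ s * (‖MvPowerSeries.coeff (α + e i) h‖ₑ *
        ((primeCode (α + e i) : ℝ≥0∞) ^ s)⁻¹) := by
        refine ENNReal.tsum_le_tsum fun α => ?_
        have h1 : ‖MvPowerSeries.coeff α (divPart e asg h i)‖ₑ ≤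
            ‖MvPowerSeries.coeff (α + e i) h‖ₑ := by
          rw [coeff_divPart]; split_ifs <;> simp
        calc _ ≤ ‖MvPowerSeries.coeff (α + e i) h‖ₑ * ((primeCode α : ℝ≥0∞) ^ s)⁻¹ := by gcongr
          _ = ‖MvPowerSeries.coeff (α + e i) h‖ₑ * ((primeCode α : ℝ≥0∞) ^ s)⁻¹ *
              ((primeCode (e i) : ℝ≥0∞) ^ s * ((primeCode (e i) : ℝ≥0∞) ^ s)⁻¹) := by
              rw [ENNReal.mul_inv_cancel (primeCode_cast_ne_zero _ _)
                (primeCode_cast_ne_top _ _), mul_one]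
          _ = _ := by rw [weight_add]; ring
    _ ≤ _ := ENNReal.tsum_comp_le_tsum_of_injective (add_left_injective (e i)) _

lemma seriesNorm_restPart_le (s : ℕ) (h : MvPowerSeries (Fin N) ℝ) :
    seriesNorm s (restPart asg h) ≤ seriesNorm s h := by
  classical
  refine ENNReal.tsum_le_tsum fun α => ?_
  have h1 : ‖MvPowerSeries.coeff α (restPart asg h)‖ₑ ≤ ‖MvPowerSeries.coeff α h‖ₑ := by
    change ‖if asg α = none then MvPowerSeries.coeff α h else 0‖ₑ ≤ _
    split_ifs <;> simp
  gcongr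

variable [Fintype ι] (g : ι → MvPowerSeries (Fin N) ℝ)

/-- The correction operator of the division algorithm. -/
noncomputable def divCorrection (h : MvPowerSeries (Fin N) ℝ) : MvPowerSeries (Fin N) ℝ :=
  ∑ i, divPart e asg h i * g i

/-- The correction strictly raises the order: an exponent divided by `e i` is multiplied by
exponents of `g i`, whose codes exceed that of `e i`. So the iteration of the division stabilises
coefficient by coefficient. -/
lemma coeff_divCorrection_congr
    (hg : ∀ i β, primeCode β ≤ primeCode (e i) → MvPowerSeries.coeff β (g i) = 0)
    {h h' : MvPowerSeries (Fin N) ℝ} {γ : Fin N →₀ ℕ}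
    (hh : ∀ β, primeCode β < primeCode γ → MvPowerSeries.coeff β h = MvPowerSeries.coeff β h') :
    MvPowerSeries.coeff γ (divCorrection e asg g h) =
      MvPowerSeries.coeff γ (divCorrection e asg g h') := by
  classical
  unfold divCorrection
  rw [map_sum, map_sum]
  refine Finset.sum_congr rfl fun i _ => ?_
  rw [MvPowerSeries.coeff_mul, MvPowerSeries.coeff_mul]
  refine Finset.sum_congr rfl fun p hp => ?_
  by_cases hb : primeCode p.2 ≤ primeCode (e i)
  · simp [hg i _ hb]
  · congr 1
    rw [coeff_divPart, coeff_divPart, hh]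
    rw [primeCode_add, ← Finset.HasAntidiagonal.mem_antidiagonal.1 hp, primeCode_add]
    exact Nat.mul_lt_mul_of_pos_left (not_le.1 hb) (primeCode_pos _)

/-- The iterates of the division algorithm. -/
noncomputable def divIter (f : MvPowerSeries (Fin N) ℝ) : ℕ → MvPowerSeries (Fin N) ℝ
  | 0 => 0
  | k + 1 => f - divCorrection e asg g (divIter f k)

lemma coeff_divIter_succ
    (hg : ∀ i β, primeCode β ≤ primeCode (e i) → MvPowerSeries.coeff β (g i) = 0)
    (f : MvPowerSeries (Fin N) ℝ) (k : ℕ) : ∀ γ : Fin N →₀ ℕ, primeCode γ ≤ k →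
    MvPowerSeries.coeff γ (divIter e asg g f (k + 1)) =
      MvPowerSeries.coeff γ (divIter e asg g f k) := by
  induction k with
  | zero => intro γ hγ; have := primeCode_pos γ; omega
  | succ k ih =>
    intro γ hγ
    rw [divIter, divIter, map_sub, map_sub]
    congr 1
    exact coeff_divCorrection_congr e asg g hg fun β hβ => ih β (by omega)

lemma coeff_divIter_stable
    (hg : ∀ i β, primeCode β ≤ primeCode (e i) → MvPowerSeries.coeff β (g i) = 0)
    (f : MvPowerSeries (Fin N) ℝ) (γ : Fin N →₀ ℕ) (k : ℕ) (hk : primeCode γ ≤ k) :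
    MvPowerSeries.coeff γ (divIter e asg g f k) =
      MvPowerSeries.coeff γ (divIter e asg g f (primeCode γ)) := by
  induction k, hk using Nat.le_induction with
  | base => rfl
  | succ k hk ih => rw [coeff_divIter_succ e asg g hg f k γ hk, ih]

/-- The equation is a fixed point problem. Its formal solution is the coefficientwise limit of the
iterates. It converges because in a sufficiently small polydisc the correction has norm at most
`1/2`, which bounds all the iterates by `2 ‖f‖`. -/
lemma exists_divFix (hg : ∀ i β, primeCode β ≤ primeCode (e i) → MvPowerSeries.coeff β (g i) = 0)
    (hgc : ∀ i, g i ∈ convergentSeries N) {f : MvPowerSeries (Fin N) ℝ}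
    (hf : f ∈ convergentSeries N) :
    ∃ h ∈ convergentSeries N, f = h + divCorrection e asg g h := by
  set h : MvPowerSeries (Fin N) ℝ := fun γ => MvPowerSeries.coeff γ (divIter e asg g f (primeCode γ))
  have hh : ∀ γ k, primeCode γ ≤ k →
      MvPowerSeries.coeff γ h = MvPowerSeries.coeff γ (divIter e asg g f k) := fun γ k hk =>
    (coeff_divIter_stable e asg g hg f γ k hk).symm
  refine ⟨h, ?_, ?_⟩
  · obtain ⟨s₀, hs₀⟩ := hf
    -- With this `ε` the sum of the contributions of all `i` is at most `1/2`; the `+ 1` covers an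
    -- empty index set.
    set ε : ℝ≥0∞ := (2 * ((Fintype.card ι : ℝ≥0∞) + 1))⁻¹
    have hε : ε ≠ 0 := by
      simp only [ε, ne_eq, ENNReal.inv_eq_zero]
      exact ENNReal.mul_ne_top (by simp) (by simp)
    choose s hs using fun i => exists_seriesNorm_tail_le (hg i) (hgc i) hε
    set S := s₀ + ∑ i, s i
    have hSi : ∀ i, (primeCode (e i) : ℝ≥0∞) ^ S * seriesNorm S (g i) ≤ ε := fun i =>
      hs i S ((Finset.single_le_sum (fun _ _ => Nat.zero_le _) (Finset.mem_univ i)).trans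
        (Nat.le_add_left _ _))
    have hcorr : ∀ F, seriesNorm S (divCorrection e asg g F) ≤ 2⁻¹ * seriesNorm S F := by
      intro F
      calc _ ≤ ∑ i, seriesNorm S (divPart e asg F i * g i) := seriesNorm_sum_le _ _ _
        _ ≤ ∑ _i : ι, ε * seriesNorm S F := by
            refine Finset.sum_le_sum fun i _ => ?_
            calc _ ≤ seriesNorm S (divPart e asg F i) * seriesNorm S (g i) := seriesNorm_mul_le _ _ _
              _ ≤ (primeCode (e i) : ℝ≥0∞) ^ S * seriesNorm S F * seriesNorm S (g i) := by
                  gcongr; exact seriesNorm_divPart_le _ _ _ _ _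
              _ = (primeCode (e i) : ℝ≥0∞) ^ S * seriesNorm S (g i) * seriesNorm S F := by ring
              _ ≤ _ := by gcongr; exact hSi i
        _ = (Fintype.card ι * ε) * seriesNorm S F := by simp [mul_assoc]
        _ ≤ _ := by
            gcongr
            simp only [ε]
            rw [ENNReal.mul_inv (by simp) (by simp), mul_left_comm]
            refine mul_le_of_le_one_right' ?_
            rw [← div_eq_mul_inv]
            refine ENNReal.div_le_of_le_mul ?_
            simp
    have hiter : ∀ k, seriesNorm S (divIter e asg g f k) ≤ 2 * seriesNorm S f := by
      intro k
      induction k with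
      | zero => simp [divIter, seriesNorm_zero]
      | succ k ih =>
        rw [divIter, sub_eq_add_neg]
        calc _ ≤ seriesNorm S f + 2⁻¹ * (2 * seriesNorm S f) :=
              (seriesNorm_add_le _ _ _).trans (add_le_add le_rfl (by
                rw [seriesNorm_neg]; exact (hcorr _).trans (by gcongr)))
          _ = _ := by
            rw [← mul_assoc, ENNReal.inv_mul_cancel (by simp) (by simp), one_mul, two_mul]
    refine ⟨S, ne_top_of_le_ne_top (b := 2 * seriesNorm S f) (ENNReal.mul_ne_top (by simp)
      (ne_top_of_le_ne_top hs₀ (seriesNorm_anti (Nat.le_add_right _ _) _))) ?_⟩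
    -- The norm is a supremum of finite partial sums, and on a finite set of exponents the limit
    -- coincides with an iterate of sufficiently large index.
    unfold seriesNorm
    rw [ENNReal.tsum_eq_iSup_sum]
    refine iSup_le fun t => ?_
    calc _ = ∑ γ ∈ t, ‖MvPowerSeries.coeff γ (divIter e asg g f (∑ δ ∈ t, primeCode δ))‖ₑ *
          ((primeCode γ : ℝ≥0∞) ^ S)⁻¹ := by
          refine Finset.sum_congr rfl fun γ hγ => ?_
          rw [hh γ _ (Finset.single_le_sum (f := primeCode) (fun _ _ => Nat.zero_le _) hγ)]
      _ ≤ seriesNorm S (divIter e asg g f (∑ δ ∈ t, primeCode δ)) := ENNReal.sum_le_tsum t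
      _ ≤ _ := hiter _
  · ext γ
    rw [map_add, hh γ (primeCode γ + 1) (by omega), divIter, map_sub,
      coeff_divCorrection_congr e asg g hg (h' := divIter e asg g f (primeCode γ))
        (fun β hβ => hh β _ hβ.le)]
    ring

end Division

/-- The initial exponents of the series in an ideal. -/
def initialExponents (I : Ideal (convergentSeries N)) : Set (Fin N →₀ ℕ) :=
  {α | ∃ F ∈ I, IsMonicAt (F : MvPowerSeries (Fin N) ℝ) α}

lemma exists_mem_initialExponents {I : Ideal (convergentSeries N)} {F : convergentSeries N}
    (hF : F ∈ I) (h0 : F ≠ 0) : ∃ α ∈ initialExponents I,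
      MvPowerSeries.coeff α (F : MvPowerSeries (Fin N) ℝ) ≠ 0 := by
  have hne : ({α | MvPowerSeries.coeff α (F : MvPowerSeries (Fin N) ℝ) ≠ 0}).Nonempty := by
    by_contra h
    rw [Set.not_nonempty_iff_eq_empty, Set.eq_empty_iff_forall_notMem] at h
    refine h0 (Subtype.ext ?_)
    ext α
    simpa using h α
  obtain ⟨α, hα, hmin⟩ := (measure (primeCode (N := N))).wf.has_min _ hne
  refine ⟨α, ⟨(MvPowerSeries.coeff α (F : MvPowerSeries (Fin N) ℝ))⁻¹ • F,
    Submodule.smul_of_tower_mem I _ hF, ?_, fun β hβ => ?_⟩, hα⟩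
  · simpa using inv_mul_cancel₀ hα
  · have : MvPowerSeries.coeff β (F : MvPowerSeries (Fin N) ℝ) = 0 := by
      by_contra h
      exact hmin β h hβ
    simp [this]

/-- Dickson's lemma: the minimal elements form an antichain, which is finite in a well-quasi-order,
and every element lies above a minimal one. -/
lemma exists_finite_le {σ : Type*} [PartialOrder σ] [WellQuasiOrderedLE σ] (S : Set σ) :
    ∃ t : Finset σ, ↑t ⊆ S ∧ ∀ α ∈ S, ∃ β ∈ t, β ≤ α := by
  have hfin : {α | Minimal (· ∈ S) α}.Finite := by
    refine WellQuasiOrderedLE.finite_of_isAntichain ?_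
    exact setOfPred_minimal_antichain _
  refine ⟨hfin.toFinset, fun α hα => ?_, fun α hα => ?_⟩
  · exact (hfin.mem_toFinset.1 hα).prop
  · obtain ⟨β, hβα, hβ⟩ := exists_minimal_le_of_wellFoundedLT (· ∈ S) α hα
    exact ⟨β, hfin.mem_toFinset.2 hβ, hβα⟩

/-- The initial exponents of an ideal lie above finitely many of them. Dividing a member of the
ideal by series with these initial exponents leaves a remainder that is in the ideal and contains no
initial exponent of it, so it vanishes and the chosen series generate. -/
instance isNoetherianRing_convergentSeries : IsNoetherianRing (convergentSeries N) := by
  classical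
  refine (isNoetherianRing_iff_ideal_fg _).2 fun I => ?_
  obtain ⟨t, htS, ht⟩ := exists_finite_le (initialExponents I)
  choose F hFI hF using fun i : t => htS i.2
  set asg : (Fin N →₀ ℕ) → Option t := fun α =>
    if h : ∃ i : t, (i : Fin N →₀ ℕ) ≤ α then some h.choose else none with hasg
  have hasg1 : ∀ α i, asg α = some i → (i : Fin N →₀ ℕ) ≤ α := by
    intro α i h
    simp only [hasg] at h
    split_ifs at h with h1
    · rw [← Option.some.inj h]; exact h1.choose_spec
  have hasg2 : ∀ α, asg α = none → α ∉ initialExponents I := by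
    intro α h hα
    obtain ⟨β, hβ, hle⟩ := ht α hα
    have h1 : ∃ i : t, (i : Fin N →₀ ℕ) ≤ α := ⟨⟨β, hβ⟩, hle⟩
    simp only [hasg, dif_pos h1, reduceCtorEq] at h
  refine ⟨Finset.univ.image F, le_antisymm (Submodule.span_le.2 ?_) fun f hf => ?_⟩
  · intro x hx
    simp only [Finset.coe_image, Finset.coe_univ, image_univ, mem_range] at hx
    obtain ⟨i, rfl⟩ := hx
    exact hFI i
  -- The divisors without their leading monomials: every exponent left has a larger code, as the
  -- division requires.
  set g : t → MvPowerSeries (Fin N) ℝ := fun i =>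
    (F i : MvPowerSeries (Fin N) ℝ) - MvPowerSeries.monomial (i : Fin N →₀ ℕ) 1
  have hmon : ∀ α : Fin N →₀ ℕ, MvPowerSeries.monomial α (1 : ℝ) ∈ convergentSeries N := fun α =>
    ⟨0, by rw [seriesNorm_monomial]; simp⟩
  obtain ⟨h, ⟨s, hs⟩, hfh⟩ := exists_divFix (fun i : t => (i : Fin N →₀ ℕ)) asg g (by
      intro i β hβ
      rcases hβ.lt_or_eq with h | h
      · have : β ≠ i := fun h' => by rw [h'] at h; exact lt_irrefl _ h
        simp [g, (hF i).2 β h, MvPowerSeries.coeff_monomial, this]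
      · rw [primeCode_injective h]
        simp [g, (hF i).1])
    (fun i => sub_mem (F i).2 (hmon _)) f.2
  have hq : ∀ i, divPart (fun i : t => (i : Fin N →₀ ℕ)) asg h i ∈ convergentSeries N := fun i =>
    ⟨s, ne_top_of_le_ne_top (ENNReal.mul_ne_top (primeCode_cast_ne_top _ _) hs)
      (seriesNorm_divPart_le _ _ _ _ _)⟩
  have hr : restPart asg h ∈ convergentSeries N :=
    ⟨s, ne_top_of_le_ne_top hs (seriesNorm_restPart_le _ _ _)⟩
  have hsum : (f : MvPowerSeries (Fin N) ℝ) =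
      ∑ i, divPart (fun i : t => (i : Fin N →₀ ℕ)) asg h i * F i + restPart asg h := by
    rw [hfh]
    nth_rewrite 1 [← sum_divPart_add_restPart (fun i : t => (i : Fin N →₀ ℕ)) asg hasg1 h]
    simp only [divCorrection, g, mul_sub, Finset.sum_sub_distrib]
    abel
  have hsum' : f = ∑ i, (⟨_, hq i⟩ : convergentSeries N) * F i + ⟨_, hr⟩ := by
    refine Subtype.ext ?_
    rw [hsum]
    simp
  have hspan : ∑ i, (⟨_, hq i⟩ : convergentSeries N) * F i ∈
      Submodule.span (convergentSeries N) ((Finset.univ.image F : Finset _) : Set _) :=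
    Submodule.sum_mem _ fun i _ => Submodule.smul_mem _ _ (Submodule.subset_span (by simp))
  have hsI : ∑ i, (⟨_, hq i⟩ : convergentSeries N) * F i ∈ I :=
    Submodule.sum_mem _ fun i _ => Submodule.smul_mem _ _ (hFI i)
  have hr0 : (⟨_, hr⟩ : convergentSeries N) = 0 := by
    by_contra h0
    have hrI : (⟨_, hr⟩ : convergentSeries N) ∈ I := by
      rw [eq_sub_of_add_eq' hsum'.symm]
      exact sub_mem hf hsI
    obtain ⟨α, hα, hα0⟩ := exists_mem_initialExponents hrI h0
    refine hα0 ?_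
    change (if asg α = none then MvPowerSeries.coeff α h else 0) = 0
    rw [if_neg fun h => hasg2 α h hα]
  rw [hsum', hr0, add_zero]
  exact hspan

end ConvergentSeries

/-! ### Analytic functions as convergent series; analytic relations among infinitely many fields. -/

section SeriesEvaluation

open scoped ENNReal NNReal

variable {N : ℕ}

variable (N) in
/-- Words in the letters `Fin N`. -/
abbrev Words : Type := Σ n : ℕ, Fin n → Fin N

/-- The multi-index that counts the letters of a word. -/
noncomputable def wordContent (w : Words N) : Fin N →₀ ℕ := ∑ k, Finsupp.single (w.2 k) 1

/-- The monomial given by a multi-index. -/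
noncomputable def monom (x : EuclideanSpace ℝ (Fin N)) (α : Fin N →₀ ℕ) : ℝ := ∏ i, x i ^ α i

lemma monom_add (x : EuclideanSpace ℝ (Fin N)) (α β : Fin N →₀ ℕ) :
    monom x (α + β) = monom x α * monom x β := by
  simp [monom, pow_add, Finset.prod_mul_distrib]

lemma monom_single (x : EuclideanSpace ℝ (Fin N)) (i : Fin N) :
    monom x (Finsupp.single i 1) = x i := by
  classical
  rw [monom, Finset.prod_eq_single i]
  · simp
  · intro j _ hj; simp [hj.symm]
  · simp

lemma monom_wordContent (x : EuclideanSpace ℝ (Fin N)) (w : Words N) :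
    monom x (wordContent w) = ∏ k, x (w.2 k) := by
  classical
  unfold wordContent
  induction (Finset.univ : Finset (Fin w.1)) using Finset.induction_on with
  | empty => simp [monom]
  | insert k t hk ih => rw [Finset.sum_insert hk, Finset.prod_insert hk, monom_add, ih, monom_single]

lemma degree_wordContent (w : Words N) : (wordContent w).degree = w.1 := by
  simp [wordContent, map_sum]

lemma exists_wordContent_eq (α : Fin N →₀ ℕ) : ∃ w : Words N, wordContent w = α := by
  induction α using Finsupp.induction_linear with
  | zero => exact ⟨⟨0, Fin.elim0⟩, by simp [wordContent]⟩
  | add α β hα hβ =>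
    obtain ⟨⟨n, w⟩, rfl⟩ := hα
    obtain ⟨⟨l, v⟩, rfl⟩ := hβ
    exact ⟨⟨n + l, Fin.append w v⟩, by simp [wordContent, Fin.sum_univ_add]⟩
  | single i n => exact ⟨⟨n, fun _ => i⟩, by simp [wordContent]⟩

lemma abs_monom_le {x : EuclideanSpace ℝ (Fin N)} {ρ : ℝ} (hx : ‖x‖ ≤ ρ) (α : Fin N →₀ ℕ) :
    |monom x α| ≤ ρ ^ α.degree := by
  rw [monom, Finset.abs_prod, Finsupp.degree_eq_sum, ← Finset.prod_pow_eq_pow_sum]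
  refine Finset.prod_le_prod (fun _ _ => abs_nonneg _) fun i _ => ?_
  rw [abs_pow]
  exact pow_le_pow_left₀ (abs_nonneg _) ((PiLp.norm_apply_le x i).trans hx) _

/-- Homogeneous multilinear terms expand along words, whereas a power series is indexed by
multi-indices. Each word gives a product of coordinates, a multilinear map of norm at most one, so
absolute summability at radius `ρ` bounds the radius of convergence from below. -/
lemma analyticAt_wordSeries {c : Words N → ℝ} {ρ : ℝ≥0} (hρ : 0 < ρ)
    (hc : Summable fun w : Words N => |c w| * (ρ : ℝ) ^ w.1) :
    AnalyticAt ℝ (fun x : EuclideanSpace ℝ (Fin N) => ∑' w, c w * monom x (wordContent w)) 0 := by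
  set M : ∀ n, (Fin n → Fin N) → (EuclideanSpace ℝ (Fin N)) [×n]→L[ℝ] ℝ := fun n w =>
    (ContinuousMultilinearMap.mkPiAlgebraFin ℝ n ℝ).compContinuousLinearMap
      fun k => EuclideanSpace.proj (w k)
  have hMapp : ∀ n w x, M n w (fun _ => x) = monom x (wordContent ⟨n, w⟩) := by
    intro n w x
    simp [M, monom_wordContent, List.prod_ofFn]
  have hproj : ∀ i : Fin N, ‖(EuclideanSpace.proj i : EuclideanSpace ℝ (Fin N) →L[ℝ] ℝ)‖ ≤ 1 :=
    fun i => ContinuousLinearMap.opNorm_le_bound _ zero_le_one fun x => by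
      simpa using PiLp.norm_apply_le x i
  have hM : ∀ n w, ‖M n w‖ ≤ 1 := by
    intro n w
    refine (ContinuousMultilinearMap.norm_compContinuousLinearMap_le _ _).trans ?_
    have h1 : ‖ContinuousMultilinearMap.mkPiAlgebraFin ℝ n ℝ‖ ≤ 1 := by
      simp
    exact mul_le_one₀ h1 (Finset.prod_nonneg fun _ _ => norm_nonneg _)
      (Finset.prod_le_one (fun _ _ => norm_nonneg _) fun _ _ => hproj _)
  set p : FormalMultilinearSeries ℝ (EuclideanSpace ℝ (Fin N)) ℝ := fun n =>
    ∑ w : Fin n → Fin N, c ⟨n, w⟩ • M n w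
  refine HasFPowerSeriesAt.analyticAt (p := p) ⟨ρ, ⟨?_, by simpa using hρ, ?_⟩⟩
  · refine p.le_radius_of_bound (∑' w : Words N, |c w| * (ρ : ℝ) ^ w.1) fun n => ?_
    calc ‖p n‖ * (ρ : ℝ) ^ n ≤ (∑ w : Fin n → Fin N, |c ⟨n, w⟩|) * (ρ : ℝ) ^ n := by
          gcongr
          refine (norm_sum_le _ _).trans (Finset.sum_le_sum fun w _ => ?_)
          rw [norm_smul, Real.norm_eq_abs]
          exact mul_le_of_le_one_right (abs_nonneg _) (hM n w)
      _ = ∑ w ∈ (Finset.univ : Finset (Fin n → Fin N)).map (Function.Embedding.sigmaMk n),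
          |c w| * (ρ : ℝ) ^ w.1 := by simp [Finset.sum_mul]
      _ ≤ _ := hc.sum_le_tsum _ fun w _ => by positivity
  · intro x hx
    rw [zero_add]
    have hxρ : ‖x‖ ≤ ρ := by
      rw [Metric.mem_eball, edist_zero_right] at hx
      exact_mod_cast (show ‖x‖₊ < ρ by exact_mod_cast hx).le
    have hsum : Summable fun w : Words N => c w * monom x (wordContent w) := by
      refine Summable.of_norm_bounded hc fun w => ?_
      rw [norm_mul, Real.norm_eq_abs, Real.norm_eq_abs]
      gcongr
      simpa [degree_wordContent] using abs_monom_le hxρ (wordContent w)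
    refine hsum.hasSum.sigma fun n => ?_
    have : p n (fun _ => x) = ∑ w : Fin n → Fin N, c ⟨n, w⟩ * monom x (wordContent ⟨n, w⟩) := by
      simp [p, hMapp]
    rw [this]
    exact hasSum_fintype _

/-- The value of a power series at a point. -/
noncomputable def seriesEval (F : MvPowerSeries (Fin N) ℝ) (x : EuclideanSpace ℝ (Fin N)) : ℝ :=
  ∑' α, MvPowerSeries.coeff α F * monom x α

lemma exists_summable_of_mem {F : MvPowerSeries (Fin N) ℝ} (hF : F ∈ convergentSeries N) :
    ∃ ρ : ℝ≥0, 0 < ρ ∧ Summable fun α => |MvPowerSeries.coeff α F| * (ρ : ℝ) ^ α.degree := by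
  obtain ⟨s, hs⟩ := hF
  -- `Q` dominates the primes of the code, so codes are at most `Q ^ degree` and the radius `Q^{-s}`
  -- is controlled by the weighted norm.
  set Q : ℕ := ∑ i : Fin N, Nat.nth Nat.Prime i + 1
  have hQ : ∀ i : Fin N, Nat.nth Nat.Prime i ≤ Q := fun i =>
    (Finset.single_le_sum (f := fun i : Fin N => Nat.nth Nat.Prime i) (fun _ _ => Nat.zero_le _)
      (Finset.mem_univ i)).trans (Nat.le_succ _)
  have hPQ : ∀ α : Fin N →₀ ℕ, primeCode α ≤ Q ^ α.degree := by
    intro α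
    rw [primeCode, Finsupp.degree_eq_sum, ← Finset.prod_pow_eq_pow_sum]
    exact Finset.prod_le_prod' fun i _ => Nat.pow_le_pow_left (hQ i) _
  have hQ0 : (0 : ℝ) < Q := by simp only [Q]; positivity
  refine ⟨((Q : ℝ≥0) ^ s)⁻¹, by simp only [Q]; positivity, ?_⟩
  refine Summable.of_nonneg_of_le (fun α => by positivity) (fun α => ?_)
    (ENNReal.summable_toReal hs)
  rw [ENNReal.toReal_mul, toReal_enorm, Real.norm_eq_abs, ENNReal.toReal_inv, ENNReal.toReal_pow,
    ENNReal.toReal_natCast]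
  gcongr
  have h1 : (primeCode α : ℝ) ≤ (Q : ℝ) ^ α.degree := by exact_mod_cast hPQ α
  have h0 : (0 : ℝ) < primeCode α := by exact_mod_cast primeCode_pos α
  push_cast
  rw [inv_pow]
  refine inv_anti₀ (by positivity) ?_
  rw [← pow_mul, mul_comm, pow_mul]
  exact pow_le_pow_left₀ h0.le h1 s

lemma eventually_summable_of_mem {F : MvPowerSeries (Fin N) ℝ} (hF : F ∈ convergentSeries N) :
    ∀ᶠ x in 𝓝 (0 : EuclideanSpace ℝ (Fin N)),
      Summable fun α => ‖MvPowerSeries.coeff α F * monom x α‖ := by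
  obtain ⟨ρ, hρ, h⟩ := exists_summable_of_mem hF
  filter_upwards [Metric.closedBall_mem_nhds 0 (show (0 : ℝ) < ρ from hρ)] with x hx
  refine Summable.of_nonneg_of_le (fun _ => norm_nonneg _) (fun α => ?_) h
  rw [norm_mul, Real.norm_eq_abs, Real.norm_eq_abs]
  gcongr
  exact abs_monom_le (by simpa using hx) α

lemma analyticAt_seriesEval {F : MvPowerSeries (Fin N) ℝ} (hF : F ∈ convergentSeries N) :
    AnalyticAt ℝ (seriesEval F) 0 := by
  classical
  obtain ⟨ρ, hρ, h⟩ := exists_summable_of_mem hF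
  choose word hword using exists_wordContent_eq (N := N)
  have hinj : Function.Injective word := fun α β hαβ => by rw [← hword α, hαβ, hword]
  -- One word is chosen for each multi-index to carry its coefficient; all the other words get
  -- coefficient zero.
  set c : Words N → ℝ := fun w =>
    if word (wordContent w) = w then MvPowerSeries.coeff (wordContent w) F else 0
  have hc0 : ∀ w, w ∉ range word → c w = 0 := fun w hw =>
    if_neg fun h => hw ⟨_, h⟩
  have hcw : ∀ α, c (word α) = MvPowerSeries.coeff α F := fun α => by simp [c, hword]
  have h1 : AnalyticAt ℝ (fun x : EuclideanSpace ℝ (Fin N) =>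
      ∑' w, c w * monom x (wordContent w)) 0 := by
    refine analyticAt_wordSeries hρ ?_
    refine (hinj.summable_iff fun w hw => by simp [hc0 w hw]).1 ?_
    refine h.congr fun α => ?_
    simp only [Function.comp_apply, hcw]
    rw [← degree_wordContent, hword]
  refine h1.congr (Filter.Eventually.of_forall fun x => ?_)
  change ∑' w, c w * monom x (wordContent w) = ∑' α, MvPowerSeries.coeff α F * monom x α
  rw [← hinj.tsum_eq]
  · simp [hcw, hword]
  · intro w hw
    by_contra h'
    exact hw (by simp [hc0 w h'])

lemma seriesEval_add {F G : MvPowerSeries (Fin N) ℝ} (hF : F ∈ convergentSeries N)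
    (hG : G ∈ convergentSeries N) : ∀ᶠ x in 𝓝 (0 : EuclideanSpace ℝ (Fin N)),
      seriesEval (F + G) x = seriesEval F x + seriesEval G x := by
  filter_upwards [eventually_summable_of_mem hF, eventually_summable_of_mem hG] with x h1 h2
  rw [seriesEval, seriesEval, seriesEval, ← h1.of_norm.tsum_add h2.of_norm]
  simp [add_mul]

lemma seriesEval_mul {F G : MvPowerSeries (Fin N) ℝ} (hF : F ∈ convergentSeries N)
    (hG : G ∈ convergentSeries N) : ∀ᶠ x in 𝓝 (0 : EuclideanSpace ℝ (Fin N)),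
      seriesEval (F * G) x = seriesEval F x * seriesEval G x := by
  filter_upwards [eventually_summable_of_mem hF, eventually_summable_of_mem hG] with x h1 h2
  set f : (Fin N →₀ ℕ) → ℝ := fun α => MvPowerSeries.coeff α F * monom x α with hf
  set g : (Fin N →₀ ℕ) → ℝ := fun α => MvPowerSeries.coeff α G * monom x α with hg
  have key : (∑' α, f α) * ∑' α, g α =
      ∑' α, ∑ p ∈ Finset.HasAntidiagonal.antidiagonal α, f p.1 * g p.2 :=
    h1.of_norm.tsum_mul_tsum_eq_tsum_sum_antidiagonal h2.of_norm
      (summable_mul_of_summable_norm h1 h2)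
  have hα : ∀ α, MvPowerSeries.coeff α (F * G) * monom x α =
      ∑ p ∈ Finset.HasAntidiagonal.antidiagonal α, f p.1 * g p.2 := by
    intro α
    rw [MvPowerSeries.coeff_mul, Finset.sum_mul]
    refine Finset.sum_congr rfl fun p hp => ?_
    have hpα : monom x α = monom x p.1 * monom x p.2 := by
      rw [← monom_add, Finset.HasAntidiagonal.mem_antidiagonal.1 hp]
    rw [hpα, hf, hg]
    ring
  change ∑' α, MvPowerSeries.coeff α (F * G) * monom x α = (∑' α, f α) * ∑' α, g α
  rw [key]
  exact tsum_congr hα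

lemma seriesEval_sum {ι : Type*} (t : Finset ι) {F : ι → MvPowerSeries (Fin N) ℝ}
    (hF : ∀ i, F i ∈ convergentSeries N) : ∀ᶠ x in 𝓝 (0 : EuclideanSpace ℝ (Fin N)),
      seriesEval (∑ i ∈ t, F i) x = ∑ i ∈ t, seriesEval (F i) x := by
  classical
  induction t using Finset.induction_on with
  | empty => simp [seriesEval]
  | insert i t hi ih =>
    rw [Finset.sum_insert hi]
    filter_upwards [ih, seriesEval_add (hF i) (Subalgebra.sum_mem _ fun i _ => hF i)] with x h1 h2
    rw [h2, h1, Finset.sum_insert hi]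

/-- Analytic functions are sums of convergent power series in the coordinates. -/
lemma exists_seriesEval_eq {f : EuclideanSpace ℝ (Fin N) → ℝ} {u : EuclideanSpace ℝ (Fin N)}
    (hf : AnalyticAt ℝ f u) : ∃ F ∈ convergentSeries N,
      ∀ᶠ x in 𝓝 (0 : EuclideanSpace ℝ (Fin N)), f (u + x) = seriesEval F x := by
  classical
  obtain ⟨p, r, hp⟩ := hf
  obtain ⟨δ, hδ0, hδr⟩ : ∃ δ : ℝ≥0, 0 < δ ∧ (δ : ℝ≥0∞) < r := by
    obtain ⟨δ, h1, h2⟩ := ENNReal.lt_iff_exists_nnreal_btwn.1 hp.r_pos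
    exact ⟨δ, by simpa using h1, h2⟩
  -- There are `N ^ n` words of length `n`, so summing over words at radius `ρ` requires `N ρ ≤ δ`.
  set ρ : ℝ≥0 := δ / (N + 1) with hρdef
  have hρ : 0 < ρ := by positivity
  have hρδ : ρ ≤ δ := by
    rw [hρdef]
    exact div_le_self zero_le (by simp)
  set b := EuclideanSpace.basisFun (Fin N) ℝ
  set c : Words N → ℝ := fun w => p w.1 fun k => b (w.2 k)
  have hcb : ∀ w : Words N, |c w| ≤ ‖p w.1‖ := fun w => by
    refine ((p w.1).le_opNorm _).trans ?_
    simp [b]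
  have hsumc : Summable fun w : Words N => |c w| * (ρ : ℝ) ^ w.1 := by
    refine Summable.of_nonneg_of_le (fun _ => by positivity)
      (fun w => mul_le_mul_of_nonneg_right (hcb w) (by positivity)) ?_
    refine (summable_sigma_of_nonneg fun _ => by positivity).2 ⟨fun n => ?_, ?_⟩
    · exact (hasSum_fintype _).summable
    · refine Summable.of_nonneg_of_le (fun n => tsum_nonneg fun _ => by positivity) (fun n => ?_)
        (p.summable_norm_mul_pow (hδr.trans_le hp.r_le))
      have h0 : ∑' _w : Fin n → Fin N, ‖p n‖ * (ρ : ℝ) ^ n =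
          ((N ^ n : ℕ) : ℝ) * (‖p n‖ * (ρ : ℝ) ^ n) := by
        rw [tsum_fintype, Finset.sum_const, nsmul_eq_mul, Finset.card_univ, Fintype.card_fun,
          Fintype.card_fin, Fintype.card_fin]
      refine h0.le.trans ?_
      have h1 : ((N : ℝ) * ρ) ^ n ≤ (δ : ℝ) ^ n := by
        refine pow_le_pow_left₀ (by positivity) ?_ n
        rw [hρdef]
        push_cast
        rw [← mul_div_assoc, div_le_iff₀ (by positivity), mul_comm]
        gcongr
        simp
      calc ((N ^ n : ℕ) : ℝ) * (‖p n‖ * (ρ : ℝ) ^ n) = ‖p n‖ * ((N : ℝ) * ρ) ^ n := by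
            push_cast; rw [mul_pow]; ring
        _ ≤ _ := by gcongr
  -- Coordinates commute, so all words of the same content contribute to a single coefficient.
  set F : MvPowerSeries (Fin N) ℝ := fun α => ∑' w : {w : Words N // wordContent w = α}, c w
  have hF : ∀ α, MvPowerSeries.coeff α F = ∑' w : {w : Words N // wordContent w = α}, c w :=
    fun α => rfl
  have hρp : ∀ α (w : {w : Words N // wordContent w = α}), (w : Words N).1 = α.degree := by
    rintro α ⟨w, rfl⟩; rw [degree_wordContent]
  have hsumfib : ∀ α, Summable fun w : {w : Words N // wordContent w = α} => c w := by
    intro α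
    refine Summable.of_norm ?_
    have := hsumc.comp_injective
      (Subtype.val_injective (p := fun w : Words N => wordContent w = α))
    refine (this.mul_right ((ρ : ℝ) ^ α.degree)⁻¹).congr fun w => ?_
    simp only [Function.comp_apply, hρp α w, Real.norm_eq_abs]
    field_simp
  refine ⟨F, ?_, ?_⟩
  -- Codes are at least `2 ^ degree`, so `2^{-s} ≤ ρ` makes the weights at exponent `s` at most `ρ ^
  -- degree`.
  · obtain ⟨s, hs⟩ : ∃ s : ℕ, ((2 : ℝ) ^ s)⁻¹ ≤ ρ := by
      obtain ⟨s, hs⟩ := exists_pow_lt_of_lt_one (show (0 : ℝ) < ρ from hρ)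
        (show (2 : ℝ)⁻¹ < 1 by norm_num)
      exact ⟨s, by rw [← inv_pow]; exact hs.le⟩
    have hs' : ((2 : ℝ≥0∞) ^ s)⁻¹ ≤ ρ := by
      have h2 : ((2 : ℝ≥0) ^ s)⁻¹ ≤ ρ := by exact_mod_cast hs
      calc ((2 : ℝ≥0∞) ^ s)⁻¹ = (((2 : ℝ≥0) ^ s)⁻¹ : ℝ≥0) := by
            rw [ENNReal.coe_inv (by positivity)]; simp
        _ ≤ ρ := by exact_mod_cast h2
    refine ⟨s, ?_⟩
    have hP : ∀ α : Fin N →₀ ℕ, ((primeCode α : ℝ≥0∞) ^ s)⁻¹ ≤ (ρ : ℝ≥0∞) ^ α.degree := by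
      intro α
      have h1 : 2 ^ α.degree ≤ primeCode α := by
        rw [primeCode, Finsupp.degree_eq_sum, ← Finset.prod_pow_eq_pow_sum]
        exact Finset.prod_le_prod' fun i _ => Nat.pow_le_pow_left (Nat.prime_nth_prime i).two_le _
      calc ((primeCode α : ℝ≥0∞) ^ s)⁻¹ ≤ ((2 ^ α.degree : ℝ≥0∞) ^ s)⁻¹ := by
            gcongr
            exact_mod_cast h1
        _ = (((2 : ℝ≥0∞) ^ s)⁻¹) ^ α.degree := by
            rw [← ENNReal.inv_pow, ← pow_mul, ← pow_mul, mul_comm]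
        _ ≤ _ := by gcongr
    refine ne_top_of_le_ne_top (b := ∑' w : Words N, ENNReal.ofReal (|c w| * (ρ : ℝ) ^ w.1))
      hsumc.tsum_ofReal_ne_top ?_
    rw [← (Equiv.sigmaFiberEquiv wordContent).tsum_eq, ENNReal.tsum_sigma']
    refine ENNReal.tsum_le_tsum fun α => ?_
    calc ‖MvPowerSeries.coeff α F‖ₑ * ((primeCode α : ℝ≥0∞) ^ s)⁻¹
        ≤ (∑' w : {w : Words N // wordContent w = α}, ‖c w‖ₑ) * (ρ : ℝ≥0∞) ^ α.degree := by
          gcongr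
          · exact enorm_tsum_le_tsum_enorm
          · exact hP α
      _ = _ := by
          rw [← ENNReal.tsum_mul_right]
          refine tsum_congr fun w => ?_
          simp only [Equiv.sigmaFiberEquiv_apply, hρp α w]
          rw [ENNReal.ofReal_mul (abs_nonneg _), ← Real.enorm_eq_ofReal_abs,
            ENNReal.ofReal_pow (by positivity), ENNReal.ofReal_coe_nnreal]
  · filter_upwards [Metric.closedBall_mem_nhds 0 (show (0 : ℝ) < ρ from hρ)] with x hx
    have hxρ : ‖x‖ ≤ ρ := by simpa using hx
    have hs : Summable fun w : Words N => c w * monom x (wordContent w) := by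
      refine Summable.of_norm_bounded hsumc fun w => ?_
      rw [norm_mul, Real.norm_eq_abs, Real.norm_eq_abs]
      gcongr
      simpa [degree_wordContent] using abs_monom_le hxρ (wordContent w)
    have h1 : HasSum (fun n => p n fun _ => x) (∑' w : Words N, c w * monom x (wordContent w)) := by
      refine hs.hasSum.sigma fun n => ?_
      have hx' : x = ∑ i, x i • b i := by
        have := b.sum_repr x
        simpa [b] using this.symm
      have : (p n fun _ => x) = ∑ w : Fin n → Fin N, c ⟨n, w⟩ * monom x (wordContent ⟨n, w⟩) := by
        conv_lhs => rw [hx']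
        have h := (p n).toMultilinearMap.map_sum (fun _ : Fin n => fun i : Fin N => x i • b i)
        refine h.trans (Finset.sum_congr rfl fun w _ => ?_)
        have h2 := (p n).toMultilinearMap.map_smul_univ (fun k => x (w k)) (fun k => b (w k))
        refine h2.trans ?_
        rw [monom_wordContent, smul_eq_mul, mul_comm]
        rfl
      rw [this]
      exact hasSum_fintype _
    have h2 : HasSum (fun α => MvPowerSeries.coeff α F * monom x α)
        (∑' w : Words N, c w * monom x (wordContent w)) := by
      refine ((Equiv.sigmaFiberEquiv wordContent).hasSum_iff.2 hs.hasSum).sigma fun α => ?_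
      rw [hF]
      have h3 := (hsumfib α).hasSum.mul_right (monom x α)
      refine h3.congr_fun ?_
      rintro ⟨w, rfl⟩
      rfl
    have h3 := hp.hasSum (y := x) (by
      rw [Metric.mem_eball, edist_zero_right]
      refine lt_of_le_of_lt ?_ hδr
      have : ‖x‖₊ ≤ δ := (show ‖x‖₊ ≤ ρ from hxρ).trans hρδ
      exact_mod_cast this)
    rw [h3.unique h1, seriesEval, h2.tsum_eq]

/-- Finite generation: among countably many analytic fields at a point, those of large index are
combinations with analytic coefficients of the previous ones. -/
lemma exists_analytic_relation {m : ℕ}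
    {G : Fin m → ℕ → EuclideanSpace ℝ (Fin N) → EuclideanSpace ℝ (Fin N)}
    {u : EuclideanSpace ℝ (Fin N)} (hG : ∀ α k, AnalyticAt ℝ (G α k) u) :
    ∃ (n : ℕ) (f : Fin m → Fin m → Fin (n + 1) → EuclideanSpace ℝ (Fin N) → ℝ),
      (∀ α β k, AnalyticAt ℝ (f α β k) u) ∧
      ∀ᶠ x in 𝓝 u, ∀ α, G α (n + 1) x = ∑ β, ∑ k : Fin (n + 1), f α β k x • G β k x := by
  have hcomp : ∀ α k i, AnalyticAt ℝ (fun x => G α k x i) u := fun α k i =>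
    ((EuclideanSpace.proj i : EuclideanSpace ℝ (Fin N) →L[ℝ] ℝ).analyticAt _).comp (hG α k)
  choose S hS hSe using fun α k i => exists_seriesEval_eq (hcomp α k i)
  set V : Fin m → ℕ → Fin N → convergentSeries N := fun α k i => ⟨S α k i, hS α k i⟩
  -- The germs of the fields live in a free module of rank `N` over the ring of convergent series.
  -- The ascending chain generated by the first fields of each sequence stabilises, with one bound
  -- valid for every `α`.
  have hmono : Monotone fun n => Submodule.span (convergentSeries N)
      (range fun q : Fin m × Fin (n + 1) => V q.1 q.2) := by
    intro n n' hn
    refine Submodule.span_mono ?_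
    rintro _ ⟨⟨α, k⟩, rfl⟩
    exact ⟨⟨α, Fin.castLE (by omega) k⟩, rfl⟩
  obtain ⟨n, hn⟩ := monotone_stabilizes_iff_noetherian.2
    (inferInstance : IsNoetherian (convergentSeries N) (Fin N → convergentSeries N)) ⟨_, hmono⟩
  have hmem : ∀ α, V α (n + 1) ∈ Submodule.span (convergentSeries N)
      (range fun q : Fin m × Fin (n + 1) => V q.1 q.2) := by
    intro α
    have := hn (n + 1) (Nat.le_succ n)
    simp only [OrderHom.coe_mk] at this
    rw [this]
    exact Submodule.subset_span ⟨⟨α, Fin.last _⟩, rfl⟩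
  choose c hc using fun α => (Submodule.mem_span_range_iff_exists_fun _).1 (hmem α)
  have hsub : Filter.Tendsto (fun x => x - u) (𝓝 u) (𝓝 0) := by
    have : Filter.Tendsto (fun x => x - u) (𝓝 u) (𝓝 (u - u)) :=
      (continuous_id.sub continuous_const).tendsto u
    rwa [sub_self] at this
  refine ⟨n, fun α β k x => seriesEval (c α (β, k)) (x - u), fun α β k => ?_, ?_⟩
  · have h1 : AnalyticAt ℝ (seriesEval (c α (β, k) : MvPowerSeries (Fin N) ℝ)) (u - u) := by
      rw [sub_self]; exact analyticAt_seriesEval (c α (β, k)).2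
    exact h1.comp (f := fun x => x - u) (analyticAt_id.sub analyticAt_const)
  · refine Filter.eventually_all.2 fun α => ?_
    have key : ∀ i, ∀ᶠ x in 𝓝 u, G α (n + 1) x i =
        ∑ q : Fin m × Fin (n + 1), seriesEval (c α q) (x - u) * G q.1 q.2 x i := by
      intro i
      have h1 : S α (n + 1) i = ∑ q, (c α q : MvPowerSeries (Fin N) ℝ) * S q.1 q.2 i := by
        have := congrArg (fun v : Fin N → convergentSeries N => (v i : MvPowerSeries (Fin N) ℝ))
          (hc α)
        simpa [V, Finset.sum_apply] using this.symm
      have e0 := hsub.eventually (hSe α (n + 1) i)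
      have e1 := hsub.eventually (seriesEval_sum Finset.univ
        (F := fun q => (c α q : MvPowerSeries (Fin N) ℝ) * S q.1 q.2 i)
        fun q => Subalgebra.mul_mem _ (c α q).2 (hS _ _ _))
      have e2 : ∀ᶠ x in 𝓝 u, ∀ q : Fin m × Fin (n + 1), seriesEval
          ((c α q : MvPowerSeries (Fin N) ℝ) * S q.1 q.2 i) (x - u) =
          seriesEval (c α q) (x - u) * seriesEval (S q.1 q.2 i) (x - u) :=
        Filter.eventually_all.2 fun q => hsub.eventually (seriesEval_mul (c α q).2 (hS _ _ _))
      have e3 : ∀ᶠ x in 𝓝 u, ∀ q : Fin m × Fin (n + 1), G q.1 q.2 (u + (x - u)) i =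
          seriesEval (S q.1 q.2 i) (x - u) :=
        Filter.eventually_all.2 fun q => hsub.eventually (hSe _ _ _)
      filter_upwards [e0, e1, e2, e3] with x h0 h1' h2 h3
      rw [add_sub_cancel] at h0
      simp only [add_sub_cancel] at h3
      rw [h0, h1, h1']
      exact Finset.sum_congr rfl fun q _ => by rw [h2, h3]
    filter_upwards [Filter.eventually_all.2 key] with x hx
    ext i
    rw [hx i, Fintype.sum_prod_type]
    simp

end SeriesEvaluation

/-! ### Analytic dependence of flows, by the implicit function theorem on paths. -/

section AnalyticFlow

open scoped unitInterval

variable {F : Type*} [NormedAddCommGroup F] [NormedSpace ℝ F]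

/-- The power series of the superposition operator `γ ↦ f ∘ γ` on continuous paths. -/
noncomputable def pathSeries (p : FormalMultilinearSeries ℝ F F) :
    FormalMultilinearSeries ℝ C(I, F) C(I, F) := fun n =>
  MultilinearMap.mkContinuous
    { toFun := fun g => ⟨fun s => p n (fun i => g i s),
        (p n).cont.comp (continuous_pi fun i => (g i).continuous)⟩
      map_update_add' := by
        intro _ g i x y
        ext s
        have key : ∀ z : C(I, F), (fun j => (Function.update g i z) j s) =
            Function.update (fun j => g j s) i (z s) := by
          intro z
          funext j
          rcases eq_or_ne j i with rfl | h <;> simp [*]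
        simp only [ContinuousMap.coe_mk, ContinuousMap.add_apply, key, ContinuousMultilinearMap.map_update_add]
      map_update_smul' := by
        intro _ g i c x
        ext s
        have key : ∀ z : C(I, F), (fun j => (Function.update g i z) j s) =
            Function.update (fun j => g j s) i (z s) := by
          intro z
          funext j
          rcases eq_or_ne j i with rfl | h <;> simp [*]
        simp only [ContinuousMap.coe_mk, ContinuousMap.smul_apply, key, ContinuousMultilinearMap.map_update_smul] }
    ‖p n‖ fun g => by
      refine (ContinuousMap.norm_le _ (by positivity)).2 fun s => ?_
      refine ((p n).le_opNorm _).trans ?_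
      gcongr
      exact ContinuousMap.norm_coe_le_norm _ _

lemma norm_pathSeries_le (p : FormalMultilinearSeries ℝ F F) (n : ℕ) :
    ‖pathSeries p n‖ ≤ ‖p n‖ :=
  MultilinearMap.mkContinuous_norm_le _ (norm_nonneg _) _

lemma radius_le_radius_pathSeries (p : FormalMultilinearSeries ℝ F F) :
    p.radius ≤ (pathSeries p).radius := by
  refine ENNReal.le_of_forall_nnreal_lt fun r hr => ?_
  obtain ⟨C, -, hC⟩ := p.norm_mul_pow_le_of_lt_radius hr
  exact FormalMultilinearSeries.le_radius_of_bound _ C fun n =>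
    (mul_le_mul_of_nonneg_right (norm_pathSeries_le p n) (by positivity)).trans (hC n)

/-- The superposition operator of an analytic map is analytic at the constant paths. -/
lemma exists_superposition [CompleteSpace F] {f : F → F} {x₀ : F} (hf : AnalyticAt ℝ f x₀) :
    ∃ S : C(I, F) → C(I, F), AnalyticAt ℝ S (ContinuousMap.const I x₀) ∧
      ∀ᶠ γ in 𝓝 (ContinuousMap.const I x₀), ∀ s, S γ s = f (γ s) := by
  obtain ⟨p, r, hp⟩ := hf
  have hr : 0 < (pathSeries p).radius :=
    (hp.r_pos.trans_le hp.r_le).trans_le (radius_le_radius_pathSeries p)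
  have h0 := (pathSeries p).hasFPowerSeriesOnBall hr
  have h1 := h0.comp_sub (ContinuousMap.const I x₀)
  rw [zero_add] at h1
  refine ⟨_, h1.analyticAt, ?_⟩
  filter_upwards [Metric.eball_mem_nhds _ hp.r_pos] with γ hγ s
  have hγ' : γ - ContinuousMap.const I x₀ ∈ Metric.eball (0 : C(I, F)) (pathSeries p).radius := by
    have := Metric.mem_eball.1 hγ
    rw [Metric.mem_eball, edist_zero_right, ← edist_eq_enorm_sub]
    exact this.trans_le (hp.r_le.trans (radius_le_radius_pathSeries p))
  have hs1 := h0.hasSum hγ'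
  rw [zero_add] at hs1
  have hs2 := hs1.map (ContinuousMap.evalCLM ℝ s : C(I, F) →L[ℝ] F)
    (ContinuousMap.evalCLM ℝ s : C(I, F) →L[ℝ] F).continuous
  have hxs : γ s - x₀ ∈ Metric.eball (0 : F) r := by
    rw [Metric.mem_eball, edist_zero_right, ← edist_eq_enorm_sub]
    refine lt_of_le_of_lt ?_ (Metric.mem_eball.1 hγ)
    rw [edist_dist, edist_dist]
    exact ENNReal.ofReal_le_ofReal (ContinuousMap.dist_apply_le_dist (g := ContinuousMap.const I x₀) s)
  have hs3 := hp.hasSum hxs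
  rw [add_sub_cancel] at hs3
  exact hs2.unique hs3

/-- The primitive of a continuous path. -/
noncomputable def pathPrimitive [CompleteSpace F] : C(I, F) →L[ℝ] C(I, F) :=
  LinearMap.mkContinuous
    { toFun := fun γ => ⟨fun s => ∫ u in (0 : ℝ)..s, γ (projIcc 0 1 zero_le_one u),
        (intervalIntegral.continuous_primitive (fun a b =>
          (γ.continuous.comp continuous_projIcc).intervalIntegrable a b) 0).comp
          continuous_subtype_val⟩
      map_add' := fun γ γ' => by
        ext s
        exact intervalIntegral.integral_add
          ((γ.continuous.comp continuous_projIcc).intervalIntegrable _ _)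
          ((γ'.continuous.comp continuous_projIcc).intervalIntegrable _ _)
      map_smul' := fun c γ => by
        ext s
        exact intervalIntegral.integral_smul c _ }
    1 fun γ => by
      rw [one_mul]
      refine (ContinuousMap.norm_le _ (norm_nonneg _)).2 fun s => ?_
      have h := intervalIntegral.norm_integral_le_of_norm_le_const (a := (0 : ℝ)) (b := s)
        (f := fun u => γ (projIcc 0 1 zero_le_one u)) (C := ‖γ‖)
        fun u _ => ContinuousMap.norm_coe_le_norm _ _
      refine h.trans ?_
      have : |(s : ℝ) - 0| ≤ 1 := by rw [sub_zero, abs_of_nonneg s.2.1]; exact s.2.2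
      nlinarith [norm_nonneg γ]

open Filter in
/-- An analytic vector field has an analytic local flow. -/
theorem exists_analytic_flow [CompleteSpace F] {f : F → F} {x₀ : F} (hf : AnalyticAt ℝ f x₀) :
    ∃ Φ : ℝ × F → F, AnalyticAt ℝ Φ (0, x₀) ∧ (∀ᶠ x in 𝓝 x₀, Φ (0, x) = x) ∧
      ∀ᶠ p in 𝓝 ((0 : ℝ), x₀), HasDerivAt (fun s => Φ (s, p.2)) (f (Φ p)) p.1 := by
  obtain ⟨S, hS, hSf⟩ := exists_superposition hf
  set c₀ := ContinuousMap.const I x₀ with hc₀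
  let constL : F →L[ℝ] C(I, F) := ContinuousLinearMap.const ℝ I
  -- A zero is a path on `[0, 1]` with `γ(s) = x + t ∫₀ˢ f(γ)`, the trajectory of `x` with time
  -- rescaled by `t`. At `t = 0` the operator in `γ` is the identity up to a constant, which makes
  -- the equation solvable.
  let G : (ℝ × F) × C(I, F) → C(I, F) := fun v =>
    v.2 - constL v.1.2 - v.1.1 • pathPrimitive (S v.2)
  have hG : AnalyticAt ℝ G ((0, x₀), c₀) := by
    have hS' : AnalyticAt ℝ S ((((0 : ℝ), x₀), c₀) : (ℝ × F) × C(I, F)).2 := hS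
    have hS2 : AnalyticAt ℝ (fun v : (ℝ × F) × C(I, F) => S v.2) ((0, x₀), c₀) :=
      hS'.comp analyticAt_snd
    have h1 : AnalyticAt ℝ (fun v : (ℝ × F) × C(I, F) => pathPrimitive (S v.2)) ((0, x₀), c₀) :=
      (pathPrimitive.analyticAt (S c₀)).comp (g := pathPrimitive)
        (f := fun v : (ℝ × F) × C(I, F) => S v.2) (x := ((0, x₀), c₀)) hS2
    have h2 : AnalyticAt ℝ (fun v : (ℝ × F) × C(I, F) => constL v.1.2) ((0, x₀), c₀) :=
      (constL.analyticAt x₀).comp (g := constL) (f := fun v : (ℝ × F) × C(I, F) => v.1.2)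
        (x := ((0, x₀), c₀)) (analyticAt_snd.comp analyticAt_fst)
    have h3 : AnalyticAt ℝ (fun v : (ℝ × F) × C(I, F) => v.1.1) ((0, x₀), c₀) :=
      analyticAt_fst.comp analyticAt_fst
    exact (analyticAt_snd.sub h2).sub (h3.smul h1)
  have hG0 : G ((0, x₀), c₀) = 0 := by
    simp only [G, zero_smul, sub_zero]
    exact sub_self c₀
  have hGd : (fderiv ℝ G ((0, x₀), c₀) ∘L .inr ℝ (ℝ × F) C(I, F)).IsInvertible := by
    have h1 : HasFDerivAt (fun γ : C(I, F) => G ((0, x₀), γ))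
        (fderiv ℝ G ((0, x₀), c₀) ∘L .inr ℝ (ℝ × F) C(I, F)) c₀ :=
      HasFDerivAt.comp c₀ hG.differentiableAt.hasFDerivAt (hasFDerivAt_prodMk_right _ _)
    have h2 : HasFDerivAt (fun γ : C(I, F) => G ((0, x₀), γ)) (.id ℝ _) c₀ := by
      have : (fun γ : C(I, F) => G ((0, x₀), γ)) = fun γ => γ - constL x₀ := by
        funext γ; simp [G]
      rw [this]
      exact (hasFDerivAt_id c₀).sub_const _
    rw [h1.unique h2]
    exact ContinuousLinearMap.isInvertible_equiv (f := ContinuousLinearEquiv.refl ℝ _)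
  have hGc : ContDiffAt ℝ ω G ((0, x₀), c₀) := hG.contDiffAt
  have hω : (ω : WithTop ℕ∞) ≠ 0 := by simp
  set ψ := hGc.implicitFunction hω hGd with hψ
  have hψ0 : ψ (0, x₀) = c₀ := hGc.implicitFunction_apply_self hω hGd
  have hψa : AnalyticAt ℝ ψ (0, x₀) :=
    (hGc.contDiffAt_implicitFunction hω hGd).analyticAt
  have hA := hGc.eventually_apply_eq_iff_implicitFunction hω hGd
  rw [hG0] at hA
  obtain ⟨δ, hδ, hδA⟩ := Metric.eventually_nhds_iff_ball.1
    (hA.and ((continuous_snd.tendsto ((0, x₀), c₀)).eventually hSf))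
  have hball : ∀ (t : ℝ) (x : F) (γ : C(I, F)), |t| < δ → dist x x₀ < δ → dist γ c₀ < δ →
      (G ((t, x), γ) = 0 ↔ ψ (t, x) = γ) ∧ ∀ s, S γ s = f (γ s) := by
    intro t x γ ht hx hγ
    refine hδA ((t, x), γ) ?_
    simp only [Metric.mem_ball, Prod.dist_eq, max_lt_iff]
    exact ⟨⟨by simpa [Real.dist_eq] using ht, hx⟩, hγ⟩
  have hGs : ∀ (t : ℝ) (x : F) (γ : C(I, F)), G ((t, x), γ) = 0 ↔
      ∀ s, γ s = x + t • ∫ u in (0 : ℝ)..s, S γ (projIcc 0 1 zero_le_one u) := by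
    intro t x γ
    rw [ContinuousMap.ext_iff]
    refine forall_congr' fun s => ?_
    have : G ((t, x), γ) s = γ s - x - t • ∫ u in (0 : ℝ)..s, S γ (projIcc 0 1 zero_le_one u) :=
      rfl
    rw [this, ContinuousMap.zero_apply, sub_sub, sub_eq_zero]
  -- By uniqueness of the implicit solution, the path for time `c t` is the path for time `t` run up
  -- to `c`. Thus the endpoints, as functions of time, trace the trajectory.
  have key : ∀ (t : ℝ) (x : F), |t| < δ → dist x x₀ < δ → dist (ψ (t, x)) c₀ < δ → ∀ c : I,
      ψ (c * t, x) 1 = ψ (t, x) c := by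
    intro t x ht hx hγ c
    set γ := ψ (t, x) with hγdef
    obtain ⟨h1, h2⟩ := hball t x γ ht hx hγ
    have h3 := (hGs t x γ).1 (h1.2 rfl)
    let γc : C(I, F) := ⟨fun s => γ (c * s), by fun_prop⟩
    have hγc : dist γc c₀ < δ := by
      refine lt_of_le_of_lt ?_ hγ
      refine (ContinuousMap.dist_le dist_nonneg).2 fun s => ?_
      exact ContinuousMap.dist_apply_le_dist (f := γ) (g := c₀) (c * s)
    have hct : |(c : ℝ) * t| < δ := by
      rw [abs_mul, abs_of_nonneg c.2.1]
      exact lt_of_le_of_lt (mul_le_of_le_one_left (abs_nonneg _) c.2.2) ht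
    obtain ⟨h4, h5⟩ := hball (c * t) x γc hct hx hγc
    have h6 : G ((c * t, x), γc) = 0 := by
      rw [hGs]
      intro s
      have e1 : γc s = γ (c * s) := rfl
      rw [e1, h3 (c * s), mul_comm (c : ℝ) t, mul_smul]
      have e2 : ∫ u in (0 : ℝ)..s, S γc (projIcc 0 1 zero_le_one u) =
          ∫ u in (0 : ℝ)..s, (fun v => S γ (projIcc 0 1 zero_le_one v)) (c * u) := by
        refine intervalIntegral.integral_congr fun u hu => ?_
        rw [uIcc_of_le s.2.1] at hu
        have hu1 : u ∈ I := ⟨hu.1, hu.2.trans s.2.2⟩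
        have hu2 : (c : ℝ) * u ∈ I := unitInterval.mul_mem c.2 hu1
        simp only
        rw [h5, projIcc_of_mem _ hu1, projIcc_of_mem _ hu2, h2]
        rfl
      have e3 := intervalIntegral.smul_integral_comp_mul_left (a := 0) (b := s)
        (fun v => S γ (projIcc 0 1 zero_le_one v)) (c : ℝ)
      rw [mul_zero] at e3
      rw [e2, e3]
      rfl
    rw [h4.1 h6]
    show γ (c * 1) = γ c
    rw [mul_one]
  let ev1 : C(I, F) →L[ℝ] F := ContinuousMap.evalCLM ℝ 1
  have hΦ : AnalyticAt ℝ (fun p => ψ p 1) (0, x₀) :=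
    (ev1.analyticAt (ψ (0, x₀))).comp hψa
  have hev : ∀ᶠ p in 𝓝 ((0 : ℝ), x₀), |p.1| < δ ∧ dist p.2 x₀ < δ ∧ dist (ψ p) c₀ < δ := by
    have e1 : ContinuousAt (fun p : ℝ × F => |p.1|) (0, x₀) := by fun_prop
    have e2 : ContinuousAt (fun p : ℝ × F => dist p.2 x₀) (0, x₀) := by fun_prop
    have e3 : ContinuousAt (fun p : ℝ × F => dist (ψ p) c₀) (0, x₀) :=
      hψa.continuousAt.dist continuousAt_const
    refine (e1.eventually_lt_const (by simpa using hδ)).and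
      ((e2.eventually_lt_const (by simpa using hδ)).and (e3.eventually_lt_const ?_))
    simpa only [hψ0, dist_self] using hδ
  -- The path for the doubled time `2t` passes through the endpoint at time `t` at its midpoint,
  -- where the primitive has a two-sided derivative. This handles `t ≠ 0`.
  have hdbl : Tendsto (fun p : ℝ × F => (2 * p.1, p.2)) (𝓝 (0, x₀)) (𝓝 (0, x₀)) := by
    have : ContinuousAt (fun p : ℝ × F => (2 * p.1, p.2)) (0, x₀) := by fun_prop
    simpa [ContinuousAt] using this
  have hd1 : ∀ᶠ p in 𝓝 ((0 : ℝ), x₀), p.1 ≠ 0 →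
      HasDerivAt (fun s => ψ (s, p.2) 1) (f (ψ p 1)) p.1 := by
    filter_upwards [hdbl.eventually hev] with p ⟨h1, h2, h3⟩ hp
    obtain ⟨t', x⟩ := p
    simp only at h1 h2 h3 hp ⊢
    set γ := ψ (2 * t', x) with hγdef
    obtain ⟨h4, h5⟩ := hball _ x γ h1 h2 h3
    have h6 := (hGs _ x γ).1 (h4.2 rfl)
    have hcont : Continuous fun u => S γ (projIcc 0 1 zero_le_one u) :=
      (S γ).continuous.comp continuous_projIcc
    let e : ℝ → F := fun c => x + (2 * t') • ∫ u in (0 : ℝ)..c, S γ (projIcc 0 1 zero_le_one u)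
    have hhalf : (1 / 2 : ℝ) ∈ I := by constructor <;> norm_num
    have he : HasDerivAt e ((2 * t') • f (γ ⟨1 / 2, hhalf⟩)) (1 / 2) := by
      rw [← h5, ← projIcc_of_mem zero_le_one hhalf]
      exact ((hcont.integral_hasStrictDerivAt 0 (1 / 2)).hasDerivAt.const_smul _).const_add _
    have h2t : t' / (2 * t') = 1 / 2 := by field_simp
    have he2 : HasDerivAt (fun s : ℝ => e (s / (2 * t')))
        ((1 / (2 * t')) • (2 * t') • f (γ ⟨1 / 2, hhalf⟩)) t' := by
      have e1 : HasDerivAt (fun s : ℝ => s / (2 * t')) (1 / (2 * t')) t' :=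
        (hasDerivAt_id t').div_const (2 * t')
      exact HasDerivAt.scomp (g₁ := e) (h := fun s : ℝ => s / (2 * t')) t' (by rwa [h2t]) e1
    rw [smul_smul, one_div_mul_cancel (by simpa using hp), one_smul] at he2
    have hΦγ : ∀ s : ℝ, s / (2 * t') ∈ I → ψ (s, x) 1 = e (s / (2 * t')) := by
      intro s hs
      have := key (2 * t') x h1 h2 h3 ⟨_, hs⟩
      rw [show (s / (2 * t')) * (2 * t') = s from div_mul_cancel₀ _ (by simpa using hp)] at this
      rw [this, ← hγdef, h6]
    have hval : ψ (t', x) 1 = γ ⟨1 / 2, hhalf⟩ := by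
      have := key (2 * t') x h1 h2 h3 ⟨_, hhalf⟩
      rw [show (1 / 2 : ℝ) * (2 * t') = t' by ring] at this
      exact this
    rw [hval]
    refine he2.congr_of_eventuallyEq ?_
    have hc : ContinuousAt (fun s : ℝ => s / (2 * t')) t' := by fun_prop
    have : ∀ᶠ s in 𝓝 t', s / (2 * t') ∈ Icc (0 : ℝ) 1 := by
      refine hc.eventually (Icc_mem_nhds ?_ ?_) <;> simp only [h2t] <;> norm_num
    filter_upwards [this] with s hs using hΦγ s hs
  refine ⟨fun p => ψ p 1, hΦ, ?_, ?_⟩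
  · have h0 : Tendsto (fun x : F => ((0 : ℝ), x)) (𝓝 x₀) (𝓝 (0, x₀)) :=
      (Continuous.prodMk_right (0 : ℝ)).tendsto x₀
    filter_upwards [h0.eventually hev] with x ⟨h1, h2, h3⟩
    obtain ⟨h4, -⟩ := hball 0 x _ h1 h2 h3
    simpa using (hGs 0 x _).1 (h4.2 rfl) 1
  · have hfe : ∀ᶠ p in 𝓝 ((0 : ℝ), x₀), AnalyticAt ℝ f (ψ p 1) := by
      have : ContinuousAt (fun p => ψ p 1) (0, x₀) := hΦ.continuousAt
      refine this.eventually ?_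
      simp only [hψ0]
      exact hf.eventually_analyticAt
    filter_upwards [hΦ.eventually_analyticAt, eventually_eventually_nhds.2 hd1, hfe] with p hp h1 h2
    have hline : ∀ q : ℝ × F, AnalyticAt ℝ (fun p => ψ p 1) q →
        HasDerivAt (fun s => ψ (s, q.2) 1) (fderiv ℝ (fun p => ψ p 1) q (1, 0)) q.1 := by
      intro q hq
      have e1 : HasDerivAt (fun s : ℝ => (s, q.2)) ((1 : ℝ), (0 : F)) q.1 :=
        (hasDerivAt_id q.1).prodMk (hasDerivAt_const _ _)
      exact HasFDerivAt.comp_hasDerivAt (f := fun s => (s, q.2)) q.1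
        hq.differentiableAt.hasFDerivAt e1
    rcases ne_or_eq p.1 0 with hp0 | hp0
    · exact h1.self_of_nhds hp0
    -- At time zero the equation follows by continuity: both sides are continuous in the time and
    -- agree at nearby nonzero times.
    · have e2 : ContinuousAt (fun s : ℝ => (s, p.2)) p.1 := by fun_prop
      have e3 : ContinuousAt (fun s : ℝ => fderiv ℝ (fun p => ψ p 1) (s, p.2) (1, 0)) p.1 :=
        (hp.fderiv.continuousAt.comp_of_eq e2 rfl).clm_apply continuousAt_const
      have e4 : ContinuousAt (fun s : ℝ => f (ψ (s, p.2) 1)) p.1 :=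
        h2.continuousAt.comp_of_eq (hp.continuousAt.comp_of_eq e2 rfl) rfl
      have e5 : ∀ᶠ s in 𝓝[≠] p.1, fderiv ℝ (fun p => ψ p 1) (s, p.2) (1, 0) =
          f (ψ (s, p.2) 1) := by
        have e6 := e2.eventually (h1.and hp.eventually_analyticAt)
        filter_upwards [e6.filter_mono nhdsWithin_le_nhds, self_mem_nhdsWithin] with s hs hs0
        exact (hline _ hs.2).unique (hs.1 (by rw [hp0] at hs0; exact hs0))
      have e7 := tendsto_nhds_unique_of_eventuallyEq (e3.mono_left nhdsWithin_le_nhds)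
        (e4.mono_left nhdsWithin_le_nhds) e5
      have := hline p hp
      rwa [show fderiv ℝ (fun p => ψ p 1) p (1, 0) = f (ψ p 1) from e7] at this

end AnalyticFlow

/-! ### The theorem of Frobenius for analytic frames. -/

section Frobenius

open Filter

/-- The variational equation of an analytic flow. -/
lemma hasDerivAt_fderiv_flow {F : Type*} [NormedAddCommGroup F] [NormedSpace ℝ F]
    [CompleteSpace F] {f : F → F} {Φ : ℝ × F → F} {p : ℝ × F} (hΦ : AnalyticAt ℝ Φ p)
    (hd : ∀ᶠ q in 𝓝 p, HasDerivAt (fun s => Φ (s, q.2)) (f (Φ q)) q.1)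
    (hf : DifferentiableAt ℝ f (Φ p)) (w : F) :
    HasDerivAt (fun s => fderiv ℝ Φ (s, p.2) (0, w))
      (fderiv ℝ f (Φ p) (fderiv ℝ Φ p (0, w))) p.1 := by
  have e0 : HasDerivAt (fun s : ℝ => (s, p.2)) ((1 : ℝ), (0 : F)) p.1 :=
    (hasDerivAt_id p.1).prodMk (hasDerivAt_const _ _)
  have e1 : HasDerivAt (fun s => fderiv ℝ Φ (s, p.2)) (fderiv ℝ (fderiv ℝ Φ) p (1, 0)) p.1 :=
    HasFDerivAt.comp_hasDerivAt (f := fun s => (s, p.2)) p.1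
      hΦ.fderiv.differentiableAt.hasFDerivAt e0
  have e2 : HasDerivAt (fun s => fderiv ℝ Φ (s, p.2) (0, w))
      (fderiv ℝ (fderiv ℝ Φ) p (1, 0) (0, w)) p.1 := by
    simpa using e1.clm_apply (hasDerivAt_const p.1 ((0 : ℝ), w))
  have hsymm := ContDiffAt.isSymmSndFDerivAt_of_omega hΦ.contDiffAt (1, 0) (0, w)
  rw [hsymm] at e2
  have e3 : HasFDerivAt (fun q => fderiv ℝ Φ q (1, 0))
      ((fderiv ℝ (fderiv ℝ Φ) p).flip (1, 0)) p := by
    simpa using hΦ.fderiv.differentiableAt.hasFDerivAt.clm_apply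
      (hasFDerivAt_const ((1 : ℝ), (0 : F)) p)
  have e4 : (fun q => fderiv ℝ Φ q (1, 0)) =ᶠ[𝓝 p] fun q => f (Φ q) := by
    filter_upwards [hd, hΦ.eventually_analyticAt] with q hq hq'
    have e0 : HasDerivAt (fun s : ℝ => (s, q.2)) ((1 : ℝ), (0 : F)) q.1 :=
      (hasDerivAt_id q.1).prodMk (hasDerivAt_const _ _)
    exact (HasFDerivAt.comp_hasDerivAt (f := fun s => (s, q.2)) q.1
      hq'.differentiableAt.hasFDerivAt e0).unique hq
  have e5 : HasFDerivAt (fun q => f (Φ q)) ((fderiv ℝ f (Φ p)).comp (fderiv ℝ Φ p)) p :=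
    hf.hasFDerivAt.comp p hΦ.differentiableAt.hasFDerivAt
  have e6 := (e3.congr_of_eventuallyEq e4.symm).unique e5
  have e7 := congrArg (fun L : ℝ × F →L[ℝ] F => L (0, w)) e6
  simp only [ContinuousLinearMap.flip_apply, ContinuousLinearMap.comp_apply] at e7
  rwa [e7] at e2

lemma linear_ode_eq_zero {E : Type*} [NormedAddCommGroup E] [NormedSpace ℝ E] {b : ℝ}
    {u : ℝ → E} {B : ℝ → E →L[ℝ] E} (hB : ContinuousOn B (Icc 0 b))
    (hu : ∀ t ∈ Icc 0 b, HasDerivAt u (B t (u t)) t) (h0 : u 0 = 0) :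
    ∀ t ∈ Icc 0 b, u t = 0 := by
  obtain ⟨K, hK⟩ := isCompact_Icc.exists_bound_of_continuousOn hB
  refine eq_zero_of_abs_deriv_le_mul_abs_self_of_eq_zero_right (f' := fun t => B t (u t)) (K := K)
    (fun t ht => (hu t ht).continuousAt.continuousWithinAt)
    (fun t ht => (hu t (Ico_subset_Icc_self ht)).hasDerivWithinAt) h0 fun t ht => ?_
  exact ((B t).le_opNorm _).trans (by gcongr; exact hK t (Ico_subset_Icc_self ht))

lemma eq_of_hasDerivAt_zero {E : Type*} [NormedAddCommGroup E] [NormedSpace ℝ E] {b : ℝ}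
    {u : ℝ → E} (hu : ∀ t ∈ Icc 0 b, HasDerivAt u 0 t) : ∀ t ∈ Icc 0 b, u t = u 0 :=
  constant_of_has_deriv_right_zero (fun t ht => (hu t ht).continuousAt.continuousWithinAt)
    fun t ht => (hu t (Ico_subset_Icc_self ht)).hasDerivWithinAt

variable {E : Type*} [NormedAddCommGroup E] [NormedSpace ℝ E]

lemma sum_coord_of_mem_span {ι : Type*} [Fintype ι] [DecidableEq ι] {w : ι → E}
    {c : E →L[ℝ] (ι → ℝ)} (hc : ∀ i, c (w i) = Pi.single i 1) {v : E}
    (hv : v ∈ Submodule.span ℝ (range w)) : ∑ i, c v i • w i = v := by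
  obtain ⟨a, rfl⟩ := (Submodule.mem_span_range_iff_exists_fun ℝ).1 hv
  congr 1
  funext i
  congr 1
  simp [map_sum, hc, Finset.sum_apply, Pi.single_apply]

variable [FiniteDimensional ℝ E]

/-- Analytic coordinates along an analytic family of linearly independent fields. -/
lemma exists_analytic_coframe {ι : Type*} [Fintype ι] [DecidableEq ι] {W : ι → E → E} {u₀ : E}
    (hW : ∀ i, AnalyticAt ℝ (W i) u₀) (hli : LinearIndependent ℝ fun i => W i u₀) :
    ∃ c : E → E →L[ℝ] (ι → ℝ), AnalyticAt ℝ c u₀ ∧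
      ∀ᶠ x in 𝓝 u₀, ∀ i, c x (W i x) = Pi.single i 1 := by
  obtain ⟨L₀, hL₀⟩ := LinearMap.exists_leftInverse_of_injective (Fintype.linearCombination ℝ fun i => W i u₀)
    (LinearMap.ker_eq_bot.2 (linearIndependent_iff_injective_fintypeLinearCombination.1 hli))
  let L : E →L[ℝ] (ι → ℝ) := LinearMap.toContinuousLinearMap L₀
  -- The matrix of the frame in the fixed coordinates `L`. It is the identity at `u₀`, hence
  -- invertible nearby, and `A⁻¹ L` is the coframe.
  let A : E → (ι → ℝ) →L[ℝ] (ι → ℝ) := fun x =>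
    ∑ i, (ContinuousLinearMap.proj (R := ℝ) (φ := fun _ : ι => ℝ) i).smulRight (L (W i x))
  have hA : AnalyticAt ℝ A u₀ := by
    refine Finset.analyticAt_fun_sum _ fun i _ => ?_
    have h1 : AnalyticAt ℝ (fun x => L (W i x)) u₀ := (L.analyticAt _).comp (hW i)
    exact ((ContinuousLinearMap.smulRightL ℝ (ι → ℝ) (ι → ℝ)
      (ContinuousLinearMap.proj (R := ℝ) (φ := fun _ : ι => ℝ) i)).analyticAt _).comp h1
  have hAi : ∀ x i, A x (Pi.single i 1) = L (W i x) := by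
    intro x i
    simp only [A, sum_apply, ContinuousLinearMap.smulRight_apply,
      ContinuousLinearMap.proj_apply]
    rw [Finset.sum_eq_single i]
    · simp
    · intro j _ hj; simp [hj]
    · simp
  have hA0 : A u₀ = 1 := by
    ext v i
    have : ∀ i, L (W i u₀) = Pi.single i 1 := by
      intro i
      have := congrArg (fun f => f (Pi.single i 1)) hL₀
      simpa [L] using this
    simp only [A, this, sum_apply, ContinuousLinearMap.smulRight_apply,
      ContinuousLinearMap.proj_apply, one_apply_eq_self, Finset.sum_apply,
      Pi.smul_apply, smul_eq_mul, Pi.single_apply]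
    simp
  have hinv : AnalyticAt ℝ (fun x => Ring.inverse (A x)) u₀ := by
    have h1 : AnalyticAt ℝ (Ring.inverse : ((ι → ℝ) →L[ℝ] (ι → ℝ)) → _) (A u₀) := by
      rw [hA0]
      exact analyticAt_inverse (𝕜 := ℝ) (1 : ((ι → ℝ) →L[ℝ] (ι → ℝ))ˣ)
    exact h1.comp hA
  refine ⟨fun x => (Ring.inverse (A x)).comp L, ?_, ?_⟩
  · exact (((ContinuousLinearMap.compL ℝ E (ι → ℝ) (ι → ℝ)).flip L).analyticAt _).comp hinv
  · have hunit : ∀ᶠ x in 𝓝 u₀, IsUnit (A x) := by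
      refine hA.continuousAt.eventually (Units.isOpen.mem_nhds ?_)
      rw [hA0]; exact isUnit_one
    filter_upwards [hunit] with x hx i
    rw [ContinuousLinearMap.comp_apply, ← hAi, ← mul_apply_eq_comp,
      Ring.inverse_mul_cancel _ hx, one_apply_eq_self]


lemma HasDerivAt.fst_comp {F₁ F₂ : Type*} [NormedAddCommGroup F₁] [NormedSpace ℝ F₁]
    [NormedAddCommGroup F₂] [NormedSpace ℝ F₂] {u : ℝ → F₁ × F₂} {u' : F₁ × F₂} {t : ℝ}
    (h : HasDerivAt u u' t) : HasDerivAt (fun s => (u s).1) u'.1 t :=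
  (ContinuousLinearMap.fst ℝ F₁ F₂).hasFDerivAt.comp_hasDerivAt t h

lemma HasDerivAt.snd_comp {F₁ F₂ : Type*} [NormedAddCommGroup F₁] [NormedSpace ℝ F₁]
    [NormedAddCommGroup F₂] [NormedSpace ℝ F₂] {u : ℝ → F₁ × F₂} {u' : F₁ × F₂} {t : ℝ}
    (h : HasDerivAt u u' t) : HasDerivAt (fun s => (u s).2) u'.2 t :=
  (ContinuousLinearMap.snd ℝ F₁ F₂).hasFDerivAt.comp_hasDerivAt t h

/-- A variation along the span of an involutive frame stays in that span. -/
lemma variation_mem_span {m : ℕ} {W : Fin m → E → E} {c : E → E →L[ℝ] (Fin m → ℝ)} {b : ℝ}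
    {x J : ℝ → E} {v w : Fin m → ℝ}
    (hW : ∀ t ∈ Icc 0 b, ∀ i, AnalyticAt ℝ (W i) (x t))
    (hc : ∀ t ∈ Icc 0 b, AnalyticAt ℝ c (x t))
    (hcW : ∀ t ∈ Icc 0 b, ∀ᶠ z in 𝓝 (x t), ∀ i, c z (W i z) = Pi.single i 1)
    (hinv : ∀ t ∈ Icc 0 b, ∀ i j, VectorField.lieBracket ℝ (W i) (W j) (x t) ∈
      Submodule.span ℝ (range fun k => W k (x t)))
    (hx : ∀ t ∈ Icc 0 b, HasDerivAt x (∑ i, v i • W i (x t)) t)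
    (hJ : ∀ t ∈ Icc 0 b, HasDerivAt J
      (∑ i, (w i • W i (x t) + v i • fderiv ℝ (W i) (x t) (J t))) t) (hJ0 : J 0 = 0) :
    ∀ t ∈ Icc 0 b, J t ∈ Submodule.span ℝ (range fun k => W k (x t)) := by
  -- Where `c` is dual to the frame, `P` is a projection whose kernel is the span of the frame. The
  -- claim becomes `P (x t) (J t) = 0`, which follows once this quantity solves a homogeneous linear
  -- equation.
  let P : E → E →L[ℝ] E := fun z => ContinuousLinearMap.id ℝ E -
    ∑ i, ((ContinuousLinearMap.proj (R := ℝ) (φ := fun _ : Fin m => ℝ) i).comp (c z)).smulRight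
      (W i z)
  have hPz : ∀ z h, P z h = h - ∑ i, c z h i • W i z := by
    intro z h
    simp [P, sum_apply]
  have hPa : ∀ t ∈ Icc 0 b, AnalyticAt ℝ P (x t) := by
    intro t ht
    refine analyticAt_const.sub (Finset.analyticAt_fun_sum _ fun i _ => ?_)
    have h1 : AnalyticAt ℝ (fun z => (ContinuousLinearMap.proj (R := ℝ) (φ := fun _ : Fin m => ℝ) i).comp
        (c z)) (x t) :=
      ((ContinuousLinearMap.compL ℝ E (Fin m → ℝ) ℝ
        (ContinuousLinearMap.proj (R := ℝ) (φ := fun _ : Fin m => ℝ) i)).analyticAt _).comp (hc t ht)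
    exact ((ContinuousLinearMap.smulRightL ℝ E E).analyticAt_bilinear _).comp₂ h1 (hW t ht i)
  have hPW : ∀ z, (∀ i, c z (W i z) = Pi.single i 1) → ∀ k, P z (W k z) = 0 := by
    intro z hz k
    rw [hPz, sum_coord_of_mem_span hz (Submodule.subset_span ⟨k, rfl⟩), sub_self]
  have hPspan : ∀ z, (∀ i, c z (W i z) = Pi.single i 1) →
      ∀ h ∈ Submodule.span ℝ (range fun k => W k z), P z h = 0 := by
    intro z hz h hh
    rw [hPz, sum_coord_of_mem_span hz hh, sub_self]
  let B : E → Fin m → E →L[ℝ] E := fun z i =>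
    fderiv ℝ P z (W i z) + (P z).comp (fderiv ℝ (W i) z)
  -- Differentiating `P W_k = 0` along `W_i` and using `P [W_i, W_k] = 0` (involutivity) gives `B_i
  -- W_k = 0`. So `B_i` factors through `P` and the derivative of `P J` depends linearly on `P J`
  -- alone.
  have hBW : ∀ t ∈ Icc 0 b, ∀ i k, B (x t) i (W k (x t)) = 0 := by
    intro t ht i k
    have e1 : HasFDerivAt (fun z => P z (W k z)) _ (x t) :=
      (hPa t ht).differentiableAt.hasFDerivAt.clm_apply (hW t ht k).differentiableAt.hasFDerivAt
    have e2 : HasFDerivAt (fun z => P z (W k z)) (0 : E →L[ℝ] E) (x t) :=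
      (hasFDerivAt_const (0 : E) (x t)).congr_of_eventuallyEq
        ((hcW t ht).mono fun z hz => hPW z hz k)
    have e3 := congrArg (fun L : E →L[ℝ] E => L (W i (x t))) (e1.unique e2)
    have e4 := hPspan _ (hcW t ht).self_of_nhds _ (hinv t ht i k)
    rw [VectorField.lieBracket, map_sub, sub_eq_zero] at e4
    simp only [add_apply, ContinuousLinearMap.comp_apply,
      ContinuousLinearMap.flip_apply, zero_apply] at e3
    simp only [B, add_apply, ContinuousLinearMap.comp_apply]
    rw [← e4, add_comm]
    exact e3
  have hBP : ∀ t ∈ Icc 0 b, ∀ i h, B (x t) i h = B (x t) i (P (x t) h) := by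
    intro t ht i h
    rw [hPz, map_sub, map_sum]
    simp [hBW t ht]
  have hu : ∀ t ∈ Icc 0 b, HasDerivAt (fun t => P (x t) (J t))
      ((∑ i, v i • B (x t) i) (P (x t) (J t))) t := by
    intro t ht
    have e1 : HasDerivAt (fun t => P (x t)) (fderiv ℝ P (x t) (∑ i, v i • W i (x t))) t :=
      (hPa t ht).differentiableAt.hasFDerivAt.comp_hasDerivAt t (hx t ht)
    have e2 := e1.clm_apply (hJ t ht)
    have e3 : (∑ i, v i • B (x t) i) (P (x t) (J t)) =
        fderiv ℝ P (x t) (∑ i, v i • W i (x t)) (J t) +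
        P (x t) (∑ i, (w i • W i (x t) + v i • fderiv ℝ (W i) (x t) (J t))) := by
      have e4 : (∑ i, v i • B (x t) i) (P (x t) (J t)) = ∑ i, v i • B (x t) i (J t) := by
        simp only [sum_apply, smul_apply, ← hBP t ht]
      rw [e4]
      simp only [sum_apply, smul_apply, map_sum, map_add, map_smul,
        hPW _ (hcW t ht).self_of_nhds, smul_zero, zero_add, B, add_apply,
        ContinuousLinearMap.comp_apply, smul_add, Finset.sum_add_distrib, Finset.sum_const_zero]
    rw [e3]
    exact e2
  have hxc : ContinuousOn x (Icc 0 b) := fun t ht => (hx t ht).continuousAt.continuousWithinAt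
  have hBc : ContinuousOn (fun t => ∑ i, v i • B (x t) i) (Icc 0 b) := by
    refine continuousOn_finsetSum _ fun i _ => ?_
    intro t ht
    have e1 : ContinuousAt (fun z => v i • B z i) (x t) := by
      refine ContinuousAt.const_smul (ContinuousAt.add (f := fun z => fderiv ℝ P z (W i z))
        (g := fun z => (P z).comp (fderiv ℝ (W i) z)) ?_ ?_) (v i)
      · exact (hPa t ht).fderiv.continuousAt.clm_apply (hW t ht i).continuousAt
      · exact (hPa t ht).continuousAt.clm_comp (hW t ht i).fderiv.continuousAt
    exact (e1.comp (hx t ht).continuousAt).continuousWithinAt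
  have h0 := linear_ode_eq_zero hBc hu (by simp [hJ0])
  intro t ht
  have := h0 t ht
  rw [hPz, sub_eq_zero] at this
  rw [this]
  exact Submodule.sum_mem _ fun i _ => Submodule.smul_mem _ _ (Submodule.subset_span ⟨i, rfl⟩)

/-- The straightening map of a commuting-free frame: the endpoint, after a fixed small time, of the
flow of a constant combination of the frame. -/
lemma exists_frame_flow {m : ℕ} {W : Fin m → E → E} {u₀ : E}
    (hW : ∀ i, AnalyticAt ℝ (W i) u₀) (hli : LinearIndependent ℝ fun i => W i u₀)
    (hinv : ∀ᶠ x in 𝓝 u₀, ∀ i j, VectorField.lieBracket ℝ (W i) (W j) x ∈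
      Submodule.span ℝ (range fun k => W k x)) :
    ∃ (G : (Fin m → ℝ) × E → E) (b : ℝ), 0 < b ∧ AnalyticAt ℝ G (0, u₀) ∧ G (0, u₀) = u₀ ∧
      (∀ w ζ, fderiv ℝ G (0, u₀) (w, ζ) = ζ + b • ∑ i, w i • W i u₀) ∧
      ∀ᶠ q in 𝓝 ((0 : Fin m → ℝ), u₀), ∀ w, fderiv ℝ G q (w, 0) ∈
        Submodule.span ℝ (range fun k => W k (G q)) := by
  obtain ⟨c, hc, hcW⟩ := exists_analytic_coframe hW hli
  -- The coefficients of the combination are added to the state with zero velocity, so analytic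
  -- dependence on them is part of analytic dependence on the initial value.
  let g : (Fin m → ℝ) × E → (Fin m → ℝ) × E := fun q => (0, ∑ i, q.1 i • W i q.2)
  have hgd : ∀ q : (Fin m → ℝ) × E, (∀ i, AnalyticAt ℝ (W i) q.2) → HasFDerivAt g
      ((0 : (Fin m → ℝ) × E →L[ℝ] (Fin m → ℝ)).prod (∑ i, (q.1 i • (fderiv ℝ (W i) q.2).comp
        (.snd ℝ (Fin m → ℝ) E) + ((ContinuousLinearMap.proj (R := ℝ) (φ := fun _ : Fin m => ℝ) i).comp
          (.fst ℝ (Fin m → ℝ) E)).smulRight (W i q.2)))) q := by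
    intro q hq
    refine (hasFDerivAt_const _ _).prodMk (HasFDerivAt.fun_sum fun i _ => ?_)
    have e1 : HasFDerivAt (fun q : (Fin m → ℝ) × E => q.1 i)
        ((ContinuousLinearMap.proj (R := ℝ) (φ := fun _ : Fin m => ℝ) i).comp (.fst ℝ (Fin m → ℝ) E)) q :=
      ((ContinuousLinearMap.proj (R := ℝ) (φ := fun _ : Fin m => ℝ) i).comp
        (.fst ℝ (Fin m → ℝ) E)).hasFDerivAt
    have e2 : HasFDerivAt (fun q : (Fin m → ℝ) × E => W i q.2)
        ((fderiv ℝ (W i) q.2).comp (.snd ℝ (Fin m → ℝ) E)) q :=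
      (hq i).differentiableAt.hasFDerivAt.comp q hasFDerivAt_snd
    exact e1.smul e2
  have hg : AnalyticAt ℝ g (0, u₀) := by
    refine analyticAt_const.prod (Finset.analyticAt_fun_sum _ fun i _ => ?_)
    have e1 : AnalyticAt ℝ (fun q : (Fin m → ℝ) × E => q.1 i) (0, u₀) :=
      ((ContinuousLinearMap.proj (R := ℝ) (φ := fun _ : Fin m => ℝ) i).comp
        (.fst ℝ (Fin m → ℝ) E)).analyticAt _
    have e2 : AnalyticAt ℝ (W i) ((0 : Fin m → ℝ), u₀).2 := hW i
    exact e1.smul (e2.comp analyticAt_snd)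
  obtain ⟨Φ, hΦ, hΦ0, hΦd⟩ := exists_analytic_flow hg
  have hΦ00 : Φ (0, (0, u₀)) = (0, u₀) := hΦ0.self_of_nhds
  have hgood : ∀ᶠ x in 𝓝 u₀, (∀ i, AnalyticAt ℝ (W i) x) ∧ AnalyticAt ℝ c x ∧
      (∀ᶠ z in 𝓝 x, ∀ i, c z (W i z) = Pi.single i 1) ∧
      ∀ i j, VectorField.lieBracket ℝ (W i) (W j) x ∈ Submodule.span ℝ (range fun k => W k x) :=
    (eventually_all.2 fun i => (hW i).eventually_analyticAt).and
      (hc.eventually_analyticAt.and ((eventually_eventually_nhds.2 hcW).and hinv))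
  have hΦ2 : Tendsto (fun p => (Φ p).2) (𝓝 (0, (0, u₀))) (𝓝 u₀) := by
    have : ContinuousAt (fun p => (Φ p).2) (0, (0, u₀)) := hΦ.continuousAt.snd
    simpa [ContinuousAt, hΦ00] using this
  have hall := (hΦ.eventually_analyticAt.and ((eventually_eventually_nhds.2 hΦd).and
    (hΦ2.eventually hgood)))
  rw [nhds_prod_eq] at hall
  obtain ⟨pt, hpt, pq, hpq, hpp⟩ := eventually_prod_iff.1 hall
  obtain ⟨b', hb', hbt⟩ := Metric.eventually_nhds_iff_ball.1 hpt
  -- The flow is available for small times only. The time is fixed to `b` and the coefficients of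
  -- the frame are the variables instead.
  set b := b' / 2 with hb
  have hbpos : 0 < b := by positivity
  have htI : ∀ t ∈ Icc 0 b, pt t := by
    intro t ht
    refine hbt t ?_
    rw [Metric.mem_ball, Real.dist_eq, sub_zero, abs_of_nonneg ht.1]
    linarith [ht.2]
  have hbI : b ∈ Icc 0 b := ⟨hbpos.le, le_rfl⟩
  have h0I : (0 : ℝ) ∈ Icc 0 b := ⟨le_rfl, hbpos.le⟩
  -- the solution and its variations for a good initial value
  have hsol : ∀ q, pq q → Φ (0, q) = q → (∀ w, fderiv ℝ Φ (0, q) (0, w) = w) →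
      (∀ t ∈ Icc 0 b, (Φ (t, q)).1 = q.1) ∧
      (∀ t ∈ Icc 0 b, HasDerivAt (fun t => (Φ (t, q)).2) (∑ i, q.1 i • W i (Φ (t, q)).2) t) ∧
      ∀ w, (∀ t ∈ Icc 0 b, (fderiv ℝ Φ (t, q) (0, w)).1 = w.1) ∧
        ∀ t ∈ Icc 0 b, HasDerivAt (fun t => (fderiv ℝ Φ (t, q) (0, w)).2)
          (∑ i, (w.1 i • W i (Φ (t, q)).2 +
            q.1 i • fderiv ℝ (W i) (Φ (t, q)).2 (fderiv ℝ Φ (t, q) (0, w)).2)) t := by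
    intro q hq hq0 hqd
    have h1 : ∀ t ∈ Icc 0 b, HasDerivAt (fun t => Φ (t, q)) (g (Φ (t, q))) t := fun t ht =>
      (hpp (htI t ht) hq).2.1.self_of_nhds
    have h2 : ∀ t ∈ Icc 0 b, (Φ (t, q)).1 = q.1 := by
      intro t ht
      have := eq_of_hasDerivAt_zero (u := fun t => (Φ (t, q)).1) (fun t ht => HasDerivAt.fst_comp (h1 t ht)) t ht
      rw [this, hq0]
    refine ⟨h2, fun t ht => ?_, fun w => ?_⟩
    · have := HasDerivAt.snd_comp (h1 t ht)
      simpa only [g, h2 t ht] using this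
    · have h3 : ∀ t ∈ Icc 0 b, HasDerivAt (fun t => fderiv ℝ Φ (t, q) (0, w))
          (fderiv ℝ g (Φ (t, q)) (fderiv ℝ Φ (t, q) (0, w))) t := by
        intro t ht
        have hh := hpp (htI t ht) hq
        exact hasDerivAt_fderiv_flow (p := (t, q)) hh.1 hh.2.1
          (hgd _ hh.2.2.1).differentiableAt w
      have h4 : ∀ t ∈ Icc 0 b, ∀ h, fderiv ℝ g (Φ (t, q)) h =
          (0, ∑ i, (h.1 i • W i (Φ (t, q)).2 + q.1 i • fderiv ℝ (W i) (Φ (t, q)).2 h.2)) := by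
        intro t ht h
        rw [(hgd _ (hpp (htI t ht) hq).2.2.1).fderiv]
        simp [sum_apply, h2 t ht, add_comm]
      have h5 : ∀ t ∈ Icc 0 b, (fderiv ℝ Φ (t, q) (0, w)).1 = w.1 := by
        intro t ht
        have := eq_of_hasDerivAt_zero (u := fun t => (fderiv ℝ Φ (t, q) (0, w)).1)
          (fun t ht => by simpa only [h4 t ht] using HasDerivAt.fst_comp (h3 t ht)) t ht
        rw [this, hqd]
      refine ⟨h5, fun t ht => ?_⟩
      have := HasDerivAt.snd_comp (h3 t ht)
      simpa only [h4 t ht, h5 t ht] using this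
  have hid : ∀ᶠ q in 𝓝 ((0 : Fin m → ℝ), u₀), Φ (0, q) = q ∧
      ∀ w, fderiv ℝ Φ (0, q) (0, w) = w := by
    filter_upwards [eventually_eventually_nhds.2 hΦ0, hpq] with q hq hq'
    refine ⟨hq.self_of_nhds, fun w => ?_⟩
    have e1 : HasFDerivAt (fun q => Φ (0, q)) ((fderiv ℝ Φ (0, q)).comp
        (.inr ℝ ℝ ((Fin m → ℝ) × E))) q :=
      (hpp (htI 0 h0I) hq').1.differentiableAt.hasFDerivAt.comp q (hasFDerivAt_prodMk_right _ _)
    have e2 := e1.unique ((hasFDerivAt_id q).congr_of_eventuallyEq hq)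
    simpa using congrArg (fun L : (Fin m → ℝ) × E →L[ℝ] _ => L w) e2
  have hGd : ∀ q, AnalyticAt ℝ Φ (b, q) → AnalyticAt ℝ (fun q => (Φ (b, q)).2) q ∧
      ∀ w, fderiv ℝ (fun q => (Φ (b, q)).2) q w = (fderiv ℝ Φ (b, q) (0, w)).2 := by
    intro q hq
    refine ⟨(analyticAt_snd).comp (hq.comp₂ analyticAt_const analyticAt_id), fun w => ?_⟩
    have e1 : HasFDerivAt (fun q => Φ (b, q)) ((fderiv ℝ Φ (b, q)).comp
        (.inr ℝ ℝ ((Fin m → ℝ) × E))) q :=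
      hq.differentiableAt.hasFDerivAt.comp q (hasFDerivAt_prodMk_right _ _)
    rw [e1.snd.fderiv]
    simp
  have hq0 := hpq.self_of_nhds
  have h0 := hsol _ hq0 hid.self_of_nhds.1 hid.self_of_nhds.2
  have hx0 : ∀ t ∈ Icc 0 b, (Φ (t, (0, u₀))).2 = u₀ := by
    intro t ht
    have := eq_of_hasDerivAt_zero (u := fun t => (Φ (t, (0, u₀))).2)
      (fun t ht => by simpa using h0.2.1 t ht) t ht
    rw [this, hΦ00]
  refine ⟨fun q => (Φ (b, q)).2, b, hbpos, (hGd _ (hpp (htI b hbI) hq0).1).1, hx0 b hbI,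
    fun w ζ => ?_, ?_⟩
  · rw [(hGd _ (hpp (htI b hbI) hq0).1).2]
    have := eq_of_hasDerivAt_zero (b := b)
      (u := fun t => (fderiv ℝ Φ (t, (0, u₀)) (0, (w, ζ))).2 - t • ∑ i, w i • W i u₀)
      (fun t ht => by
        have e1 := (h0.2.2 (w, ζ)).2 t ht
        simp only [hx0 t ht, Pi.zero_apply, zero_smul, add_zero] at e1
        have e2 := e1.fun_sub ((hasDerivAt_id t).smul_const (∑ i, w i • W i u₀))
        simpa using e2) b hbI
    rw [sub_eq_iff_eq_add] at this
    rw [this, hid.self_of_nhds.2]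
    simp
  · filter_upwards [hid, hpq] with q hq hq' w
    rw [(hGd _ (hpp (htI b hbI) hq').1).2]
    have h1 := hsol q hq' hq.1 hq.2
    refine variation_mem_span (b := b) (c := c) (v := q.1) (w := w) (x := fun t => (Φ (t, q)).2)
      (J := fun t => (fderiv ℝ Φ (t, q) (0, (w, 0))).2)
      (fun t ht => (hpp (htI t ht) hq').2.2.1) (fun t ht => (hpp (htI t ht) hq').2.2.2.1)
      (fun t ht => (hpp (htI t ht) hq').2.2.2.2.1) (fun t ht => (hpp (htI t ht) hq').2.2.2.2.2)
      h1.2.1 (h1.2.2 (w, 0)).2 ?_ b hbI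
    simp only [hq.2]

/-- Frobenius: an involutive analytic frame has a local first integral whose derivative has the
span of the frame as its kernel. -/
theorem exists_first_integral {m : ℕ} {W : Fin m → E → E} {u₀ : E}
    (hW : ∀ i, AnalyticAt ℝ (W i) u₀) (hli : LinearIndependent ℝ fun i => W i u₀)
    (hinv : ∀ᶠ x in 𝓝 u₀, ∀ i j, VectorField.lieBracket ℝ (W i) (W j) x ∈
      Submodule.span ℝ (range fun k => W k x)) :
    ∃ π : E → E, ∀ᶠ x in 𝓝 u₀, ∃ π' : E →L[ℝ] E, HasFDerivAt π π' x ∧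
      ∀ v, π' v = 0 ↔ v ∈ Submodule.span ℝ (range fun k => W k x) := by
  obtain ⟨c, hc, hcW⟩ := exists_analytic_coframe hW hli
  obtain ⟨G, b, hb, hG, hG0, hGd, hGs⟩ := exists_frame_flow hW hli hinv
  have hc0 := hcW.self_of_nhds
  -- `Z` is a complement of the span of the frame at `u₀`. Flowing from `u₀ + Z` along the frame
  -- gives local coordinates `(w, ζ)`, and the first integral is the component `ζ`.
  let Z : Submodule ℝ E := LinearMap.ker (c u₀ : E →ₗ[ℝ] (Fin m → ℝ))
  let H : (Fin m → ℝ) × Z → E := fun q => G (q.1, u₀ + q.2)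
  let j : (Fin m → ℝ) × Z →L[ℝ] (Fin m → ℝ) × E :=
    (ContinuousLinearMap.id ℝ (Fin m → ℝ)).prodMap Z.subtypeL
  have hja : ∀ q, HasFDerivAt (fun q : (Fin m → ℝ) × Z => (q.1, u₀ + (q.2 : E))) j q := by
    intro q
    have : (fun q : (Fin m → ℝ) × Z => (q.1, u₀ + (q.2 : E))) = fun q => (0, u₀) + j q := by
      funext q; simp [j, Prod.ext_iff]
    rw [this]
    exact j.hasFDerivAt.const_add _
  have hjA : AnalyticAt ℝ (fun q : (Fin m → ℝ) × Z => (q.1, u₀ + (q.2 : E))) 0 :=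
    analyticAt_fst.prod (analyticAt_const.add ((Z.subtypeL.analyticAt _).comp analyticAt_snd))
  have hj0 : (fun q : (Fin m → ℝ) × Z => (q.1, u₀ + (q.2 : E))) 0 = (0, u₀) := by simp
  have hHA : AnalyticAt ℝ H 0 := AnalyticAt.fun_comp (f := fun q : (Fin m → ℝ) × Z => (q.1, u₀ + (q.2 : E)))
    (g := G) (by simpa using hG) hjA
  have hHd : ∀ q : (Fin m → ℝ) × Z, AnalyticAt ℝ G (q.1, u₀ + q.2) →
      HasFDerivAt H ((fderiv ℝ G (q.1, u₀ + q.2)).comp j) q := fun q hq =>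
    hq.differentiableAt.hasFDerivAt.comp q (hja q)
  let L : (Fin m → ℝ) × Z →L[ℝ] E := (fderiv ℝ G (0, u₀)).comp j
  have hL : ∀ w (ζ : Z), L (w, ζ) = ζ + b • ∑ i, w i • W i u₀ := by
    intro w ζ
    simp [L, j, hGd]
  have hcL : ∀ w (ζ : Z), c u₀ (L (w, ζ)) = b • w := by
    intro w ζ
    have h1 : c u₀ (ζ : E) = 0 := ζ.2
    rw [hL, map_add, h1, zero_add, map_smul, map_sum]
    congr 1
    simp only [map_smul, hc0]
    funext i
    simp [Finset.sum_apply, Pi.single_apply]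
  have hbij : Function.Bijective L := by
    constructor
    · rw [injective_iff_map_eq_zero]
      rintro ⟨w, ζ⟩ h
      have h1 := hcL w ζ
      rw [h, map_zero] at h1
      have hw : w = 0 := by
        rcases smul_eq_zero.1 h1.symm with h | h
        · exact absurd h hb.ne'
        · exact h
      have h2 := hL w ζ
      rw [h, hw] at h2
      simp only [Pi.zero_apply, zero_smul, Finset.sum_const_zero, smul_zero, add_zero] at h2
      exact Prod.ext hw (Subtype.ext h2.symm)
    · intro h
      have hz : h - ∑ i, c u₀ h i • W i u₀ ∈ Z := by
        show c u₀ (h - ∑ i, c u₀ h i • W i u₀) = 0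
        rw [map_sub, map_sum, sub_eq_zero]
        simp only [map_smul, hc0]
        funext i
        simp [Finset.sum_apply, Pi.single_apply]
      refine ⟨(b⁻¹ • c u₀ h, ⟨_, hz⟩), ?_⟩
      rw [hL]
      simp only [Pi.smul_apply, smul_assoc, ← Finset.smul_sum]
      rw [smul_inv_smul₀ hb.ne', sub_add_cancel]
  let Le : ((Fin m → ℝ) × Z) ≃L[ℝ] E :=
    (LinearEquiv.ofBijective (L : (Fin m → ℝ) × Z →ₗ[ℝ] E) hbij).toContinuousLinearEquiv
  have hHL : HasFDerivAt H (Le : (Fin m → ℝ) × Z →L[ℝ] E) 0 := by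
    have h1 := hHd 0 (by simpa using hG)
    have h2 : ((fderiv ℝ G ((0 : (Fin m → ℝ) × Z).1, u₀ + ((0 : (Fin m → ℝ) × Z).2 : E))).comp j) =
        (Le : (Fin m → ℝ) × Z →L[ℝ] E) := by
      ext q <;> simp [Le, L]
    rwa [h2] at h1
  have hH0 : H 0 = u₀ := by simp [H, hG0]
  have hHc : ContDiffAt ℝ ω H 0 := hHA.contDiffAt
  have hω : (ω : WithTop ℕ∞) ≠ 0 := by simp
  have hHs : HasStrictFDerivAt H (Le : (Fin m → ℝ) × Z →L[ℝ] E) 0 :=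
    hHc.hasStrictFDerivAt' hHL hω
  set Θ := hHc.localInverse hHL hω with hΘ
  have hΘA : AnalyticAt ℝ Θ u₀ := by
    have := (hHc.to_localInverse hHL hω).analyticAt
    rwa [hH0] at this
  have hΘ0 : Θ u₀ = 0 := by
    have := hHc.localInverse_apply_image hHL hω
    rwa [hH0] at this
  have hright : ∀ᶠ x in 𝓝 u₀, H (Θ x) = x := by
    have := hHs.eventually_right_inverse
    rw [hH0] at this
    exact this
  have hleft : ∀ᶠ q in 𝓝 0, Θ (H q) = q := hHs.eventually_left_inverse
  have hΘt : Tendsto Θ (𝓝 u₀) (𝓝 0) := by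
    have := hΘA.continuousAt.tendsto
    rwa [hΘ0] at this
  have hjt : Tendsto (fun x => ((Θ x).1, u₀ + ((Θ x).2 : E))) (𝓝 u₀) (𝓝 ((0 : Fin m → ℝ), u₀)) := by
    have h1 := hjA.continuousAt.tendsto
    simp only [Prod.fst_zero, Prod.snd_zero, ZeroMemClass.coe_zero, add_zero] at h1
    exact h1.comp hΘt
  refine ⟨fun x => ((Θ x).2 : E), ?_⟩
  filter_upwards [hΘA.eventually_analyticAt, eventually_eventually_nhds.2 hright,
    hΘt.eventually (eventually_eventually_nhds.2 hleft),
    hjt.eventually (hG.eventually_analyticAt.and hGs)] with x h1 h2 h3 ⟨h4, h5⟩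
  have dΘ := h1.differentiableAt.hasFDerivAt
  have hHx : H (Θ x) = x := h2.self_of_nhds
  have dH := hHd (Θ x) h4
  have hHx' : G ((Θ x).1, u₀ + ((Θ x).2 : E)) = x := hHx
  have e1 : ∀ v, (fderiv ℝ G ((Θ x).1, u₀ + ((Θ x).2 : E))) (j (fderiv ℝ Θ x v)) = v := by
    intro v
    have := (dH.comp x dΘ).unique ((hasFDerivAt_id x).congr_of_eventuallyEq h2)
    simpa using congrArg (fun L : E →L[ℝ] E => L v) this
  have e2 : ∀ q, fderiv ℝ Θ x ((fderiv ℝ G ((Θ x).1, u₀ + ((Θ x).2 : E))) (j q)) = q := by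
    intro q
    have dΘ' : HasFDerivAt Θ (fderiv ℝ Θ x) (H (Θ x)) := by rwa [hHx]
    have := (dΘ'.comp (Θ x) dH).unique ((hasFDerivAt_id (Θ x)).congr_of_eventuallyEq h3)
    simpa using congrArg (fun L : (Fin m → ℝ) × Z →L[ℝ] (Fin m → ℝ) × Z => L q) this
  rw [hHx'] at h5
  let R : (Fin m → ℝ) →ₗ[ℝ] E := (fderiv ℝ G ((Θ x).1, u₀ + ((Θ x).2 : E))).toLinearMap ∘ₗ
    (j.toLinearMap ∘ₗ LinearMap.inl ℝ (Fin m → ℝ) Z)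
  have hR : ∀ w, R w = fderiv ℝ G ((Θ x).1, u₀ + ((Θ x).2 : E)) (j (w, 0)) := fun w => rfl
  have hRs : LinearMap.range R ≤ Submodule.span ℝ (range fun k => W k x) := by
    rintro _ ⟨w, rfl⟩
    exact h5 w
  have hRi : Function.Injective R := by
    intro w w' h
    have := congrArg (fderiv ℝ Θ x) h
    rw [hR, hR, e2, e2] at this
    exact congrArg Prod.fst this
  -- The directions of `w` lie in the span of the frame by `variation_mem_span`, and they are `m`
  -- independent directions, so they exhaust it.
  have hReq : LinearMap.range R = Submodule.span ℝ (range fun k => W k x) := by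
    refine Submodule.eq_of_le_of_finrank_le hRs ?_
    rw [LinearMap.finrank_range_of_inj hRi, Module.finrank_fin_fun]
    have := finrank_range_le_card (R := ℝ) (fun k => W k x)
    rwa [Fintype.card_fin] at this
  refine ⟨Z.subtypeL.comp ((ContinuousLinearMap.snd ℝ (Fin m → ℝ) Z).comp (fderiv ℝ Θ x)),
    Z.subtypeL.hasFDerivAt.comp x (hasFDerivAt_snd.comp x dΘ), fun v => ?_⟩
  rw [← hReq]
  constructor
  · intro hv
    refine ⟨(fderiv ℝ Θ x v).1, ?_⟩
    rw [hR]
    have : ((fderiv ℝ Θ x v).1, (0 : Z)) = fderiv ℝ Θ x v :=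
      Prod.ext rfl (Subtype.ext hv.symm)
    rw [this, e1]
  · rintro ⟨w, rfl⟩
    rw [hR]
    simp [e2]

end Frobenius

/-! ### Extracting coefficients from families of relations modulo a subspace. -/

section LinearAlgebra

variable {E : Type*} [AddCommGroup E] [Module ℝ E]

/-- A linear form that vanishes on `D` turns the sum into a real polynomial in `ε` that is
identically zero. If `y k` were outside `D`, some such form would not vanish on it. -/
lemma coeff_mem_of_forall_sum_pow_mem (D : Submodule ℝ E) {n : ℕ} {y : ℕ → E}
    (h : ∀ ε : ℝ, ∑ k ∈ Finset.range n, ε ^ k • y k ∈ D) {k : ℕ} (hk : k < n) : y k ∈ D := by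
  by_contra hy
  obtain ⟨f, hf, hfD⟩ := Submodule.exists_le_ker_of_notMem hy
  let P : Polynomial ℝ := ∑ k ∈ Finset.range n, Polynomial.monomial k (f (y k))
  have hP : P = 0 := by
    refine Polynomial.funext fun ε => ?_
    have h1 : f (∑ k ∈ Finset.range n, ε ^ k • y k) = 0 := hfD (h ε)
    rw [map_sum] at h1
    simp only [P, Polynomial.eval_finsetSum, Polynomial.eval_monomial, Polynomial.eval_zero]
    rw [← h1]
    exact Finset.sum_congr rfl fun k _ => by rw [map_smul, smul_eq_mul, mul_comm]
  have h2 : P.coeff k = f (y k) := by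
    simp only [P, Polynomial.finsetSum_coeff, Polynomial.coeff_monomial]
    simp [hk]
  rw [hP, Polynomial.coeff_zero] at h2
  exact hf h2.symm

/-- The binomials are polynomials in `n` of degrees `0, …, q`. The difference of the relations at `n
+ 1` and `n` removes the term `a = 0` and, by Pascal's rule, is a relation of the same form with one
term fewer. -/
lemma mem_of_forall_sum_choose_mem (D : Submodule ℝ E) (q : ℕ) : ∀ (w : ℕ → E) (n₁ : ℕ),
    (∀ n ≥ n₁, ∑ a ∈ Finset.range (q + 1), (a + n).choose a • w a ∈ D) → ∀ a ≤ q, w a ∈ D := by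
  induction q with
  | zero =>
    intro w n₁ h a ha
    obtain rfl : a = 0 := by omega
    simpa using h n₁ le_rfl
  | succ q ih =>
    intro w n₁ h
    have h1 : ∀ n ≥ n₁ + 1, ∑ a ∈ Finset.range (q + 1), (a + n).choose a • w (a + 1) ∈ D := by
      intro n hn
      obtain ⟨n, rfl⟩ : ∃ k, n = k + 1 := ⟨n - 1, by omega⟩
      have h2 := D.sub_mem (h (n + 1) (by omega)) (h n (by omega))
      rw [Finset.sum_range_succ', Finset.sum_range_succ' _ (q + 1)] at h2
      simp only [zero_add, Nat.choose_zero_right, add_sub_add_right_eq_sub] at h2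
      rw [← Finset.sum_sub_distrib] at h2
      convert h2 using 1
      refine Finset.sum_congr rfl fun a _ => ?_
      have : (a + 1 + (n + 1)).choose (a + 1) = (a + (n + 1)).choose a + (a + 1 + n).choose (a + 1) := by
        rw [show a + 1 + (n + 1) = (a + (n + 1)) + 1 by ring, Nat.choose_succ_succ,
          show a + (n + 1) = a + 1 + n by ring]
      rw [this, add_smul, add_sub_cancel_right]
    have h3 := ih (fun a => w (a + 1)) (n₁ + 1) h1
    have h4 : ∀ a, a ≤ q → w (a + 1) ∈ D := h3
    intro a ha
    rcases a with _ | a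
    · have h5 := h n₁ le_rfl
      rw [Finset.sum_range_succ'] at h5
      simp only [zero_add, Nat.choose_zero_right, one_smul] at h5
      exact (D.add_mem_iff_right (D.sum_mem fun a ha => D.smul_of_tower_mem _
        (h4 a (by simpa [Nat.lt_succ_iff] using ha)))).1 h5
    · exact h4 a (by omega)

end LinearAlgebra

/-! ### Perturbing `T` so that its iterated brackets absorb brackets of depth two, over an algebra
of functions. -/

section Perturbation

variable {𝒪 : Type*} [CommRing 𝒪] [Algebra ℝ 𝒪]


/-- The operator `[T, ·]`, iterated. -/
noncomputable def adPow (T : Derivation ℝ 𝒪 𝒪) (k : ℕ) : (Derivation ℝ 𝒪 𝒪) →ₗ[ℝ] (Derivation ℝ 𝒪 𝒪) := (LieAlgebra.ad ℝ (Derivation ℝ 𝒪 𝒪) T : (Derivation ℝ 𝒪 𝒪) →ₗ[ℝ] (Derivation ℝ 𝒪 𝒪)) ^ k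

lemma adPow_zero (T X : Derivation ℝ 𝒪 𝒪) : adPow T 0 X = X := rfl

lemma adPow_succ (T X : Derivation ℝ 𝒪 𝒪) (k : ℕ) : adPow T (k + 1) X = ⁅T, adPow T k X⁆ := by
  rw [adPow, pow_succ']; rfl

lemma adPow_succ' (T X : Derivation ℝ 𝒪 𝒪) (k : ℕ) : adPow T (k + 1) X = adPow T k ⁅T, X⁆ := by
  rw [adPow, pow_succ]; rfl

lemma lie_smul_derivation (X Y : Derivation ℝ 𝒪 𝒪) (f : 𝒪) : ⁅X, f • Y⁆ = X f • Y + f • ⁅X, Y⁆ := by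
  ext g
  simp only [Derivation.commutator_apply, Derivation.smul_apply, Derivation.add_apply, smul_eq_mul,
    Derivation.leibniz]
  ring

lemma smul_lie_derivation (X Y : Derivation ℝ 𝒪 𝒪) (f : 𝒪) : ⁅f • X, Y⁆ = f • ⁅X, Y⁆ - Y f • X := by
  rw [← lie_skew, lie_smul_derivation, ← lie_skew X Y, smul_neg]
  abel

lemma adPow_smul (T X : Derivation ℝ 𝒪 𝒪) (f : 𝒪) (a : ℕ) :
    adPow T a (f • X) = ∑ ij ∈ Finset.HasAntidiagonal.antidiagonal a,
      a.choose ij.1 • ((T^[ij.1] f) • adPow T ij.2 X) := by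
  induction a with
  | zero => simp [adPow_zero]
  | succ a ih =>
    rw [adPow_succ, ih, lie_sum,
      Finset.sum_antidiagonal_choose_succ_nsmul (fun i j => (T^[i] f) • adPow T j X) a,
      ← Finset.sum_add_distrib]
    refine Finset.sum_congr rfl fun ij hij => ?_
    rw [lie_nsmul, lie_smul_derivation, smul_add, add_comm]
    congr 1
    · rw [adPow_succ]
    · rw [Function.iterate_succ_apply']
      rw [← Nat.choose_symm_of_eq_add (Finset.HasAntidiagonal.mem_antidiagonal.1 hij).symm]

/-- At a zero of `ξ` only the terms in which each of the `n` derivatives hits a different factor `ξ`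
survive, hence the factor `n!`. -/
lemma eval_iterate_pow_mul (χ : 𝒪 →ₐ[ℝ] ℝ) (T : Derivation ℝ 𝒪 𝒪) {ξ : 𝒪} (hξ : χ ξ = 0) (n : ℕ) :
    ∀ g : 𝒪, χ (T^[n] (ξ ^ n * g)) = n.factorial * χ (T ξ) ^ n * χ g := by
  induction n with
  | zero => intro g; simp
  | succ n ih =>
    intro g
    rw [Function.iterate_succ_apply]
    have h1 : T (ξ ^ (n + 1) * g) = ξ ^ n * ((n + 1 : ℕ) * T ξ * g + ξ * T g) := by
      rw [Derivation.leibniz, Derivation.leibniz_pow]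
      simp only [smul_eq_mul, nsmul_eq_mul, add_tsub_cancel_right]
      push_cast
      ring
    rw [h1, ih]
    simp only [map_add, map_mul, hξ, map_natCast, Nat.factorial_succ, Nat.cast_mul]
    push_cast
    ring

lemma eval_iterate_pow_of_lt (χ : 𝒪 →ₐ[ℝ] ℝ) (T : Derivation ℝ 𝒪 𝒪) {ξ : 𝒪} (hξ : χ ξ = 0) {i n : ℕ}
    (h : i < n) : χ (T^[i] (ξ ^ n)) = 0 := by
  obtain ⟨k, rfl⟩ : ∃ k, n = i + (k + 1) := ⟨n - i - 1, by omega⟩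
  rw [pow_add, eval_iterate_pow_mul χ T hξ]
  simp [hξ]

/-- The fields of order at least `n` along `ξ`. -/
def orderGE (ξ : 𝒪) (n : ℕ) : Submodule 𝒪 (Derivation ℝ 𝒪 𝒪) := LinearMap.range (LinearMap.lsmul 𝒪 (Derivation ℝ 𝒪 𝒪) (ξ ^ n))

lemma mem_orderGE {ξ : 𝒪} {n : ℕ} {X : Derivation ℝ 𝒪 𝒪} : X ∈ orderGE ξ n ↔ ∃ Y : Derivation ℝ 𝒪 𝒪, ξ ^ n • Y = X := Iff.rfl

lemma orderGE_anti {ξ : 𝒪} {n k : ℕ} (h : k ≤ n) : orderGE ξ n ≤ orderGE ξ k := by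
  rintro _ ⟨Y, rfl⟩
  refine ⟨ξ ^ (n - k) • Y, ?_⟩
  simp only [LinearMap.lsmul_apply]
  rw [smul_smul, ← pow_add, Nat.add_sub_cancel' h]

lemma lie_mem_orderGE (T : Derivation ℝ 𝒪 𝒪) {ξ : 𝒪} {n : ℕ} {X : Derivation ℝ 𝒪 𝒪} (hX : X ∈ orderGE ξ n) :
    ⁅T, X⁆ ∈ orderGE ξ (n - 1) := by
  obtain ⟨Y, rfl⟩ := mem_orderGE.1 hX
  rw [lie_smul_derivation, Derivation.leibniz_pow]
  refine add_mem ?_ (orderGE_anti (Nat.sub_le n 1) (mem_orderGE.2 ⟨_, rfl⟩))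
  refine mem_orderGE.2 ⟨(n • T ξ) • Y, ?_⟩
  rw [smul_smul]
  congr 1
  simp only [smul_eq_mul, nsmul_eq_mul]
  ring

/-- A bracket differentiates once and so loses at most one order of vanishing. Counting these losses
tells how flat a perturbation must be in order to leave given brackets unchanged at the point. -/
lemma lie_sub_lie_mem_orderGE {ξ : 𝒪} {n : ℕ} {X X' Y Y' : Derivation ℝ 𝒪 𝒪} (hX : X' - X ∈ orderGE ξ n)
    (hY : Y' - Y ∈ orderGE ξ n) : ⁅X', Y'⁆ - ⁅X, Y⁆ ∈ orderGE ξ (n - 1) := by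
  have h : ⁅X', Y'⁆ - ⁅X, Y⁆ = ⁅X, Y' - Y⁆ - ⁅Y', X' - X⁆ := by
    rw [lie_sub, lie_sub, ← lie_skew X' Y', ← lie_skew X Y']
    abel
  rw [h]
  exact sub_mem (lie_mem_orderGE _ hY) (lie_mem_orderGE _ hX)

lemma adPow_sub_mem_orderGE {T Z : Derivation ℝ 𝒪 𝒪} {ξ : 𝒪} {n : ℕ} (hZ : Z ∈ orderGE ξ n) (X : Derivation ℝ 𝒪 𝒪) (j : ℕ) :
    adPow (T + Z) j X - adPow T j X ∈ orderGE ξ (n - j) := by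
  induction j with
  | zero => simp [adPow_zero]
  | succ j ih =>
    rw [adPow_succ, adPow_succ]
    have hZ' : T + Z - T ∈ orderGE ξ (n - j) := by
      rw [add_sub_cancel_left]
      exact orderGE_anti (Nat.sub_le _ _) hZ
    exact lie_sub_lie_mem_orderGE hZ' ih

/-- The coefficient of `ε ^ k` in `[T + ε Z, ·]` applied `j` times. -/
noncomputable def pertCoeff (T Z X : Derivation ℝ 𝒪 𝒪) : ℕ → ℕ → (Derivation ℝ 𝒪 𝒪)
  | 0, k => if k = 0 then X else 0
  | j + 1, k => ⁅T, pertCoeff T Z X j k⁆ + if k = 0 then 0 else ⁅Z, pertCoeff T Z X j (k - 1)⁆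

lemma pertCoeff_eq_zero (T Z X : Derivation ℝ 𝒪 𝒪) (j : ℕ) : ∀ k, j < k → pertCoeff T Z X j k = 0 := by
  induction j with
  | zero => intro k hk; simp [pertCoeff, hk.ne']
  | succ j ih =>
    intro k hk
    rw [pertCoeff, ih k (by omega), ih (k - 1) (by omega)]
    simp

lemma adPow_add_smul (T Z X : Derivation ℝ 𝒪 𝒪) (ε : ℝ) (j : ℕ) :
    adPow (T + ε • Z) j X = ∑ k ∈ Finset.range (j + 1), ε ^ k • pertCoeff T Z X j k := by
  induction j with
  | zero => simp [adPow_zero, pertCoeff]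
  | succ j ih =>
    rw [adPow_succ, ih]
    simp only [pertCoeff, smul_add, Finset.sum_add_distrib]
    rw [add_lie, Finset.sum_range_succ _ (j + 1), pertCoeff_eq_zero T Z X j (j + 1) (by omega),
      lie_zero, smul_zero, add_zero, Finset.sum_range_succ' _ (j + 1)]
    simp only [lie_sum, lie_smul, smul_lie, if_true, smul_zero, add_zero, Nat.add_sub_cancel,
      Nat.succ_ne_zero, if_false, smul_smul, pow_succ']
    congr 1
    exact Finset.sum_congr rfl fun k _ => by rw [mul_comm]

lemma pertCoeff_zero_right (T Z X : Derivation ℝ 𝒪 𝒪) (j : ℕ) : pertCoeff T Z X j 0 = adPow T j X := by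
  induction j with
  | zero => simp [pertCoeff, adPow_zero]
  | succ j ih => simp [pertCoeff, adPow_succ, ih]

/-- First variation of `ad_T^{j+1}` in the direction `Z`: one of the `j + 1` brackets with `T` is
replaced by a bracket with `Z`. -/
lemma pertCoeff_one_right (T Z X : Derivation ℝ 𝒪 𝒪) (j : ℕ) : pertCoeff T Z X (j + 1) 1 =
    ∑ ab ∈ Finset.HasAntidiagonal.antidiagonal j, adPow T ab.1 ⁅Z, adPow T ab.2 X⁆ := by
  induction j with
  | zero => simp [pertCoeff, adPow_zero]
  | succ j ih =>
    rw [pertCoeff, ih, Finset.Nat.sum_antidiagonal_succ, lie_sum]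
    simp only [adPow_succ, one_ne_zero, if_false, Nat.sub_self, pertCoeff_zero_right, adPow_zero]
    rw [add_comm]

variable {V : Type*} [AddCommGroup V] [Module ℝ V] {ι : Type*} {χ : 𝒪 →ₐ[ℝ] ℝ}
  {θ : (Derivation ℝ 𝒪 𝒪) →ₗ[ℝ] V} {ξ : 𝒪} {W : ι → (Derivation ℝ 𝒪 𝒪)}

/-- In the application `χ` is the evaluation of functions at a point and `θ` the value of a field at
it; the compatibility `hθ` is all that is used of them. -/
lemma eval_eq_of_sub_mem_orderGE (hθ : ∀ f X, θ (f • X) = χ f • θ X) (hξ : χ ξ = 0)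
    {n : ℕ} (hn : 1 ≤ n) {X X' : Derivation ℝ 𝒪 𝒪} (h : X' - X ∈ orderGE ξ n) : θ X' = θ X := by
  obtain ⟨Y, hY⟩ := mem_orderGE.1 h
  rw [← sub_eq_zero, ← map_sub, ← hY, hθ, map_pow, hξ, zero_pow (by omega), zero_smul]

lemma eval_adPow_smul (hθ : ∀ f X, θ (f • X) = χ f • θ X) (T X : Derivation ℝ 𝒪 𝒪) (f : 𝒪) (a : ℕ) :
    θ (adPow T a (f • X)) = ∑ ij ∈ Finset.HasAntidiagonal.antidiagonal a,
      ((a.choose ij.1 : ℝ) * χ (T^[ij.1] f)) • θ (adPow T ij.2 X) := by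
  rw [adPow_smul, map_sum]
  refine Finset.sum_congr rfl fun ij _ => ?_
  rw [map_nsmul, hθ, mul_smul, Nat.cast_smul_eq_nsmul]

lemma sum_antidiagonal_assoc {A : Type*} [AddCommMonoid A] (n : ℕ) (f : ℕ → ℕ → ℕ → A) :
    ∑ ab ∈ Finset.HasAntidiagonal.antidiagonal n,
      ∑ ic ∈ Finset.HasAntidiagonal.antidiagonal ab.1, f ic.1 ic.2 ab.2 =
    ∑ iq ∈ Finset.HasAntidiagonal.antidiagonal n,
      ∑ cb ∈ Finset.HasAntidiagonal.antidiagonal iq.2, f iq.1 cb.1 cb.2 := by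
  rw [Finset.sum_sigma', Finset.sum_sigma']
  refine Finset.sum_nbij' (fun p => ⟨(p.2.1, p.2.2 + p.1.2), (p.2.2, p.1.2)⟩)
    (fun p => ⟨(p.1.1 + p.2.1, p.2.2), (p.1.1, p.2.1)⟩) ?_ ?_ ?_ ?_ ?_
  · rintro ⟨⟨a, b⟩, ⟨i, c⟩⟩ h
    simp only [Finset.mem_sigma, Finset.HasAntidiagonal.mem_antidiagonal] at h ⊢
    exact ⟨by omega, trivial⟩
  · rintro ⟨⟨i, q⟩, ⟨c, b⟩⟩ h
    simp only [Finset.mem_sigma, Finset.HasAntidiagonal.mem_antidiagonal] at h ⊢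
    exact ⟨by omega, trivial⟩
  · rintro ⟨⟨a, b⟩, ⟨i, c⟩⟩ h
    simp only [Finset.mem_sigma, Finset.HasAntidiagonal.mem_antidiagonal] at h ⊢
    obtain ⟨-, rfl⟩ := h
    rfl
  · rintro ⟨⟨i, q⟩, ⟨c, b⟩⟩ h
    simp only [Finset.mem_sigma, Finset.HasAntidiagonal.mem_antidiagonal] at h ⊢
    obtain ⟨-, rfl⟩ := h
    rfl
  · rintro ⟨⟨a, b⟩, ⟨i, c⟩⟩ h
    rfl

/-- The linear term in `ε` of the perturbed brackets lies in `D`. After expansion it is a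
combination of the vectors `v a b = θ (ad_T^a [W_γ, ad_T^b W_α])`, with coefficients given by
derivatives of `ξ ^ n` at the point. Varying `n` and the number of brackets separates these vectors.
-/
lemma eval_adPow_lie_mem_of_forall_perturbation (hθ : ∀ f X, θ (f • X) = χ f • θ X)
    (hξ : χ ξ = 0) {T : Derivation ℝ 𝒪 𝒪} (hT : χ (T ξ) ≠ 0) {D : Submodule ℝ V} {γ : ι} {n₁ : ℕ}
    (hD : ∀ n ≥ n₁, ∀ (ε : ℝ) (j : ℕ) (α : ι), θ (adPow (T + ε • ξ ^ n • W γ) j (W α)) ∈ D)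
    (α : ι) (a b : ℕ) : θ (adPow T a ⁅W γ, adPow T b (W α)⁆) ∈ D := by
  have hD0 : ∀ (j : ℕ) (α : ι), θ (adPow T j (W α)) ∈ D := fun j α => by
    simpa using hD n₁ le_rfl 0 j α
  set v : ℕ → ℕ → V := fun a b => θ (adPow T a ⁅W γ, adPow T b (W α)⁆) with hv
  have h1 : ∀ n ≥ n₁, ∀ j, ∑ ab ∈ Finset.HasAntidiagonal.antidiagonal j,
      θ (adPow T ab.1 ⁅ξ ^ n • W γ, adPow T ab.2 (W α)⁆) ∈ D := by
    intro n hn j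
    have h2 : ∀ ε : ℝ, ∑ k ∈ Finset.range (j + 2),
        ε ^ k • θ (pertCoeff T (ξ ^ n • W γ) (W α) (j + 1) k) ∈ D := by
      intro ε
      have := hD n hn ε (j + 1) α
      rw [adPow_add_smul, map_sum] at this
      simpa only [map_smul] using this
    have h3 := coeff_mem_of_forall_sum_pow_mem D h2 (k := 1) (by omega)
    rwa [pertCoeff_one_right, map_sum] at h3
  have h2 : ∀ n ≥ n₁, ∀ j, ∑ iq ∈ Finset.HasAntidiagonal.antidiagonal j,
      ∑ cb ∈ Finset.HasAntidiagonal.antidiagonal iq.2,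
        (((iq.1 + cb.1).choose iq.1 : ℝ) * χ (T^[iq.1] (ξ ^ n))) • v cb.1 cb.2 ∈ D := by
    intro n hn j
    rw [← sum_antidiagonal_assoc j (fun i c b =>
      (((i + c).choose i : ℝ) * χ (T^[i] (ξ ^ n))) • v c b)]
    have h3 : ∑ ab ∈ Finset.HasAntidiagonal.antidiagonal j,
        θ (adPow T ab.1 (ξ ^ n • ⁅W γ, adPow T ab.2 (W α)⁆)) ∈ D := by
      -- The part of `[ξ^n W_γ, X] = ξ^n [W_γ, X] - X(ξ^n) W_γ` in which `ξ^n` is differentiated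
      -- only produces multiples of the vectors `ad_T^i W_γ`, which are in `D`.
      have h4 : ∑ ab ∈ Finset.HasAntidiagonal.antidiagonal j,
          θ (adPow T ab.1 ((adPow T ab.2 (W α) (ξ ^ n)) • W γ)) ∈ D := by
        refine D.sum_mem fun ab _ => ?_
        rw [eval_adPow_smul hθ]
        exact D.sum_mem fun ij _ => D.smul_mem _ (hD0 _ _)
      have h5 := D.add_mem (h1 n hn j) h4
      rw [← Finset.sum_add_distrib] at h5
      convert h5 using 1
      refine Finset.sum_congr rfl fun ab _ => ?_
      rw [smul_lie_derivation, map_sub, map_sub, sub_add_cancel]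
    convert h3 using 1
    refine Finset.sum_congr rfl fun ab _ => ?_
    rw [eval_adPow_smul hθ]
    refine Finset.sum_congr rfl fun ic hic => ?_
    rw [Finset.HasAntidiagonal.mem_antidiagonal.1 hic]
  have h3 : ∀ q a b, a + b = q → v a b ∈ D := by
    intro q
    induction q using Nat.strong_induction_on with
    | _ q ih =>
      -- For `j = n + q`, the terms with fewer than `n` derivatives on `ξ ^ n` vanish, those with
      -- more than `n` involve only `v a b` with `a + b < q`, and those with exactly `n` have the
      -- common nonzero factor `n! (T ξ)^n`.
      have h4 : ∀ n ≥ n₁, ∑ a ∈ Finset.range (q + 1), (a + n).choose a • v a (q - a) ∈ D := by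
        intro n hn
        have h5 := h2 n hn (n + q)
        have hmem : (n, q) ∈ Finset.HasAntidiagonal.antidiagonal (n + q) :=
          Finset.HasAntidiagonal.mem_antidiagonal.2 rfl
        rw [← Finset.add_sum_erase _ _ hmem] at h5
        have h6 := (D.add_mem_iff_left (D.sum_mem fun iq hiq => ?_)).1 h5
        · have h7 : ∑ cb ∈ Finset.HasAntidiagonal.antidiagonal q,
              (((n + cb.1).choose n : ℝ) * χ (T^[n] (ξ ^ n))) • v cb.1 cb.2 =
              χ (T^[n] (ξ ^ n)) • ∑ a ∈ Finset.range (q + 1), (a + n).choose a • v a (q - a) := by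
            rw [Finset.Nat.sum_antidiagonal_eq_sum_range_succ (fun c b =>
              (((n + c).choose n : ℝ) * χ (T^[n] (ξ ^ n))) • v c b), Finset.smul_sum]
            refine Finset.sum_congr rfl fun a _ => ?_
            rw [← Nat.cast_smul_eq_nsmul ℝ, smul_smul, mul_comm, add_comm n a,
              Nat.choose_symm_add]
          have h8 : χ (T^[n] (ξ ^ n)) ≠ 0 := by
            have := eval_iterate_pow_mul χ T hξ n 1
            rw [mul_one] at this
            rw [this, map_one, mul_one]
            exact mul_ne_zero (Nat.cast_ne_zero.2 n.factorial_ne_zero) (pow_ne_zero _ hT)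
          simp only [h7] at h6
          exact (D.smul_mem_iff h8).1 h6
        · obtain ⟨hne, hiq⟩ := Finset.mem_erase.1 hiq
          have hiq := Finset.HasAntidiagonal.mem_antidiagonal.1 hiq
          rcases lt_trichotomy iq.1 n with h | h | h
          · rw [eval_iterate_pow_of_lt χ T hξ h]
            simp
          · exact absurd (Prod.ext h (by simp only; omega)) hne
          · refine D.sum_mem fun cb hcb => D.smul_mem _ (ih iq.2 (by omega) _ _ ?_)
            exact Finset.HasAntidiagonal.mem_antidiagonal.1 hcb
      have h5 := mem_of_forall_sum_choose_mem D q (fun a => v a (q - a)) n₁ h4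
      intro a b hab
      have h6 := h5 a (by omega)
      rwa [show q - a = b by omega] at h6
  exact h3 _ a b rfl

/-- By the Jacobi identity, `[ad^{i+1} W, X] = [T, [ad^i W, X]] - [ad^i W, [T, X]]`, which trades
each bracket with `T` on the left entry for one outside or one on the right entry. -/
lemma eval_adPow_lie_adPow_mem {T : Derivation ℝ 𝒪 𝒪} {D : Submodule ℝ V} {γ α : ι}
    (h : ∀ a b, θ (adPow T a ⁅W γ, adPow T b (W α)⁆) ∈ D) (i : ℕ) :
    ∀ a c, θ (adPow T a ⁅adPow T i (W γ), adPow T c (W α)⁆) ∈ D := by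
  induction i with
  | zero => exact h
  | succ i ih =>
    intro a c
    rw [adPow_succ, lie_lie, ← adPow_succ, map_sub, map_sub, ← adPow_succ']
    exact D.sub_mem (ih (a + 1) c) (ih a (c + 1))

variable (θ W) in
/-- The span of the values of the iterated brackets of `T` with the frame. -/
noncomputable def adSpan (T : Derivation ℝ 𝒪 𝒪) : Submodule ℝ V :=
  Submodule.span ℝ (range fun p : ι × ℕ => θ (adPow T p.2 (W p.1)))

lemma exists_span_iUnion_eq [FiniteDimensional ℝ V] {s : ℕ → Set V} (hs : Monotone s) :
    ∃ n, ∀ k, s k ⊆ Submodule.span ℝ (s n) := by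
  obtain ⟨n, hn⟩ := monotone_stabilizes_iff_noetherian.2 (inferInstance : IsNoetherian ℝ V)
    ⟨fun k => Submodule.span ℝ (s k), fun i j h => Submodule.span_mono (hs h)⟩
  refine ⟨n, fun k => ?_⟩
  have h1 : Submodule.span ℝ (s n) = Submodule.span ℝ (s (max n k)) := hn _ (le_max_left _ _)
  rw [h1]
  exact (hs (le_max_right n k)).trans Submodule.subset_span

/-- A perturbation of `T` along the frame `W` absorbs all brackets of depth two. -/
theorem exists_perturbation [Fintype ι] [DecidableEq ι] [FiniteDimensional ℝ V] (hθ : ∀ f X, θ (f • X) = χ f • θ X)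
    (hξ : χ ξ = 0) {T : Derivation ℝ 𝒪 𝒪} (hT : χ (T ξ) ≠ 0) :
    ∃ h : ι → 𝒪, (∀ α, χ (h α) = 0) ∧
      (∀ α j, θ (adPow T j (W α)) ∈ adSpan θ W (T + ∑ α, h α • W α)) ∧
      ∀ γ α i c, θ ⁅adPow T i (W γ), adPow T c (W α)⁆ ∈ adSpan θ W (T + ∑ α, h α • W α) := by
  let s : ℕ → Set V := fun k => {v | ∃ α, ∃ j ≤ k, v = θ (adPow T j (W α))} ∪
    {v | ∃ γ α, ∃ i ≤ k, ∃ c ≤ k, v = θ ⁅adPow T i (W γ), adPow T c (W α)⁆}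
  have hs : Monotone s := by
    intro k l hkl
    rintro v (⟨α, j, hj, rfl⟩ | ⟨γ, α, i, hi, c, hc, rfl⟩)
    · exact Or.inl ⟨α, j, hj.trans hkl, rfl⟩
    · exact Or.inr ⟨γ, α, i, hi.trans hkl, c, hc.trans hkl, rfl⟩
  -- Only finitely many vectors have to be absorbed: brackets with at most `Q` applications of
  -- `ad_T` in each entry span all of them.
  obtain ⟨Q, hQ⟩ := exists_span_iUnion_eq hs
  -- With order `Q + 2`, at most `Q` brackets leave a difference of order at least `2`, and the
  -- mutual bracket one of order at least `1`. The values in `s Q` are therefore the same for `T`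
  -- and for every `P g`.
  let P : (ι → 𝒪) → (Derivation ℝ 𝒪 𝒪) := fun g => T + ∑ α, (ξ ^ (Q + 2) * g α) • W α
  let rk : (ι → 𝒪) → ℕ := fun g => Module.finrank ℝ V - Module.finrank ℝ (adSpan θ W (P g))
  -- `rk` is the codimension of the span; a minimum over natural numbers exists, so `g` realises the
  -- largest dimension.
  let g : ι → 𝒪 := Function.argmin rk
  have hg : ∀ g', Module.finrank ℝ (adSpan θ W (P g')) ≤ Module.finrank ℝ (adSpan θ W (P g)) := by
    intro g'
    have h1 : rk g ≤ rk g' := Function.argmin_le rk g'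
    have h2 := Submodule.finrank_le (adSpan θ W (P g'))
    have h3 := Submodule.finrank_le (adSpan θ W (P g))
    simp only [rk] at h1
    omega
  have hPord : ∀ g : ι → 𝒪, ∑ α, (ξ ^ (Q + 2) * g α) • W α ∈ orderGE ξ (Q + 2) := by
    intro g
    exact sum_mem fun α _ => mem_orderGE.2 ⟨g α • W α, by rw [smul_smul]⟩
  set T' := P g with hT'
  have hTT' : ∀ f : 𝒪, χ (T' f) = χ (T f) := by
    intro f
    obtain ⟨Y, hY⟩ := mem_orderGE.1 (hPord g)
    simp [hT', P, ← hY, hξ]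
  obtain ⟨J, hJ⟩ := exists_span_iUnion_eq
    (s := fun k => {v | ∃ α, ∃ j ≤ k, v = θ (adPow T' j (W α))})
    (fun k l hkl => by rintro v ⟨α, j, hj, rfl⟩; exact ⟨α, j, hj.trans hkl, rfl⟩)
  have hstep : ∀ γ α a b, θ (adPow T' a ⁅W γ, adPow T' b (W α)⁆) ∈ adSpan θ W T' := by
    intro γ
    -- `n ≥ Q + 2` keeps the perturbed field among the `P g'`. `n > J` leaves unchanged the values
    -- of the at most `J`-fold brackets, which span the space for `T'`. So the span does not shrink,
    -- and maximality makes it equal.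
    refine eval_adPow_lie_mem_of_forall_perturbation hθ hξ (by rwa [hTT']) (n₁ := J + Q + 2) ?_
    intro n hn ε j α
    let g' : ι → 𝒪 := g + Pi.single γ (ε • ξ ^ (n - (Q + 2)))
    have hPg' : P g' = T' + ε • ξ ^ n • W γ := by
      have : ∀ α, (ξ ^ (Q + 2) * g' α) • W α = (ξ ^ (Q + 2) * g α) • W α +
          (ξ ^ (Q + 2) * (Pi.single γ (ε • ξ ^ (n - (Q + 2))) : ι → 𝒪) α) • W α := by
        intro α
        simp only [g', Pi.add_apply, mul_add, add_smul]
      simp only [hT', P, this, Finset.sum_add_distrib, add_assoc]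
      congr 2
      rw [Finset.sum_eq_single γ]
      · rw [Pi.single_eq_same, mul_smul_comm, ← pow_add, Nat.add_sub_cancel' (by omega), smul_assoc]
      · intro β _ hβ
        rw [Pi.single_eq_of_ne hβ, mul_zero, zero_smul]
      · simp
    have hle : adSpan θ W T' ≤ adSpan θ W (P g') := by
      have h1 : Submodule.span ℝ {v | ∃ α, ∃ j ≤ J, v = θ (adPow T' j (W α))} ≤
          adSpan θ W (P g') := by
        refine Submodule.span_le.2 ?_
        rintro _ ⟨α, j, hj, rfl⟩
        have hord : ε • ξ ^ n • W γ ∈ orderGE ξ n :=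
          mem_orderGE.2 ⟨ε • W γ, by rw [smul_comm]⟩
        have h2 := adPow_sub_mem_orderGE (T := T') hord (W α) j
        rw [← hPg'] at h2
        rw [← eval_eq_of_sub_mem_orderGE hθ hξ (by omega) h2]
        exact Submodule.subset_span ⟨(α, j), rfl⟩
      refine le_trans (Submodule.span_le.2 ?_) h1
      rintro _ ⟨⟨α, j⟩, rfl⟩
      exact hJ j ⟨α, j, le_rfl, rfl⟩
    rw [Submodule.eq_of_le_of_finrank_le hle (hg g'), ← hPg']
    exact Submodule.subset_span ⟨(α, j), rfl⟩
  have hmem : (s Q : Set V) ⊆ adSpan θ W T' := by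
    have hd : ∀ α j, j ≤ Q → adPow T' j (W α) - adPow T j (W α) ∈ orderGE ξ 2 := by
      intro α j hj
      exact orderGE_anti (by omega) (adPow_sub_mem_orderGE (T := T) (hPord g) (W α) j)
    rintro _ (⟨α, j, hj, rfl⟩ | ⟨γ, α, i, hi, c, hc, rfl⟩)
    · rw [← eval_eq_of_sub_mem_orderGE hθ hξ (by omega) (hd α j hj)]
      exact Submodule.subset_span ⟨(α, j), rfl⟩
    · rw [← eval_eq_of_sub_mem_orderGE hθ hξ (by omega)
        (lie_sub_lie_mem_orderGE (hd γ i hi) (hd α c hc))]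
      exact eval_adPow_lie_adPow_mem (hstep γ α) i 0 c
  have hall : ∀ k, s k ⊆ adSpan θ W T' := fun k => (hQ k).trans (Submodule.span_le.2 hmem)
  refine ⟨fun α => ξ ^ (Q + 2) * g α, fun α => by simp [hξ], fun α j => ?_, fun γ α i c => ?_⟩
  · exact hall j (Or.inl ⟨α, j, le_rfl, rfl⟩)
  · exact hall (max i c) (Or.inr ⟨γ, α, i, le_max_left _ _, c, le_max_right _ _, rfl⟩)

end Perturbation

/-! ### Analytic fields on a vector space as derivations. -/

section AnalyticFields

variable {E : Type*} [NormedAddCommGroup E] [NormedSpace ℝ E]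

/-- The iterated bracket `[T, [T, … [T, X] …]]` of fields on a vector space. -/
noncomputable def adVec (T : E → E) : ℕ → (E → E) → E → E
  | 0, X => X
  | k + 1, X => VectorField.lieBracket ℝ T (adVec T k X)

lemma analyticAt_clm_apply {E' F G : Type*} [NormedAddCommGroup E'] [NormedSpace ℝ E']
    [NormedAddCommGroup F] [NormedSpace ℝ F] [NormedAddCommGroup G] [NormedSpace ℝ G]
    {L : E' → F →L[ℝ] G} {v : E' → F} {x : E'} (hL : AnalyticAt ℝ L x) (hv : AnalyticAt ℝ v x) :
    AnalyticAt ℝ (fun z => L z (v z)) x :=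
  ((ContinuousLinearMap.id ℝ (F →L[ℝ] G)).analyticAt_bilinear (L x, v x)).comp₂ hL hv

lemma AnalyticAt.lieBracket [CompleteSpace E] {X Y : E → E} {x : E} (hX : AnalyticAt ℝ X x)
    (hY : AnalyticAt ℝ Y x) : AnalyticAt ℝ (VectorField.lieBracket ℝ X Y) x :=
  (analyticAt_clm_apply hY.fderiv hX).sub (analyticAt_clm_apply hX.fderiv hY)

lemma analyticAt_adVec [CompleteSpace E] {T X : E → E} {x : E} (hT : AnalyticAt ℝ T x)
    (hX : AnalyticAt ℝ X x) (k : ℕ) : AnalyticAt ℝ (adVec T k X) x := by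
  induction k with
  | zero => exact hX
  | succ k ih => exact AnalyticAt.lieBracket hT ih

variable (Ω : Set E)

/-- The algebra of the functions that are analytic on `Ω`. -/
def analyticAlg : Subalgebra ℝ (E → ℝ) where
  carrier := {f | AnalyticOnNhd ℝ f Ω}
  mul_mem' := fun hf hg => hf.mul hg
  add_mem' := fun hf hg => hf.add hg
  algebraMap_mem' := fun _ => analyticOnNhd_const

variable {Ω}

/-- The derivation of the algebra of analytic functions that is given by an analytic field. -/
noncomputable def fieldDerivation [CompleteSpace E] (hΩ : IsOpen Ω) {X : E → E} (hX : AnalyticOnNhd ℝ X Ω) :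
    Derivation ℝ (analyticAlg Ω) (analyticAlg Ω) :=
  Derivation.mk'
    -- Members of the algebra are functions on all of `E`, constrained on `Ω` only. Extension by
    -- zero outside `Ω` makes the identities of derivations hold everywhere.
    { toFun := fun f => ⟨Ω.indicator fun x => fderiv ℝ (f : E → ℝ) x (X x), fun x hx => by
        refine (analyticAt_clm_apply (f.2 x hx).fderiv (hX x hx)).congr ?_
        filter_upwards [hΩ.mem_nhds hx] with z hz
        rw [indicator_of_mem hz]⟩
      map_add' := fun f g => by
        ext x
        by_cases hx : x ∈ Ω
        · simp only [Subalgebra.coe_add, Pi.add_apply, indicator_of_mem hx]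
          rw [fderiv_add (f.2 x hx).differentiableAt (g.2 x hx).differentiableAt]
          rfl
        · simp [indicator_of_notMem hx]
      map_smul' := fun c f => by
        ext x
        by_cases hx : x ∈ Ω
        · simp only [Subalgebra.coe_smul, Pi.smul_apply, indicator_of_mem hx, RingHom.id_apply]
          rw [fderiv_const_smul (f.2 x hx).differentiableAt]
          rfl
        · simp [indicator_of_notMem hx] }
    fun f g => by
      ext x
      by_cases hx : x ∈ Ω
      · simp only [LinearMap.coe_mk, AddHom.coe_mk, Subalgebra.coe_mul, Subalgebra.coe_add,
          indicator_of_mem hx, smul_eq_mul, Pi.add_apply, Pi.mul_apply]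
        rw [fderiv_mul (f.2 x hx).differentiableAt (g.2 x hx).differentiableAt]
        simp
      · simp [indicator_of_notMem hx]

lemma fieldDerivation_apply [CompleteSpace E] (hΩ : IsOpen Ω) {X : E → E} (hX : AnalyticOnNhd ℝ X Ω)
    (f : analyticAlg Ω) {x : E} (hx : x ∈ Ω) :
    (fieldDerivation hΩ hX f : E → ℝ) x = fderiv ℝ (f : E → ℝ) x (X x) := by
  classical exact indicator_of_mem hx fun x => fderiv ℝ (f : E → ℝ) x (X x)

lemma fieldDerivation_apply_of_notMem [CompleteSpace E] (hΩ : IsOpen Ω) {X : E → E} (hX : AnalyticOnNhd ℝ X Ω)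
    (f : analyticAlg Ω) {x : E} (hx : x ∉ Ω) : (fieldDerivation hΩ hX f : E → ℝ) x = 0 := by
  classical exact indicator_of_notMem hx fun x => fderiv ℝ (f : E → ℝ) x (X x)

lemma AnalyticOnNhd.lieBracket [CompleteSpace E] {X Y : E → E} (hX : AnalyticOnNhd ℝ X Ω)
    (hY : AnalyticOnNhd ℝ Y Ω) : AnalyticOnNhd ℝ (VectorField.lieBracket ℝ X Y) Ω :=
  fun x hx => AnalyticAt.lieBracket (hX x hx) (hY x hx)

lemma analyticOnNhd_adVec [CompleteSpace E] {T X : E → E} (hT : AnalyticOnNhd ℝ T Ω)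
    (hX : AnalyticOnNhd ℝ X Ω) (k : ℕ) : AnalyticOnNhd ℝ (adVec T k X) Ω :=
  fun x hx => analyticAt_adVec (hT x hx) (hX x hx) k

/-- The second derivatives of `f` cancel by symmetry; outside `Ω` both sides are zero. -/
lemma fieldDerivation_lieBracket [CompleteSpace E] (hΩ : IsOpen Ω) {X Y : E → E}
    (hX : AnalyticOnNhd ℝ X Ω) (hY : AnalyticOnNhd ℝ Y Ω) :
    fieldDerivation hΩ (AnalyticOnNhd.lieBracket hX hY) =
      ⁅fieldDerivation hΩ hX, fieldDerivation hΩ hY⁆ := by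
  ext f x
  rw [Derivation.commutator_apply]
  by_cases hx : x ∈ Ω
  · have key : ∀ {X Y : E → E} (hX : AnalyticOnNhd ℝ X Ω) (hY : AnalyticOnNhd ℝ Y Ω),
        (fieldDerivation hΩ hX (fieldDerivation hΩ hY f) : E → ℝ) x =
          fderiv ℝ (fderiv ℝ (f : E → ℝ)) x (X x) (Y x) +
            fderiv ℝ (f : E → ℝ) x (fderiv ℝ Y x (X x)) := by
      intro X Y hX hY
      rw [fieldDerivation_apply hΩ hX _ hx]
      have e1 : (fieldDerivation hΩ hY f : E → ℝ) =ᶠ[𝓝 x]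
          fun z => fderiv ℝ (f : E → ℝ) z (Y z) := by
        filter_upwards [hΩ.mem_nhds hx] with z hz using fieldDerivation_apply hΩ hY f hz
      rw [e1.fderiv_eq]
      have e2 := (f.2 x hx).fderiv.differentiableAt.hasFDerivAt.clm_apply
        (hY x hx).differentiableAt.hasFDerivAt
      rw [e2.fderiv]
      simp [add_comm]
    rw [fieldDerivation_apply hΩ _ _ hx]
    show _ = (fieldDerivation hΩ hX (fieldDerivation hΩ hY f) : E → ℝ) x -
      (fieldDerivation hΩ hY (fieldDerivation hΩ hX f) : E → ℝ) x
    rw [key hX hY, key hY hX,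
      ContDiffAt.isSymmSndFDerivAt_of_omega (f.2 x hx).contDiffAt (X x) (Y x),
      VectorField.lieBracket, map_sub]
    ring
  · show _ = (fieldDerivation hΩ hX (fieldDerivation hΩ hY f) : E → ℝ) x -
      (fieldDerivation hΩ hY (fieldDerivation hΩ hX f) : E → ℝ) x
    simp only [fieldDerivation_apply_of_notMem hΩ _ _ hx, sub_zero]

lemma fieldDerivation_adVec [CompleteSpace E] (hΩ : IsOpen Ω) {T X : E → E}
    (hT : AnalyticOnNhd ℝ T Ω) (hX : AnalyticOnNhd ℝ X Ω) (k : ℕ) :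
    fieldDerivation hΩ (analyticOnNhd_adVec hT hX k) =
      adPow (fieldDerivation hΩ hT) k (fieldDerivation hΩ hX) := by
  induction k with
  | zero => rfl
  | succ k ih => rw [adPow_succ, ← ih, ← fieldDerivation_lieBracket]; rfl

end AnalyticFields

/-! ### The absorbing perturbation for fields on a Euclidean space. -/

section Lift

variable {N : ℕ}

/-- An analytic field `T`, not zero at `u`, can be changed along the analytic fields `W` so that
the iterated brackets with the new field span at `u` all brackets of depth two of the old ones. -/
theorem exists_absorbing_field {m : ℕ} {Ω : Set (EuclideanSpace ℝ (Fin N))} (hΩ : IsOpen Ω)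
    {u : EuclideanSpace ℝ (Fin N)} (hu : u ∈ Ω)
    {T : EuclideanSpace ℝ (Fin N) → EuclideanSpace ℝ (Fin N)}
    {W : Fin m → EuclideanSpace ℝ (Fin N) → EuclideanSpace ℝ (Fin N)}
    (hT : AnalyticOnNhd ℝ T Ω) (hW : ∀ α, AnalyticOnNhd ℝ (W α) Ω) (hTu : T u ≠ 0) :
    ∃ h : Fin m → EuclideanSpace ℝ (Fin N) → ℝ, (∀ α, AnalyticOnNhd ℝ (h α) Ω) ∧
      ∀ T' : EuclideanSpace ℝ (Fin N) → EuclideanSpace ℝ (Fin N),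
        T' = (fun x => T x + ∑ α, h α x • W α x) →
      (∀ α j, adVec T j (W α) u ∈ Submodule.span ℝ
        (range fun p : Fin m × ℕ => adVec T' p.2 (W p.1) u)) ∧
      ∀ γ α i c, VectorField.lieBracket ℝ (adVec T i (W γ)) (adVec T c (W α)) u ∈
        Submodule.span ℝ (range fun p : Fin m × ℕ => adVec T' p.2 (W p.1) u) := by
  obtain ⟨i₀, hi₀⟩ : ∃ i, T u i ≠ 0 := by
    by_contra! h
    exact hTu (by ext i; simpa using h i)
  let coord : Fin N → analyticAlg Ω := fun i =>
    ⟨fun x => x i, fun x _ => (EuclideanSpace.proj (𝕜 := ℝ) i).analyticAt x⟩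
  let χ : analyticAlg Ω →ₐ[ℝ] ℝ := (Pi.evalAlgHom ℝ (fun _ => ℝ) u).comp (analyticAlg Ω).val
  have hχ : ∀ f, χ f = (f : EuclideanSpace ℝ (Fin N) → ℝ) u := fun f => rfl
  -- The value at `u` of a field is recovered by applying its derivation to the coordinate
  -- functions.
  let θ : Derivation ℝ (analyticAlg Ω) (analyticAlg Ω) →ₗ[ℝ] EuclideanSpace ℝ (Fin N) :=
    { toFun := fun D => WithLp.toLp 2 fun i => χ (D (coord i))
      map_add' := fun D D' => by ext i; simp
      map_smul' := fun c D => by ext i; simp }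
  have hθ : ∀ (f : analyticAlg Ω) (D : Derivation ℝ (analyticAlg Ω) (analyticAlg Ω)),
      θ (f • D) = χ f • θ D := by
    intro f D
    ext i
    show χ ((f • D) (coord i)) = χ f * χ (D (coord i))
    rw [Derivation.smul_apply, smul_eq_mul, map_mul]
  have hθX : ∀ {X} (hX : AnalyticOnNhd ℝ X Ω), θ (fieldDerivation hΩ hX) = X u := by
    intro X hX
    ext i
    show (fieldDerivation hΩ hX (coord i) : EuclideanSpace ℝ (Fin N) → ℝ) u = X u i
    rw [fieldDerivation_apply hΩ hX _ hu]
    have : fderiv ℝ (fun x : EuclideanSpace ℝ (Fin N) => x i) u = EuclideanSpace.proj i :=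
      (EuclideanSpace.proj (𝕜 := ℝ) i).fderiv
    show fderiv ℝ (fun x : EuclideanSpace ℝ (Fin N) => x i) u (X u) = _
    rw [this]
    rfl
  -- A coordinate in the direction of which `T u` does not vanish, shifted to be zero at `u`.
  let ξ : analyticAlg Ω := coord i₀ - algebraMap ℝ _ (u i₀)
  have hξ : χ ξ = 0 := by simp [ξ, hχ, coord]
  have hTξ : χ (fieldDerivation hΩ hT ξ) ≠ 0 := by
    have h1 : fieldDerivation hΩ hT ξ = fieldDerivation hΩ hT (coord i₀) := by
      simp [ξ]
    have h2 : χ (fieldDerivation hΩ hT (coord i₀)) = θ (fieldDerivation hΩ hT) i₀ := rfl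
    rw [h1, h2, hθX]
    exact hi₀
  obtain ⟨h, -, h1, h2⟩ := exists_perturbation (W := fun α => fieldDerivation hΩ (hW α)) hθ hξ hTξ
  refine ⟨fun α => h α, fun α => (h α).2, ?_⟩
  rintro T' hT'
  have hT'a : AnalyticOnNhd ℝ T' Ω := by
    rw [hT']
    intro x hx
    exact (hT x hx).add (Finset.analyticAt_fun_sum _ fun α _ => ((h α).2 x hx).smul (hW α x hx))
  have hd : fieldDerivation hΩ hT'a =
      fieldDerivation hΩ hT + ∑ α, h α • fieldDerivation hΩ (hW α) := by
    have hsum : ∀ (f : analyticAlg Ω) x, ((∑ α, h α • fieldDerivation hΩ (hW α)) f :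
        EuclideanSpace ℝ (Fin N) → ℝ) x = ∑ α, (h α : EuclideanSpace ℝ (Fin N) → ℝ) x *
          (fieldDerivation hΩ (hW α) f : EuclideanSpace ℝ (Fin N) → ℝ) x := by
      intro f x
      have e : (∑ α, h α • fieldDerivation hΩ (hW α)) f =
          ∑ α, h α * fieldDerivation hΩ (hW α) f := by
        rw [← Derivation.coeFnAddMonoidHom_apply, map_sum, Finset.sum_apply]
        rfl
      rw [e]
      simp
    ext f x
    show _ = (fieldDerivation hΩ hT f : EuclideanSpace ℝ (Fin N) → ℝ) x +
      ((∑ α, h α • fieldDerivation hΩ (hW α)) f : EuclideanSpace ℝ (Fin N) → ℝ) x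
    rw [hsum]
    by_cases hx : x ∈ Ω
    · simp only [fieldDerivation_apply hΩ _ _ hx, hT', map_add, map_sum, map_smul, smul_eq_mul]
    · simp [fieldDerivation_apply_of_notMem hΩ _ _ hx]
  have hspan : adSpan θ (fun α => fieldDerivation hΩ (hW α)) (fieldDerivation hΩ hT +
      ∑ α, h α • fieldDerivation hΩ (hW α)) =
      Submodule.span ℝ (range fun p : Fin m × ℕ => adVec T' p.2 (W p.1) u) := by
    rw [adSpan, ← hd]
    simp only [← fieldDerivation_adVec, hθX]
  rw [hspan] at h1 h2
  simp only [← fieldDerivation_adVec, ← fieldDerivation_lieBracket, hθX] at h1 h2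
  exact ⟨h1, h2⟩

end Lift

/-! ### Transport of a finite family of fields along the flow of `-T`. -/

section Transport

open Filter

variable {E : Type*} [NormedAddCommGroup E] [NormedSpace ℝ E] [CompleteSpace E]

lemma fderiv_flow_zero {F : Type*} [NormedAddCommGroup F] [NormedSpace ℝ F] {Φ : ℝ × F → F} {x : F}
    (hΦ : AnalyticAt ℝ Φ (0, x)) (h0 : ∀ᶠ z in 𝓝 x, Φ (0, z) = z) (w : F) :
    fderiv ℝ Φ (0, x) (0, w) = w := by
  have e1 : HasFDerivAt (fun q => Φ (0, q)) ((fderiv ℝ Φ (0, x)).comp (.inr ℝ ℝ F)) x :=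
    hΦ.differentiableAt.hasFDerivAt.comp x (hasFDerivAt_prodMk_right _ _)
  have e2 := e1.unique ((hasFDerivAt_id x).congr_of_eventuallyEq h0)
  simpa using congrArg (fun L : F →L[ℝ] F => L w) e2

/-- The transport of a family of fields `G`, closed under `[T, ·]`, along the flow `Ψ` of `-T`:
`A` are the coefficients of the transported fields. -/
theorem exists_transport {ι : Type*} [Fintype ι] [DecidableEq ι] {T : E → E} {G : ι → E → E}
    {F : ι → ι → E → ℝ} {u₀ : E} (hT : AnalyticAt ℝ T u₀) (hG : ∀ i, AnalyticAt ℝ (G i) u₀)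
    (hF : ∀ i j, AnalyticAt ℝ (F i j) u₀)
    (hrel : ∀ᶠ x in 𝓝 u₀, ∀ i, VectorField.lieBracket ℝ T (G i) x = ∑ j, F i j x • G j x) :
    ∃ (Ψ : ℝ × E → E) (A : ℝ × E → ι → ι → ℝ), AnalyticAt ℝ Ψ (0, u₀) ∧ Ψ (0, u₀) = u₀ ∧
      AnalyticAt ℝ A (0, u₀) ∧
      A (0, u₀) = (fun i j => if i = j then 1 else 0) ∧
      ∀ᶠ δ in 𝓝[>] (0 : ℝ), ∀ s ∈ Icc 0 δ, ∀ x ∈ Metric.ball u₀ δ,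
        AnalyticAt ℝ Ψ (s, x) ∧ AnalyticAt ℝ A (s, x) ∧ Ψ (0, x) = x ∧
        HasDerivAt (fun s => Ψ (s, x)) (-T (Ψ (s, x))) s ∧
        HasDerivAt (fun s => A (s, x)) (fun i j => -∑ k, F i k (Ψ (s, x)) * A (s, x) k j) s ∧
        (fderiv ℝ (fun z => Ψ (s, z)) x).IsInvertible ∧
        ∀ i, fderiv ℝ (fun z => Ψ (s, z)) x (∑ j, A (s, x) i j • G j x) = G i (Ψ (s, x)) := by
  let one : ι → ι → ℝ := fun i j => if i = j then 1 else 0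
  -- The position and the coefficients of the transported fields solve one analytic system, `A' = -F
  -- A` along the trajectory, so a single analytic flow yields both.
  let g : E × (ι → ι → ℝ) → E × (ι → ι → ℝ) := fun p =>
    (-T p.1, fun i j => -∑ k, F i k p.1 * p.2 k j)
  have hg : AnalyticAt ℝ g (u₀, one) := by
    have e1 : AnalyticAt ℝ (fun p : E × (ι → ι → ℝ) => T p.1) (u₀, one) :=
      AnalyticAt.fun_comp (g := T) (f := fun p : E × (ι → ι → ℝ) => p.1) hT analyticAt_fst
    have e2 : ∀ i k, AnalyticAt ℝ (fun p : E × (ι → ι → ℝ) => F i k p.1) (u₀, one) := fun i k =>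
      AnalyticAt.fun_comp (g := F i k) (f := fun p : E × (ι → ι → ℝ) => p.1) (hF i k) analyticAt_fst
    refine e1.neg.prod (AnalyticAt.pi fun i => AnalyticAt.pi fun j => ?_)
    refine (Finset.analyticAt_fun_sum _ fun k _ => (e2 i k).mul ?_).neg
    exact (((ContinuousLinearMap.proj (R := ℝ) (φ := fun _ : ι => ℝ) j).comp
      (ContinuousLinearMap.proj (R := ℝ) (φ := fun _ : ι => ι → ℝ) k)).comp
        (.snd ℝ E (ι → ι → ℝ))).analyticAt _
  obtain ⟨Φ, hΦ, hΦ0, hΦd⟩ := exists_analytic_flow hg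
  have hj : AnalyticAt ℝ (fun p : ℝ × E => (p.1, (p.2, one))) (0, u₀) :=
    analyticAt_fst.prod (analyticAt_snd.prod analyticAt_const)
  have hjt : Tendsto (fun p : ℝ × E => (p.1, (p.2, one))) (𝓝 (0, u₀)) (𝓝 (0, (u₀, one))) :=
    hj.continuousAt
  have hjt2 : Tendsto (fun x : E => (x, one)) (𝓝 u₀) (𝓝 (u₀, one)) :=
    (Continuous.prodMk_left one).tendsto u₀
  have hΦj : AnalyticAt ℝ (fun p : ℝ × E => Φ (p.1, (p.2, one))) (0, u₀) :=
    AnalyticAt.fun_comp (g := Φ) (f := fun p : ℝ × E => (p.1, (p.2, one))) hΦ hj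
  have hΨ : AnalyticAt ℝ (fun p : ℝ × E => (Φ (p.1, (p.2, one))).1) (0, u₀) :=
    ((ContinuousLinearMap.fst ℝ E (ι → ι → ℝ)).analyticAt _).comp hΦj
  have hA : AnalyticAt ℝ (fun p : ℝ × E => (Φ (p.1, (p.2, one))).2) (0, u₀) :=
    ((ContinuousLinearMap.snd ℝ E (ι → ι → ℝ)).analyticAt _).comp hΦj
  set Ψ : ℝ × E → E := fun p => (Φ (p.1, (p.2, one))).1 with hΨdef
  set A : ℝ × E → ι → ι → ℝ := fun p => (Φ (p.1, (p.2, one))).2 with hAdef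
  have hΨ0 : ∀ᶠ x in 𝓝 u₀, Ψ (0, x) = x ∧ A (0, x) = one := by
    filter_upwards [hjt2.eventually hΦ0] with x hx
    simp only [hΨdef, hAdef, hx, and_self]
  have hΨ00 : Ψ (0, u₀) = u₀ := hΨ0.self_of_nhds.1
  have hder : ∀ᶠ p in 𝓝 ((0 : ℝ), u₀), HasDerivAt (fun s => Ψ (s, p.2)) (-T (Ψ p)) p.1 ∧
      HasDerivAt (fun s => A (s, p.2)) (fun i j => -∑ k, F i k (Ψ p) * A p k j) p.1 := by
    filter_upwards [hjt.eventually hΦd] with p hp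
    exact ⟨HasDerivAt.fst_comp hp, HasDerivAt.snd_comp hp⟩
  have hΨt : Tendsto Ψ (𝓝 (0, u₀)) (𝓝 u₀) := by
    have := hΨ.continuousAt.tendsto
    rwa [hΨ00] at this
  have hΨx : ∀ p, AnalyticAt ℝ Ψ p → HasFDerivAt (fun z => Ψ (p.1, z))
      ((fderiv ℝ Ψ p).comp (.inr ℝ ℝ E)) p.2 := fun p hp =>
    HasFDerivAt.comp (g := Ψ) (f := fun z => (p.1, z)) p.2 hp.differentiableAt.hasFDerivAt
      (hasFDerivAt_prodMk_right _ _)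
  have hunit : ∀ᶠ p in 𝓝 ((0 : ℝ), u₀), IsUnit ((fderiv ℝ Ψ p).comp (.inr ℝ ℝ E)) := by
    have hc : ContinuousAt (fun p => (fderiv ℝ Ψ p).comp (.inr ℝ ℝ E)) (0, u₀) :=
      hΨ.fderiv.continuousAt.clm_comp continuousAt_const
    refine hc.eventually (Units.isOpen.mem_nhds ?_)
    have h1 : (fderiv ℝ Ψ (0, u₀)).comp (.inr ℝ ℝ E) = 1 := by
      ext w
      exact fderiv_flow_zero hΨ (hΨ0.mono fun _ h => h.1) w
    show IsUnit ((fderiv ℝ Ψ (0, u₀)).comp (.inr ℝ ℝ E))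
    rw [h1]; exact isUnit_one
  obtain ⟨K₁, hK₁⟩ : ∃ K, ∀ᶠ x in 𝓝 u₀, ‖fderiv ℝ T x‖ ≤ K :=
    ⟨‖fderiv ℝ T u₀‖ + 1, (hT.fderiv.continuousAt.norm.eventually_lt_const
      (lt_add_one _)).mono fun _ h => h.le⟩
  obtain ⟨K₂, hK₂⟩ : ∃ K, ∀ᶠ x in 𝓝 u₀, ∀ i, ∑ j, ‖F i j x‖ ≤ K := by
    refine ⟨∑ i, ∑ j, ‖F i j u₀‖ + 1, eventually_all.2 fun i => ?_⟩
    have hc : ContinuousAt (fun x => ∑ j, ‖F i j x‖) u₀ :=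
      tendsto_finsetSum _ fun j _ => (hF i j).continuousAt.norm
    refine (hc.eventually_lt_const (lt_of_le_of_lt ?_ (lt_add_one _))).mono fun _ h => h.le
    exact Finset.single_le_sum (f := fun i => ∑ j, ‖F i j u₀‖)
      (fun i _ => Finset.sum_nonneg fun _ _ => norm_nonneg _) (Finset.mem_univ i)
  have hgood := hΨt.eventually ((eventually_all.2 fun i => (hG i).eventually_analyticAt).and
    (hT.eventually_analyticAt.and (hrel.and (hK₁.and hK₂))))
  have hall := hΨ.eventually_analyticAt.and (hA.eventually_analyticAt.and
    (hder.eventually_nhds.and (hunit.and hgood)))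
  rw [nhds_prod_eq] at hall
  obtain ⟨pt, hpt, px, hpx, hpp⟩ := eventually_prod_iff.1 hall
  obtain ⟨δ₁, hδ₁, hδ₁t⟩ := Metric.eventually_nhds_iff_ball.1 hpt
  obtain ⟨δ₂, hδ₂, hδ₂x⟩ := Metric.eventually_nhds_iff_ball.1 (hpx.and hΨ0.eventually_nhds)
  refine ⟨Ψ, A, hΨ, hΨ00, hA, hΨ0.self_of_nhds.2, ?_⟩
  filter_upwards [Ioo_mem_nhdsGT (lt_min hδ₁ hδ₂)] with δ hδ
  intro s hs x hx
  have hxx := hδ₂x x (Metric.ball_subset_ball (hδ.2.le.trans (min_le_right _ _)) hx)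
  have hx0 := hxx.2.self_of_nhds
  have hsI : ∀ t ∈ Icc 0 δ, pt t := fun t ht => by
    refine hδ₁t t ?_
    rw [Metric.mem_ball, Real.dist_eq, sub_zero, abs_of_nonneg ht.1]
    exact lt_of_le_of_lt ht.2 (hδ.2.trans_le (min_le_left _ _))
  have hs' := hpp (hsI s hs) hxx.1
  obtain ⟨ha, hAa, hd, hu, hgd⟩ := hs'
  have hfd := hΨx (s, x) ha
  refine ⟨ha, hAa, hx0.1, hd.self_of_nhds.1, hd.self_of_nhds.2, ?_, ?_⟩
  · rw [hfd.fderiv]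
    obtain ⟨U, hU⟩ := hu
    rw [← hU]
    exact ⟨ContinuousLinearEquiv.unitsEquiv ℝ E U, rfl⟩
  rw [hfd.fderiv]
  -- both sides solve the same linear equation
  let u : ℝ → ι → E := fun t i =>
    (∑ j, A (t, x) i j • fderiv ℝ Ψ (t, x) (0, G j x)) - G i (Ψ (t, x))
  let u' : ℝ → ι → E := fun t i =>
    -fderiv ℝ T (Ψ (t, x)) (u t i) - ∑ k, F i k (Ψ (t, x)) • u t k
  have hu' : ∀ t ∈ Icc 0 δ, HasDerivAt u (u' t) t := by
    intro t ht
    obtain ⟨ha, hAa, hd, -, hGa, hTa, hr, -⟩ := hpp (hsI t ht) hxx.1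
    have hd0 := hd.self_of_nhds
    simp only at hd0
    refine hasDerivAt_pi.2 fun i => ?_
    have e1 : HasDerivAt (fun t => G i (Ψ (t, x))) (fderiv ℝ (G i) (Ψ (t, x)) (-T (Ψ (t, x)))) t :=
      (hGa i).differentiableAt.hasFDerivAt.comp_hasDerivAt t hd0.1
    have e2 : ∀ j, HasDerivAt (fun t => fderiv ℝ Ψ (t, x) (0, G j x))
        (fderiv ℝ (fun z => -T z) (Ψ (t, x)) (fderiv ℝ Ψ (t, x) (0, G j x))) t := fun j =>
      hasDerivAt_fderiv_flow (f := fun z => -T z) (p := (t, x)) ha (hd.mono fun _ h => h.1)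
        hTa.neg.differentiableAt _
    have e3 : ∀ j, HasDerivAt (fun t => A (t, x) i j)
        (-∑ k, F i k (Ψ (t, x)) * A (t, x) k j) t := fun j =>
      hasDerivAt_pi.1 (hasDerivAt_pi.1 hd0.2 i) j
    have e4 := (HasDerivAt.fun_sum (u := Finset.univ) fun j _ => (e3 j).smul (e2 j)).fun_sub e1
    refine e4.congr_deriv ?_
    have e5 := hr i
    rw [VectorField.lieBracket, sub_eq_iff_eq_add] at e5
    have e6 : fderiv ℝ (fun z => -T z) (Ψ (t, x)) = -fderiv ℝ T (Ψ (t, x)) := fderiv_fun_neg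
    simp only [u', u, map_neg, e5, e6, neg_apply, map_sub, map_sum, map_smul, smul_neg, smul_sub,
      Finset.sum_sub_distrib, neg_smul, Finset.sum_neg_distrib, Finset.sum_add_distrib,
      Finset.sum_smul, Finset.smul_sum, smul_smul]
    rw [Finset.sum_comm]
    abel
  have hu0 : u 0 = 0 := by
    have ha0 := (hpp (hsI 0 ⟨le_rfl, hδ.1.le⟩) hxx.1).1
    funext i
    have e : ∀ w, fderiv ℝ Ψ (0, x) (0, w) = w :=
      fderiv_flow_zero ha0 (hxx.2.mono fun _ h => h.1)
    simp only [u, hx0.1, hx0.2, e, one, Pi.zero_apply]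
    simp
  have hz := eq_zero_of_abs_deriv_le_mul_abs_self_of_eq_zero_right (f := u) (f' := u')
    (K := K₁ + K₂) (a := 0) (b := δ)
    (fun t ht => (hu' t ht).continuousAt.continuousWithinAt)
    (fun t ht => (hu' t (Ico_subset_Icc_self ht)).hasDerivWithinAt) hu0 (fun t ht => by
      obtain ⟨-, -, -, -, -, -, -, h1, h2⟩ := hpp (hsI t (Ico_subset_Icc_self ht)) hxx.1
      have hK : 0 ≤ K₁ := (norm_nonneg _).trans h1
      have hKi : ∀ i, ‖u' t i‖ ≤ (K₁ + K₂) * ‖u t‖ := by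
        intro i
        refine (norm_sub_le _ _).trans ?_
        rw [norm_neg, add_mul]
        refine add_le_add ?_ ?_
        · exact ((fderiv ℝ T _).le_opNorm _).trans (mul_le_mul h1 (norm_le_pi_norm _ i)
            (norm_nonneg _) hK)
        · refine (norm_sum_le _ _).trans
            (le_trans ?_ (mul_le_mul_of_nonneg_right (h2 i) (norm_nonneg (u t))))
          rw [Finset.sum_mul]
          refine Finset.sum_le_sum fun k _ => ?_
          rw [norm_smul]
          exact mul_le_mul_of_nonneg_left (norm_le_pi_norm _ k) (norm_nonneg _)
      rcases isEmpty_or_nonempty ι with hι | ⟨⟨i⟩⟩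
      · have : u' t = 0 := Subsingleton.elim _ _
        have h0 : u t = 0 := Subsingleton.elim _ _
        simp [this, h0]
      · exact (pi_norm_le_iff_of_nonneg ((norm_nonneg _).trans (hKi i))).2 hKi) s hs
  intro i
  have := congrFun hz i
  simp only [u, Pi.zero_apply, sub_eq_zero] at this
  rw [← this, map_sum]
  simp

end Transport

/-! ### Choice of depths and embeddings by successive flows. -/

section Leaflet

open Filter

variable {E : Type*} [NormedAddCommGroup E] [NormedSpace ℝ E]

/-- Greedy choice: as long as fewer than `r` vectors are chosen, their span has dimension less than
`r`, so some parameter below all the previous ones gives a vector outside it. -/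
lemma exists_strictAnti_linearIndependent {κ : Type*} {V : Type*} [AddCommGroup V] [Module ℝ V]
    {c : κ → ℝ → V} {r : ℕ}
    (h : ∀ S : Submodule ℝ V, FiniteDimensional ℝ S → Module.finrank ℝ S < r → ∀ δ > 0,
      ∃ τ ∈ Ioo 0 δ, ∃ α, c α τ ∉ S) {T₀ : ℝ} (hT₀ : 0 < T₀) (d : ℕ) (hd : d ≤ r) :
    ∃ (τ : Fin d → ℝ) (α : Fin d → κ), StrictAnti τ ∧ (∀ l, τ l ∈ Ioo 0 T₀) ∧
      LinearIndependent ℝ fun l => c (α l) (τ l) := by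
  induction d with
  | zero =>
    exact ⟨Fin.elim0, Fin.elim0, fun i => i.elim0, fun i => i.elim0, linearIndependent_empty_type⟩
  | succ d ih =>
    obtain ⟨τ, α, hτ, hτI, hli⟩ := ih (by omega)
    obtain ⟨δ, hδ, hδτ, hδT⟩ : ∃ δ > 0, (∀ l, δ ≤ τ l) ∧ δ ≤ T₀ := by
      have h1 : ∀ᶠ δ in 𝓝[>] (0 : ℝ), (∀ l, δ ≤ τ l) ∧ δ ≤ T₀ := by
        refine (eventually_all.2 fun l => ?_).and ?_
        · exact (eventually_le_nhds (hτI l).1).filter_mono nhdsWithin_le_nhds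
        · exact (eventually_le_nhds hT₀).filter_mono nhdsWithin_le_nhds
      obtain ⟨δ, h2, h3⟩ := (h1.and self_mem_nhdsWithin).exists
      exact ⟨δ, h3, h2⟩
    obtain ⟨t, ht, a, hta⟩ := h (Submodule.span ℝ (range fun l => c (α l) (τ l)))
      (FiniteDimensional.span_of_finite ℝ (finite_range _))
      (by
        have := finrank_range_le_card (R := ℝ) fun l => c (α l) (τ l)
        rw [Fintype.card_fin] at this
        exact lt_of_le_of_lt this (by omega)) δ hδ
    refine ⟨Fin.snoc τ t, Fin.snoc α a, ?_, ?_, ?_⟩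
    · intro i j hij
      induction j using Fin.lastCases with
      | last =>
        induction i using Fin.lastCases with
        | last => exact absurd hij (lt_irrefl _)
        | cast i => simpa using ht.2.trans_le (hδτ i)
      | cast j =>
        induction i using Fin.lastCases with
        | last => exact absurd (hij.trans (Fin.castSucc_lt_last j)) (lt_irrefl _)
        | cast i => simpa using hτ (by simpa using hij)
    · intro l
      induction l using Fin.lastCases with
      | last => simpa using ⟨ht.1, ht.2.trans_le hδT⟩
      | cast l => simpa using hτI l
    · have : (fun l => c ((Fin.snoc α a : Fin (d + 1) → κ) l) ((Fin.snoc τ t : Fin (d + 1) → ℝ) l)) =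
          (Fin.snoc (fun l => c (α l) (τ l)) (c a t) : Fin (d + 1) → V) := by
        funext l
        induction l using Fin.lastCases with
        | last => simp
        | cast l => simp
      rw [this, linearIndependent_finSnoc]
      exact ⟨hli, hta⟩

lemma mem_of_hasDerivAt_of_mem [FiniteDimensional ℝ E] (S : Submodule ℝ E) {c : ℝ → E} {c' : E} {s : ℝ}
    (hc : ∀ᶠ t in 𝓝 s, c t ∈ S) (h : HasDerivAt c c' s) : c' ∈ S := by
  by_contra hn
  obtain ⟨f, hf, hfS⟩ := Submodule.exists_le_ker_of_notMem hn
  have h1 := (LinearMap.toContinuousLinearMap f).hasFDerivAt.comp_hasDerivAt s h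
  have h2 : (LinearMap.toContinuousLinearMap f ∘ c) =ᶠ[𝓝 s] fun _ => 0 := by
    filter_upwards [hc] with t ht using hfS ht
  exact hf (h1.unique ((hasDerivAt_const s (0 : ℝ)).congr_of_eventuallyEq h2))

/-- The flow of successive fields, as a map of the times. -/
noncomputable def flowChain {d : ℕ} (Φ : Fin d → ℝ × E → E) (u₀ : E) :
    ℕ → EuclideanSpace ℝ (Fin d) → E
  | 0 => fun _ => u₀
  | k + 1 => fun s => if h : k < d then Φ ⟨k, h⟩ (s ⟨k, h⟩, flowChain Φ u₀ k s)
      else flowChain Φ u₀ k s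

/-- Successive flows of linearly independent fields form an embedding of the times. -/
theorem exists_flow_embedding [FiniteDimensional ℝ E] {d : ℕ} {X : Fin d → E → E} {u₀ : E}
    (hX : ∀ l, AnalyticAt ℝ (X l) u₀) (hli : LinearIndependent ℝ fun l => X l u₀)
    {O : Set E} (hO : O ∈ 𝓝 u₀) {ε : ℝ} (hε : 0 < ε) :
    ∃ (p : ℕ → EuclideanSpace ℝ (Fin d) → E) (P : Set (EuclideanSpace ℝ (Fin d))),
      IsOpen P ∧ 0 ∈ P ∧ (∀ s, p 0 s = u₀) ∧ p d 0 = u₀ ∧ AnalyticOnNhd ℝ (p d) P ∧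
      (∀ s ∈ P, Function.Injective (fderiv ℝ (p d) s)) ∧ Topology.IsEmbedding (P.domRestrict (p d)) ∧
      (∀ s ∈ P, p d s ∈ O) ∧
      ∀ s ∈ P, ∀ l : Fin d, s l ∈ Ioo (-ε) ε ∧ ∃ γ : ℝ → E, γ 0 = p l s ∧ γ (s l) = p (l + 1) s ∧
        ∀ t ∈ uIcc 0 (s l), HasDerivAt γ (X l (γ t)) t ∧ γ t ∈ O := by
  choose Φ hΦ hΦ0 hΦd using fun l => exists_analytic_flow (hX l)
  have hΦ00 : ∀ l, Φ l (0, u₀) = u₀ := fun l => (hΦ0 l).self_of_nhds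
  let p := flowChain Φ u₀
  have hpS : ∀ k (h : k < d) s, p (k + 1) s = Φ ⟨k, h⟩ (s ⟨k, h⟩, p k s) := by
    intro k h s
    show (if h : k < d then _ else _) = _
    rw [dif_pos h]
  let π : Fin d → EuclideanSpace ℝ (Fin d) →L[ℝ] ℝ := fun l => EuclideanSpace.proj l
  -- The differential at `0` of the chain of the first `k` flows is `v ↦ ∑ v_i X_i(u₀)`, because
  -- each flow is the identity at time zero. For `k = d` it is injective by independence.
  have hp : ∀ k ≤ d, p k 0 = u₀ ∧ AnalyticAt ℝ (p k) 0 ∧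
      ∀ v, fderiv ℝ (p k) 0 v = ∑ i : Fin d, if (i : ℕ) < k then v i • X i u₀ else 0 := by
    intro k
    induction k with
    | zero =>
      intro _
      refine ⟨rfl, analyticAt_const, fun v => ?_⟩
      have : fderiv ℝ (p 0) 0 = 0 := by
        show fderiv ℝ (fun _ => u₀) 0 = 0
        simp
      simp [this]
    | succ k ih =>
      intro hk
      obtain ⟨h1, h2, h3⟩ := ih (by omega)
      have hk : k < d := hk
      have e0 : p (k + 1) = fun s => Φ ⟨k, hk⟩ (s ⟨k, hk⟩, p k s) := funext (hpS k hk)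
      have e1 : AnalyticAt ℝ (fun s : EuclideanSpace ℝ (Fin d) => (s ⟨k, hk⟩, p k s)) 0 :=
        ((π ⟨k, hk⟩).analyticAt 0).prod h2
      have e2 : AnalyticAt ℝ (Φ ⟨k, hk⟩) ((0 : EuclideanSpace ℝ (Fin d)) ⟨k, hk⟩, p k 0) := by
        rw [h1]; exact hΦ _
      have e3 : HasFDerivAt (fun s : EuclideanSpace ℝ (Fin d) => (s ⟨k, hk⟩, p k s))
          ((π ⟨k, hk⟩).prod (fderiv ℝ (p k) 0)) 0 :=
        (π ⟨k, hk⟩).hasFDerivAt.prodMk h2.differentiableAt.hasFDerivAt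
      refine ⟨?_, ?_, fun v => ?_⟩
      · rw [hpS k hk, h1]; exact hΦ00 _
      · rw [e0]
        exact AnalyticAt.fun_comp (g := Φ ⟨k, hk⟩)
          (f := fun s : EuclideanSpace ℝ (Fin d) => (s ⟨k, hk⟩, p k s)) e2 e1
      · have e4 : fderiv ℝ (p (k + 1)) 0 = (fderiv ℝ (Φ ⟨k, hk⟩)
            ((0 : EuclideanSpace ℝ (Fin d)) ⟨k, hk⟩, p k 0)).comp
              ((π ⟨k, hk⟩).prod (fderiv ℝ (p k) 0)) := by
          rw [e0]
          exact (HasFDerivAt.comp (g := Φ ⟨k, hk⟩)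
            (f := fun s : EuclideanSpace ℝ (Fin d) => (s ⟨k, hk⟩, p k s)) 0
            e2.differentiableAt.hasFDerivAt e3).fderiv
        rw [e4, ContinuousLinearMap.comp_apply, ContinuousLinearMap.prod_apply, h1, h3]
        have e5 : ∀ (t : ℝ) w, fderiv ℝ (Φ ⟨k, hk⟩) (0, u₀) (t, w) = t • X ⟨k, hk⟩ u₀ + w := by
          intro t w
          have e6 : HasDerivAt (fun s : ℝ => Φ ⟨k, hk⟩ (s, u₀))
              (fderiv ℝ (Φ ⟨k, hk⟩) (0, u₀) (1, 0)) 0 :=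
            HasFDerivAt.comp_hasDerivAt (f := fun s : ℝ => (s, u₀)) 0
              (hΦ _).differentiableAt.hasFDerivAt ((hasDerivAt_id (0 : ℝ)).prodMk (hasDerivAt_const _ _))
          have e7 := e6.unique (hΦd ⟨k, hk⟩).self_of_nhds
          rw [hΦ00] at e7
          have e8 : ((t, w) : ℝ × E) = t • ((1 : ℝ), (0 : E)) + ((0 : ℝ), w) := by simp
          rw [e8, map_add, map_smul, e7, fderiv_flow_zero (hΦ _) (hΦ0 _)]
        have e9 : ((0 : EuclideanSpace ℝ (Fin d)) ⟨k, hk⟩ : ℝ) = 0 := rfl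
        rw [e9, e5]
        have e10 : ∀ i : Fin d, (if (i : ℕ) < k + 1 then v i • X i u₀ else 0) =
            (if i = ⟨k, hk⟩ then v i • X i u₀ else 0) + if (i : ℕ) < k then v i • X i u₀ else 0 := by
          intro i
          rcases lt_trichotomy (i : ℕ) k with h | h | h
          · have : i ≠ ⟨k, hk⟩ := fun e => by rw [e] at h; exact absurd h (lt_irrefl _)
            simp [h, this, Nat.lt_succ_of_lt h]
          · have : i = ⟨k, hk⟩ := Fin.ext h
            subst this
            simp
          · have : i ≠ ⟨k, hk⟩ := fun e => by rw [e] at h; exact absurd h (lt_irrefl _)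
            simp [this, not_lt.2 h.le, show ¬ (i : ℕ) < k + 1 by omega]
        simp only [e10, Finset.sum_add_distrib, Finset.sum_ite_eq', Finset.mem_univ, if_true]
        rfl
  obtain ⟨hpd0, hpda, hpdd⟩ := hp d le_rfl
  have hinj0 : Function.Injective (fderiv ℝ (p d) 0) := by
    rw [injective_iff_map_eq_zero]
    intro v hv
    rw [hpdd] at hv
    simp only [Fin.is_lt, if_true] at hv
    ext i
    exact Fintype.linearIndependent_iff.1 hli (fun i => v i) hv i
  -- Composed with a left inverse of its differential, the chain becomes a local homeomorphism;
  -- hence it is an embedding near `0`.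
  obtain ⟨L₀, hL₀⟩ := LinearMap.exists_leftInverse_of_injective
    (fderiv ℝ (p d) 0 : EuclideanSpace ℝ (Fin d) →ₗ[ℝ] E) (LinearMap.ker_eq_bot.2 hinj0)
  let L : E →L[ℝ] EuclideanSpace ℝ (Fin d) := LinearMap.toContinuousLinearMap L₀
  have hL : ∀ v, L (fderiv ℝ (p d) 0 v) = v := fun v => congrArg (fun f => f v) hL₀
  have hLp : HasStrictFDerivAt (fun s => L (p d s))
      ((ContinuousLinearEquiv.refl ℝ (EuclideanSpace ℝ (Fin d)) : _ ≃L[ℝ] _) :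
        EuclideanSpace ℝ (Fin d) →L[ℝ] EuclideanSpace ℝ (Fin d)) 0 := by
    have h1 := L.hasStrictFDerivAt.comp (0 : EuclideanSpace ℝ (Fin d)) hpda.hasStrictFDerivAt
    refine h1.congr_fderiv ?_
    ext v : 1
    exact hL v
  let e := hLp.toOpenPartialHomeomorph
  have he0 : (0 : EuclideanSpace ℝ (Fin d)) ∈ e.source := hLp.mem_toOpenPartialHomeomorph_source
  have hinj : ∀ᶠ s in 𝓝 (0 : EuclideanSpace ℝ (Fin d)), Function.Injective (fderiv ℝ (p d) s) := by
    have h1 : ContinuousAt (fun s => L.comp (fderiv ℝ (p d) s)) 0 :=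
      continuousAt_const.clm_comp hpda.fderiv.continuousAt
    have h2 : ∀ᶠ s in 𝓝 (0 : EuclideanSpace ℝ (Fin d)), IsUnit (L.comp (fderiv ℝ (p d) s)) := by
      refine h1.eventually (Units.isOpen.mem_nhds ?_)
      have h3 : L.comp (fderiv ℝ (p d) 0) = 1 := by
        ext v : 1
        exact hL v
      show IsUnit (L.comp (fderiv ℝ (p d) 0))
      rw [h3]; exact isUnit_one
    filter_upwards [h2] with s ⟨U, hU⟩
    intro v w hvw
    have h4 : (U : EuclideanSpace ℝ (Fin d) →L[ℝ] EuclideanSpace ℝ (Fin d)) v = U.1 w := by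
      rw [hU]; exact congrArg L hvw
    have h5 := congrArg (U⁻¹ : (EuclideanSpace ℝ (Fin d) →L[ℝ] EuclideanSpace ℝ (Fin d))ˣ).1 h4
    have h6 : ∀ v, (U⁻¹ : (EuclideanSpace ℝ (Fin d) →L[ℝ] EuclideanSpace ℝ (Fin d))ˣ).1 (U.1 v) = v :=
      fun v => congrArg (fun f => f v) U.inv_mul
    rwa [h6, h6] at h5
  have hcurve : ∀ᶠ s in 𝓝 (0 : EuclideanSpace ℝ (Fin d)), ∀ l : Fin d, s l ∈ Ioo (-ε) ε ∧
      ∃ γ : ℝ → E, γ 0 = p l s ∧ γ (s l) = p (l + 1) s ∧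
        ∀ t ∈ uIcc 0 (s l), HasDerivAt γ (X l (γ t)) t ∧ γ t ∈ O := by
    refine eventually_all.2 fun l => ?_
    obtain ⟨h1, h2, -⟩ := hp l l.2.le
    have hO' : ∀ᶠ q in 𝓝 ((0 : ℝ), u₀), Φ l q ∈ O := by
      refine (hΦ l).continuousAt.eventually ?_
      rw [hΦ00]; exact hO
    have h3 := (hΦd l).and hO'
    rw [nhds_prod_eq] at h3
    obtain ⟨pt, hpt, px, hpx, hpp⟩ := eventually_prod_iff.1 h3
    obtain ⟨δ, hδ, hδt⟩ := Metric.eventually_nhds_iff_ball.1 hpt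
    have h4 : ∀ᶠ s in 𝓝 (0 : EuclideanSpace ℝ (Fin d)), |s l| < min δ ε := by
      have : ContinuousAt (fun s : EuclideanSpace ℝ (Fin d) => |s l|) 0 :=
        (π l).continuous.abs.continuousAt
      refine this.eventually_lt_const ?_
      simpa using lt_min hδ hε
    have h5 : ∀ᶠ s in 𝓝 (0 : EuclideanSpace ℝ (Fin d)), px (p l s) ∧ Φ l (0, p l s) = p l s := by
      have h6 : ∀ᶠ x in 𝓝 (p l 0), px x ∧ Φ l (0, x) = x := by
        rw [h1]; exact hpx.and (hΦ0 l)
      exact h2.continuousAt.eventually h6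
    filter_upwards [h4, h5] with s hs ⟨hs1, hs2⟩
    refine ⟨abs_lt.1 (hs.trans_le (min_le_right _ _)), fun t => Φ l (t, p l s), hs2,
      (hpS l l.2 s).symm, fun t ht => ?_⟩
    refine hpp (hδt t ?_) hs1
    rw [Metric.mem_ball, Real.dist_eq, sub_zero]
    refine lt_of_le_of_lt ?_ (hs.trans_le (min_le_left _ _))
    simpa using abs_sub_left_of_mem_uIcc ht
  have hOp : ∀ᶠ s in 𝓝 (0 : EuclideanSpace ℝ (Fin d)), p d s ∈ O := by
    refine hpda.continuousAt.eventually ?_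
    rw [hpd0]; exact hO
  obtain ⟨P, hP, hPo, h0P⟩ := eventually_nhds_iff.1 ((hpda.eventually_analyticAt).and
    (hinj.and (hcurve.and (hOp.and (e.open_source.mem_nhds he0)))))
  refine ⟨p, P, hPo, h0P, fun _ => rfl, hpd0, fun s hs => (hP s hs).1, fun s hs => (hP s hs).2.1,
    ?_, fun s hs => (hP s hs).2.2.2.1, fun s hs => (hP s hs).2.2.1⟩
  refine Topology.IsEmbedding.of_comp (g := L) ?_ L.continuous ?_
  · exact continuousOn_iff_continuous_domRestrict.1
      fun s hs => (hP s hs).1.continuousAt.continuousWithinAt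
  · have h1 := e.isOpenEmbedding_restrict.isEmbedding
    exact h1.comp (Topology.IsEmbedding.inclusion fun s hs => (hP s hs).2.2.2.2)

/-- The fields obtained from the frame `W` by the flow of `T`, when the brackets `ad_T^(n+1) W` are
combinations of the brackets of lower order. -/
theorem exists_transported_frame [FiniteDimensional ℝ E] {m n : ℕ} {T : E → E} {W : Fin m → E → E}
    {f : Fin m → Fin m → Fin (n + 1) → E → ℝ} {u₀ : E} (hT : AnalyticAt ℝ T u₀)
    (hW : ∀ α, AnalyticAt ℝ (W α) u₀) (hf : ∀ α β k, AnalyticAt ℝ (f α β k) u₀)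
    (hrel : ∀ᶠ x in 𝓝 u₀, ∀ α, adVec T (n + 1) (W α) x =
      ∑ β, ∑ k : Fin (n + 1), f α β k x • adVec T k (W β) x) :
    ∃ (Ψ : ℝ × E → E) (B : Fin m → ℝ → Fin m × Fin (n + 1) → E → ℝ) (Y : Fin m → ℝ → E → E),
      (∀ α s x, Y α s x = ∑ i, B α s i x • adVec T i.2 (W i.1) x) ∧
      AnalyticAt ℝ Ψ (0, u₀) ∧ Ψ (0, u₀) = u₀ ∧
      (∀ᶠ δ in 𝓝[>] (0 : ℝ), ∀ s ∈ Icc 0 δ, ∀ x ∈ Metric.ball u₀ δ,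
        AnalyticAt ℝ Ψ (s, x) ∧ Ψ (0, x) = x ∧ HasDerivAt (fun s => Ψ (s, x)) (-T (Ψ (s, x))) s ∧
        (fderiv ℝ (fun z => Ψ (s, z)) x).IsInvertible ∧ (∀ α i, AnalyticAt ℝ (B α s i) x) ∧
        ∀ α, fderiv ℝ (fun z => Ψ (s, z)) x (Y α s x) = W α (Ψ (s, x))) ∧
      ∀ S : Submodule ℝ E, Module.finrank ℝ S < Module.finrank ℝ (Submodule.span ℝ
          (range fun i : Fin m × Fin (n + 1) => adVec T i.2 (W i.1) u₀)) →
        ∀ δ > 0, ∃ τ ∈ Ioo 0 δ, ∃ α, Y α τ u₀ ∉ S := by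
  let ι := Fin m × Fin (n + 1)
  let G : ι → E → E := fun i => adVec T i.2 (W i.1)
  -- Companion form: below the top order a bracket with `T` moves to the next generator, and at the
  -- top order the given relation is used.
  let F : ι → ι → E → ℝ := fun i j => if (i.2 : ℕ) < n then
    (fun _ => if j.1 = i.1 ∧ (j.2 : ℕ) = i.2 + 1 then 1 else 0) else f i.1 j.1 j.2
  have hF : ∀ i j, AnalyticAt ℝ (F i j) u₀ := by
    intro i j
    by_cases h : (i.2 : ℕ) < n
    · simp only [F, if_pos h]; exact analyticAt_const
    · simp only [F, if_neg h]; exact hf _ _ _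
  have hsucc : ∀ (α : Fin m) (k : Fin (n + 1)) (h : (k : ℕ) < n) (c : ι → E) x,
      ∑ j, F (α, k) j x • c j = c (α, ⟨k + 1, by omega⟩) := by
    intro α k h c x
    rw [Finset.sum_eq_single (α, ⟨k + 1, by omega⟩)]
    · simp [F, h]
    · rintro ⟨β, l⟩ - hne
      have : ¬ (β = α ∧ (l : ℕ) = k + 1) := fun ⟨h1, h2⟩ => hne (Prod.ext h1 (Fin.ext h2))
      simp [F, h, this]
    · simp
  have hrel' : ∀ᶠ x in 𝓝 u₀, ∀ i, VectorField.lieBracket ℝ T (G i) x = ∑ j, F i j x • G j x := by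
    filter_upwards [hrel] with x hx
    rintro ⟨α, k⟩
    by_cases h : (k : ℕ) < n
    · rw [hsucc α k h (fun j => G j x)]
      rfl
    · have hk : (k : ℕ) = n := by omega
      have h1 := hx α
      rw [← Fintype.sum_prod_type' (f := fun β (k : Fin (n + 1)) =>
        f α β k x • adVec T k (W β) x)] at h1
      simp only [F, h, if_false]
      rw [← h1]
      show VectorField.lieBracket ℝ T (adVec T k (W α)) x = _
      rw [hk]
      rfl
  obtain ⟨Ψ, A, hΨ, hΨ0, hA, hA0, hev⟩ := exists_transport (G := G) hT
    (fun i => analyticAt_adVec hT (hW i.1) i.2) hF hrel'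
  refine ⟨Ψ, fun α s i x => A (s, x) (α, 0) i, fun α s x => ∑ i, A (s, x) (α, 0) i • G i x,
    fun _ _ _ => rfl, hΨ, hΨ0, ?_, ?_⟩
  · filter_upwards [hev] with δ hδ s hs x hx
    obtain ⟨h1, h2, h3, h4, -, h6, h7⟩ := hδ s hs x hx
    refine ⟨h1, h3, h4, h6, fun α i => ?_, fun α => h7 (α, 0)⟩
    have h8 : AnalyticAt ℝ (fun z => A (s, z)) x := h2.comp₂ analyticAt_const analyticAt_id
    exact ((ContinuousLinearMap.proj (R := ℝ) (φ := fun _ : ι => ℝ) i).comp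
      (ContinuousLinearMap.proj (R := ℝ) (φ := fun _ : ι => ι → ℝ) (α, 0))).analyticAt _ |>.comp h8
  · intro S hS δ' hδ'
    by_contra! hcon
    obtain ⟨δ, hδ, hδpos, hδδ'⟩ := (hev.and (Ioo_mem_nhdsGT hδ')).exists
    let c : ι → ℝ → E := fun i s => ∑ j, A (s, u₀) i j • G j u₀
    have hc : ∀ s ∈ Icc 0 δ, ∀ i, HasDerivAt (c i) (-∑ k, F i k (Ψ (s, u₀)) • c k s) s := by
      intro s hs i
      obtain ⟨-, -, -, -, h5, -, -⟩ := hδ s hs u₀ (Metric.mem_ball_self hδpos)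
      have h6 : ∀ j, HasDerivAt (fun s => A (s, u₀) i j)
          (-∑ k, F i k (Ψ (s, u₀)) * A (s, u₀) k j) s := fun j =>
        hasDerivAt_pi.1 (hasDerivAt_pi.1 h5 i) j
      refine (HasDerivAt.fun_sum (u := Finset.univ) fun j _ =>
        (h6 j).smul_const (G j u₀)).congr_deriv ?_
      simp only [c, neg_smul, Finset.sum_neg_distrib, Finset.sum_smul, Finset.smul_sum, smul_smul]
      rw [Finset.sum_comm]
    -- If the transported frame stayed in `S` for all small times, so would its time derivatives,
    -- which in companion form are, up to sign, the transports of the brackets of the next order. At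
    -- time zero this would place all the brackets themselves in `S`.
    have hmem : ∀ k (hk : k < n + 1) α, ∀ s ∈ Ioo 0 δ, c (α, ⟨k, hk⟩) s ∈ S := by
      intro k
      induction k with
      | zero => intro hk α s hs; exact hcon s ⟨hs.1, hs.2.trans hδδ'⟩ α
      | succ k ih =>
        intro hk α s hs
        have h1 := hc s (Ioo_subset_Icc_self hs) (α, ⟨k, by omega⟩)
        rw [hsucc α ⟨k, by omega⟩ (by simpa using hk) (fun j => c j s)] at h1
        have h2 := mem_of_hasDerivAt_of_mem S (c := c (α, ⟨k, by omega⟩)) (by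
          filter_upwards [Ioo_mem_nhds hs.1 hs.2] with t ht using ih (by omega) α t ht) h1
        exact S.neg_mem_iff.1 h2
    have hle : Submodule.span ℝ (range fun i : ι => G i u₀) ≤ S := by
      rw [Submodule.span_le]
      rintro _ ⟨i, rfl⟩
      have h1 : c i 0 = G i u₀ := by simp [c, hA0]
      have h2 : Tendsto (c i) (𝓝[>] 0) (𝓝 (c i 0)) :=
        ((hc 0 ⟨le_rfl, hδpos.le⟩ i).continuousAt.tendsto).mono_left nhdsWithin_le_nhds
      show G i u₀ ∈ S
      rw [← h1]
      refine S.closed_of_finiteDimensional.mem_of_tendsto h2 ?_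
      filter_upwards [Ioo_mem_nhdsGT hδpos] with s hs using hmem i.2 i.2.2 i.1 s hs
    exact absurd (Submodule.finrank_mono hle) (not_le.2 hS)

end Leaflet

set_option linter.unusedSectionVars false

/-! ### Germs of analytic fields and functions on manifolds, and their pull-backs. -/

section Germs

variable {N : ℕ} {M : Type*} [TopologicalSpace M] [ChartedSpace (EuclideanSpace ℝ (Fin N)) M]
  [IsManifold (𝓡 N) ω M]
  {M₁ : Type*} [TopologicalSpace M₁] [ChartedSpace (EuclideanSpace ℝ (Fin N)) M₁]
  [IsManifold (𝓡 N) ω M₁]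

/-- The field `X` is real analytic near `x`. -/
def VFAt (X : VF N M) (x : M) : Prop :=
  ContMDiffAt (𝓡 N) (𝓡 N).tangent ω (fun z => (⟨z, X z⟩ : TangentBundle (𝓡 N) M)) x

variable (N) in
/-- The function `f` is real analytic near `x`. -/
def FunAt (f : M → ℝ) (x : M) : Prop := ContMDiffAt (𝓡 N) 𝓘(ℝ, ℝ) ω f x

theorem IsAnalyticVF.vfAt {X : VF N M} {O : Set M} (h : IsAnalyticVF X O) (hO : IsOpen O) {x : M}
    (hx : x ∈ O) : VFAt X x :=
  ContMDiffOn.contMDiffAt h (hO.mem_nhds hx)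

theorem isAnalyticVF_of_vfAt {X : VF N M} {O : Set M} (h : ∀ x ∈ O, VFAt X x) :
    IsAnalyticVF X O :=
  fun x hx => (h x hx).contMDiffWithinAt

theorem IsAnalyticFun.funAt {f : M → ℝ} {O : Set M} (h : IsAnalyticFun (N := N) f O)
    (hO : IsOpen O) {x : M} (hx : x ∈ O) : FunAt N f x :=
  ContMDiffOn.contMDiffAt h (hO.mem_nhds hx)

theorem isAnalyticFun_of_funAt {f : M → ℝ} {O : Set M} (h : ∀ x ∈ O, FunAt N f x) :
    IsAnalyticFun (N := N) f O :=
  fun x hx => (h x hx).contMDiffWithinAt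

theorem VFAt.eventually {X : VF N M} {x : M} (h : VFAt X x) : ∀ᶠ z in 𝓝 x, VFAt X z :=
  (contMDiffAt_iff_contMDiffAt_nhds (by simp)).1 h

theorem FunAt.eventually {f : M → ℝ} {x : M} (h : FunAt N f x) : ∀ᶠ z in 𝓝 x, FunAt N f z :=
  (contMDiffAt_iff_contMDiffAt_nhds (by simp)).1 h

theorem VFAt.mdifferentiableAt {X : VF N M} {x : M} (h : VFAt X x) :
    MDifferentiableAt (𝓡 N) (𝓡 N).tangent (fun z => (⟨z, X z⟩ : TangentBundle (𝓡 N) M)) x :=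
  ContMDiffAt.mdifferentiableAt h (by simp)

theorem FunAt.mdifferentiableAt {f : M → ℝ} {x : M} (h : FunAt N f x) :
    MDifferentiableAt (𝓡 N) 𝓘(ℝ, ℝ) f x :=
  ContMDiffAt.mdifferentiableAt h (by simp)

theorem VFAt.congr {X Y : VF N M} {x : M} (h : VFAt X x) (hXY : Y =ᶠ[𝓝 x] X) : VFAt Y x := by
  refine ContMDiffAt.congr_of_eventuallyEq h ?_
  filter_upwards [hXY] with z hz
  rw [hz]

theorem VFAt.add {X Y : VF N M} {x : M} (hX : VFAt X x) (hY : VFAt Y x) : VFAt (X + Y) x :=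
  ContMDiffAt.add_section hX hY

theorem VFAt.smul {X : VF N M} {f : M → ℝ} {x : M} (hf : FunAt N f x) (hX : VFAt X x) :
    VFAt (f • X) x :=
  ContMDiffAt.smul_section hf hX

theorem vfAt_zero (x : M) : VFAt (0 : VF N M) x :=
  Bundle.contMDiffAt_zeroSection ℝ (fun x : M => TangentSpace (𝓡 N) x)

theorem VFAt.sum {ι : Type*} (s : Finset ι) {X : ι → VF N M} {x : M} (hX : ∀ i ∈ s, VFAt (X i) x) :
    VFAt (∑ i ∈ s, X i) x := by
  classical
  induction s using Finset.induction_on with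
  | empty => simpa using vfAt_zero x
  | insert i s hi ih =>
    rw [Finset.sum_insert hi]
    exact (hX i (Finset.mem_insert_self i s)).add
      (ih fun j hj => hX j (Finset.mem_insert_of_mem hj))

theorem VFAt.bracket {X Y : VF N M} {x : M} (hX : VFAt X x) (hY : VFAt Y x) :
    VFAt (bracket X Y) x := by
  have h := ContMDiffWithinAt.mlieBracketWithin_vectorField (n := ω) (m := ω) (s := univ)
    (contMDiffWithinAt_univ.2 hX) (contMDiffWithinAt_univ.2 hY) uniqueMDiffOn_univ (mem_univ x)
    (by simp)
  rw [contMDiffWithinAt_univ, VectorField.mlieBracketWithin_univ] at h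
  exact h

theorem VFAt.adIter {X Y : VF N M} {x : M} (hX : VFAt X x) (hY : VFAt Y x) (k : ℕ) :
    VFAt (adIter X k Y) x := by
  induction k with
  | zero => exact hY
  | succ k ih => exact hX.bracket ih

theorem bracket_congr {X X' Y Y' : VF N M} {x : M} (hX : X =ᶠ[𝓝 x] X') (hY : Y =ᶠ[𝓝 x] Y') :
    bracket X Y =ᶠ[𝓝 x] bracket X' Y' :=
  Filter.EventuallyEq.mlieBracket_vectorField hX hY

theorem adIter_congr {X X' Y Y' : VF N M} {x : M} (hX : X =ᶠ[𝓝 x] X') (hY : Y =ᶠ[𝓝 x] Y') (k : ℕ) :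
    adIter X k Y =ᶠ[𝓝 x] adIter X' k Y' := by
  induction k with
  | zero => exact hY
  | succ k ih => exact bracket_congr hX ih

/-- The sign is a constant coefficient function, so that closure under multiplication by analytic
functions applies to it directly. -/
theorem bracket_swap (X Y : VF N M) : bracket X Y = (fun _ : M => (-1 : ℝ)) • bracket Y X := by
  ext x
  rw [bracket, VectorField.mlieBracket_swap_apply]
  simp [bracket]

theorem bracket_add_right {X Y Z : VF N M} {x : M} (hY : VFAt Y x) (hZ : VFAt Z x) :
    bracket X (Y + Z) =ᶠ[𝓝 x] bracket X Y + bracket X Z := by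
  filter_upwards [hY.eventually, hZ.eventually] with z h h'
  exact VectorField.mlieBracket_add_right h.mdifferentiableAt h'.mdifferentiableAt

/-- The derivative of `f` along `X`. -/
noncomputable def dirDeriv (X : VF N M) (f : M → ℝ) : M → ℝ :=
  fun x => mvfderiv (𝓡 N) f x (X x)

theorem bracket_smul_right {X Y : VF N M} {f : M → ℝ} {x : M} (hf : FunAt N f x) (hY : VFAt Y x) :
    bracket X (f • Y) =ᶠ[𝓝 x] dirDeriv X f • Y + f • bracket X Y := by
  filter_upwards [hf.eventually, hY.eventually] with z h h'
  exact VectorField.mlieBracket_smul_right h.mdifferentiableAt h'.mdifferentiableAt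

theorem bracket_jacobi {X Y Z : VF N M} {x : M} (hX : VFAt X x) (hY : VFAt Y x) (hZ : VFAt Z x) :
    bracket (bracket X Y) Z =ᶠ[𝓝 x]
      bracket X (bracket Y Z) + (fun _ : M => (-1 : ℝ)) • bracket Y (bracket X Z) := by
  filter_upwards [hX.eventually, hY.eventually, hZ.eventually] with z h h' h''
  have := VectorField.leibniz_identity_mlieBracket_apply (ContMDiffAt.of_le h (by simp))
    (ContMDiffAt.of_le h' (by simp)) (ContMDiffAt.of_le h'' (by simp))
  show _ = VectorField.mlieBracket (𝓡 N) X (VectorField.mlieBracket (𝓡 N) Y Z) z +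
    (-1 : ℝ) • VectorField.mlieBracket (𝓡 N) Y (VectorField.mlieBracket (𝓡 N) X Z) z
  rw [this, neg_one_smul, add_neg_cancel_right]
  rfl

theorem bracket_eq_lieBracket (X Y : VF N (EuclideanSpace ℝ (Fin N))) :
    bracket X Y = VectorField.lieBracket ℝ X Y := by
  have h := VectorField.mlieBracketWithin_eq_lieBracketWithin (𝕜 := ℝ) (V := X) (W := Y)
    (s := univ)
  rw [VectorField.mlieBracketWithin_univ] at h
  exact h.trans VectorField.lieBracketWithin_univ

theorem adIter_eq_adVec (T X : VF N (EuclideanSpace ℝ (Fin N))) (k : ℕ) :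
    adIter T k X = adVec T k X := by
  induction k with
  | zero => rfl
  | succ k ih =>
    show bracket T _ = _
    rw [bracket_eq_lieBracket, ih]
    rfl

theorem vfAt_iff_analyticAt {X : EuclideanSpace ℝ (Fin N) → EuclideanSpace ℝ (Fin N)}
    {u : EuclideanSpace ℝ (Fin N)} :
    VFAt (N := N) (M := EuclideanSpace ℝ (Fin N)) X u ↔ AnalyticAt ℝ X u := by
  rw [← analyticWithinAt_univ, ← contDiffWithinAt_omega_iff_analyticWithinAt, contDiffWithinAt_univ]
  exact contMDiffAt_vectorSpace_iff_contDiffAt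

/-- `g` is real analytic near `x`, with invertible differential. -/
def LDAt (g : M₁ → M) (x : M₁) : Prop :=
  ∀ᶠ z in 𝓝 x, ContMDiffAt (𝓡 N) (𝓡 N) ω g z ∧ (mfderiv (𝓡 N) (𝓡 N) g z).IsInvertible

/-- The pull-back of a field. -/
noncomputable abbrev pull (g : M₁ → M) (X : VF N M) : VF N M₁ :=
  VectorField.mpullback (𝓡 N) (𝓡 N) g X

theorem LDAt.continuousAt {g : M₁ → M} {x : M₁} (hg : LDAt (N := N) g x) : ContinuousAt g x :=
  hg.self_of_nhds.1.continuousAt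

theorem VFAt.pull {g : M₁ → M} {x : M₁} {X : VF N M} (hg : LDAt (N := N) g x)
    (hX : VFAt X (g x)) : VFAt (pull g X) x :=
  ContMDiffAt.mpullback_vectorField_preimage (m := ω) (n := ω) hX hg.self_of_nhds.1
    hg.self_of_nhds.2 (by simp)

theorem FunAt.comp {g : M₁ → M} {x : M₁} {f : M → ℝ} (hg : LDAt (N := N) g x)
    (hf : FunAt N f (g x)) : FunAt N (f ∘ g) x :=
  ContMDiffAt.comp x hf hg.self_of_nhds.1

theorem pull_congr {g : M₁ → M} {x : M₁} {X Y : VF N M} (hg : LDAt (N := N) g x)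
    (h : X =ᶠ[𝓝 (g x)] Y) : pull g X =ᶠ[𝓝 x] pull g Y := by
  filter_upwards [hg.continuousAt.eventually h] with z hz
  show (mfderiv (𝓡 N) (𝓡 N) g z).inverse (X (g z)) = (mfderiv (𝓡 N) (𝓡 N) g z).inverse (Y (g z))
  rw [hz]

theorem pull_bracket {g : M₁ → M} {x : M₁} {X Y : VF N M} (hg : LDAt (N := N) g x)
    (hX : VFAt X (g x)) (hY : VFAt Y (g x)) :
    pull g (bracket X Y) =ᶠ[𝓝 x] bracket (pull g X) (pull g Y) := by
  filter_upwards [hg, hg.continuousAt.eventually hX.eventually,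
    hg.continuousAt.eventually hY.eventually] with z h h' h''
  exact VectorField.mpullback_mlieBracket h'.mdifferentiableAt h''.mdifferentiableAt h.1 (by simp)

theorem pull_adIter {g : M₁ → M} {x : M₁} {X Y : VF N M} (hg : LDAt (N := N) g x)
    (hX : VFAt X (g x)) (hY : VFAt Y (g x)) (k : ℕ) :
    pull g (adIter X k Y) =ᶠ[𝓝 x] adIter (pull g X) k (pull g Y) := by
  induction k with
  | zero => exact Filter.EventuallyEq.rfl
  | succ k ih =>
    exact (pull_bracket hg hX (hX.adIter hY k)).trans (bracket_congr Filter.EventuallyEq.rfl ih)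

theorem FunAt.dirDeriv {X : VF N M} {f : M → ℝ} {x : M} (hX : VFAt X x) (hf : FunAt N f x) :
    FunAt N (dirDeriv X f) x := by
  obtain ⟨O, hO, hfO⟩ := (contMDiffAt_iff_contMDiffOn_nhds (by simp)).1 hf
  obtain ⟨O', hO'O, hO', hx⟩ := mem_nhds_iff.1 hO
  have h1 := (hfO.mono hO'O).contMDiffOn_tangentMapWithin (m := ω) (by simp) hO'.uniqueMDiffOn
  have h2 : ContMDiffOn (𝓡 N) 𝓘(ℝ, ℝ).tangent ω
      (fun z => tangentMapWithin (𝓡 N) 𝓘(ℝ, ℝ) f O' (⟨z, X z⟩ : TangentBundle (𝓡 N) M))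
      (O' ∩ {z | VFAt X z}) :=
    h1.comp (fun z hz => hz.2.contMDiffWithinAt) (fun z hz => hz.1)
  have h3 := ((contMDiff_snd_tangentBundle_modelSpace (n := ω) ℝ 𝓘(ℝ, ℝ)).comp_contMDiffOn
    h2).contMDiffAt (Filter.inter_mem (hO'.mem_nhds hx) hX.eventually)
  refine h3.congr_of_eventuallyEq ?_
  filter_upwards [hO'.mem_nhds hx] with z hz
  simp only [RiggedControl.dirDeriv, Function.comp, tangentMapWithin, mvfderiv]
  rw [mfderivWithin_of_isOpen hO' hz]
  rfl

end Germs

set_option linter.unusedSectionVars false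

/-! ### Analytic combinations of fields near a point and their closure under brackets. -/

section GermSpans

variable {N : ℕ} {M : Type*} [TopologicalSpace M] [ChartedSpace (EuclideanSpace ℝ (Fin N)) M]
  [IsManifold (𝓡 N) ω M]

/-- The fields that are, near `x`, combinations with analytic coefficients of fields of `G`
defined near `x`. -/
inductive GermSpan (G : FieldFamily N M) (x : M) : VF N M → Prop
  | of {O : Set M} {X : VF N M} : IsOpen O → x ∈ O → X ∈ G O → GermSpan G x X
  | zero : GermSpan G x 0
  | add {X Y : VF N M} : GermSpan G x X → GermSpan G x Y → GermSpan G x (X + Y)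
  | smul {f : M → ℝ} {X : VF N M} : FunAt N f x → GermSpan G x X → GermSpan G x (f • X)
  | congr {X Y : VF N M} : GermSpan G x X → Y =ᶠ[𝓝 x] X → GermSpan G x Y

theorem funAt_const (c : ℝ) (x : M) : FunAt N (fun _ : M => c) x := contMDiffAt_const

theorem GermSpan.sum {G : FieldFamily N M} {x : M} {ι : Type*} (s : Finset ι) {X : ι → VF N M}
    (h : ∀ i ∈ s, GermSpan G x (X i)) : GermSpan G x (∑ i ∈ s, X i) := by
  classical
  induction s using Finset.induction_on with
  | empty => simpa using GermSpan.zero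
  | insert i s hi ih =>
    rw [Finset.sum_insert hi]
    exact (h i (Finset.mem_insert_self i s)).add
      (ih fun j hj => h j (Finset.mem_insert_of_mem hj))

theorem GermSpan.of_mem_analyticSpan {G : FieldFamily N M} {x : M} {O : Set M} {X : VF N M}
    (hX : X ∈ analyticSpan G O) (hx : x ∈ O) : GermSpan G x X := by
  obtain ⟨O', hO', hxO', -, n, f, Y, hf, hY, h⟩ := hX.2.2 x hx
  refine (GermSpan.sum Finset.univ (X := fun i => f i • Y i) fun i _ =>
    GermSpan.smul ((hf i).funAt hO' hxO') (.of hO' hxO' (hY i))).congr ?_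
  filter_upwards [hO'.mem_nhds hxO'] with z hz
  rw [h z hz, Finset.sum_apply]
  rfl

theorem GermSpan.trans {G H : FieldFamily N M} {x : M} {X : VF N M} (hX : GermSpan G x X)
    (h : ∀ O, IsOpen O → x ∈ O → ∀ Y ∈ G O, GermSpan H x Y) : GermSpan H x X := by
  induction hX with
  | of hO hx hX => exact h _ hO hx _ hX
  | zero => exact .zero
  | add _ _ h₁ h₂ => exact h₁.add h₂
  | smul hf _ h₁ => exact h₁.smul hf
  | congr _ he h₁ => exact h₁.congr he

theorem GermSpan.apply_mem {G : FieldFamily N M} {x : M} {X : VF N M} (hX : GermSpan G x X)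
    {S : Submodule ℝ (TangentSpace (𝓡 N) x)}
    (h : ∀ O, IsOpen O → x ∈ O → ∀ Y ∈ G O, Y x ∈ S) : X x ∈ S := by
  induction hX with
  | of hO hx hX => exact h _ hO hx _ hX
  | zero => exact S.zero_mem
  | add _ _ h₁ h₂ => exact S.add_mem h₁ h₂
  | smul hf _ h₁ => exact S.smul_mem _ h₁
  | congr _ he h₁ => rw [he.self_of_nhds]; exact h₁

/-- Families of analytic local fields that are stable under restriction. -/
structure IsPresheaf (G : FieldFamily N M) : Prop where
  analytic : ∀ O, IsOpen O → ∀ X ∈ G O, IsAnalyticVF X O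
  mono : ∀ O O', IsOpen O' → O' ⊆ O → G O ⊆ G O'

theorem IsPresheaf.vfAt {G : FieldFamily N M} (hG : IsPresheaf G) {O : Set M} (hO : IsOpen O)
    {x : M} (hx : x ∈ O) {X : VF N M} (hX : X ∈ G O) : VFAt X x :=
  (hG.analytic O hO X hX).vfAt hO hx

theorem GermSpan.vfAt {G : FieldFamily N M} (hG : IsPresheaf G) {x : M} {X : VF N M}
    (hX : GermSpan G x X) : VFAt X x := by
  induction hX with
  | of hO hx hX => exact hG.vfAt hO hx hX
  | zero => exact vfAt_zero x
  | add _ _ h₁ h₂ => exact h₁.add h₂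
  | smul hf _ h₁ => exact h₁.smul hf
  | congr _ he h₁ => exact h₁.congr he

theorem isPresheaf_analyticSpan {G : FieldFamily N M}
    (hG : ∀ O O', IsOpen O' → O' ⊆ O → G O ⊆ G O') : IsPresheaf (analyticSpan G) where
  analytic O _ X hX := hX.2.1
  mono O O' hO' h X hX := by
    refine ⟨hO', hX.2.1.mono h, fun x hx => ?_⟩
    obtain ⟨O₁, hO₁, hxO₁, -, n, f, Y, hf, hY, hX⟩ := hX.2.2 x (h hx)
    exact ⟨O₁ ∩ O', hO₁.inter hO', ⟨hxO₁, hx⟩, inter_subset_right, n, f, Y,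
      fun i => (hf i).mono inter_subset_left,
      fun i => hG _ _ (hO₁.inter hO') inter_subset_left (hY i), fun z hz => hX z hz.1⟩

theorem GermSpan.exists_sum {G : FieldFamily N M}
    (hG : ∀ O O', IsOpen O' → O' ⊆ O → G O ⊆ G O') {x : M} {X : VF N M} (hX : GermSpan G x X) :
    ∃ O : Set M, IsOpen O ∧ x ∈ O ∧ ∃ (n : ℕ) (f : Fin n → M → ℝ) (Y : Fin n → VF N M),
      (∀ i, IsAnalyticFun (N := N) (f i) O) ∧ (∀ i, Y i ∈ G O) ∧
      ∀ z ∈ O, X z = ∑ i, f i z • Y i z := by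
  induction hX with
  | @of O X hO hx hX =>
    exact ⟨O, hO, hx, 1, fun _ _ => 1, fun _ => X, fun _ => contMDiffOn_const, fun _ => hX,
      fun z _ => by simp⟩
  | zero => exact ⟨univ, isOpen_univ, mem_univ x, 0, Fin.elim0, Fin.elim0, fun i => i.elim0,
      fun i => i.elim0, fun z _ => by simp⟩
  | add _ _ h₁ h₂ =>
    obtain ⟨O₁, hO₁, hx₁, n₁, f₁, Y₁, hf₁, hY₁, h₁⟩ := h₁
    obtain ⟨O₂, hO₂, hx₂, n₂, f₂, Y₂, hf₂, hY₂, h₂⟩ := h₂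
    refine ⟨O₁ ∩ O₂, hO₁.inter hO₂, ⟨hx₁, hx₂⟩, n₁ + n₂, Fin.append f₁ f₂, Fin.append Y₁ Y₂,
      fun i => ?_, fun i => ?_, fun z hz => ?_⟩
    · refine Fin.addCases (fun i => ?_) (fun i => ?_) i
      · rw [Fin.append_left]; exact (hf₁ i).mono inter_subset_left
      · rw [Fin.append_right]; exact (hf₂ i).mono inter_subset_right
    · refine Fin.addCases (fun i => ?_) (fun i => ?_) i
      · rw [Fin.append_left]
        exact hG _ _ (hO₁.inter hO₂) inter_subset_left (hY₁ i)
      · rw [Fin.append_right]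
        exact hG _ _ (hO₁.inter hO₂) inter_subset_right (hY₂ i)
    · rw [Fin.sum_univ_add, Pi.add_apply, h₁ z hz.1, h₂ z hz.2]
      simp
  | @smul f X hf _ h₁ =>
    obtain ⟨O₁, hO₁, hx₁, n, g, Y, hg, hY, h₁⟩ := h₁
    obtain ⟨O₂, hO₂f, hO₂, hx₂⟩ := eventually_nhds_iff.1 hf.eventually
    refine ⟨O₁ ∩ O₂, hO₁.inter hO₂, ⟨hx₁, hx₂⟩, n, fun i => f • g i, Y, fun i => ?_, fun i => ?_,
      fun z hz => ?_⟩
    · exact ContMDiffOn.smul (fun z hz => (hO₂f z hz.2).contMDiffWithinAt)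
        ((hg i).mono inter_subset_left)
    · exact hG _ _ (hO₁.inter hO₂) inter_subset_left (hY i)
    · rw [Pi.smul_apply', h₁ z hz.1, Finset.smul_sum]
      simp [smul_smul]
  | congr _ he h₁ =>
    obtain ⟨O₁, hO₁, hx₁, n, g, Y, hg, hY, h₁⟩ := h₁
    obtain ⟨O₂, hO₂f, hO₂, hx₂⟩ := eventually_nhds_iff.1 he
    exact ⟨O₁ ∩ O₂, hO₁.inter hO₂, ⟨hx₁, hx₂⟩, n, g, Y, fun i => (hg i).mono inter_subset_left,
      fun i => hG _ _ (hO₁.inter hO₂) inter_subset_left (hY i),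
      fun z hz => by rw [hO₂f z hz.2, h₁ z hz.1]⟩

theorem GermSpan.exists_mem_analyticSpan {G : FieldFamily N M} (hG : IsPresheaf G) {x : M}
    {X : VF N M} (hX : GermSpan G x X) :
    ∃ O : Set M, IsOpen O ∧ x ∈ O ∧ X ∈ analyticSpan G O := by
  obtain ⟨O₁, hO₁, hx₁, n, f, Y, hf, hY, h₁⟩ := hX.exists_sum hG.mono
  obtain ⟨O₂, hO₂f, hO₂, hx₂⟩ := eventually_nhds_iff.1 (hX.vfAt hG).eventually
  refine ⟨O₁ ∩ O₂, hO₁.inter hO₂, ⟨hx₁, hx₂⟩, hO₁.inter hO₂,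
    isAnalyticVF_of_vfAt fun z hz => hO₂f z hz.2, fun z hz =>
    ⟨O₁ ∩ O₂, hO₁.inter hO₂, hz, Subset.rfl, n, f, Y, fun i => (hf i).mono inter_subset_left,
      fun i => hG.mono _ _ (hO₁.inter hO₂) inter_subset_left (hY i), fun z hz => h₁ z hz.1⟩⟩

theorem GermSpan.mem_fiber {G : FieldFamily N M} (hG : IsPresheaf G) {x : M}
    {X : VF N M} (hX : GermSpan G x X) : X x ∈ fiber (analyticSpan G) x := by
  obtain ⟨O, hO, hx, h⟩ := hX.exists_mem_analyticSpan hG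
  exact Submodule.subset_span ⟨O, hO, hx, X, h, rfl⟩

/-- By additivity and the Leibniz rule it suffices to bracket with generators; the derivative terms
are again combinations of generators. -/
theorem GermSpan.bracket_right {G : FieldFamily N M} (hG : IsPresheaf G) {x : M} {X Y : VF N M}
    (h : ∀ O, IsOpen O → x ∈ O → ∀ Y ∈ G O, GermSpan G x (bracket X Y))
    (hY : GermSpan G x Y) (hX : VFAt X x) : GermSpan G x (bracket X Y) := by
  induction hY with
  | of hO hx hX => exact h _ hO hx _ hX
  | zero =>
    refine GermSpan.zero.congr (Filter.Eventually.of_forall fun z => ?_)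
    rw [bracket, VectorField.mlieBracket_zero_right]
  | add h₁ h₂ ih₁ ih₂ => exact (ih₁.add ih₂).congr (bracket_add_right (h₁.vfAt hG) (h₂.vfAt hG))
  | smul hf h₁ ih =>
    exact ((h₁.smul (hf.dirDeriv hX)).add (ih.smul hf)).congr
      (bracket_smul_right hf (h₁.vfAt hG))
  | congr _ he h₁ => exact h₁.congr (bracket_congr Filter.EventuallyEq.rfl he)

theorem GermSpan.bracket_symm {G : FieldFamily N M} {x : M} {X Y : VF N M}
    (h : GermSpan G x (bracket X Y)) : GermSpan G x (bracket Y X) := by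
  rw [bracket_swap]
  exact h.smul (funAt_const _ x)

/-- The iterated brackets of fields of a family. -/
def iterBrackets (V : FieldFamily N M) : FieldFamily N M := fun O =>
  {X | ∃ l : List (VF N M), l ≠ [] ∧ (∀ Y ∈ l, Y ∈ V O) ∧ X = iterBracket l}

theorem iterBracket_cons {l : List (VF N M)} (hl : l ≠ []) (X : VF N M) :
    iterBracket (X :: l) = bracket X (iterBracket l) := by
  cases l with
  | nil => exact absurd rfl hl
  | cons Y l => rfl

theorem isPresheaf_iterBrackets {V : FieldFamily N M} (hV : IsPresheaf V) :
    IsPresheaf (iterBrackets V) where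
  analytic O hO X hX := by
    obtain ⟨l, hl, hlV, rfl⟩ := hX
    clear hl
    refine isAnalyticVF_of_vfAt fun x hx => ?_
    induction l with
    | nil => exact vfAt_zero x
    | cons Y l ih =>
      by_cases hl : l = []
      · subst hl
        exact hV.vfAt hO hx (hlV Y (by simp))
      · rw [iterBracket_cons hl]
        exact (hV.vfAt hO hx (hlV Y (by simp))).bracket
          (ih fun Z hZ => hlV Z (List.mem_cons_of_mem _ hZ))
  mono O O' hO' h X hX := by
    obtain ⟨l, hl, hlV, rfl⟩ := hX
    exact ⟨l, hl, fun Y hY => hV.mono O O' hO' h (hlV Y hY), rfl⟩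

theorem GermSpan.bracket_base {V : FieldFamily N M} (hV : IsPresheaf V) {x : M} {O : Set M}
    (hO : IsOpen O) (hx : x ∈ O) {X Y : VF N M} (hX : X ∈ V O)
    (hY : GermSpan (iterBrackets V) x Y) : GermSpan (iterBrackets V) x (bracket X Y) := by
  refine hY.bracket_right (isPresheaf_iterBrackets hV) (fun O' hO' hx' Y hY => ?_)
    (hV.vfAt hO hx hX)
  obtain ⟨l, hl, hlV, rfl⟩ := hY
  refine .of (hO.inter hO') ⟨hx, hx'⟩ ⟨X :: l, by simp, fun Z hZ => ?_, (iterBracket_cons hl X).symm⟩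
  rcases List.mem_cons.1 hZ with rfl | hZ
  · exact hV.mono _ _ (hO.inter hO') inter_subset_left hX
  · exact hV.mono _ _ (hO.inter hO') inter_subset_right (hlV Z hZ)

/-- Iterated brackets are nested to the right. The bracket of two of them is brought back to this
shape by the Jacobi identity, by induction on the length of the left one. -/
theorem GermSpan.bracket {V : FieldFamily N M} (hV : IsPresheaf V) {x : M} {X Y : VF N M}
    (hX : GermSpan (iterBrackets V) x X) (hY : GermSpan (iterBrackets V) x Y) :
    GermSpan (iterBrackets V) x (bracket X Y) := by
  have hI := isPresheaf_iterBrackets hV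
  refine (hX.bracket_right hI (fun O hO hx X hX => ?_) (hY.vfAt hI)).bracket_symm
  refine GermSpan.bracket_symm ?_
  obtain ⟨l, hl, hlV, rfl⟩ := hX
  induction l generalizing Y with
  | nil => exact absurd rfl hl
  | cons Z l ih =>
    by_cases hl' : l = []
    · subst hl'
      exact hY.bracket_base hV hO hx (hlV Z (by simp))
    · rw [iterBracket_cons hl']
      have hlV' : ∀ Y ∈ l, Y ∈ V O := fun Y hY => hlV Y (List.mem_cons_of_mem _ hY)
      have hZ := hlV Z (by simp)
      refine GermSpan.congr ?_ (bracket_jacobi (hV.vfAt hO hx hZ)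
        (hI.vfAt hO hx ⟨l, hl', hlV', rfl⟩) (hY.vfAt hI))
      exact ((ih hY hl' hlV').bracket_base hV hO hx hZ).add
        ((ih (hY.bracket_base hV hO hx hZ) hl' hlV').smul (funAt_const _ x))

theorem bracket_leibniz {X Y Z : VF N M} {x : M} (hX : VFAt X x) (hY : VFAt Y x) (hZ : VFAt Z x) :
    bracket X (bracket Y Z) =ᶠ[𝓝 x] bracket (bracket X Y) Z + bracket Y (bracket X Z) := by
  filter_upwards [bracket_jacobi hX hY hZ] with z h
  rw [Pi.add_apply, h]
  show _ = _ + (-1 : ℝ) • bracket Y (bracket X Z) z + bracket Y (bracket X Z) z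
  rw [neg_one_smul, neg_add_cancel_right]

/-- The generators of the secondary family. -/
def adFields (DI : Distr N M) (T : VF N M) (U : Set M) : FieldFamily N M := fun O =>
  {Y | O ⊆ U ∧ ∃ Z ∈ tangentFields DI O, ∃ k : ℕ, Y = adIter T k Z}

theorem isPresheaf_tangentFields (D : Distr N M) : IsPresheaf (tangentFields D) where
  analytic _ _ _ hX := hX.2.1
  mono _ _ hO' h _ hX := ⟨hO', hX.2.1.mono h, fun x hx => hX.2.2 x (h hx)⟩

theorem isPresheaf_adFields (DI : Distr N M) {T : VF N M} {U : Set M} (hT : ∀ x ∈ U, VFAt T x) :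
    IsPresheaf (adFields DI T U) where
  analytic O hO X hX := by
    obtain ⟨hOU, Z, hZ, k, rfl⟩ := hX
    exact isAnalyticVF_of_vfAt fun x hx => (hT x (hOU hx)).adIter (hZ.2.1.vfAt hO hx) k
  mono O O' hO' h X hX := by
    obtain ⟨hOU, Z, hZ, k, rfl⟩ := hX
    exact ⟨h.trans hOU, Z, (isPresheaf_tangentFields DI).mono O O' hO' h hZ, k, rfl⟩

theorem isPresheaf_secondary (DI : Distr N M) {T : VF N M} {U : Set M} (hT : ∀ x ∈ U, VFAt T x) :
    IsPresheaf (secondary DI T U) :=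
  isPresheaf_analyticSpan (isPresheaf_adFields DI hT).mono

theorem secondary_subset (DI : Distr N M) (T : VF N M) {U U' O : Set M} (h : U' ⊆ U) :
    secondary DI T U' O ⊆ secondary DI T U O := by
  intro X hX
  refine ⟨hX.1, hX.2.1, fun x hx => ?_⟩
  obtain ⟨O₁, hO₁, hxO₁, hO, n, f, Y, hf, hY, hX⟩ := hX.2.2 x hx
  exact ⟨O₁, hO₁, hxO₁, hO, n, f, Y, hf, fun i => ⟨(hY i).1.trans h, (hY i).2⟩, hX⟩

theorem analyticSpan_mono {G H : FieldFamily N M} (h : ∀ O, G O ⊆ H O) (O : Set M) :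
    analyticSpan G O ⊆ analyticSpan H O := by
  intro X hX
  refine ⟨hX.1, hX.2.1, fun x hx => ?_⟩
  obtain ⟨O₁, hO₁, hxO₁, hO, n, f, Y, hf, hY, hX⟩ := hX.2.2 x hx
  exact ⟨O₁, hO₁, hxO₁, hO, n, f, Y, hf, fun i => h _ (hY i), hX⟩

theorem lieClosure_mono {G H : FieldFamily N M} (h : ∀ O, G O ⊆ H O) (O : Set M) :
    lieClosure G O ⊆ lieClosure H O := by
  refine analyticSpan_mono (fun O => ?_) O
  rintro X ⟨l, hl, hlV, rfl⟩
  exact ⟨l, hl, fun Y hY => h O (hlV Y hY), rfl⟩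

theorem fiber_mono {G H : FieldFamily N M} (h : ∀ O, G O ⊆ H O) (x : M) :
    fiber G x ≤ fiber H x := by
  refine Submodule.span_mono ?_
  rintro v ⟨O, hO, hx, X, hX, rfl⟩
  exact ⟨O, hO, hx, X, h O hX, rfl⟩

theorem GermSpan.bracket_adFields {DI : Distr N M} {T : VF N M} {U : Set M}
    (hT : ∀ x ∈ U, VFAt T x) {x : M} (hx : x ∈ U) {X : VF N M}
    (hX : GermSpan (adFields DI T U) x X) : GermSpan (adFields DI T U) x (RiggedControl.bracket T X) := by
  refine hX.bracket_right (isPresheaf_adFields DI hT) (fun O hO hx Y hY => ?_) (hT x hx)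
  obtain ⟨hOU, Z, hZ, k, rfl⟩ := hY
  exact .of hO hx ⟨hOU, Z, hZ, k + 1, rfl⟩

/-- `[T, ·]` preserves the secondary family up to analytic combinations and is a derivation of the
bracket, so it preserves the bracket generated family although `T` does not belong to it. This
permits changing the lift. -/
theorem GermSpan.bracket_secondary {DI : Distr N M} {T : VF N M} {U : Set M}
    (hT : ∀ x ∈ U, VFAt T x) {x : M} (hx : x ∈ U) {X : VF N M}
    (hX : GermSpan (iterBrackets (secondary DI T U)) x X) :
    GermSpan (iterBrackets (secondary DI T U)) x (RiggedControl.bracket T X) := by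
  have hV := isPresheaf_secondary DI hT
  have hI := isPresheaf_iterBrackets hV
  have key : ∀ O, IsOpen O → x ∈ O → ∀ Y ∈ secondary DI T U O,
      GermSpan (iterBrackets (secondary DI T U)) x (RiggedControl.bracket T Y) := by
    intro O hO hxO Y hY
    obtain ⟨O', hO', hx', h⟩ := ((GermSpan.of_mem_analyticSpan hY hxO).bracket_adFields hT
      hx).exists_mem_analyticSpan (isPresheaf_adFields DI hT)
    exact .of hO' hx' ⟨[_], by simp, fun Z hZ => by rw [List.mem_singleton.1 hZ]; exact h, rfl⟩
  refine hX.bracket_right hI (fun O hO hxO Y hY => ?_) (hT x hx)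
  obtain ⟨l, hl, hlV, rfl⟩ := hY
  induction l with
  | nil => exact absurd rfl hl
  | cons Z l ih =>
    by_cases hl' : l = []
    · subst hl'
      exact key O hO hxO Z (hlV Z (by simp))
    · rw [iterBracket_cons hl']
      have hlV' : ∀ Y ∈ l, Y ∈ secondary DI T U O := fun Y hY => hlV Y (List.mem_cons_of_mem _ hY)
      have hZ := hlV Z (by simp)
      have hl : iterBracket l ∈ iterBrackets (secondary DI T U) O := ⟨l, hl', hlV', rfl⟩
      refine GermSpan.congr ?_ (bracket_leibniz (hT x hx) (hV.vfAt hO hxO hZ)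
        (hI.vfAt hO hxO hl))
      exact ((key O hO hxO Z hZ).bracket hV (.of hO hxO hl)).add
        ((ih hl' hlV').bracket_base hV hO hxO hZ)

theorem GermSpan.of_tangentFields {DI : Distr N M} {T : VF N M} {U : Set M} (hU : IsOpen U) {x : M}
    (hx : x ∈ U) {O : Set M} (hO : IsOpen O) (hxO : x ∈ O) {Z : VF N M}
    (hZ : Z ∈ tangentFields DI O) : GermSpan (iterBrackets (secondary DI T U)) x Z := by
  have hZ' := (isPresheaf_tangentFields DI).mono O (O ∩ U) (hO.inter hU) inter_subset_left hZ
  refine .of (hO.inter hU) ⟨hxO, hx⟩ ⟨[Z], by simp, fun Y hY => ?_, rfl⟩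
  rw [List.mem_singleton] at hY
  subst hY
  refine ⟨hO.inter hU, hZ'.2.1, fun z hz => ⟨O ∩ U, hO.inter hU, hz, Subset.rfl, 1, fun _ _ => 1,
    fun _ => Y, fun _ => contMDiffOn_const, fun _ => ⟨inter_subset_right, Y, hZ', 0, rfl⟩,
    fun z _ => by simp⟩⟩

/-- Induction on the fields of the bracket generated family of a secondary family. -/
theorem lieClosure_secondary_induction {DI : Distr N M} {T : VF N M} {U : Set M} {x : M}
    {Q : VF N M → Prop} (zero : Q 0) (add : ∀ X Y, Q X → Q Y → Q (X + Y))
    (smul : ∀ f X, FunAt N f x → Q X → Q (f • X))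
    (congr : ∀ X Y, Q X → Y =ᶠ[𝓝 x] X → Q Y) (brak : ∀ X Y, Q X → Q Y → Q (bracket X Y))
    (ad : ∀ X, Q X → Q (bracket T X))
    (tangent : ∀ O, IsOpen O → x ∈ O → ∀ Z ∈ tangentFields DI O, Q Z) {O : Set M} {X : VF N M}
    (hX : X ∈ lieClosure (secondary DI T U) O) (hx : x ∈ O) : Q X := by
  have span : ∀ {G : FieldFamily N M} {X}, GermSpan G x X →
      (∀ O, IsOpen O → x ∈ O → ∀ Y ∈ G O, Q Y) → Q X := by
    intro G X hX h
    induction hX with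
    | of hO hx hX => exact h _ hO hx _ hX
    | zero => exact zero
    | add _ _ h₁ h₂ => exact add _ _ h₁ h₂
    | smul hf _ h₁ => exact smul _ _ hf h₁
    | congr _ he h₁ => exact congr _ _ h₁ he
  have sec : ∀ O, IsOpen O → x ∈ O → ∀ Y ∈ secondary DI T U O, Q Y := by
    intro O hO hx Y hY
    refine span (GermSpan.of_mem_analyticSpan hY hx) fun O' hO' hx' Y' hY' => ?_
    obtain ⟨-, Z, hZ, k, rfl⟩ := hY'
    induction k with
    | zero => exact tangent O' hO' hx' Z hZ
    | succ k ih => exact ad _ ih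
  refine span (GermSpan.of_mem_analyticSpan hX hx) fun O hO hx Y hY => ?_
  obtain ⟨l, hl, hlV, rfl⟩ := hY
  induction l with
  | nil => exact absurd rfl hl
  | cons Z l ih =>
    have hZ := sec O hO hx Z (hlV Z (by simp))
    by_cases hl' : l = []
    · subst hl'
      exact hZ
    · rw [iterBracket_cons hl']
      exact brak _ _ hZ (ih hl' fun Y hY => hlV Y (List.mem_cons_of_mem _ hY))

end GermSpans

set_option linter.unusedSectionVars false

/-! ### Passing between fields on the manifold and their expressions in a chart. -/

section Charts

variable {N : ℕ} {M : Type*} [TopologicalSpace M] [ChartedSpace (EuclideanSpace ℝ (Fin N)) M]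
  [IsManifold (𝓡 N) ω M]
  {M₁ : Type*} [TopologicalSpace M₁] [ChartedSpace (EuclideanSpace ℝ (Fin N)) M₁]
  [IsManifold (𝓡 N) ω M₁]
  {M₂ : Type*} [TopologicalSpace M₂] [ChartedSpace (EuclideanSpace ℝ (Fin N)) M₂]
  [IsManifold (𝓡 N) ω M₂]

instance (x : M) : FiniteDimensional ℝ (TangentSpace (𝓡 N) x) :=
  inferInstanceAs (FiniteDimensional ℝ (EuclideanSpace ℝ (Fin N)))

theorem ldAt_extChartAt_symm (y : M) {u : EuclideanSpace ℝ (Fin N)}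
    (hu : u ∈ (extChartAt (𝓡 N) y).target) : LDAt (N := N) (extChartAt (𝓡 N) y).symm u := by
  filter_upwards [(isOpen_extChartAt_target (I := 𝓡 N) y).mem_nhds hu] with v hv
  refine ⟨(contMDiffOn_extChartAt_symm y).contMDiffAt
    ((isOpen_extChartAt_target (I := 𝓡 N) y).mem_nhds hv), ?_⟩
  have h := isInvertible_mfderivWithin_extChartAt_symm (I := 𝓡 N) hv
  rwa [ModelWithCorners.range_eq_univ, mfderivWithin_univ] at h

theorem ldAt_extChartAt (y : M) {x : M} (hx : x ∈ (extChartAt (𝓡 N) y).source) :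
    LDAt (N := N) (extChartAt (𝓡 N) y) x := by
  filter_upwards [(isOpen_extChartAt_source (I := 𝓡 N) y).mem_nhds hx] with z hz
  exact ⟨contMDiffAt_extChartAt' (by rwa [extChartAt_source] at hz),
    isInvertible_mfderiv_extChartAt hz⟩

theorem eventually_of_chart {y x : M} (hx : x ∈ (extChartAt (𝓡 N) y).source) {P : M → Prop}
    (h : ∀ᶠ u in 𝓝 (extChartAt (𝓡 N) y x), P ((extChartAt (𝓡 N) y).symm u)) :
    ∀ᶠ z in 𝓝 x, P z := by
  filter_upwards [(ldAt_extChartAt y hx).continuousAt.eventually h,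
    (isOpen_extChartAt_source (I := 𝓡 N) y).mem_nhds hx] with z hz hz'
  rwa [(extChartAt (𝓡 N) y).left_inv hz'] at hz

theorem eventually_chart {y x : M} (hx : x ∈ (extChartAt (𝓡 N) y).source) {P : M → Prop}
    (h : ∀ᶠ z in 𝓝 x, P z) :
    ∀ᶠ u in 𝓝 (extChartAt (𝓡 N) y x), P ((extChartAt (𝓡 N) y).symm u) := by
  have := (ldAt_extChartAt_symm y ((extChartAt (𝓡 N) y).map_source hx)).continuousAt
  rw [ContinuousAt, (extChartAt (𝓡 N) y).left_inv hx] at this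
  exact this.eventually h

theorem FunAt.of_chart {y x : M} (hx : x ∈ (extChartAt (𝓡 N) y).source)
    {f : EuclideanSpace ℝ (Fin N) → ℝ} (hf : AnalyticAt ℝ f (extChartAt (𝓡 N) y x)) :
    FunAt N (f ∘ extChartAt (𝓡 N) y) x := by
  refine FunAt.comp (ldAt_extChartAt y hx) ?_
  exact contMDiffAt_iff_contDiffAt.2 hf.contDiffAt

theorem pull_apply (g : M₁ → M) (X : VF N M) (u : M₁) :
    pull g X u = (mfderiv (𝓡 N) (𝓡 N) g u).inverse (X (g u)) := rfl

/-- The linear isomorphism between the values of a field and of its pull-back. -/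
noncomputable def pullEquiv {g : M₁ → M} {u : M₁}
    (h : (mfderiv (𝓡 N) (𝓡 N) g u).IsInvertible) :
    TangentSpace (𝓡 N) (g u) ≃ₗ[ℝ] TangentSpace (𝓡 N) u :=
  (h.choose.symm : TangentSpace (𝓡 N) (g u) ≃ₗ[ℝ] TangentSpace (𝓡 N) u)

theorem pullEquiv_apply {g : M₁ → M} {u : M₁}
    (h : (mfderiv (𝓡 N) (𝓡 N) g u).IsInvertible) (X : VF N M) :
    pullEquiv h (X (g u)) = pull g X u := by
  have := h.choose_spec
  rw [pull_apply]
  conv_rhs => rw [← this]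
  rw [ContinuousLinearMap.inverse_equiv]
  rfl

theorem mfderiv_pull {g : M₁ → M} {u : M₁}
    (h : (mfderiv (𝓡 N) (𝓡 N) g u).IsInvertible) (X : VF N M) :
    mfderiv (𝓡 N) (𝓡 N) g u (pull g X u) = X (g u) := by
  rw [pull_apply, ← ContinuousLinearMap.comp_apply, h.self_comp_inverse]
  rfl

theorem pull_eq_of_mfderiv {g : M₁ → M} {u : M₁}
    (h : (mfderiv (𝓡 N) (𝓡 N) g u).IsInvertible) {X : VF N M} {v : TangentSpace (𝓡 N) u}
    (hv : mfderiv (𝓡 N) (𝓡 N) g u v = X (g u)) : pull g X u = v := by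
  rw [pull_apply, ← hv, ← ContinuousLinearMap.comp_apply, h.inverse_comp_self]
  rfl

theorem pull_congr_fun {g g' : M₁ → M} {u : M₁} (h : g =ᶠ[𝓝 u] g') (X : VF N M) :
    pull g X u = pull g' X u := by
  have h1 : mfderiv (𝓡 N) (𝓡 N) g u = mfderiv (𝓡 N) (𝓡 N) g' u := h.mfderiv_eq
  -- Tangent spaces at equal points are distinct types, so the values are compared in the model
  -- space.
  have h2 : ∀ z z' : M, z = z' → (X z : EuclideanSpace ℝ (Fin N)) = X z' := by
    rintro z _ rfl
    rfl
  rw [pull_apply, pull_apply]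
  show (mfderiv (𝓡 N) (𝓡 N) g u).inverse (X (g u) : EuclideanSpace ℝ (Fin N)) = _
  rw [h2 _ _ h.self_of_nhds]
  exact congrArg (fun L : EuclideanSpace ℝ (Fin N) →L[ℝ] EuclideanSpace ℝ (Fin N) =>
    L.inverse (X (g' u))) h1

theorem pull_comp {g : M₁ → M} {f : M₂ → M₁} {u : M₂}
    (hg : MDifferentiableAt (𝓡 N) (𝓡 N) g (f u)) (hf : MDifferentiableAt (𝓡 N) (𝓡 N) f u)
    (hg' : (mfderiv (𝓡 N) (𝓡 N) g (f u)).IsInvertible)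
    (hf' : (mfderiv (𝓡 N) (𝓡 N) f u).IsInvertible) (X : VF N M) :
    pull (g ∘ f) X u = pull f (pull g X) u := by
  have h := mfderiv_comp u hg hf
  have hi : (mfderiv (𝓡 N) (𝓡 N) (g ∘ f) u).IsInvertible := by rw [h]; exact hg'.comp hf'
  refine pull_eq_of_mfderiv hi ?_
  rw [h, ContinuousLinearMap.comp_apply, mfderiv_pull hf', mfderiv_pull hg']
  rfl

theorem analyticAt_hat (y : M) {u : EuclideanSpace ℝ (Fin N)}
    (hu : u ∈ (extChartAt (𝓡 N) y).target) {X : VF N M} (hX : VFAt X ((extChartAt (𝓡 N) y).symm u)) :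
    AnalyticAt ℝ (pull (extChartAt (𝓡 N) y).symm X) u :=
  vfAt_iff_analyticAt.1 (hX.pull (ldAt_extChartAt_symm y hu))

theorem hat_adIter (y : M) {u : EuclideanSpace ℝ (Fin N)}
    (hu : u ∈ (extChartAt (𝓡 N) y).target) {T X : VF N M}
    (hT : VFAt T ((extChartAt (𝓡 N) y).symm u)) (hX : VFAt X ((extChartAt (𝓡 N) y).symm u)) (k : ℕ) :
    pull (extChartAt (𝓡 N) y).symm (adIter T k X) u =
      adVec (pull (extChartAt (𝓡 N) y).symm T) k (pull (extChartAt (𝓡 N) y).symm X) u := by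
  have := (pull_adIter (ldAt_extChartAt_symm y hu) hT hX k).self_of_nhds
  rw [adIter_eq_adVec] at this
  exact this

theorem pull_sum_smul {ι : Type*} [Fintype ι] (g : M₁ → M) (u : M₁) (c : ι → ℝ) (X : ι → VF N M) :
    pull g (fun x => ∑ i, c i • X i x) u = ∑ i, c i • pull g (X i) u := by
  rw [pull_apply, map_sum]
  simp only [map_smul, pull_apply]

theorem coframe_apply {ι F : Type*} [Fintype ι] [DecidableEq ι] [NormedAddCommGroup F]
    [NormedSpace ℝ F] {c : F →L[ℝ] (ι → ℝ)} {w : ι → F} (h : ∀ i, c (w i) = Pi.single i 1)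
    {a : ι → ℝ} {v : F} (hv : v = ∑ i, a i • w i) (i : ι) : c v i = a i := by
  rw [hv, map_sum]
  simp only [map_smul, h]
  simp [Pi.single_apply]

theorem linearIndependent_pull {ι : Type*} {g : M₁ → M} {u : M₁}
    (h : (mfderiv (𝓡 N) (𝓡 N) g u).IsInvertible) {X : ι → VF N M}
    (hX : LinearIndependent ℝ fun i => X i (g u)) : LinearIndependent ℝ fun i => pull g (X i) u := by
  have := hX.map' (pullEquiv h : _ →ₗ[ℝ] TangentSpace (𝓡 N) u) (pullEquiv h).ker
  convert! this using 2 with i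
  exact (pullEquiv_apply h (X i)).symm

theorem finrank_span_pull {ι : Type*} {g : M₁ → M} {u : M₁}
    (h : (mfderiv (𝓡 N) (𝓡 N) g u).IsInvertible) (X : ι → VF N M) :
    Module.finrank ℝ (Submodule.span ℝ (range fun i => pull g (X i) u)) =
      Module.finrank ℝ (Submodule.span ℝ (range fun i => X i (g u))) := by
  have : (fun i => pull g (X i) u) = pullEquiv h ∘ fun i => X i (g u) :=
    funext fun i => (pullEquiv_apply h (X i)).symm
  rw [← LinearEquiv.finrank_map_eq (pullEquiv h) (Submodule.span ℝ (range fun i => X i (g u))),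
    Submodule.map_span, ← range_comp, this]
  rfl

/-- Fields with values in the span of linearly independent analytic fields have analytic
coefficients. -/
theorem exists_coefficients {ι : Type*} [Fintype ι] [DecidableEq ι] {W : ι → VF N M} {x : M}
    (hW : ∀ i, VFAt (W i) x) (hli : LinearIndependent ℝ fun i => W i x) {Z : VF N M}
    (hZ : VFAt Z x) (h : ∀ᶠ z in 𝓝 x, Z z ∈ Submodule.span ℝ (range fun i => W i z)) :
    ∃ f : ι → M → ℝ, (∀ i, FunAt N (f i) x) ∧ ∀ᶠ z in 𝓝 x, Z z = ∑ i, f i z • W i z := by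
  have hx : x ∈ (extChartAt (𝓡 N) x).source := mem_extChartAt_source x
  have hu := (extChartAt (𝓡 N) x).map_source hx
  have hinv := (extChartAt (𝓡 N) x).left_inv hx
  have hld := ldAt_extChartAt_symm x hu
  let Wh : ι → EuclideanSpace ℝ (Fin N) → EuclideanSpace ℝ (Fin N) := fun i =>
    pull (extChartAt (𝓡 N) x).symm (W i)
  let Zh : EuclideanSpace ℝ (Fin N) → EuclideanSpace ℝ (Fin N) :=
    pull (extChartAt (𝓡 N) x).symm Z
  have hWa : ∀ i, AnalyticAt ℝ (Wh i) (extChartAt (𝓡 N) x x) := fun i =>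
    analyticAt_hat x hu (by rw [hinv]; exact hW i)
  have hZa : AnalyticAt ℝ Zh (extChartAt (𝓡 N) x x) :=
    analyticAt_hat x hu (by rw [hinv]; exact hZ)
  have hli' : LinearIndependent ℝ fun i => Wh i (extChartAt (𝓡 N) x x) :=
    linearIndependent_pull hld.self_of_nhds.2 (by rw [hinv]; exact hli)
  obtain ⟨c, hc, hcW⟩ := exists_analytic_coframe hWa hli'
  refine ⟨fun i => (fun u => c u (Zh u) i) ∘ extChartAt (𝓡 N) x,
    fun i => FunAt.of_chart hx ?_, ?_⟩
  · exact ((ContinuousLinearMap.proj (R := ℝ) (φ := fun _ : ι => ℝ) i).analyticAt _).comp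
      (analyticAt_clm_apply hc hZa)
  · refine eventually_of_chart (y := x) hx (P := fun z => Z z = ∑ i,
      ((fun u => c u (Zh u) i) ∘ extChartAt (𝓡 N) x) z • W i z) ?_
    filter_upwards [hcW, eventually_chart hx h, hld,
      (isOpen_extChartAt_target (I := 𝓡 N) x).mem_nhds hu] with u hcu hZu hldu hut
    obtain ⟨a, ha⟩ := (Submodule.mem_span_range_iff_exists_fun ℝ).1 hZu
    have hZp : Zh u = ∑ i, a i • Wh i u := by
      have h1 := pullEquiv_apply hldu.2 Z
      rw [← ha, map_sum] at h1
      simp only [map_smul, pullEquiv_apply] at h1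
      exact h1.symm
    rw [← ha]
    refine Finset.sum_congr rfl fun i _ => ?_
    rw [Function.comp_apply, (extChartAt (𝓡 N) x).right_inv hut,
      coframe_apply hcu hZp]

end Charts

set_option linter.unusedSectionVars false

/-! ### Adapted generators from a finite analytic relation. -/

section Adapted

variable {N : ℕ} {M : Type*} [TopologicalSpace M] [ChartedSpace (EuclideanSpace ℝ (Fin N)) M]
  [IsManifold (𝓡 N) ω M]

/-- The restrictions to the open subsets of `U` of the fields `gen i`. -/
def restrictions {ι : Type*} (gen : ι → VF N M) (U : Set M) : FieldFamily N M := fun O =>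
  {X | O ⊆ U ∧ ∃ i, X = gen i}

theorem isPresheaf_restrictions {ι : Type*} {gen : ι → VF N M} {U : Set M}
    (h : ∀ i, ∀ x ∈ U, VFAt (gen i) x) : IsPresheaf (restrictions gen U) where
  analytic O _ X hX := by
    obtain ⟨hO, i, rfl⟩ := hX
    exact isAnalyticVF_of_vfAt fun x hx => h i x (hO hx)
  mono O O' _ hO' X hX := by
    obtain ⟨hO, i, rfl⟩ := hX
    exact ⟨hO'.trans hO, i, rfl⟩

theorem GermSpan.sum_smul {G : FieldFamily N M} {x : M} {ι : Type*} [Fintype ι]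
    {f : ι → M → ℝ} {X : ι → VF N M} {Y : VF N M} (hf : ∀ i, FunAt N (f i) x)
    (hX : ∀ i, GermSpan G x (X i)) (hY : ∀ᶠ z in 𝓝 x, Y z = ∑ i, f i z • X i z) :
    GermSpan G x Y := by
  refine (GermSpan.sum Finset.univ (X := fun i => f i • X i) fun i _ =>
    (hX i).smul (hf i)).congr ?_
  filter_upwards [hY] with z hz
  rw [hz, Finset.sum_apply]
  rfl

theorem GermSpan.exists_restrictions {ι : Type*} [Fintype ι] [DecidableEq ι] {gen : ι → VF N M}
    {U : Set M} {x : M} {X : VF N M} (hX : GermSpan (restrictions gen U) x X) :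
    ∃ f : ι → M → ℝ, (∀ i, FunAt N (f i) x) ∧ ∀ᶠ z in 𝓝 x, X z = ∑ i, f i z • gen i z := by
  induction hX with
  | of hO hx hX =>
    obtain ⟨-, j, rfl⟩ := hX
    refine ⟨fun i _ => if i = j then 1 else 0, fun i => funAt_const _ _,
      Filter.Eventually.of_forall fun z => ?_⟩
    simp
  | zero =>
    refine ⟨fun i _ => 0, fun i => funAt_const _ _, Filter.Eventually.of_forall fun z => ?_⟩
    simp
  | add _ _ h₁ h₂ =>
    obtain ⟨f₁, hf₁, h₁⟩ := h₁
    obtain ⟨f₂, hf₂, h₂⟩ := h₂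
    refine ⟨fun i => f₁ i + f₂ i, fun i => ContMDiffAt.add (hf₁ i) (hf₂ i), ?_⟩
    filter_upwards [h₁, h₂] with z hz₁ hz₂
    simp only [Pi.add_apply, add_smul, Finset.sum_add_distrib]
    rw [hz₁, hz₂]
  | @smul f X hf _ h₁ =>
    obtain ⟨f₁, hf₁, h₁⟩ := h₁
    refine ⟨fun i => f • f₁ i, fun i => ContMDiffAt.smul hf (hf₁ i), ?_⟩
    filter_upwards [h₁] with z hz
    rw [Pi.smul_apply', hz, Finset.smul_sum]
    refine Finset.sum_congr rfl fun i _ => ?_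
    rw [Pi.smul_apply', smul_smul, smul_eq_mul]
  | congr _ he h₁ =>
    obtain ⟨f₁, hf₁, h₁⟩ := h₁
    refine ⟨f₁, hf₁, ?_⟩
    filter_upwards [he, h₁] with z hz hz'
    rw [hz, hz']

theorem GermSpan.of_frame {DI : Distr N M} {m : ℕ} {W : Fin m → VF N M} {x : M} {U : Set M}
    (hU : IsOpen U) (hx : x ∈ U) (hW : ∀ α, ∀ z ∈ U, VFAt (W α) z)
    (hframe : ∀ z ∈ U, LinearIndependent ℝ (fun α => W α z) ∧
      DI z = Submodule.span ℝ (range fun α => W α z)) {O : Set M} (hO : IsOpen O) (hxO : x ∈ O)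
    {Z : VF N M} (hZ : Z ∈ tangentFields DI O) :
    ∃ f : Fin m → M → ℝ, (∀ i, FunAt N (f i) x) ∧ ∀ᶠ z in 𝓝 x, Z z = ∑ i, f i z • W i z := by
  refine exists_coefficients (fun i => hW i x hx) (hframe x hx).1 (hZ.2.1.vfAt hO hxO) ?_
  filter_upwards [hU.mem_nhds hx, hO.mem_nhds hxO] with z hz hzO
  rw [← (hframe z hz).2]
  exact hZ.2.2 z hzO

/-- The relation makes the analytic span of the brackets of order at most `n` stable under `[T, ·]`.
It contains the frame, hence the whole secondary family. With all heights equal to `n`, the ordering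
condition on heights is automatic. -/
theorem isAdapted_of_relation {DI : Distr N M} {T : VF N M} {U : Set M} (hU : IsOpen U)
    (hT : ∀ x ∈ U, VFAt T x) {m : ℕ} {W : Fin m → VF N M} (hW : ∀ α, ∀ x ∈ U, VFAt (W α) x)
    (hframe : ∀ x ∈ U, LinearIndependent ℝ (fun α => W α x) ∧
      DI x = Submodule.span ℝ (range fun α => W α x))
    {n : ℕ} {f : Fin m → Fin m → Fin (n + 1) → M → ℝ}
    (hf : ∀ α β k, ∀ x ∈ U, FunAt N (f α β k) x)
    (hrel : ∀ x ∈ U, ∀ α, adIter T (n + 1) (W α) x =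
      ∑ β, ∑ k : Fin (n + 1), f α β k x • adIter T k (W β) x) :
    IsAdapted DI T U W (fun _ => n) ∧ ∀ x ∈ U, ∀ α k, adIter T k (W α) x ∈
      Submodule.span ℝ (range fun i : Fin m × Fin (n + 1) => adIter T i.2 (W i.1) x) := by
  set gen : Fin m × Fin (n + 1) → VF N M := fun i => adIter T i.2 (W i.1) with hgen
  have hgenA : ∀ i, ∀ x ∈ U, VFAt (gen i) x := fun i x hx => (hT x hx).adIter (hW _ x hx) _
  have hP := isPresheaf_restrictions hgenA
  have hof : ∀ x ∈ U, ∀ i, GermSpan (restrictions gen U) x (gen i) := fun x hx i =>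
    .of hU hx ⟨Subset.rfl, i, rfl⟩
  have hbr : ∀ x ∈ U, ∀ X, GermSpan (restrictions gen U) x X →
      GermSpan (restrictions gen U) x (bracket T X) := by
    intro x hx X hX
    refine hX.bracket_right hP (fun O hO hxO Y hY => ?_) (hT x hx)
    obtain ⟨hOU, ⟨α, k⟩, rfl⟩ := hY
    by_cases hk : (k : ℕ) + 1 < n + 1
    · exact hof x hx (α, ⟨k + 1, hk⟩)
    · have hk' : (k : ℕ) = n := by omega
      have : bracket T (gen (α, k)) = adIter T (n + 1) (W α) := by
        simp only [hgen, hk']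
        rfl
      rw [this]
      refine (GermSpan.sum Finset.univ (X := fun β => ∑ k : Fin (n + 1), f α β k • gen (β, k))
        fun β _ => GermSpan.sum Finset.univ fun k _ => (hof x hx (β, k)).smul
          (hf α β k x hx)).congr ?_
      filter_upwards [hU.mem_nhds hx] with z hz
      rw [hrel z hz, Finset.sum_apply]
      refine Finset.sum_congr rfl fun β _ => ?_
      rw [Finset.sum_apply]
      rfl
  have hWg : ∀ x ∈ U, ∀ α, GermSpan (restrictions gen U) x (W α) := fun x hx α =>
    hof x hx (α, 0)
  have had : ∀ x ∈ U, ∀ X k, GermSpan (restrictions gen U) x X →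
      GermSpan (restrictions gen U) x (adIter T k X) := by
    intro x hx X k hX
    induction k with
    | zero => exact hX
    | succ k ih => exact hbr x hx _ ih
  have hmem : ∀ x ∈ U, ∀ α k, adIter T k (W α) x ∈
      Submodule.span ℝ (range fun i : Fin m × Fin (n + 1) => adIter T i.2 (W i.1) x) := by
    intro x hx α k
    refine (had x hx _ k (hWg x hx α)).apply_mem fun O hO hxO Y hY => ?_
    obtain ⟨-, i, rfl⟩ := hY
    exact Submodule.subset_span ⟨i, rfl⟩
  refine ⟨⟨fun α => isAnalyticVF_of_vfAt (hW α), hframe, fun O X hX x hx => ?_,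
    fun α x hx => ?_⟩, hmem⟩
  · by_cases hxU : x ∈ U
    swap
    -- Generators are defined only on subsets of `U`, so near a point outside `U` the local sum is
    -- empty and the field is zero.
    · obtain ⟨O', hO', hxO', hO'O, l, g, Y, hg, hY, hXY⟩ := hX.2.2 x hx
      have hl : l = 0 := by
        by_contra hl
        exact hxU ((hY ⟨0, Nat.pos_of_ne_zero hl⟩).1 hxO')
      subst hl
      exact ⟨O', hO', hxO', hO'O, fun _ _ => 0, fun _ => contMDiffOn_const,
        fun z hz => by rw [hXY z hz]; simp⟩
    have hG : GermSpan (restrictions gen U) x X := by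
      refine (GermSpan.of_mem_analyticSpan hX hx).trans fun O hO hxO Y hY => ?_
      obtain ⟨hOU, Z, hZ, k, rfl⟩ := hY
      refine had x (hOU hxO) Z k ?_
      obtain ⟨g, hg, hZg⟩ := GermSpan.of_frame hU (hOU hxO) hW hframe hO hxO hZ
      exact GermSpan.sum_smul hg (hWg x (hOU hxO)) hZg
    obtain ⟨g, hg, hXg⟩ := hG.exists_restrictions
    obtain ⟨O₁, hO₁, hO₁o, hxO₁⟩ := eventually_nhds_iff.1
      ((Filter.eventually_all.2 fun i => (hg i).eventually).and hXg)
    refine ⟨O₁ ∩ O, hO₁o.inter hX.1, ⟨hxO₁, hx⟩, inter_subset_right,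
      fun i => g (i.1, i.2), fun i => isAnalyticFun_of_funAt fun z hz => (hO₁ z hz.1).1 _,
      fun z hz => ?_⟩
    rw [(hO₁ z hz.1).2, Fintype.sum_prod_type, Fintype.sum_sigma]
  · refine Submodule.span_mono ?_ (hmem x hx α (n + 1))
    rintro v ⟨i, rfl⟩
    exact ⟨i.1, le_rfl, i.2, Nat.lt_succ_iff.1 i.2.2, rfl⟩

end Adapted

set_option linter.unusedSectionVars false

/-! ### Flows and pushed-forward fields computed in a chart. -/

section Flows

variable {N : ℕ} {M : Type*} [TopologicalSpace M] [ChartedSpace (EuclideanSpace ℝ (Fin N)) M]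
  [IsManifold (𝓡 N) ω M]

theorem hasDerivWithinAt_of_hasFDerivWithinAt {F : Type*} [NormedAddCommGroup F] [NormedSpace ℝ F]
    {f : ℝ → F} {L : ℝ →L[ℝ] F} {v : F} {s : Set ℝ} {t : ℝ} (h : HasFDerivWithinAt f L s t)
    (hv : L 1 = v) : HasDerivWithinAt f v s t :=
  hv ▸ h.hasDerivWithinAt

theorem hasDerivAt_comp_neg {F : Type*} [NormedAddCommGroup F] [NormedSpace ℝ F]
    {f : ℝ → F} {v : F} {t : ℝ} (h : HasDerivAt f (-v) (-t)) :
    HasDerivAt (fun t => f (-t)) v t := by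
  have := h.scomp t (hasDerivAt_neg t)
  rwa [neg_one_smul, neg_neg] at this

theorem isMIntegralCurveOn_of_chart {y : M} {X : VF N M} {γ : ℝ → EuclideanSpace ℝ (Fin N)}
    {s : Set ℝ} (h : ∀ t ∈ s, γ t ∈ (extChartAt (𝓡 N) y).target ∧
      HasDerivAt γ (pull (extChartAt (𝓡 N) y).symm X (γ t)) t) :
    IsMIntegralCurveOn ((extChartAt (𝓡 N) y).symm ∘ γ) X s := by
  intro t ht
  obtain ⟨h1, h2⟩ := h t ht
  obtain ⟨h3, h4⟩ := (ldAt_extChartAt_symm y h1).self_of_nhds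
  have h5 := (h3.mdifferentiableAt (by simp)).hasMFDerivAt
  have h6 := h5.comp t h2.hasFDerivAt.hasMFDerivAt
  refine (h6.hasMFDerivWithinAt (s := s)).congr_mfderiv ?_
  ext
  show mfderiv (𝓡 N) (𝓡 N) (extChartAt (𝓡 N) y).symm (γ t)
    ((1 : ℝ) • pull (extChartAt (𝓡 N) y).symm X (γ t)) = (1 : ℝ) • X ((extChartAt (𝓡 N) y).symm (γ t))
  rw [one_smul, one_smul, mfderiv_pull h4]

theorem mfderiv_extChartAt_apply {y x : M} (hx : x ∈ (extChartAt (𝓡 N) y).source) (X : VF N M) :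
    mfderiv (𝓡 N) (𝓡 N) (extChartAt (𝓡 N) y) x (X x) =
      (pull (extChartAt (𝓡 N) y).symm X (extChartAt (𝓡 N) y x) : EuclideanSpace ℝ (Fin N)) := by
  obtain ⟨u, hu, rfl⟩ : ∃ u ∈ (extChartAt (𝓡 N) y).target, (extChartAt (𝓡 N) y).symm u = x :=
    ⟨_, (extChartAt (𝓡 N) y).map_source hx, (extChartAt (𝓡 N) y).left_inv hx⟩
  obtain ⟨h3, h4⟩ := (ldAt_extChartAt_symm y hu).self_of_nhds
  obtain ⟨h5, -⟩ := (ldAt_extChartAt y hx).self_of_nhds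
  have h6 := (h5.mdifferentiableAt (by simp)).hasMFDerivAt.comp u
    (h3.mdifferentiableAt (by simp)).hasMFDerivAt
  have h7 : HasMFDerivAt (𝓡 N) (𝓡 N) (extChartAt (𝓡 N) y ∘ (extChartAt (𝓡 N) y).symm) u
      (ContinuousLinearMap.id ℝ (TangentSpace (𝓡 N) u)) := by
    refine (hasMFDerivAt_id u).congr_of_eventuallyEq ?_
    filter_upwards [(isOpen_extChartAt_target (I := 𝓡 N) y).mem_nhds hu] with v hv
    exact (extChartAt (𝓡 N) y).right_inv hv
  have h8 := hasMFDerivAt_unique h6 h7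
  have h9 := congrArg (fun L : EuclideanSpace ℝ (Fin N) →L[ℝ] EuclideanSpace ℝ (Fin N) =>
    L (pull (extChartAt (𝓡 N) y).symm X u)) h8
  rw [(extChartAt (𝓡 N) y).right_inv hu]
  refine Eq.trans ?_ h9
  show _ = mfderiv (𝓡 N) (𝓡 N) (extChartAt (𝓡 N) y) ((extChartAt (𝓡 N) y).symm u)
    (mfderiv (𝓡 N) (𝓡 N) (extChartAt (𝓡 N) y).symm u (pull (extChartAt (𝓡 N) y).symm X u))
  rw [mfderiv_pull h4]
  rfl

theorem hasDerivWithinAt_chart {y : M} {X : VF N M} {γ : ℝ → M} {s : Set ℝ}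
    (h : IsMIntegralCurveOn γ X s) {t : ℝ} (ht : t ∈ s) (hγ : γ t ∈ (extChartAt (𝓡 N) y).source) :
    HasDerivWithinAt (extChartAt (𝓡 N) y ∘ γ)
      (pull (extChartAt (𝓡 N) y).symm X (extChartAt (𝓡 N) y (γ t))) s t := by
  obtain ⟨h5, -⟩ := (ldAt_extChartAt y hγ).self_of_nhds
  have h6 := (h5.mdifferentiableAt (by simp)).hasMFDerivAt.comp_hasMFDerivWithinAt t (h t ht)
  have h7 : HasFDerivWithinAt (extChartAt (𝓡 N) y ∘ γ)
      ((mfderiv (𝓡 N) (𝓡 N) (extChartAt (𝓡 N) y) (γ t) :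
        EuclideanSpace ℝ (Fin N) →L[ℝ] EuclideanSpace ℝ (Fin N)).comp
        ((1 : ℝ →L[ℝ] ℝ).smulRight (X (γ t) : EuclideanSpace ℝ (Fin N)))) s t :=
    h6.hasFDerivWithinAt
  refine hasDerivWithinAt_of_hasFDerivWithinAt (F := EuclideanSpace ℝ (Fin N)) h7 ?_
  show mfderiv (𝓡 N) (𝓡 N) (extChartAt (𝓡 N) y) (γ t) ((1 : ℝ) • X (γ t)) = _
  rw [one_smul]
  exact mfderiv_extChartAt_apply hγ X

/-- The domain of the chart at `y` that corresponds to the ball of radius `ρ`. -/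
def chartBall (N : ℕ) {M : Type*} [TopologicalSpace M] [ChartedSpace (EuclideanSpace ℝ (Fin N)) M]
    (y : M) (ρ : ℝ) : Set M :=
  (extChartAt (𝓡 N) y).source ∩
    extChartAt (𝓡 N) y ⁻¹' Metric.ball (extChartAt (𝓡 N) y y) ρ

theorem isOpen_chartBall (y : M) (ρ : ℝ) : IsOpen (chartBall N y ρ) :=
  isOpen_extChartAt_preimage' y Metric.isOpen_ball

theorem mem_chartBall (y : M) {ρ : ℝ} (hρ : 0 < ρ) : y ∈ chartBall N y ρ :=
  ⟨mem_extChartAt_source y, Metric.mem_ball_self hρ⟩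

/-- `flow` is a choice among the endpoints of integral curves. Inside a chart ball on which the
field is Lipschitz the endpoint is unique, so the choice is the chart trajectory. The curve `γ`
follows `-T` forwards, hence the time `-s`. -/
theorem flow_eq_of_chart {y : M} {T : VF N M} {ρ : ℝ} {K : NNReal}
    (hball : Metric.ball (extChartAt (𝓡 N) y y) ρ ⊆ (extChartAt (𝓡 N) y).target)
    (hLip : LipschitzOnWith K (pull (extChartAt (𝓡 N) y).symm T :
      EuclideanSpace ℝ (Fin N) → EuclideanSpace ℝ (Fin N)) (Metric.ball (extChartAt (𝓡 N) y y) ρ))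
    {s : ℝ} (hs : 0 < s) {x : M} (hx : x ∈ (extChartAt (𝓡 N) y).source)
    {γ : ℝ → EuclideanSpace ℝ (Fin N)} (hγ0 : γ 0 = extChartAt (𝓡 N) y x)
    (hγ : ∀ t ∈ Icc 0 s, γ t ∈ Metric.ball (extChartAt (𝓡 N) y y) ρ ∧
      HasDerivAt γ (-(pull (extChartAt (𝓡 N) y).symm T (γ t) : EuclideanSpace ℝ (Fin N))) t) :
    FlowTo T (chartBall N y ρ) (-s) x ((extChartAt (𝓡 N) y).symm (γ s)) ∧
      flow T (chartBall N y ρ) (-s) x = (extChartAt (𝓡 N) y).symm (γ s) := by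
  have huIcc : uIcc 0 (-s) = Icc (-s) 0 := uIcc_of_ge (by linarith)
  have hneg : ∀ t ∈ Icc (-s) 0, -t ∈ Icc 0 s := fun t ht => ⟨by linarith [ht.2], by linarith [ht.1]⟩
  have hder : ∀ t ∈ Icc (-s) 0, HasDerivAt (fun t => γ (-t))
      (pull (extChartAt (𝓡 N) y).symm T (γ (-t)) : EuclideanSpace ℝ (Fin N)) t := by
    intro t ht
    exact hasDerivAt_comp_neg (hγ (-t) (hneg t ht)).2
  have hmem : ∀ t ∈ Icc (-s) 0, (extChartAt (𝓡 N) y).symm (γ (-t)) ∈ chartBall N y ρ := by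
    intro t ht
    have h1 := (hγ _ (hneg t ht)).1
    refine ⟨(extChartAt (𝓡 N) y).map_target (hball h1), ?_⟩
    rw [mem_preimage, (extChartAt (𝓡 N) y).right_inv (hball h1)]
    exact h1
  have hF : FlowTo T (chartBall N y ρ) (-s) x ((extChartAt (𝓡 N) y).symm (γ s)) := by
    refine ⟨(extChartAt (𝓡 N) y).symm ∘ fun t => γ (-t), ?_, ?_, ?_, ?_⟩
    · show (extChartAt (𝓡 N) y).symm (γ (-0)) = x
      rw [neg_zero, hγ0, (extChartAt (𝓡 N) y).left_inv hx]
    · simp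
    · refine isMIntegralCurveOn_of_chart fun t ht => ?_
      rw [huIcc] at ht
      exact ⟨hball (hγ _ (hneg t ht)).1, hder t ht⟩
    · intro t ht
      rw [huIcc] at ht
      exact hmem t ht
  have huniq : ∀ z, FlowTo T (chartBall N y ρ) (-s) x z → z = (extChartAt (𝓡 N) y).symm (γ s) := by
    rintro z ⟨c, hc0, hcs, hc, hcU⟩
    rw [huIcc] at hc hcU
    have hd : ∀ t ∈ Icc (-s) 0, HasDerivWithinAt (extChartAt (𝓡 N) y ∘ c)
        (pull (extChartAt (𝓡 N) y).symm T (extChartAt (𝓡 N) y (c t))) (Icc (-s) 0) t := fun t ht =>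
      hasDerivWithinAt_chart hc ht (hcU t ht).1
    have := ODE_solution_unique_of_mem_Icc_left (a := -s) (b := 0) (K := K)
      (v := fun _ => (pull (extChartAt (𝓡 N) y).symm T :
        EuclideanSpace ℝ (Fin N) → EuclideanSpace ℝ (Fin N)))
      (s := fun _ => Metric.ball (extChartAt (𝓡 N) y y) ρ)
      (f := extChartAt (𝓡 N) y ∘ c) (g := fun t => γ (-t))
      (fun _ _ => hLip) (fun t ht => (hd t ht).continuousWithinAt)
      (fun t ht => (hd t ⟨ht.1.le, ht.2⟩).mono_of_mem_nhdsWithin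
        (Icc_mem_nhdsLE_of_mem ht))
      (fun t ht => (hcU t ⟨ht.1.le, ht.2⟩).2)
      (fun t ht => (hder t ht).continuousAt.continuousWithinAt)
      (fun t ht => (hder t ⟨ht.1.le, ht.2⟩).hasDerivWithinAt)
      (fun t ht => (hγ _ (hneg t ⟨ht.1.le, ht.2⟩)).1)
      (by simp [hc0, hγ0])
    have h1 := this (left_mem_Icc.2 (by linarith) : -s ∈ Icc (-s) 0)
    simp only [Function.comp_apply, neg_neg, hcs] at h1
    rw [← h1, (extChartAt (𝓡 N) y).left_inv]
    rw [← hcs]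
    exact (hcU (-s) (left_mem_Icc.2 (by linarith))).1
  refine ⟨hF, ?_⟩
  have hex : ∃ z, FlowTo T (chartBall N y ρ) (-s) x z := ⟨_, hF⟩
  rw [flow, dif_pos hex]
  exact huniq _ hex.choose_spec

/-- In the chart the flow for time `-s` is `ψ`, and the condition on `Y` says that `Y` is the
pull-back of `W` under `ψ`. Functoriality of pull-backs carries the expansion of `Y` to the
manifold. -/
theorem flowPush_eq_of_chart {y : M} {T W : VF N M} {U : Set M} {s : ℝ}
    {D : Set (EuclideanSpace ℝ (Fin N))} (hD : IsOpen D)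
    {ψ Y : EuclideanSpace ℝ (Fin N) → EuclideanSpace ℝ (Fin N)}
    (hψ : ∀ u ∈ D, ψ u ∈ (extChartAt (𝓡 N) y).target ∧
      flow T U (-s) ((extChartAt (𝓡 N) y).symm u) = (extChartAt (𝓡 N) y).symm (ψ u) ∧
      DifferentiableAt ℝ ψ u ∧ (fderiv ℝ ψ u).IsInvertible ∧
      fderiv ℝ ψ u (Y u) = pull (extChartAt (𝓡 N) y).symm W (ψ u))
    {ι : Type*} [Fintype ι] {b : ι → EuclideanSpace ℝ (Fin N) → ℝ} {G : ι → VF N M}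
    (hY : ∀ u ∈ D, Y u = ∑ i, b i u • (pull (extChartAt (𝓡 N) y).symm (G i) u :
      EuclideanSpace ℝ (Fin N)))
    {x : M} (hx : x ∈ (extChartAt (𝓡 N) y).source) (hxD : extChartAt (𝓡 N) y x ∈ D) :
    flowPush T U s W x = ∑ i, b i (extChartAt (𝓡 N) y x) • G i x := by
  obtain ⟨u, hu, rfl⟩ : ∃ u ∈ (extChartAt (𝓡 N) y).target, (extChartAt (𝓡 N) y).symm u = x :=
    ⟨_, (extChartAt (𝓡 N) y).map_source hx, (extChartAt (𝓡 N) y).left_inv hx⟩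
  rw [(extChartAt (𝓡 N) y).right_inv hu] at hxD ⊢
  obtain ⟨h1, h2, h3, h4, h5⟩ := hψ u hxD
  have hs := (ldAt_extChartAt_symm y hu).self_of_nhds
  have he := (ldAt_extChartAt y hx).self_of_nhds
  have hsψ := (ldAt_extChartAt_symm y h1).self_of_nhds
  have hψm : MDifferentiableAt (𝓡 N) (𝓡 N) ψ u := h3.mdifferentiableAt
  have hψi : (mfderiv (𝓡 N) (𝓡 N) ψ u).IsInvertible := by rw [mfderiv_eq_fderiv]; exact h4
  have hflow : flow T U (-s) ∘ (extChartAt (𝓡 N) y).symm =ᶠ[𝓝 u]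
      (extChartAt (𝓡 N) y).symm ∘ ψ := by
    filter_upwards [hD.mem_nhds hxD] with v hv
    exact (hψ v hv).2.1
  have hflow' : flow T U (-s) =ᶠ[𝓝 ((extChartAt (𝓡 N) y).symm u)]
      ((extChartAt (𝓡 N) y).symm ∘ ψ) ∘ extChartAt (𝓡 N) y := by
    have hc := he.1.continuousAt
    rw [ContinuousAt, (extChartAt (𝓡 N) y).right_inv hu] at hc
    filter_upwards [hc.eventually (hD.mem_nhds hxD),
      (isOpen_extChartAt_source (I := 𝓡 N) y).mem_nhds hx] with z hz hzs
    have := (hψ _ hz).2.1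
    rw [(extChartAt (𝓡 N) y).left_inv hzs] at this
    exact this
  have hcomp : MDifferentiableAt (𝓡 N) (𝓡 N) ((extChartAt (𝓡 N) y).symm ∘ ψ) u :=
    (hsψ.1.mdifferentiableAt (by simp)).comp u hψm
  have hcompi : (mfderiv (𝓡 N) (𝓡 N) ((extChartAt (𝓡 N) y).symm ∘ ψ) u).IsInvertible := by
    rw [mfderiv_comp u (hsψ.1.mdifferentiableAt (by simp)) hψm]
    exact hsψ.2.comp hψi
  have hru := (extChartAt (𝓡 N) y).right_inv hu
  have hcomp' : MDifferentiableAt (𝓡 N) (𝓡 N) ((extChartAt (𝓡 N) y).symm ∘ ψ)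
      (extChartAt (𝓡 N) y ((extChartAt (𝓡 N) y).symm u)) := by rw [hru]; exact hcomp
  have hcompi' : (mfderiv (𝓡 N) (𝓡 N) ((extChartAt (𝓡 N) y).symm ∘ ψ)
      (extChartAt (𝓡 N) y ((extChartAt (𝓡 N) y).symm u))).IsInvertible := by rw [hru]; exact hcompi
  have hfm : MDifferentiableAt (𝓡 N) (𝓡 N) (flow T U (-s)) ((extChartAt (𝓡 N) y).symm u) :=
    (hcomp'.comp _ (he.1.mdifferentiableAt (by simp))).congr_of_eventuallyEq hflow'
  have hfi : (mfderiv (𝓡 N) (𝓡 N) (flow T U (-s))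
      ((extChartAt (𝓡 N) y).symm u)).IsInvertible := by
    have h := hflow'.mfderiv_eq (I := 𝓡 N) (I' := 𝓡 N)
    rw [mfderiv_comp _ hcomp' (he.1.mdifferentiableAt (by simp))] at h
    have h' := hcompi'.comp he.2
    rw [← h] at h'
    exact h'
  have key : pull (extChartAt (𝓡 N) y).symm (flowPush T U s W) u =
      ∑ i, b i u • pull (extChartAt (𝓡 N) y).symm (G i) u := by
    rw [flowPush, ← pull_comp hfm (hs.1.mdifferentiableAt (by simp)) hfi hs.2,
      pull_congr_fun hflow, pull_comp (hsψ.1.mdifferentiableAt (by simp)) hψm hsψ.2 hψi]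
    refine (pull_eq_of_mfderiv hψi ?_).trans (hY u hxD)
    rw [mfderiv_eq_fderiv]
    exact h5
  have h6 := pull_sum_smul (extChartAt (𝓡 N) y).symm u (fun i => b i u) G
  rw [← key, ← pullEquiv_apply hs.2, ← pullEquiv_apply hs.2] at h6
  exact ((pullEquiv hs.2).injective h6).symm

end Flows

set_option linter.unusedSectionVars false

/-! ### Criterion for `T`-goodness by the rank of the iterated brackets. -/

section Leaflets

variable {N : ℕ} {M : Type*} [TopologicalSpace M] [ChartedSpace (EuclideanSpace ℝ (Fin N)) M]
  [IsManifold (𝓡 N) ω M]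

theorem isEmbedding_chart_symm_comp {y : M} {F : Type*} [TopologicalSpace F] {P : Set F}
    {q : F → EuclideanSpace ℝ (Fin N)} (hq : Topology.IsEmbedding (P.domRestrict q))
    (hqt : ∀ s ∈ P, q s ∈ (extChartAt (𝓡 N) y).target) :
    Topology.IsEmbedding (P.domRestrict ((extChartAt (𝓡 N) y).symm ∘ q)) := by
  have h1 := (chartAt (EuclideanSpace ℝ (Fin N)) y).symm.isOpenEmbedding_restrict.isEmbedding
  have hqt' : ∀ s ∈ P, q s ∈ (chartAt (EuclideanSpace ℝ (Fin N)) y).target := fun s hs => by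
    simpa using hqt s hs
  have h2 := hq.codRestrict (chartAt (EuclideanSpace ℝ (Fin N)) y).symm.source
    (fun s => hqt' s s.2)
  exact h1.comp h2

/-- With as many fields as dimensions, each parameter is the time of its own flow: `K = d`, `σ` and
`i` are identities, and `exists_flow_embedding` supplies the rest. -/
theorem exists_isDistrMap_of_chart {y : M} {V : FieldFamily N M} {d : ℕ}
    {D : Set (EuclideanSpace ℝ (Fin N))} (hD : D ∈ 𝓝 (extChartAt (𝓡 N) y y))
    (hDt : D ⊆ (extChartAt (𝓡 N) y).target)
    {Y : Fin d → EuclideanSpace ℝ (Fin N) → EuclideanSpace ℝ (Fin N)}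
    (hY : ∀ l, AnalyticAt ℝ (Y l) (extChartAt (𝓡 N) y y))
    (hli : LinearIndependent ℝ fun l => Y l (extChartAt (𝓡 N) y y)) {X : Fin d → VF N M}
    (hXY : ∀ l, ∀ u ∈ D, pull (extChartAt (𝓡 N) y).symm (X l) u = Y l u)
    (hV : ∀ l, X l ∈ V ((extChartAt (𝓡 N) y).source ∩ extChartAt (𝓡 N) y ⁻¹' D)) :
    ∃ (F : EuclideanSpace ℝ (Fin d) → M) (P : Set (EuclideanSpace ℝ (Fin d))),
      IsDistrMap V F P y
        (fun _ => (extChartAt (𝓡 N) y).source ∩ extChartAt (𝓡 N) y ⁻¹' D) X := by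
  obtain ⟨p, P, hP, h0P, hp0, hpd, hpA, hpi, hpe, hpD, hpγ⟩ :=
    exists_flow_embedding hY hli hD one_pos
  have hinv := (extChartAt (𝓡 N) y).left_inv (mem_extChartAt_source (I := 𝓡 N) y)
  have hld : ∀ s ∈ P, _ := fun s hs => (ldAt_extChartAt_symm y (hDt (hpD s hs))).self_of_nhds
  refine ⟨(extChartAt (𝓡 N) y).symm ∘ p d, P, hP, h0P, ?_, ?_,
    isEmbedding_chart_symm_comp hpe fun s hs => hDt (hpD s hs), ?_, le_rfl, hV, 1, one_pos,
    fun _ t => t, id, fun _ => contDiffOn_id, fun s hs => ⟨fun l => (hpγ s hs l).1, ?_⟩⟩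
  · intro s hs
    have h1 : ContMDiffAt (𝓡 d) (𝓡 N) ∞ (p d) s :=
      contMDiffAt_iff_contDiffAt.2 (hpA s hs).contDiffAt
    exact (((hld s hs).1.of_le (by simp)).comp s h1).contMDiffWithinAt
  · intro s hs
    have h1 : MDifferentiableAt (𝓡 d) (𝓡 N) (p d) s :=
      (hpA s hs).differentiableAt.mdifferentiableAt
    rw [mfderiv_comp s ((hld s hs).1.mdifferentiableAt (by simp)) h1, mfderiv_eq_fderiv]
    obtain ⟨L, hL⟩ := (hld s hs).2
    rw [← hL]
    exact L.injective.comp (hpi s hs)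
  · rw [Function.comp_apply, hpd, hinv]
  · refine ⟨fun l => (extChartAt (𝓡 N) y).symm (p l s), ?_, rfl, fun l => ?_⟩
    · show (extChartAt (𝓡 N) y).symm (p 0 s) = y
      rw [hp0, hinv]
    · obtain ⟨-, γ, hγ0, hγs, hγ⟩ := hpγ s hs l
      refine ⟨(extChartAt (𝓡 N) y).symm ∘ γ, ?_, ?_, ?_, ?_⟩
      · rw [Function.comp_apply, hγ0]
        rfl
      · show (extChartAt (𝓡 N) y).symm (γ (s l)) = _
        rw [hγs]
        rfl
      · refine isMIntegralCurveOn_of_chart fun t ht => ?_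
        obtain ⟨h1, h2⟩ := hγ t ht
        refine ⟨hDt h2, ?_⟩
        rw [hXY l _ h2]
        exact h1
      · intro t ht
        have h2 := (hγ t ht).2
        refine ⟨(extChartAt (𝓡 N) y).map_target (hDt h2), ?_⟩
        rw [mem_preimage, Function.comp_apply, (extChartAt (𝓡 N) y).right_inv (hDt h2)]
        exact h2

theorem exists_ball_chart {y : M} {S : Set M} (hS : S ∈ 𝓝 y)
    {g : EuclideanSpace ℝ (Fin N) → EuclideanSpace ℝ (Fin N)}
    (hg : AnalyticAt ℝ g (extChartAt (𝓡 N) y y)) :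
    ∃ ρ > 0, ∃ K, Metric.ball (extChartAt (𝓡 N) y y) ρ ⊆ (extChartAt (𝓡 N) y).target ∧
      LipschitzOnWith K g (Metric.ball (extChartAt (𝓡 N) y y) ρ) ∧ chartBall N y ρ ⊆ S := by
  have hys := mem_extChartAt_source (I := 𝓡 N) y
  obtain ⟨K, t, ht, hK⟩ := (hg.contDiffAt (n := 1)).exists_lipschitzOnWith
  obtain ⟨ρ, hρ, h⟩ := Metric.nhds_basis_ball.mem_iff.1 (Filter.inter_mem (Filter.inter_mem ht
    ((isOpen_extChartAt_target (I := 𝓡 N) y).mem_nhds ((extChartAt (𝓡 N) y).map_source hys)))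
    (eventually_chart hys (P := fun z => z ∈ S) hS))
  refine ⟨ρ, hρ, K, fun u hu => (h hu).1.2, hK.mono fun u hu => (h hu).1.1, fun z hz => ?_⟩
  have := (h hz.2).2
  rwa [mem_ofPred_eq, (extChartAt (𝓡 N) y).left_inv hz.1] at this

/-- If the iterated brackets with `T` of a frame of `DI` span at `y` a space of dimension at least
the one of the bracket generated distribution, then `y` is `T`-good. -/
theorem isTGood_of_finrank_le {DI : Distr N M} {m : ℕ} {T : VF N M} {U Ω : Set M} {y : M}
    (hΩ : IsOpen Ω) (hy : y ∈ Ω) (hΩU : Ω ⊆ U) (hT : ∀ x ∈ Ω, VFAt T x) {W : Fin m → VF N M}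
    (hW : ∀ α, ∀ x ∈ Ω, VFAt (W α) x)
    (hframe : ∀ x ∈ Ω, LinearIndependent ℝ (fun α => W α x) ∧
      DI x = Submodule.span ℝ (range fun α => W α x))
    (hrank : Module.finrank ℝ (fiber (lieClosure (secondary DI T Ω)) y) ≤ Module.finrank ℝ
      (Submodule.span ℝ (range fun i : Fin m × ℕ => adIter T i.2 (W i.1) y))) :
    IsTGood DI m T U y := by
  have hys := mem_extChartAt_source (I := 𝓡 N) y
  have hyt := (extChartAt (𝓡 N) y).map_source hys
  have hinv := (extChartAt (𝓡 N) y).left_inv hys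
  set u₀ : EuclideanSpace ℝ (Fin N) := extChartAt (𝓡 N) y y with hu₀
  let Th : EuclideanSpace ℝ (Fin N) → EuclideanSpace ℝ (Fin N) := pull (extChartAt (𝓡 N) y).symm T
  let Wh : Fin m → EuclideanSpace ℝ (Fin N) → EuclideanSpace ℝ (Fin N) := fun α =>
    pull (extChartAt (𝓡 N) y).symm (W α)
  have hTh : AnalyticAt ℝ Th u₀ := analyticAt_hat y hyt (by rw [hinv]; exact hT y hy)
  have hWh : ∀ α, AnalyticAt ℝ (Wh α) u₀ := fun α =>
    analyticAt_hat y hyt (by rw [hinv]; exact hW α y hy)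
  have hhat : ∀ u ∈ (extChartAt (𝓡 N) y).target, (extChartAt (𝓡 N) y).symm u ∈ Ω → ∀ α k,
      (pull (extChartAt (𝓡 N) y).symm (adIter T k (W α)) u : EuclideanSpace ℝ (Fin N)) =
        adVec Th k (Wh α) u := fun u hu huΩ α k => hat_adIter y hu (hT _ huΩ) (hW α _ huΩ) k
  obtain ⟨n, f, hf, hrel⟩ := exists_analytic_relation (G := fun α k => adVec Th k (Wh α)) (u := u₀)
    (fun α k => analyticAt_adVec hTh (hWh α) k)
  let fM : Fin m → Fin m → Fin (n + 1) → M → ℝ := fun α β k => f α β k ∘ extChartAt (𝓡 N) y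
  have hfM : ∀ᶠ z in 𝓝 y, ∀ α β k, FunAt N (fM α β k) z :=
    Filter.eventually_all.2 fun α => Filter.eventually_all.2 fun β => Filter.eventually_all.2
      fun k => (FunAt.of_chart hys (hf α β k)).eventually
  have hrelM : ∀ᶠ z in 𝓝 y, ∀ α, adIter T (n + 1) (W α) z =
      ∑ β, ∑ k : Fin (n + 1), fM α β k z • adIter T k (W β) z := by
    refine eventually_of_chart hys ?_
    filter_upwards [hrel, eventually_chart hys (hΩ.mem_nhds hy),
      (isOpen_extChartAt_target (I := 𝓡 N) y).mem_nhds hyt] with u hu huΩ hut α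
    have hs := (ldAt_extChartAt_symm y hut).self_of_nhds.2
    apply (pullEquiv hs).injective
    rw [pullEquiv_apply, map_sum]
    refine (hhat u hut huΩ α (n + 1)).trans ((hu α).trans (Finset.sum_congr rfl fun β _ => ?_))
    rw [map_sum]
    refine Finset.sum_congr rfl fun k _ => ?_
    rw [map_smul, pullEquiv_apply, ← hhat u hut huΩ β k]
    show f α β k u • _ = f α β k (extChartAt (𝓡 N) y ((extChartAt (𝓡 N) y).symm u)) • _
    rw [(extChartAt (𝓡 N) y).right_inv hut]
    rfl
  obtain ⟨ρ, hρ, K, hball, hLip, hsub⟩ := exists_ball_chart (S := Ω ∩ {z | _})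
    (Filter.inter_mem (hΩ.mem_nhds hy) (hfM.and hrelM)) hTh
  set U' := chartBall N y ρ with hU'
  have hU'o : IsOpen U' := isOpen_chartBall y ρ
  have hyU' : y ∈ U' := mem_chartBall y hρ
  have hU'Ω : U' ⊆ Ω := fun z hz => (hsub hz).1
  obtain ⟨hadapt, hmem⟩ := isAdapted_of_relation (DI := DI) (T := T) (W := W) hU'o
    (fun x hx => hT x (hU'Ω hx)) (fun α x hx => hW α x (hU'Ω hx))
    (fun x hx => hframe x (hU'Ω hx)) (f := fM) (fun α β k x hx => (hsub hx).2.1 α β k)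
    (fun x hx => (hsub hx).2.2)
  refine ⟨U', hU'o, hyU', hU'Ω.trans hΩU, W, fun _ => n, hadapt, fun T₀ hT₀ => ?_⟩
  set d := Module.finrank ℝ (fiber (lieClosure (secondary DI T U')) y) with hd
  have hdle : d ≤ Module.finrank ℝ (Submodule.span ℝ
      (range fun i : Fin m × Fin (n + 1) => adVec Th i.2 (Wh i.1) u₀)) := by
    -- The surrogate leaflet must have the dimension computed on the small neighbourhood `U'`;
    -- restricting the secondary family can only make its bracket generated space smaller.
    have h1 : d ≤ Module.finrank ℝ (fiber (lieClosure (secondary DI T Ω)) y) :=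
      Submodule.finrank_mono (fiber_mono (lieClosure_mono fun O => secondary_subset DI T hU'Ω) y)
    have h2 : Module.finrank ℝ
        (Submodule.span ℝ (range fun i : Fin m × ℕ => adIter T i.2 (W i.1) y)) ≤
        Module.finrank ℝ (Submodule.span ℝ
          (range fun i : Fin m × Fin (n + 1) => adIter T i.2 (W i.1) y)) := by
      refine Submodule.finrank_mono (Submodule.span_le.2 ?_)
      rintro _ ⟨i, rfl⟩
      exact hmem y hyU' i.1 i.2
    have h3 := finrank_span_pull (ldAt_extChartAt_symm y hyt).self_of_nhds.2
      (fun i : Fin m × Fin (n + 1) => adIter T i.2 (W i.1))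
    have h4 : (fun i : Fin m × Fin (n + 1) => adVec Th i.2 (Wh i.1) u₀) = fun i =>
        (pull (extChartAt (𝓡 N) y).symm (adIter T i.2 (W i.1)) u₀ : EuclideanSpace ℝ (Fin N)) :=
      funext fun i => (hhat u₀ hyt (by rw [hinv]; exact hy) i.1 i.2).symm
    rw [h4]
    rw [hinv] at h3
    exact (h1.trans (hrank.trans h2)).trans h3.symm.le
  obtain ⟨Ψ, B, Y, hYB, hΨA, hΨ0, hδ, hYS⟩ := exists_transported_frame hTh hWh hf hrel
  have hcont : ∀ᶠ δ in 𝓝[>] (0 : ℝ), ∀ s ∈ Icc 0 δ, ∀ x ∈ Metric.ball u₀ δ,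
      Ψ (s, x) ∈ Metric.ball u₀ ρ := by
    obtain ⟨η, hη, h⟩ := Metric.continuousAt_iff.1 hΨA.continuousAt ρ hρ
    filter_upwards [Ioo_mem_nhdsGT hη] with δ hδ s hs x hx
    have := @h (s, x) (by
      rw [Prod.dist_eq, max_lt_iff, Real.dist_eq, sub_zero, abs_of_nonneg hs.1]
      exact ⟨hs.2.trans_lt hδ.2, (Metric.mem_ball.1 hx).trans hδ.2⟩)
    rw [hΨ0] at this
    exact this
  obtain ⟨δ, ⟨hδP, hδc⟩, hδ0, hδρ⟩ := ((hδ.and hcont).and (Ioo_mem_nhdsGT hρ)).exists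
  have hDρ : Metric.ball u₀ δ ⊆ Metric.ball u₀ ρ := Metric.ball_subset_ball hδρ.le
  have hDt := hDρ.trans hball
  -- The bound `min T₀ δ` makes the depths small enough both for the prescribed `T₀` and for the
  -- transport to be defined.
  obtain ⟨τ, α, hτ, hτ0, hli⟩ := exists_strictAnti_linearIndependent
    (c := fun α τ => Y α τ u₀) (fun S _ hS => hYS S hS) (lt_min hT₀ hδ0) d hdle
  have hτδ : ∀ l, τ l ∈ Icc 0 δ := fun l =>
    ⟨(hτ0 l).1.le, ((hτ0 l).2.trans_le (min_le_right _ _)).le⟩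
  have hflow : ∀ l, ∀ x ∈ (extChartAt (𝓡 N) y).source, extChartAt (𝓡 N) y x ∈ Metric.ball u₀ δ →
      FlowTo T U' (-τ l) x ((extChartAt (𝓡 N) y).symm (Ψ (τ l, extChartAt (𝓡 N) y x))) ∧
      flow T U' (-τ l) x = (extChartAt (𝓡 N) y).symm (Ψ (τ l, extChartAt (𝓡 N) y x)) := by
    intro l x hx hxD
    refine flow_eq_of_chart hball hLip (hτ0 l).1 hx
      (γ := fun s => Ψ (s, extChartAt (𝓡 N) y x)) (hδP 0 ⟨le_rfl, hδ0.le⟩ _ hxD).2.1 ?_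
    intro t ht
    have ht' : t ∈ Icc 0 δ := ⟨ht.1, ht.2.trans (hτδ l).2⟩
    exact ⟨hδc t ht' _ hxD, (hδP t ht' _ hxD).2.2.1⟩
  set O : Set M := (extChartAt (𝓡 N) y).source ∩ extChartAt (𝓡 N) y ⁻¹' Metric.ball u₀ δ with hO
  have hOo : IsOpen O := isOpen_extChartAt_preimage' y Metric.isOpen_ball
  have hOU' : O ⊆ U' := fun z hz => ⟨hz.1, hDρ hz.2⟩
  -- The coefficients `λ` are unit vectors: each field is the push-forward of a single member of the
  -- frame.
  let X : Fin d → VF N M := fun l x =>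
    ∑ β, (Pi.single (α l) 1 : Fin m → ℝ) β • flowPush T U' (τ l) (W β) x
  have hX : ∀ l, ∀ x ∈ O, X l x =
      ∑ i, B (α l) (τ l) i (extChartAt (𝓡 N) y x) • adIter T i.2 (W i.1) x := by
    intro l x hx
    have h1 : X l x = flowPush T U' (τ l) (W (α l)) x := by
      show ∑ β, _ = _
      rw [Finset.sum_eq_single (α l)]
      · rw [Pi.single_eq_same, one_smul]
      · intro β _ hβ
        rw [Pi.single_eq_of_ne hβ, zero_smul]
      · simp
    rw [h1]
    refine flowPush_eq_of_chart (D := Metric.ball u₀ δ) Metric.isOpen_ball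
      (ψ := fun u => Ψ (τ l, u)) (Y := Y (α l) (τ l)) ?_ ?_ hx.1 hx.2
    · intro u hu
      have hut := hDt hu
      obtain ⟨h1, h2, h3, h4, h5, h6⟩ := hδP (τ l) (hτδ l) u hu
      refine ⟨hball (hδc _ (hτδ l) u hu), ?_, ?_, h4, h6 (α l)⟩
      · have h7 := (hflow l ((extChartAt (𝓡 N) y).symm u) ((extChartAt (𝓡 N) y).map_target hut)
          (by rw [(extChartAt (𝓡 N) y).right_inv hut]; exact hu)).2
        rwa [(extChartAt (𝓡 N) y).right_inv hut] at h7
      · exact h1.differentiableAt.comp u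
          ((differentiableAt_const (τ l)).prodMk differentiableAt_id)
    · intro u hu
      rw [hYB]
      refine Finset.sum_congr rfl fun i _ => ?_
      rw [hhat u (hDt hu) (hU'Ω (hOU' ⟨(extChartAt (𝓡 N) y).map_target (hDt hu), by
        rw [mem_preimage, (extChartAt (𝓡 N) y).right_inv (hDt hu)]; exact hu⟩))]
      rfl
  have hBA : ∀ l i, ∀ x ∈ O, FunAt N (B (α l) (τ l) i ∘ extChartAt (𝓡 N) y) x := fun l i x hx =>
    FunAt.of_chart hx.1 ((hδP (τ l) (hτδ l) _ hx.2).2.2.2.2.1 (α l) i)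
  have hXV : ∀ l, X l ∈ secondary DI T U' O := by
    intro l
    let eq := (Fintype.equivFin (Fin m × Fin (n + 1))).symm
    have hgen : ∀ i : Fin m × Fin (n + 1), ∀ x ∈ O, VFAt (adIter T i.2 (W i.1)) x := fun i x hx =>
      (hT x (hU'Ω (hOU' hx))).adIter (hW _ x (hU'Ω (hOU' hx))) _
    refine ⟨hOo, isAnalyticVF_of_vfAt fun x hx => ?_, fun x hx => ⟨O, hOo, hx, Subset.rfl, _,
      fun j => B (α l) (τ l) (eq j) ∘ extChartAt (𝓡 N) y,
      fun j => adIter T (eq j).2 (W (eq j).1),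
      fun j => isAnalyticFun_of_funAt (hBA l (eq j)), fun j => ⟨hOU', W (eq j).1,
        ⟨hOo, isAnalyticVF_of_vfAt fun z hz => hW _ z (hU'Ω (hOU' hz)), fun z hz => ?_⟩, _, rfl⟩,
      fun z hz => ?_⟩⟩
    · refine (VFAt.sum Finset.univ (X := fun i => (B (α l) (τ l) i ∘ extChartAt (𝓡 N) y) •
        adIter T i.2 (W i.1)) fun i _ => VFAt.smul (hBA l i x hx) (hgen i x hx)).congr ?_
      filter_upwards [hOo.mem_nhds hx] with z hz
      rw [hX l z hz, Finset.sum_apply]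
      rfl
    · rw [(hframe z (hU'Ω (hOU' hz))).2]
      exact Submodule.subset_span ⟨_, rfl⟩
    · rw [hX l z hz]
      exact (Equiv.sum_comp eq (fun i => B (α l) (τ l) i (extChartAt (𝓡 N) y z) •
        adIter T i.2 (W i.1) z)).symm
  have hYA : ∀ l, AnalyticAt ℝ (Y (α l) (τ l)) u₀ := by
    intro l
    have h1 := (hδP (τ l) (hτδ l) u₀ (Metric.mem_ball_self hδ0)).2.2.2.2.1 (α l)
    have h2 : Y (α l) (τ l) = fun x => ∑ i : Fin m × Fin (n + 1),
        B (α l) (τ l) i x • adVec Th i.2 (Wh i.1) x := funext fun x => hYB _ _ x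
    rw [h2]
    exact Finset.analyticAt_fun_sum _ fun i _ => (h1 i).smul (analyticAt_adVec hTh (hWh _) _)
  have hXY : ∀ l, ∀ u ∈ Metric.ball u₀ δ,
      pull (extChartAt (𝓡 N) y).symm (X l) u = Y (α l) (τ l) u := by
    intro l u hu
    have hut := hDt hu
    have hs := (ldAt_extChartAt_symm y hut).self_of_nhds.2
    have huO : (extChartAt (𝓡 N) y).symm u ∈ O := ⟨(extChartAt (𝓡 N) y).map_target hut, by
        rw [mem_preimage, (extChartAt (𝓡 N) y).right_inv hut]; exact hu⟩
    rw [← pullEquiv_apply hs, hX l _ huO, map_sum, hYB]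
    refine Finset.sum_congr rfl fun i _ => ?_
    rw [map_smul, pullEquiv_apply, (extChartAt (𝓡 N) y).right_inv hut,
      ← hhat u hut (hU'Ω (hOU' huO))]
    rfl
  obtain ⟨F, P, hFP⟩ := exists_isDistrMap_of_chart (V := secondary DI T U')
    (Metric.ball_mem_nhds u₀ hδ0) hDt hYA hli hXY hXV
  exact ⟨d, τ, fun l => Pi.single (α l) 1, fun _ => O, F, P, hτ,
    fun l => ⟨(hτ0 l).1, (hτ0 l).2.trans_le (min_le_left _ _)⟩,
    fun l x hx => ⟨_, (hflow l x hx.1 hx.2).1⟩, hFP⟩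

end Leaflets

set_option linter.unusedSectionVars false

/-! ### Local inverses and push-forwards under local diffeomorphisms. -/

section LocalInverse

variable {N : ℕ} {M : Type*} [TopologicalSpace M] [ChartedSpace (EuclideanSpace ℝ (Fin N)) M]
  [IsManifold (𝓡 N) ω M]
  {M₁ : Type*} [TopologicalSpace M₁] [ChartedSpace (EuclideanSpace ℝ (Fin N)) M₁]
  [IsManifold (𝓡 N) ω M₁]
  {M₂ : Type*} [TopologicalSpace M₂] [ChartedSpace (EuclideanSpace ℝ (Fin N)) M₂]
  [IsManifold (𝓡 N) ω M₂]

theorem LDAt.mdifferentiableAt {g : M₁ → M} {x : M₁} (hg : LDAt (N := N) g x) :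
    MDifferentiableAt (𝓡 N) (𝓡 N) g x :=
  hg.self_of_nhds.1.mdifferentiableAt (by simp)

theorem LDAt.eventually {g : M₁ → M} {x : M₁} (hg : LDAt (N := N) g x) :
    ∀ᶠ z in 𝓝 x, LDAt (N := N) g z :=
  eventually_eventually_nhds.2 hg

theorem LDAt.comp {g : M₁ → M} {f : M₂ → M₁} {x : M₂} (hg : LDAt (N := N) g (f x))
    (hf : LDAt (N := N) f x) : LDAt (N := N) (g ∘ f) x := by
  filter_upwards [hf.eventually, hf.continuousAt.eventually hg.eventually] with z hz hz'
  refine ⟨hz'.self_of_nhds.1.comp z hz.self_of_nhds.1, ?_⟩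
  rw [mfderiv_comp z hz'.mdifferentiableAt hz.mdifferentiableAt]
  exact hz'.self_of_nhds.2.comp hz.self_of_nhds.2

theorem ldAt_of_contDiffAt {g : EuclideanSpace ℝ (Fin N) → EuclideanSpace ℝ (Fin N)}
    {u : EuclideanSpace ℝ (Fin N)} (hg : ContDiffAt ℝ ω g u) (hi : (fderiv ℝ g u).IsInvertible) :
    LDAt (N := N) g u := by
  obtain ⟨L, hL⟩ := hi
  have h1 : ∀ᶠ v in 𝓝 u, (fderiv ℝ g v).IsInvertible := by
    have hc := (hg.fderiv_right (m := 0) (by simp)).continuousAt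
    have := L.nhds
    rw [hL] at this
    exact hc.eventually this
  filter_upwards [h1, hg.eventually (by simp)] with v hv hv'
  exact ⟨contMDiffAt_iff_contDiffAt.2 hv', by rw [mfderiv_eq_fderiv]; exact hv⟩

theorem LDAt.exists_localInverse {φ : M₁ → M} {x : M₁} (hφ : LDAt (N := N) φ x) :
    ∃ ψ : M → M₁, LDAt (N := N) ψ (φ x) ∧ ψ (φ x) = x ∧ ∀ᶠ z in 𝓝 (φ x), φ (ψ z) = z := by
  have hxs := mem_extChartAt_source (I := 𝓡 N) x
  have hxt := (extChartAt (𝓡 N) x).map_source hxs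
  have hinv := (extChartAt (𝓡 N) x).left_inv hxs
  have hys := mem_extChartAt_source (I := 𝓡 N) (φ x)
  let g : EuclideanSpace ℝ (Fin N) → EuclideanSpace ℝ (Fin N) :=
    extChartAt (𝓡 N) (φ x) ∘ φ ∘ (extChartAt (𝓡 N) x).symm
  have hg : LDAt (N := N) g (extChartAt (𝓡 N) x x) := by
    refine LDAt.comp ?_ (LDAt.comp ?_ (ldAt_extChartAt_symm x hxt))
    · rw [Function.comp_apply, hinv]
      exact ldAt_extChartAt _ hys
    · rw [hinv]
      exact hφ
  have hgc : ContDiffAt ℝ ω g (extChartAt (𝓡 N) x x) :=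
    contMDiffAt_iff_contDiffAt.1 hg.self_of_nhds.1
  have hgi := hg.self_of_nhds.2
  rw [mfderiv_eq_fderiv] at hgi
  obtain ⟨L, hL⟩ : ∃ L : EuclideanSpace ℝ (Fin N) ≃L[ℝ] EuclideanSpace ℝ (Fin N),
    (L : EuclideanSpace ℝ (Fin N) →L[ℝ] EuclideanSpace ℝ (Fin N)) =
      fderiv ℝ g (extChartAt (𝓡 N) x x) := hgi
  have hgu : g (extChartAt (𝓡 N) x x) = extChartAt (𝓡 N) (φ x) (φ x) := by
    show extChartAt (𝓡 N) (φ x) (φ ((extChartAt (𝓡 N) x).symm (extChartAt (𝓡 N) x x))) = _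
    rw [hinv]
  have hd : HasFDerivAt g (L : EuclideanSpace ℝ (Fin N) →L[ℝ] EuclideanSpace ℝ (Fin N))
      (extChartAt (𝓡 N) x x) := by
    rw [hL]
    exact (hgc.differentiableAt (by simp)).hasFDerivAt
  have hs := hgc.hasStrictFDerivAt' hd (by simp)
  let ψ₀ := hs.localInverse g L (extChartAt (𝓡 N) x x)
  have hψ₀c : ContDiffAt ℝ ω ψ₀ (g (extChartAt (𝓡 N) x x)) := hgc.to_localInverse hd (by simp)
  have hψ₀ : LDAt (N := N) ψ₀ (g (extChartAt (𝓡 N) x x)) := by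
    refine ldAt_of_contDiffAt hψ₀c ⟨L.symm, ?_⟩
    exact hs.to_localInverse.hasFDerivAt.fderiv.symm
  have hψ₀u : ψ₀ (g (extChartAt (𝓡 N) x x)) = extChartAt (𝓡 N) x x := hs.localInverse_apply_image
  have hψ₀r : ∀ᶠ v in 𝓝 (g (extChartAt (𝓡 N) x x)), g (ψ₀ v) = v := hs.eventually_right_inverse
  rw [hgu] at hψ₀ hψ₀u hψ₀r
  have hψ : LDAt (N := N) ((extChartAt (𝓡 N) x).symm ∘ ψ₀ ∘ extChartAt (𝓡 N) (φ x)) (φ x) := by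
    refine LDAt.comp ?_ (LDAt.comp hψ₀ (ldAt_extChartAt _ hys))
    rw [Function.comp_apply, hψ₀u]
    exact ldAt_extChartAt_symm x hxt
  have hψx : ((extChartAt (𝓡 N) x).symm ∘ ψ₀ ∘ extChartAt (𝓡 N) (φ x)) (φ x) = x := by
    rw [Function.comp_apply, Function.comp_apply, hψ₀u, hinv]
  refine ⟨(extChartAt (𝓡 N) x).symm ∘ ψ₀ ∘ extChartAt (𝓡 N) (φ x), hψ, hψx, ?_⟩
  have hsrc := (isOpen_extChartAt_source (I := 𝓡 N) (φ x)).mem_nhds hys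
  have hc : ContinuousAt (φ ∘ ((extChartAt (𝓡 N) x).symm ∘ ψ₀ ∘ extChartAt (𝓡 N) (φ x))) (φ x) := by
    refine ContinuousAt.comp ?_ hψ.continuousAt
    rw [hψx]
    exact hφ.continuousAt
  have hc' : ∀ᶠ z in 𝓝 (φ x), φ (((extChartAt (𝓡 N) x).symm ∘ ψ₀ ∘ extChartAt (𝓡 N) (φ x)) z) ∈
      (extChartAt (𝓡 N) (φ x)).source := by
    refine hc.eventually_mem ?_
    rw [Function.comp_apply, hψx]
    exact hsrc
  filter_upwards [(ldAt_extChartAt (φ x) hys).continuousAt.eventually hψ₀r, hc', hsrc]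
    with z h1 h2 h3
  exact (extChartAt (𝓡 N) (φ x)).injOn h2 h3 h1

theorem mfderiv_localInverse {φ : M₁ → M} {ψ : M → M₁} {z : M} (hφ : LDAt (N := N) φ (ψ z))
    (hψ : LDAt (N := N) ψ z) (h : ∀ᶠ w in 𝓝 z, φ (ψ w) = w) (v : TangentSpace (𝓡 N) (ψ z)) :
    mfderiv (𝓡 N) (𝓡 N) ψ z (mfderiv (𝓡 N) (𝓡 N) φ (ψ z) v : EuclideanSpace ℝ (Fin N)) = v := by
  have h1 := hφ.mdifferentiableAt.hasMFDerivAt.comp z hψ.mdifferentiableAt.hasMFDerivAt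
  have h2 : HasMFDerivAt (𝓡 N) (𝓡 N) (φ ∘ ψ) z
      (ContinuousLinearMap.id ℝ (TangentSpace (𝓡 N) z)) :=
    (hasMFDerivAt_id z).congr_of_eventuallyEq h
  have h3 := hasMFDerivAt_unique h1 h2
  obtain ⟨L, hL⟩ := hψ.self_of_nhds.2
  obtain ⟨w, hw⟩ := L.surjective v
  have hw' : mfderiv (𝓡 N) (𝓡 N) ψ z w = v := by rw [← hL]; exact hw
  have h4 := congrArg (fun L : EuclideanSpace ℝ (Fin N) →L[ℝ] EuclideanSpace ℝ (Fin N) => L w) h3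
  rw [← hw']
  exact congrArg (mfderiv (𝓡 N) (𝓡 N) ψ z) h4

/-- The push-forward of an analytic field under a local diffeomorphism is analytic. -/
theorem vfAt_of_related {φ : M₁ → M} {x : M₁} (hφ : LDAt (N := N) φ x) {T : VF N M₁} {T' : VF N M}
    (hT : VFAt T x) (h : ∀ᶠ z in 𝓝 x, T' (φ z) = mfderiv (𝓡 N) (𝓡 N) φ z (T z)) :
    VFAt T' (φ x) := by
  obtain ⟨ψ, hψ, hψx, hr⟩ := hφ.exists_localInverse
  have hψc := hψ.continuousAt
  rw [ContinuousAt, hψx] at hψc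
  refine (VFAt.pull hψ (X := T) (by rw [hψx]; exact hT)).congr ?_
  filter_upwards [hψc.eventually h, hψc.eventually hφ.eventually, hψ.eventually,
    eventually_eventually_nhds.2 hr] with z h1 h2 h3 h4
  symm
  refine pull_eq_of_mfderiv h3.self_of_nhds.2 ?_
  have h5 : ∀ w w' : M, w = w' → (T' w : EuclideanSpace ℝ (Fin N)) = T' w' := by
    rintro w _ rfl
    rfl
  have h6 : (T' z : EuclideanSpace ℝ (Fin N)) = mfderiv (𝓡 N) (𝓡 N) φ (ψ z) (T (ψ z)) :=
    (h5 _ _ h4.self_of_nhds).symm.trans h1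
  show mfderiv (𝓡 N) (𝓡 N) ψ z (T' z : EuclideanSpace ℝ (Fin N)) = _
  rw [h6]
  exact mfderiv_localInverse h2 h3 h4 _

end LocalInverse

set_option linter.unusedSectionVars false

/-! ### Ranks of the bracket generated space and of the iterated brackets under a diffeomorphism. -/

section Transport

variable {N : ℕ} {M : Type*} [TopologicalSpace M] [ChartedSpace (EuclideanSpace ℝ (Fin N)) M]
  [IsManifold (𝓡 N) ω M]

theorem LDAt.image_mem_nhds {φ : M → M} {x : M} (hφ : LDAt (N := N) φ x) {S : Set M}
    (hS : S ∈ 𝓝 x) : φ '' S ∈ 𝓝 (φ x) := by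
  obtain ⟨ψ, hψ, hψx, hr⟩ := hφ.exists_localInverse
  have hψc := hψ.continuousAt
  rw [ContinuousAt, hψx] at hψc
  filter_upwards [hψc.eventually_mem hS, hr] with z h1 h2
  exact ⟨ψ z, h1, h2⟩

theorem isInvertible_of_bijective {F : Type*} [NormedAddCommGroup F] [NormedSpace ℝ F]
    [FiniteDimensional ℝ F] {A : F →L[ℝ] F} (h : Function.Bijective A) : A.IsInvertible :=
  ⟨(LinearEquiv.ofBijective A.toLinearMap h).toContinuousLinearEquiv, by ext; rfl⟩

theorem PreservesLeaves.ldAt {DI : Distr N M} {U : Set M} {φ : M → M}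
    (hφ : PreservesLeaves DI U φ) (hU : IsOpen U) {x : M} (hx : x ∈ U) : LDAt (N := N) φ x := by
  filter_upwards [hU.mem_nhds hx] with z hz
  refine ⟨hφ.1.contMDiffAt (hU.mem_nhds hz), ?_⟩
  exact isInvertible_of_bijective (F := EuclideanSpace ℝ (Fin N)) (hφ.2.2.1 z hz)

theorem pull_add_eq (φ : M → M) (X Y : VF N M) : pull φ (X + Y) = pull φ X + pull φ Y :=
  VectorField.mpullback_add

theorem pull_smul_eq (φ : M → M) (f : M → ℝ) (X : VF N M) :
    pull φ (f • X) = (f ∘ φ) • pull φ X := by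
  ext x
  rw [pull_apply]
  show (mfderiv (𝓡 N) (𝓡 N) φ x).inverse (f (φ x) • X (φ x)) = f (φ x) • _
  rw [map_smul]
  rfl

theorem pull_zero_eq (φ : M → M) : pull φ (0 : VF N M) = 0 := by
  ext x
  rw [pull_apply]
  exact map_zero _

/-- The bracket generated distribution of a transported secondary family is not larger than the
original one. -/
theorem finrank_fiber_le_of_related {DI : Distr N M} {T T' T'' Z : VF N M}
    {U Ω O : Set M} {φ : M → M} {x : M} (hU : IsOpen U) (hx : x ∈ U) (hT : ∀ z ∈ U, VFAt T z)
    (hO : IsOpen O) (hxO : x ∈ O) (hZ : Z ∈ tangentFields DI O) (hT' : T' =ᶠ[𝓝 x] T + Z) (hφ : LDAt (N := N) φ x)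
    (hT''A : VFAt T'' (φ x)) (hT'' : pull φ T'' =ᶠ[𝓝 x] T')
    (hDI : ∀ᶠ z in 𝓝 x, ∀ v, mfderiv (𝓡 N) (𝓡 N) φ z v ∈ DI (φ z) → v ∈ DI z) :
    Module.finrank ℝ (fiber (lieClosure (secondary DI T'' Ω)) (φ x)) ≤
      Module.finrank ℝ (fiber (lieClosure (secondary DI T U)) x) := by
  have hV := isPresheaf_secondary DI hT
  have hI := isPresheaf_iterBrackets hV
  -- The fields whose pull-backs belong, near `x`, to the bracket generated family of the original
  -- lift. This property passes through all the operations that build the transported family.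
  let Q : VF N M → Prop := fun X => VFAt X (φ x) ∧
    GermSpan (iterBrackets (secondary DI T U)) x (pull φ X)
  have hQ : ∀ O X, X ∈ lieClosure (secondary DI T'' Ω) O → φ x ∈ O → Q X := by
    intro O₁ X hX hxO₁
    refine lieClosure_secondary_induction (Q := Q) ?_ ?_ ?_ ?_ ?_ ?_ ?_ hX hxO₁
    · exact ⟨vfAt_zero _, by rw [pull_zero_eq]; exact .zero⟩
    · exact fun X Y hX hY => ⟨hX.1.add hY.1, by rw [pull_add_eq]; exact hX.2.add hY.2⟩
    · exact fun f X hf hX => ⟨hX.1.smul hf, by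
        rw [pull_smul_eq]; exact hX.2.smul (FunAt.comp hφ hf)⟩
    · exact fun X Y hX hY => ⟨hX.1.congr hY, hX.2.congr (pull_congr hφ hY)⟩
    · exact fun X Y hX hY => ⟨hX.1.bracket hY.1,
        (hX.2.bracket hV hY.2).congr (pull_bracket hφ hX.1 hY.1)⟩
    · intro X hX
      refine ⟨hT''A.bracket hX.1, ?_⟩
      -- The pull-back of `T''` is `T + Z`. The bracket with `T` stays in the family by
      -- `bracket_secondary`, and the one with `Z` does because `Z` is a field of `DI`.
      have h1 : bracket (pull φ T'') (pull φ X) =ᶠ[𝓝 x] bracket (T + Z) (pull φ X) :=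
        bracket_congr (hT''.trans hT') Filter.EventuallyEq.rfl
      refine GermSpan.congr (GermSpan.bracket_symm ?_) ((pull_bracket hφ hT''A hX.1).trans h1)
      refine GermSpan.congr ?_ (bracket_add_right (hT x hx) (hZ.2.1.vfAt hO hxO))
      exact (hX.2.bracket_secondary hT hx).bracket_symm.add
        (hX.2.bracket hV (GermSpan.of_tangentFields hU hx hO hxO hZ))
    · intro O hO hxO Y hY
      have hYA := hY.2.1.vfAt hO hxO
      refine ⟨hYA, ?_⟩
      obtain ⟨O', hO', hO'o, hxO'⟩ := eventually_nhds_iff.1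
        ((hDI.and hφ.eventually).and ((hφ.continuousAt.eventually_mem (hO.mem_nhds hxO)).and
          (VFAt.pull hφ hYA).eventually))
      refine GermSpan.of_tangentFields hU hx hO'o hxO'
        ⟨hO'o, isAnalyticVF_of_vfAt fun z hz => (hO' z hz).2.2, fun z hz => ?_⟩
      obtain ⟨⟨h1, h2⟩, h3, -⟩ := hO' z hz
      apply h1
      rw [mfderiv_pull h2.self_of_nhds.2]
      exact hY.2.2 _ h3
  have hi := hφ.self_of_nhds.2
  rw [← LinearEquiv.finrank_map_eq (pullEquiv hi)]
  refine Submodule.finrank_mono ?_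
  rw [Submodule.map_le_iff_le_comap]
  refine Submodule.span_le.2 ?_
  rintro _ ⟨O, hO, hxO, X, hX, rfl⟩
  show pullEquiv hi (X (φ x)) ∈ fiber (lieClosure (secondary DI T U)) x
  rw [pullEquiv_apply hi]
  exact (hQ O X hX hxO).2.mem_fiber hI

/-- The space that is spanned by the iterated brackets of a frame does not depend on the frame and
is compatible with local diffeomorphisms. -/
theorem finrank_span_le_of_related {DI : Distr N M} {T' T'' : VF N M} {U : Set M}
    {φ : M → M} {x : M} (hU : IsOpen U) (hx : x ∈ U) (hφx : φ x ∈ U) {m : ℕ} {W : Fin m → VF N M}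
    (hW : ∀ α, ∀ z ∈ U, VFAt (W α) z)
    (hframe : ∀ z ∈ U, LinearIndependent ℝ (fun α => W α z) ∧
      DI z = Submodule.span ℝ (range fun α => W α z)) (hφ : LDAt (N := N) φ x)
    (hT' : VFAt T' x) (hT''A : VFAt T'' (φ x)) (hT'' : pull φ T'' =ᶠ[𝓝 x] T')
    (hDI : ∀ᶠ z in 𝓝 x, ∀ v ∈ DI z, mfderiv (𝓡 N) (𝓡 N) φ z v ∈ DI (φ z)) :
    Module.finrank ℝ (Submodule.span ℝ
      (range fun i : Fin m × ℕ => adIter T' i.2 (W i.1) x)) ≤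
    Module.finrank ℝ (Submodule.span ℝ
      (range fun i : Fin m × ℕ => adIter T'' i.2 (W i.1) (φ x))) := by
  have hi := hφ.self_of_nhds.2
  have hWφ : ∀ α, VFAt (pull φ (W α)) x := fun α => VFAt.pull hφ (hW α _ hφx)
  -- The pulled-back frame is independent, and since `φ` maps `DI` into itself it spans `DI` near
  -- `x`; hence the frame `W` has analytic coefficients in it.
  have hcoef : ∀ α, ∃ f : Fin m → M → ℝ, (∀ i, FunAt N (f i) x) ∧
      ∀ᶠ z in 𝓝 x, W α z = ∑ i, f i z • pull φ (W i) z := by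
    intro α
    refine exists_coefficients hWφ (linearIndependent_pull hi (hframe _ hφx).1) (hW α x hx) ?_
    filter_upwards [hDI, hφ.eventually, hU.mem_nhds hx,
      hφ.continuousAt.eventually_mem (hU.mem_nhds hφx)] with z h1 h2 h3 h4
    have hiz := h2.self_of_nhds.2
    have h5 := h1 (W α z) (by rw [(hframe z h3).2]; exact Submodule.subset_span ⟨α, rfl⟩)
    rw [(hframe _ h4).2] at h5
    obtain ⟨c, hc⟩ := (Submodule.mem_span_range_iff_exists_fun ℝ).1 h5
    refine (Submodule.mem_span_range_iff_exists_fun ℝ).2 ⟨c, ?_⟩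
    obtain ⟨L, hL⟩ := hiz
    apply L.injective
    have h6 : ∀ v, L v = mfderiv (𝓡 N) (𝓡 N) φ z v := fun v => by rw [← hL]; rfl
    rw [h6, h6, ← hc, map_sum]
    refine Finset.sum_congr rfl fun i _ => ?_
    rw [map_smul, mfderiv_pull ⟨L, hL⟩]
  obtain ⟨O, hO, hOo, hxO⟩ := eventually_nhds_iff.1
    (hT'.eventually.and (Filter.eventually_all.2 fun α => (hWφ α).eventually))
  let gen : Fin m × ℕ → VF N M := fun i => adIter T' i.2 (pull φ (W i.1))
  have hgenA : ∀ i, ∀ z ∈ O, VFAt (gen i) z := fun i z hz =>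
    (hO z hz).1.adIter ((hO z hz).2 i.1) i.2
  have hof : ∀ i, GermSpan (restrictions gen O) x (gen i) := fun i =>
    .of hOo hxO ⟨Subset.rfl, i, rfl⟩
  have had : ∀ X k, GermSpan (restrictions gen O) x X →
      GermSpan (restrictions gen O) x (adIter T' k X) := by
    intro X k hX
    induction k with
    | zero => exact hX
    | succ k ih =>
      refine ih.bracket_right (isPresheaf_restrictions hgenA) (fun O' hO' hxO' Y hY => ?_) hT'
      obtain ⟨-, ⟨α, k⟩, rfl⟩ := hY
      exact hof (α, k + 1)
  rw [← finrank_span_pull hi]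
  refine Submodule.finrank_mono (Submodule.span_le.2 ?_)
  rintro _ ⟨⟨α, k⟩, rfl⟩
  obtain ⟨f, hf, hWf⟩ := hcoef α
  refine (had (W α) k (GermSpan.sum_smul hf (fun i => hof (i, 0)) hWf)).apply_mem
    fun O' _ _ Y hY => ?_
  obtain ⟨-, i, rfl⟩ := hY
  refine Submodule.subset_span ⟨i, ?_⟩
  exact ((pull_adIter hφ hT''A (hW _ _ hφx) i.2).trans
    (adIter_congr hT'' Filter.EventuallyEq.rfl i.2)).self_of_nhds

end Transport

set_option linter.unusedSectionVars false

/-! ### The absorbing lift on the manifold; first integrals. -/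

section Lift

variable {N : ℕ} {M : Type*} [TopologicalSpace M] [ChartedSpace (EuclideanSpace ℝ (Fin N)) M]
  [IsManifold (𝓡 N) ω M]

theorem mem_span_pull_iff {ι M₁ : Type*} [TopologicalSpace M₁]
    [ChartedSpace (EuclideanSpace ℝ (Fin N)) M₁] [IsManifold (𝓡 N) ω M₁] {g : M₁ → M} {u : M₁}
    (h : (mfderiv (𝓡 N) (𝓡 N) g u).IsInvertible) (X : VF N M) (Y : ι → VF N M) :
    pull g X u ∈ Submodule.span ℝ (range fun i => pull g (Y i) u) ↔
      X (g u) ∈ Submodule.span ℝ (range fun i => Y i (g u)) := by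
  have hf : (fun i => pull g (Y i) u) = pullEquiv h ∘ fun i => Y i (g u) :=
    funext fun i => (pullEquiv_apply h (Y i)).symm
  have hm : Submodule.span ℝ (range fun i => pull g (Y i) u) =
      (Submodule.span ℝ (range fun i => Y i (g u))).map
        (pullEquiv h : TangentSpace (𝓡 N) (g u) →ₗ[ℝ] TangentSpace (𝓡 N) u) := by
    rw [Submodule.map_span, ← range_comp, hf]
    rfl
  rw [hm, ← pullEquiv_apply h]
  refine ⟨?_, fun hX => Submodule.mem_map_of_mem hX⟩
  rintro ⟨w, hw, hwX⟩
  rwa [← (pullEquiv h).injective hwX]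

/-- For a suitable modification of `T` along a frame, the iterated brackets of the frame span all
the iterated brackets with `T` and their mutual brackets. -/
theorem exists_absorbing_lift {m : ℕ} {U : Set M} (hU : IsOpen U) {y : M} (hy : y ∈ U)
    {T : VF N M} {W : Fin m → VF N M} (hT : ∀ z ∈ U, VFAt T z) (hW : ∀ α, ∀ z ∈ U, VFAt (W α) z)
    (hTy : T y ≠ 0) :
    ∃ (g : Fin m → M → ℝ) (U₁ : Set M), IsOpen U₁ ∧ y ∈ U₁ ∧ U₁ ⊆ U ∧
      (∀ α, ∀ z ∈ U₁, FunAt N (g α) z) ∧ ∀ T' : VF N M,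
        T' = (fun z => T z + ∑ α, g α z • W α z) →
        (∀ α j, adIter T j (W α) y ∈ Submodule.span ℝ
          (range fun i : Fin m × ℕ => adIter T' i.2 (W i.1) y)) ∧
        ∀ γ α i c, bracket (adIter T i (W γ)) (adIter T c (W α)) y ∈ Submodule.span ℝ
          (range fun i : Fin m × ℕ => adIter T' i.2 (W i.1) y) := by
  have hys := mem_extChartAt_source (I := 𝓡 N) y
  have hyt := (extChartAt (𝓡 N) y).map_source hys
  have hinv := (extChartAt (𝓡 N) y).left_inv hys
  let Ω : Set (EuclideanSpace ℝ (Fin N)) :=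
    (extChartAt (𝓡 N) y).target ∩ (extChartAt (𝓡 N) y).symm ⁻¹' U
  have hΩ : IsOpen Ω := (continuousOn_extChartAt_symm y).isOpen_inter_preimage
    (isOpen_extChartAt_target y) hU
  have huΩ : extChartAt (𝓡 N) y y ∈ Ω := ⟨hyt, by rw [mem_preimage, hinv]; exact hy⟩
  let Th : EuclideanSpace ℝ (Fin N) → EuclideanSpace ℝ (Fin N) := pull (extChartAt (𝓡 N) y).symm T
  let Wh : Fin m → EuclideanSpace ℝ (Fin N) → EuclideanSpace ℝ (Fin N) := fun α =>
    pull (extChartAt (𝓡 N) y).symm (W α)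
  have hi := (ldAt_extChartAt_symm y hyt).self_of_nhds.2
  have hTh : Th (extChartAt (𝓡 N) y y) ≠ 0 := by
    intro h
    have h1 := mfderiv_pull hi T
    have h2 : pull (extChartAt (𝓡 N) y).symm T (extChartAt (𝓡 N) y y) = 0 := h
    rw [h2, map_zero, hinv] at h1
    exact hTy h1.symm
  obtain ⟨h, hh, hT'⟩ := exists_absorbing_field hΩ huΩ (T := Th) (W := Wh)
    (fun u hu => analyticAt_hat y hu.1 (hT _ hu.2))
    (fun α u hu => analyticAt_hat y hu.1 (hW α _ hu.2)) hTh
  refine ⟨fun α => h α ∘ extChartAt (𝓡 N) y, (extChartAt (𝓡 N) y).source ∩ U,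
    (isOpen_extChartAt_source y).inter hU, ⟨hys, hy⟩, inter_subset_right,
    fun α z hz => FunAt.of_chart hz.1 (hh α _ ⟨(extChartAt (𝓡 N) y).map_source hz.1, by
      rw [mem_preimage, (extChartAt (𝓡 N) y).left_inv hz.1]; exact hz.2⟩), ?_⟩
  intro T' hT'eq
  obtain ⟨h1, h2⟩ := hT' _ rfl
  have hT'A : VFAt T' y := by
    refine VFAt.congr ((hT y hy).add (VFAt.sum Finset.univ
      (X := fun α => (h α ∘ extChartAt (𝓡 N) y) • W α) fun α _ => VFAt.smul
      (FunAt.of_chart hys (hh α _ huΩ)) (hW α y hy))) (Filter.Eventually.of_forall fun z => ?_)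
    rw [hT'eq, Pi.add_apply, Finset.sum_apply]
    rfl
  have hT'h : (pull (extChartAt (𝓡 N) y).symm T' :
      EuclideanSpace ℝ (Fin N) → EuclideanSpace ℝ (Fin N)) =ᶠ[𝓝 (extChartAt (𝓡 N) y y)]
      fun u => Th u + ∑ α, h α u • Wh α u := by
    filter_upwards [hΩ.mem_nhds huΩ] with u hu
    rw [hT'eq, pull_apply, map_add, map_sum]
    refine congrArg _ (Finset.sum_congr rfl fun α _ => ?_)
    rw [map_smul]
    show h α (extChartAt (𝓡 N) y ((extChartAt (𝓡 N) y).symm u)) • _ = _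
    rw [(extChartAt (𝓡 N) y).right_inv hu.1]
    rfl
  have hhat : ∀ α k, (pull (extChartAt (𝓡 N) y).symm (adIter T k (W α)) (extChartAt (𝓡 N) y y) :
      EuclideanSpace ℝ (Fin N)) = adVec Th k (Wh α) (extChartAt (𝓡 N) y y) := fun α k =>
    hat_adIter y hyt (by rw [hinv]; exact hT y hy) (by rw [hinv]; exact hW α y hy) k
  have hhat' : (fun i : Fin m × ℕ => adVec (fun u => Th u + ∑ α, h α u • Wh α u) i.2 (Wh i.1)
      (extChartAt (𝓡 N) y y)) = fun i => (pull (extChartAt (𝓡 N) y).symm (adIter T' i.2 (W i.1))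
      (extChartAt (𝓡 N) y y) : EuclideanSpace ℝ (Fin N)) := by
    funext i
    refine Eq.trans ?_ (hat_adIter y hyt (by rw [hinv]; exact hT'A)
      (by rw [hinv]; exact hW i.1 y hy) i.2).symm
    refine (congrFun (adIter_eq_adVec _ _ _) _).symm.trans
      (Eq.trans ?_ (congrFun (adIter_eq_adVec _ _ _) _))
    exact (adIter_congr hT'h.symm Filter.EventuallyEq.rfl i.2).self_of_nhds
  rw [hhat'] at h1 h2
  refine ⟨fun α j => ?_, fun γ α i c => ?_⟩
  · have h3 := h1 α j
    rw [← hhat] at h3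
    have h4 := (mem_span_pull_iff hi _ _).1 h3
    rw [hinv] at h4
    exact h4
  · have h3 := h2 γ α i c
    have h5 : (pull (extChartAt (𝓡 N) y).symm (bracket (adIter T i (W γ)) (adIter T c (W α)))
        (extChartAt (𝓡 N) y y) : EuclideanSpace ℝ (Fin N)) =
        VectorField.lieBracket ℝ (adVec Th i (Wh γ)) (adVec Th c (Wh α))
          (extChartAt (𝓡 N) y y) := by
      have hTA : VFAt T ((extChartAt (𝓡 N) y).symm (extChartAt (𝓡 N) y y)) := by
        rw [hinv]; exact hT y hy
      have hWA : ∀ α, VFAt (W α) ((extChartAt (𝓡 N) y).symm (extChartAt (𝓡 N) y y)) := fun α => by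
        rw [hinv]; exact hW α y hy
      have hld := ldAt_extChartAt_symm y hyt
      have h6 := ((pull_bracket hld (hTA.adIter (hWA γ) i) (hTA.adIter (hWA α) c)).trans
        (bracket_congr (pull_adIter hld hTA (hWA γ) i)
          (pull_adIter hld hTA (hWA α) c))).self_of_nhds
      rw [bracket_eq_lieBracket, adIter_eq_adVec, adIter_eq_adVec] at h6
      exact h6
    rw [← h5] at h3
    have h4 := (mem_span_pull_iff hi _ _).1 h3
    rw [hinv] at h4
    exact h4

theorem GermSpan.bracket_apply_mem {G : FieldFamily N M} (hG : IsPresheaf G) {x : M}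
    {X Y : VF N M} (hY : GermSpan G x Y) {S : Submodule ℝ (TangentSpace (𝓡 N) x)}
    (h : ∀ O, IsOpen O → x ∈ O → ∀ Y ∈ G O, Y x ∈ S)
    (hb : ∀ O, IsOpen O → x ∈ O → ∀ Y ∈ G O, RiggedControl.bracket X Y x ∈ S) :
    RiggedControl.bracket X Y x ∈ S := by
  induction hY with
  | of hO hx hX => exact hb _ hO hx _ hX
  | zero =>
    rw [RiggedControl.bracket, VectorField.mlieBracket_zero_right]
    exact S.zero_mem
  | add h₁ h₂ ih₁ ih₂ =>
    rw [(bracket_add_right (h₁.vfAt hG) (h₂.vfAt hG)).self_of_nhds]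
    exact S.add_mem ih₁ ih₂
  | smul hf h₁ ih =>
    rw [(bracket_smul_right hf (h₁.vfAt hG)).self_of_nhds]
    exact S.add_mem (S.smul_mem _ (h₁.apply_mem h)) (S.smul_mem _ ih)
  | congr _ he h₁ =>
    have h₂ := (bracket_congr (X := X) (X' := X) Filter.EventuallyEq.rfl he).self_of_nhds
    rw [h₂]
    exact h₁

/-- Expanding a bracket of two combinations of generators by the Leibniz rule leaves only values of
generators and of brackets of two generators, so these suffice to bound the fibre of depth two. -/
theorem depthFiber_two_le {V G : FieldFamily N M} (hG : IsPresheaf G) {x : M}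
    (hV : ∀ O, IsOpen O → x ∈ O → ∀ X ∈ V O, GermSpan G x X)
    {S : Submodule ℝ (TangentSpace (𝓡 N) x)}
    (h : ∀ O, IsOpen O → x ∈ O → ∀ Y ∈ G O, Y x ∈ S)
    (hb : ∀ O O', x ∈ O → x ∈ O' → ∀ X ∈ G O, ∀ Y ∈ G O', bracket X Y x ∈ S) :
    depthFiber V 2 x ≤ S := by
  refine Submodule.span_le.2 ?_
  rintro _ ⟨O, hO, hx, l, hl, hl2, hlV, rfl⟩
  match l, hl, hl2, hlV with
  | [X], _, _, hlV => exact (hV O hO hx X (hlV X (by simp))).apply_mem h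
  | [X, Y], _, _, hlV =>
    refine (hV O hO hx Y (hlV Y (by simp))).bracket_apply_mem hG h fun O₁ hO₁ hx₁ Y' hY' => ?_
    rw [bracket_swap]
    refine S.smul_mem _ ?_
    exact (hV O hO hx X (hlV X (by simp))).bracket_apply_mem hG h fun O₂ hO₂ hx₂ X' hX' =>
      hb O₁ O₂ hx₁ hx₂ Y' hY' X' hX'

/-- An involutive regular distribution is locally the kernel of the differential of a map. -/
theorem exists_first_integral_of_frame {DI : Distr N M} (hDI : IsInvolutiveDistr DI) {m : ℕ}
    {U : Set M} (hU : IsOpen U) {y : M} (hy : y ∈ U) {W : Fin m → VF N M}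
    (hW : ∀ α, ∀ z ∈ U, VFAt (W α) z)
    (hframe : ∀ z ∈ U, LinearIndependent ℝ (fun α => W α z) ∧
      DI z = Submodule.span ℝ (range fun α => W α z)) :
    ∃ q : M → EuclideanSpace ℝ (Fin N), ∀ᶠ z in 𝓝 y,
      ∃ A : TangentSpace (𝓡 N) z →L[ℝ] EuclideanSpace ℝ (Fin N),
        HasMFDerivAt (𝓡 N) (𝓡 N) q z A ∧ ∀ v, A v = 0 ↔ v ∈ DI z := by
  have hys := mem_extChartAt_source (I := 𝓡 N) y
  have hyt := (extChartAt (𝓡 N) y).map_source hys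
  have hinv := (extChartAt (𝓡 N) y).left_inv hys
  let Wh : Fin m → EuclideanSpace ℝ (Fin N) → EuclideanSpace ℝ (Fin N) := fun α =>
    pull (extChartAt (𝓡 N) y).symm (W α)
  have hmem : ∀ α, W α ∈ tangentFields DI U := fun α =>
    ⟨hU, isAnalyticVF_of_vfAt (hW α), fun z hz => by
      rw [(hframe z hz).2]; exact Submodule.subset_span ⟨α, rfl⟩⟩
  have hWh : ∀ α, AnalyticAt ℝ (Wh α) (extChartAt (𝓡 N) y y) := fun α =>
    analyticAt_hat y hyt (by rw [hinv]; exact hW α y hy)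
  have hli : LinearIndependent ℝ fun α => Wh α (extChartAt (𝓡 N) y y) :=
    linearIndependent_pull (ldAt_extChartAt_symm y hyt).self_of_nhds.2
      (by rw [hinv]; exact (hframe y hy).1)
  obtain ⟨π, hπ⟩ := exists_first_integral hWh hli (by
    filter_upwards [eventually_chart hys (hU.mem_nhds hy),
      (isOpen_extChartAt_target (I := 𝓡 N) y).mem_nhds hyt] with u hu hut i j
    have hld := ldAt_extChartAt_symm y hut
    have h1 := (pull_bracket hld (hW i _ hu) (hW j _ hu)).self_of_nhds
    rw [bracket_eq_lieBracket] at h1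
    have h2 := hDI U (W i) (hmem i) (W j) (hmem j) _ hu
    rw [(hframe _ hu).2] at h2
    have h3 := (mem_span_pull_iff hld.self_of_nhds.2 _ _).2 h2
    rw [h1] at h3
    exact h3)
  refine ⟨π ∘ extChartAt (𝓡 N) y, ?_⟩
  filter_upwards [(ldAt_extChartAt y hys).continuousAt.eventually hπ, hU.mem_nhds hy,
    (isOpen_extChartAt_source (I := 𝓡 N) y).mem_nhds hys] with z hz hzU hzs
  obtain ⟨π', hπ', hker⟩ := hz
  have he := ldAt_extChartAt y hzs
  refine ⟨_, HasMFDerivAt.comp z hπ'.hasMFDerivAt he.mdifferentiableAt.hasMFDerivAt, fun v => ?_⟩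
  refine (hker _).trans ?_
  rw [(hframe z hzU).2]
  refine (Submodule.mem_span_range_iff_exists_fun ℝ).trans
    (Iff.trans ?_ (Submodule.mem_span_range_iff_exists_fun ℝ).symm)
  obtain ⟨L, hL⟩ := he.self_of_nhds.2
  refine exists_congr fun c => ?_
  have h1 : (∑ i, c i • Wh i (extChartAt (𝓡 N) y z) : EuclideanSpace ℝ (Fin N)) =
      mfderiv (𝓡 N) (𝓡 N) (extChartAt (𝓡 N) y) z (∑ i, c i • W i z) := by
    rw [map_sum]
    refine Finset.sum_congr rfl fun i _ => ?_
    rw [map_smul, mfderiv_extChartAt_apply hzs]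
    rfl
  rw [h1, ← hL]
  exact L.injective.eq_iff

end Lift

set_option linter.unusedSectionVars false

/-! ### Diffeomorphisms preserving the leaves, and the conclusion. -/

section Main

variable {N : ℕ} {M : Type*} [TopologicalSpace M] [ChartedSpace (EuclideanSpace ℝ (Fin N)) M]
  [IsManifold (𝓡 N) ω M]

theorem integralLeaf_subset {V : FieldFamily N M} {U : Set M} {x z : M} (hx : x ∈ U)
    (hz : z ∈ integralLeaf V U x) : z ∈ U := by
  refine Relation.ReflTransGen.head_induction_on (motive := fun a _ => a ∈ U → z ∈ U) hz id ?_ hx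
  rintro a b ⟨O, hO, X, -, t, γ, -, hγt, -, hγ⟩ - ih -
  exact ih (hγt ▸ hO (hγ t right_mem_uIcc))

theorem integralLeaf_mono {V V' : FieldFamily N M} {U U' : Set M} (hU : U ⊆ U')
    (hV : ∀ O ⊆ U, V O ⊆ V' O) (x : M) : integralLeaf V U x ⊆ integralLeaf V' U' x := by
  intro z hz
  refine Relation.ReflTransGen.mono ?_ _ _ hz
  rintro a b ⟨O, hO, X, hX, t, h⟩
  exact ⟨O, hO.trans hU, X, hV O hO hX, t, h⟩

theorem subset_lieClosure_secondary {DI : Distr N M} {T : VF N M} {U O : Set M} (hO : O ⊆ U) :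
    tangentFields DI O ⊆ lieClosure (secondary DI T U) O := by
  intro X hX
  have h1 : X ∈ secondary DI T U O := ⟨hX.1, hX.2.1, fun x hx => ⟨O, hX.1, hx, Subset.rfl, 1,
    fun _ _ => 1, fun _ => X, fun _ => contMDiffOn_const, fun _ => ⟨hO, X, hX, 0, rfl⟩,
    fun z _ => by simp⟩⟩
  exact ⟨hX.1, hX.2.1, fun x hx => ⟨O, hX.1, hx, Subset.rfl, 1, fun _ _ => 1, fun _ => X,
    fun _ => contMDiffOn_const, fun _ => ⟨[X], by simp, by simpa using h1, rfl⟩,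
    fun z _ => by simp⟩⟩

/-- The leaves lie in the fibres of a first integral. -/
theorem eq_of_mem_integralLeaf {DI : Distr N M} {U : Set M} {q : M → EuclideanSpace ℝ (Fin N)}
    (hq : ∀ z ∈ U, ∃ A : TangentSpace (𝓡 N) z →L[ℝ] EuclideanSpace ℝ (Fin N),
      HasMFDerivAt (𝓡 N) (𝓡 N) q z A ∧ ∀ v, A v = 0 ↔ v ∈ DI z) {x z : M}
    (hz : z ∈ integralLeaf (tangentFields DI) U x) : q z = q x := by
  refine Relation.ReflTransGen.head_induction_on (motive := fun a _ => q z = q a) hz rfl ?_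
  rintro a b ⟨O, hO, X, hX, t, γ, hγ0, hγt, hγ, hγO⟩ - ih
  rw [ih, ← hγ0, ← hγt]
  have hd : ∀ s ∈ uIcc 0 t, HasDerivWithinAt (q ∘ γ) 0 (uIcc 0 t) s := by
    intro s hs
    obtain ⟨A, hA, hker⟩ := hq (γ s) (hO (hγO s hs))
    have h1 : HasFDerivWithinAt (q ∘ γ) ((A : EuclideanSpace ℝ (Fin N) →L[ℝ] _).comp
        ((1 : ℝ →L[ℝ] ℝ).smulRight (X (γ s) : EuclideanSpace ℝ (Fin N)))) (uIcc 0 t) s :=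
      (hA.comp_hasMFDerivWithinAt s (hγ s hs)).hasFDerivWithinAt
    refine hasDerivWithinAt_of_hasFDerivWithinAt (F := EuclideanSpace ℝ (Fin N)) h1 ?_
    show A ((1 : ℝ) • X (γ s)) = 0
    rw [one_smul]
    exact (hker _).2 (hX.2.2 _ (hγO s hs))
  have := (convex_uIcc 0 t).norm_image_sub_le_of_norm_hasDerivWithin_le (C := 0) hd (by simp)
    left_mem_uIcc right_mem_uIcc
  rw [zero_mul] at this
  exact sub_eq_zero.1 (norm_le_zero_iff.1 this)

theorem PreservesLeaves.mem {DI : Distr N M} {U : Set M} {φ : M → M}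
    (hφ : PreservesLeaves DI U φ) {x : M} (hx : x ∈ U) :
    φ x ∈ integralLeaf (tangentFields DI) U x :=
  hφ.2.2.2 x hx ⟨x, Relation.ReflTransGen.refl, rfl⟩

/-- Leaves lie in fibres of the first integral, so `q ∘ φ = q` and `dq ∘ dφ = dq`; the distribution
is the kernel of `dq` at both points. -/
theorem PreservesLeaves.mfderiv_mem_iff {DI : Distr N M} {U : Set M} {φ : M → M}
    (hφ : PreservesLeaves DI U φ) (hU : IsOpen U) {q : M → EuclideanSpace ℝ (Fin N)}
    (hq : ∀ z ∈ U, ∃ A : TangentSpace (𝓡 N) z →L[ℝ] EuclideanSpace ℝ (Fin N),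
      HasMFDerivAt (𝓡 N) (𝓡 N) q z A ∧ ∀ v, A v = 0 ↔ v ∈ DI z) {x : M} (hx : x ∈ U)
    (v : TangentSpace (𝓡 N) x) : v ∈ DI x ↔ mfderiv (𝓡 N) (𝓡 N) φ x v ∈ DI (φ x) := by
  obtain ⟨A, hA, hker⟩ := hq x hx
  obtain ⟨A', hA', hker'⟩ := hq (φ x) (integralLeaf_subset hx (hφ.mem hx))
  have h1 := hA'.comp x (hφ.ldAt hU hx).mdifferentiableAt.hasMFDerivAt
  have h2 : HasMFDerivAt (𝓡 N) (𝓡 N) (q ∘ φ) x A := by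
    refine hA.congr_of_eventuallyEq ?_
    filter_upwards [hU.mem_nhds hx] with z hz
    exact eq_of_mem_integralLeaf hq (hφ.mem hz)
  have h3 := hasMFDerivAt_unique h2 h1
  rw [← hker, ← hker', h3]
  rfl

theorem linearIndependent_of_pull {ι M₁ : Type*} [TopologicalSpace M₁]
    [ChartedSpace (EuclideanSpace ℝ (Fin N)) M₁] [IsManifold (𝓡 N) ω M₁] {g : M₁ → M} {u : M₁}
    (h : (mfderiv (𝓡 N) (𝓡 N) g u).IsInvertible) {X : ι → VF N M}
    (hX : LinearIndependent ℝ fun i => pull g (X i) u) :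
    LinearIndependent ℝ fun i => X i (g u) := by
  have h1 := hX.map' ((pullEquiv h).symm : TangentSpace (𝓡 N) u →ₗ[ℝ] TangentSpace (𝓡 N) (g u))
    (pullEquiv h).symm.ker
  convert! h1 using 2 with i
  exact ((pullEquiv h).symm_apply_eq.2 (pullEquiv_apply h (X i)).symm).symm

theorem eventually_linearIndependent {ι : Type*} [Finite ι] {X : ι → VF N M} {y : M}
    (hX : ∀ i, VFAt (X i) y) (hli : LinearIndependent ℝ fun i => X i y) :
    ∀ᶠ z in 𝓝 y, LinearIndependent ℝ fun i => X i z := by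
  have hys := mem_extChartAt_source (I := 𝓡 N) y
  have hyt := (extChartAt (𝓡 N) y).map_source hys
  have hinv := (extChartAt (𝓡 N) y).left_inv hys
  let Xh : ι → EuclideanSpace ℝ (Fin N) → EuclideanSpace ℝ (Fin N) := fun i =>
    pull (extChartAt (𝓡 N) y).symm (X i)
  have hXh : ∀ i, AnalyticAt ℝ (Xh i) (extChartAt (𝓡 N) y y) := fun i =>
    analyticAt_hat y hyt (by rw [hinv]; exact hX i)
  have hli' : LinearIndependent ℝ fun i => Xh i (extChartAt (𝓡 N) y y) :=
    linearIndependent_pull (ldAt_extChartAt_symm y hyt).self_of_nhds.2 (by rw [hinv]; exact hli)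
  have hc : ContinuousAt (fun u => fun i => Xh i u) (extChartAt (𝓡 N) y y) :=
    continuousAt_pi.2 fun i => (hXh i).continuousAt
  refine eventually_of_chart hys ?_
  filter_upwards [hc.eventually_mem (isOpen_setOfPred_linearIndependent.mem_nhds hli'),
    ldAt_extChartAt_symm y hyt] with u hu hld
  exact linearIndependent_of_pull hld.2 hu

/-- Lower semicontinuity of the rank: finitely many of the values at `y` form a basis of the span,
and these fields stay independent nearby. The family itself may be infinite. -/
theorem eventually_finrank_le {ι : Type*} {X : ι → VF N M} {y : M} (hX : ∀ i, VFAt (X i) y) :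
    ∀ᶠ z in 𝓝 y, Module.finrank ℝ (Submodule.span ℝ (range fun i => X i y)) ≤
      Module.finrank ℝ (Submodule.span ℝ (range fun i => X i z)) := by
  obtain ⟨f, hf, -, hli⟩ := Submodule.exists_fun_fin_finrank_span_eq ℝ (range fun i => X i y)
  choose idx hidx using hf
  have hli' : LinearIndependent ℝ fun j => X (idx j) y := by
    convert! hli using 2 with j
    exact hidx j
  filter_upwards [eventually_linearIndependent (fun j => hX (idx j)) hli'] with z hz
  have h1 := finrank_span_eq_card hz
  rw [Fintype.card_fin] at h1
  rw [← h1]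
  refine Submodule.finrank_mono (Submodule.span_mono ?_)
  rintro _ ⟨j, rfl⟩
  exact ⟨idx j, rfl⟩

/-- The passage from `T` to `T + Z` and then to its image under `φ` does not increase the dimension
of the bracket generated space, while the rank of the iterated brackets does not decrease from `x`
to `φ x`. The inequality assumed at `x` thus becomes the criterion at `φ x`. -/
theorem isTGood_image {DI : Distr N M} {m : ℕ} {U U₂ : Set M} {T T' T'' Z : VF N M}
    {W : Fin m → VF N M} {φ : M → M} {x : M} (hU : IsOpen U) (hU₂ : IsOpen U₂) (hU₂U : U₂ ⊆ U)
    (hT : ∀ z ∈ U, VFAt T z) (hW : ∀ α, ∀ z ∈ U, VFAt (W α) z)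
    (hframe : ∀ z ∈ U, LinearIndependent ℝ (fun α => W α z) ∧
      DI z = Submodule.span ℝ (range fun α => W α z)) (hZ : Z ∈ tangentFields DI U₂)
    (hT' : ∀ z ∈ U₂, T' z = T z + Z z) {q : M → EuclideanSpace ℝ (Fin N)}
    (hq : ∀ z ∈ U₂, ∃ A : TangentSpace (𝓡 N) z →L[ℝ] EuclideanSpace ℝ (Fin N),
      HasMFDerivAt (𝓡 N) (𝓡 N) q z A ∧ ∀ v, A v = 0 ↔ v ∈ DI z)
    (hφ : PreservesLeaves DI U₂ φ) (hx : x ∈ U₂)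
    (hT'' : ∀ z ∈ U₂, T'' (φ z) = mfderiv (𝓡 N) (𝓡 N) φ z (T' z))
    (hr : Module.finrank ℝ (fiber (lieClosure (secondary DI T U)) x) ≤ Module.finrank ℝ
      (Submodule.span ℝ (range fun i : Fin m × ℕ => adIter T' i.2 (W i.1) x))) :
    IsTGood DI m T'' (φ '' U₂) (φ x) := by
  have hmaps : ∀ z ∈ U₂, φ z ∈ U₂ := fun z hz => integralLeaf_subset hz (hφ.mem hz)
  have hΩU : φ '' U₂ ⊆ U := by
    rintro _ ⟨z, hz, rfl⟩
    exact hU₂U (hmaps z hz)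
  have hT'A : ∀ z ∈ U₂, VFAt T' z := fun z hz =>
    ((hT z (hU₂U hz)).add (hZ.2.1.vfAt hU₂ hz)).congr
      (Filter.eventually_of_mem (hU₂.mem_nhds hz) fun w hw => hT' w hw)
  have hT''A : ∀ z ∈ U₂, VFAt T'' (φ z) := fun z hz =>
    vfAt_of_related (hφ.ldAt hU₂ hz) (hT'A z hz)
      (Filter.eventually_of_mem (hU₂.mem_nhds hz) hT'')
  have hpull : pull φ T'' =ᶠ[𝓝 x] T' := by
    filter_upwards [hU₂.mem_nhds hx] with z hz
    exact pull_eq_of_mfderiv (hφ.ldAt hU₂ hz).self_of_nhds.2 (hT'' z hz).symm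
  have hDI : ∀ᶠ z in 𝓝 x, ∀ v, v ∈ DI z ↔ mfderiv (𝓡 N) (𝓡 N) φ z v ∈ DI (φ z) :=
    Filter.eventually_of_mem (hU₂.mem_nhds hx) fun z hz => hφ.mfderiv_mem_iff hU₂ hq hz
  refine isTGood_of_finrank_le (Ω := φ '' U₂) (W := W) ?_ ⟨x, hx, rfl⟩ Subset.rfl ?_
    (fun α z hz => hW α z (hΩU hz)) (fun z hz => hframe z (hΩU hz)) ?_
  · rw [isOpen_iff_mem_nhds]
    rintro _ ⟨z, hz, rfl⟩
    exact (hφ.ldAt hU₂ hz).image_mem_nhds (hU₂.mem_nhds hz)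
  · rintro _ ⟨z, hz, rfl⟩
    exact hT''A z hz
  · refine (finrank_fiber_le_of_related hU (hU₂U hx) hT hU₂ hx hZ ?_ (hφ.ldAt hU₂ hx)
      (hT''A x hx) hpull (hDI.mono fun z hz v => (hz v).2)).trans (hr.trans ?_)
    · exact Filter.eventually_of_mem (hU₂.mem_nhds hx) fun w hw => hT' w hw
    · exact finrank_span_le_of_related hU (hU₂U hx) (hU₂U (hmaps x hx)) hW hframe
        (hφ.ldAt hU₂ hx) (hT'A x hx) (hT''A x hx) hpull (hDI.mono fun z hz v => (hz v).1)

theorem preservesLeaves_id (DI : Distr N M) (U : Set M) : PreservesLeaves DI U id := by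
  refine ⟨contMDiffOn_id, injOn_id U, fun x _ => ?_, fun x _ => by rw [image_id]⟩
  rw [mfderiv_id]
  exact Function.bijective_id

/-- A point of a stratum of depth two is good. -/
theorem RiggedDistribution.isGood_of_depth_eq_two {m : ℕ} (R : RiggedDistribution N M m) {y : M}
    {U : Set M} (hU : IsOpen U) (hy : y ∈ U) {T : VF N M} (hT : R.IsLift T U)
    {W : Fin m → VF N M} {a : Fin m → ℕ} (hW : IsAdapted R.DI T U W a)
    (S : StrataDecomposition (secondary R.DI T U) U) {j₀ : Fin (S.q + 1)}
    (hj₀ : y ∈ S.stratum j₀) (hdepth : S.depth j₀ = 2) : R.IsGood y := by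
  have hTA : ∀ z ∈ U, VFAt T z := fun z hz => hT.1.vfAt hU hz
  have hWA : ∀ α, ∀ z ∈ U, VFAt (W α) z := fun α z hz => (hW.analytic α).vfAt hU hz
  have hWDI : ∀ α, ∀ z ∈ U, W α z ∈ R.DI z := fun α z hz => by
    rw [(hW.frame z hz).2]
    exact Submodule.subset_span ⟨α, rfl⟩
  -- The section of `D / D^I` vanishes nowhere, so no lift vanishes; this provides the transversal
  -- coordinate for the perturbation.
  have hTy : T y ≠ 0 := by
    intro h
    have h1 := (hT.2 y hy).2
    rw [h, map_zero] at h1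
    exact R.sec_ne_zero y h1.symm
  obtain ⟨g, U₁, hU₁, hyU₁, hU₁U, hg, hT'⟩ := exists_absorbing_lift hU hy hTA hWA hTy
  let Z : VF N M := fun z => ∑ α, g α z • W α z
  let T' : VF N M := fun z => T z + ∑ α, g α z • W α z
  obtain ⟨had, hbr⟩ := hT' T' rfl
  have hZDI : ∀ z ∈ U, Z z ∈ R.DI z := fun z hz =>
    Submodule.sum_mem _ fun α _ => Submodule.smul_mem _ _ (hWDI α z hz)
  have hZA : ∀ z ∈ U₁, VFAt Z z := fun z hz => by
    refine (VFAt.sum Finset.univ (X := fun α => g α • W α) fun α _ => (hWA α z (hU₁U hz)).smul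
      (hg α z hz)).congr (Filter.Eventually.of_forall fun w => ?_)
    rw [Finset.sum_apply]
    rfl
  have hT'A : ∀ z ∈ U₁, VFAt T' z := fun z hz => (hTA z (hU₁U hz)).add (hZA z hz)
  have hE : Module.finrank ℝ (fiber (lieClosure (secondary R.DI T U)) y) ≤ Module.finrank ℝ
      (Submodule.span ℝ (range fun i : Fin m × ℕ => adIter T' i.2 (W i.1) y)) := by
    refine Submodule.finrank_mono ?_
    -- Depth two enters here: brackets of at most two fields suffice, and the new lift absorbs all
    -- of those.
    rw [S.fiber_eq j₀ y hj₀, hdepth]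
    let gen : (Σ α : Fin m, Fin (a α + 1)) → VF N M := fun i => adIter T i.2 (W i.1)
    have hgenA : ∀ i, ∀ z ∈ U, VFAt (gen i) z := fun i z hz => (hTA z hz).adIter (hWA _ z hz) _
    refine depthFiber_two_le (isPresheaf_restrictions hgenA) ?_ ?_ ?_
    · intro O hO hyO X hX
      obtain ⟨O', hO', hyO', -, f, hf, hXf⟩ := hW.generates O X hX y hyO
      exact GermSpan.sum_smul (X := gen) (fun i => (hf i).funAt hO' hyO')
        (fun i => .of hU hy ⟨Subset.rfl, i, rfl⟩) (Filter.eventually_of_mem (hO'.mem_nhds hyO') hXf)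
    · rintro O - - Y ⟨-, i, rfl⟩
      exact had _ _
    · rintro O O' - - X ⟨-, i, rfl⟩ Y ⟨-, j, rfl⟩
      exact hbr _ _ _ _
  have hfin := eventually_finrank_le (X := fun i : Fin m × ℕ => adIter T' i.2 (W i.1)) (y := y)
    fun i => (hT'A y hyU₁).adIter (hWA _ y hy) _
  obtain ⟨q, hq⟩ := exists_first_integral_of_frame R.DI_involutive hU hy hWA hW.frame
  obtain ⟨U₂, hU₂P, hU₂, hyU₂⟩ := eventually_nhds_iff.1
    ((hfin.and hq).and (hU₁.mem_nhds hyU₁))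
  have hU₂U₁ : U₂ ⊆ U₁ := fun z hz => (hU₂P z hz).2
  have hU₂U := hU₂U₁.trans hU₁U
  have hZ₂ : Z ∈ tangentFields R.DI U₂ :=
    ⟨hU₂, isAnalyticVF_of_vfAt fun z hz => hZA z (hU₂U₁ hz), fun z hz => hZDI z (hU₂U hz)⟩
  have key : ∀ (φ : M → M) (T'' : VF N M), PreservesLeaves R.DI U₂ φ → y ∈ φ '' U₂ →
      (∀ x ∈ U₂, T'' (φ x) = mfderiv (𝓡 N) (𝓡 N) φ x (T' x)) →
      IsTGood R.DI m T'' (φ '' U₂) y := by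
    rintro φ T'' hφ ⟨x, hx, hxy⟩ hT''
    have hr : Module.finrank ℝ (fiber (lieClosure (secondary R.DI T U)) x) ≤ Module.finrank ℝ
        (Submodule.span ℝ (range fun i : Fin m × ℕ => adIter T' i.2 (W i.1) x)) := by
      -- The diffeomorphism moves `x` to `y` along a leaf of `D^I`, which is contained in a leaf of
      -- the bracket generated family. Strata contain such leaves, so `x` lies in the stratum of
      -- `y`.
      have hleaf : y ∈ integralLeaf (lieClosure (secondary R.DI T U)) U x := by
        have h1 := hφ.mem hx
        rw [hxy] at h1
        exact integralLeaf_mono hU₂U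
          (fun O hO => subset_lieClosure_secondary (hO.trans hU₂U)) x h1
      have hxS : x ∈ S.stratum j₀ := by
        have hxU : x ∈ ⋃ j, S.stratum j := by rw [S.iUnion_eq]; exact hU₂U hx
        obtain ⟨j, hj⟩ := mem_iUnion.1 hxU
        have hyj := S.leaf_subset j x hj hleaf
        by_cases hjj : j = j₀
        · rwa [← hjj]
        · exact absurd hj₀ (Set.disjoint_left.1 (S.disjoint hjj) hyj)
      rw [S.finrank_eq j₀ x hxS y hj₀]
      exact hE.trans (hU₂P x hx).1.1
    have := isTGood_image hU hU₂ hU₂U hTA hWA hW.frame hZ₂ (fun z _ => rfl)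
      (fun z hz => (hU₂P z hz).1.2) hφ hx hT'' hr
    rwa [hxy] at this
  refine ⟨U₂, T', hU₂, hyU₂, ⟨isAnalyticVF_of_vfAt fun z hz => hT'A z (hU₂U₁ hz),
    fun z hz => ?_⟩, ?_, key⟩
  · have h1 := hT.2 z (hU₂U hz)
    have h2 := hZDI z (hU₂U hz)
    refine ⟨Submodule.add_mem _ h1.1 (R.DI_le z h2), ?_⟩
    show (R.DI z).mkQ (T z + Z z) = _
    rw [map_add, h1.2, (R.DI z).mkQ_apply (Z z), (Submodule.Quotient.mk_eq_zero _).2 h2, add_zero]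
  -- Goodness with respect to `T'` itself is the case of the identity diffeomorphism.
  · have := key id T' (preservesLeaves_id R.DI U₂) ⟨y, hyU₂, rfl⟩ fun x _ => by
      rw [mfderiv_id]; rfl
    rwa [image_id] at this

end Main

end RiggedControl

open RiggedControl in
theorem mainTheorem3 {N : ℕ} {M : Type*} [TopologicalSpace M] [T2Space M]
    [ChartedSpace (EuclideanSpace ℝ (Fin N)) M] [IsManifold (𝓡 N) ω M]
    {m : ℕ} (R : RiggedDistribution N M m)
    (y : M) (U : Set M) (hU : IsOpen U) (hy : y ∈ U)
    (T : VF N M) (hT : R.IsLift T U)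
    (W : Fin m → VF N M) (a : Fin m → ℕ) (hW : IsAdapted R.DI T U W a)
    (S : StrataDecomposition (secondary R.DI T U) U) (j₀ : Fin (S.q + 1))
    (hj₀ : y ∈ S.stratum j₀) (hdepth : S.depth j₀ = 2)
    (r : ℕ) (hr : r = Module.finrank ℝ (fiber (lieClosure (secondary R.DI T U)) y))
    (p : ℕ) (hp : p + 1 ≤ r)
    (A : Fin p → Σ α : Fin m, Fin (a α + 1))
    (B : Fin (r - p) → VF N M) (B' : Fin (r - p) → Σ α : Fin m, Fin (a α + 1))
    (hB : ∀ j, ∃ β : Fin m, IsSubAdaptedGenerator T U y (W β) (B j) ∧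
      IsFirstKind (secondary (lineDistr (W β)) T U) U y)
    (hgen : ∃ O : Set M, IsOpen O ∧ y ∈ O ∧ ∀ x ∈ O ∩ S.stratum j₀,
      fiber (lieClosure (secondary R.DI T U)) x = Submodule.span ℝ
        (Set.range (fun i => adIter T (A i).2 (W (A i).1) x) ∪
          Set.range (fun j => bracket (B j) (adIter T (B' j).2 (W (B' j).1)) x))) :
    R.IsGood y := 
  R.isGood_of_depth_eq_two hU hy hT hW S hj₀ hdepth
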